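/- Let $\mathbb K\in\{\mathbb R,\mathbb C\}$ and let $\mathfrak g$ be a finite-dimensional Lie algebra over $\mathbb K$. **Setup.** A disk in $\mathbb R^m$ is an open subset diffeomorphic to $\mathbb R^m$. Let $\mathcal P_{\mathbb R^m}$ be the operad coloured by disks with exactly one operation $\iota^D_{\underline D}$ for every finite (possibly empty) tuple $\underline D=(D_1,\dots,D_n)$ of pairwise disjoint disks contained in $D$; prefactorization algebras are its algebras in cochain complexes of $\mathbb K$-vector spaces. The factorization envelope $\mathfrak U\mathfrak g^{\mathbb R^m}$ assigns to $D$ the complex $\big(\mathrm{Sym}(\mathfrak g\otimes\Omega^\bullet_{\mathrm c}(D)[1]),\ \mathrm d_{\mathrm{dR}[1]}+\mathrm d_{\mathrm{CE}}\big)$, where $\mathrm d_{\mathrm{dR}[1]}$ is the derivation extending $X\otimes\omega\mapsto -X\otimes \mathrm d_{\mathrm{dR}}\omega$ and $\mathrm d_{\mathrm{CE}}(w_1\cdots w_n)=\sum_{i<j}\pm(-1)^{|\omega_i|}([X_i,X_j]\otimes\omega_i\wedge\omega_j)\prod_{a\ne i,j}w_a$ for $w_a=X_a\otimes\omega_a$,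 with $\pm$ the Koszul sign of moving $w_i,w_j$ to the front. Its structure maps are extension by zero followed by multiplication. A strong deformation retract (SDR) of a prefactorization algebra $\mathfrak F$ onto its cohomology consists, for every disk $D$, of a graded vector space $B(D)$ (with zero differential) and linear maps $i_D:B(D)\to\mathfrak F(D)$, $p_D:\mathfrak F(D)\to B(D)$ of degree $0$ and $h_D:\mathfrak F(D)\to\mathfrak F(D)$ of degree $-1$, with $\mathrm d\,i=0$, $p\,\mathrm d=0$, $pi=\mathrm{id}$, $\mathrm d h+h\mathrm d=ip-\mathrm{id}$, $hi=0$, $ph=0$, $h^2=0$. For a rooted tree whose vertices are non-identity operations, the transferred operation $\beta$ (on tensor products of the $B(D)$) is obtained by decorating leaves with $i$, vertices with the structure maps of $\mathfrak F$, internal edges with $h$ and the root with $p$. On one-vertex trees this gives the induced strict structure maps $\mu$ on $B\cong\mathsf H\mathfrak F$. The Massey cocycle $\beta^{(2)}$ is the restriction of $\beta$ to trees with two vertices. The universal first-order Massey product of $\mathfrak F$ is the class $[\beta^{(2)}]$. It is trivial if for every SDR onto cohomology there is a $\Sigma$-equivariant family of multilinear maps $\chi(\iota^D_{\underline D})$ on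 $B$ of degree $-1$ such that, for all non-identity composable operations, the value of $\beta^{(2)}$ on the tree with vertices $\iota^D_{(\underline L,D',\underline R)}$ and $\iota^{D'}_{\underline E}$ is $$\beta^{(2)}(l,e,r)=(-1)^{|l|}\chi(l,e,r)-(-1)^{|l|}\chi(l,\mu(e),r)-\mu(l,\chi(e),r)$$ for homogeneous tuples $l,e,r$. The prefactorization algebra $\mathfrak F$ is formal if there is an $\infty$-quasi-isomorphism of prefactorization algebras from $\mathsf H\mathfrak F$ with its induced strict structure to $\mathfrak F$. *Explicit retracts ($m\ge1$).* Choices consist, for every disk $D$, of a form $\omega_D\in\Omega^m_{\mathrm c}(D)$ with $\int_D\omega_D=1$ and, for $1\le r\le m-1$, complements $K^r(D)$ of $\mathrm d_{\mathrm{dR}}\Omega^{r-1}_{\mathrm c}(D)$ in $\Omega^r_{\mathrm c}(D)$; put $K^0(D)=\Omega^0_{\mathrm c}(D)$ and $K^m(D)=\mathbb K\,\omega_D$. Let $h^r_D:\Omega^r_{\mathrm c}(D)\to K^{r-1}(D)$ vanish on $K^r(D)$ and invert $\mathrm d_{\mathrm{dR}}:K^{r-1}(D)\to\mathrm d_{\mathrm{dR}}\Omega^{r-1}_{\mathrm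 c}(D)$. Let $i,p$ be the algebra maps between $\mathrm{Sym}(\mathfrak g[1-m])$ and $\mathrm{Sym}(\mathfrak g\otimes\Omega^\bullet_{\mathrm c}(D)[1])$ given on generators by $i[1](X)=X\otimes\omega_D$, $p[1](X\otimes\omega)=X\int_D\omega$. With $h[1](X\otimes\omega)=X\otimes h^r_D(\omega)$ for $\omega\in\Omega^r_{\mathrm c}(D)$, let $h$ be, in symmetric degree $n$, the symmetrization $\frac1{n!}\sum_{j=1}^n\sum_{\sigma\in\Sigma_n}\tau_\sigma(\mathrm{id}^{\otimes(j-1)}\otimes h[1]\otimes(i[1]p[1])^{\otimes(n-j)})\tau_{\sigma^{-1}}$. Define $\widehat p=\sum_{j\ge0}p(\mathrm d_{\mathrm{CE}}h)^j$, $\widehat h=\sum_{j\ge0}h(\mathrm d_{\mathrm{CE}}h)^j$, $\widetilde p_D=\widehat p_{\mathbb R^m}\circ\mathfrak U\mathfrak g^{\mathbb R^m}(\iota_D^{\mathbb R^m})$ and $\widetilde h_D=\widehat h_D-i_D\widetilde p_D\widehat h_D$. **Theorem.** *(Dimension $m=1$.)* 1. For every disk (interval) $D$, the cohomology of $\mathfrak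 U\mathfrak g^{\mathbb R}(D)$ is $\mathrm{Sym}(\mathfrak g)$, concentrated in degree $0$: for every $\alpha\in\Omega^1_{\mathrm c}(D)$ with $\int_D\alpha=1$, the assignment $X_1\cdots X_n\mapsto(X_1\otimes\alpha)\cdots(X_n\otimes\alpha)$ is a well-defined linear map from $\mathrm{Sym}(\mathfrak g)$ to cocycles inducing an isomorphism $\mathrm{Sym}(\mathfrak g)\cong\mathsf H^0$, and $\mathsf H^n=0$ for $n\neq0$. 2. Choices as above exist, and for all choices $(i,\widehat p,\widehat h)$ is an SDR of $\mathfrak U\mathfrak g^{\mathbb R}$ onto $\mathrm{Sym}(\mathfrak g)$. For every SDR of $\mathfrak U\mathfrak g^{\mathbb R}$ onto its cohomology, the transferred operations $\beta$ vanish on all trees with more than one vertex. 3. $\mathfrak U\mathfrak g^{\mathbb R}$ is formal. *(Dimension $m\ge3$.)* Choices as above exist. For all choices, both $(i,\widehat p,\widehat h)$ and $(i,\widetilde p,\widetilde h)$ are SDRs of $\mathfrak U\mathfrak g^{\mathbb R^m}$ onto $\mathrm{Sym}(\mathfrak g[1-m])$, and their Massey cocycles $\widehat\beta^{(2)}$ and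 $\widetilde\beta^{(2)}$ vanish identically on all trees with two vertices. Consequently the universal first-order Massey product of $\mathfrak U\mathfrak g^{\mathbb R^m}$ is trivial. -/

import Mathlib

open scoped DirectSum TensorProduct ContDiff
open MeasureTheory

universe u

namespace FactEnv

noncomputable section

/-! ## Graded modules and graded symmetric algebras -/

theorem neg_one_zpow_congr {𝕜 : Type} [Field 𝕜] {a b : ℤ} (h : Even (a - b)) :
    (-1 : 𝕜) ^ a = (-1) ^ b := by
  obtain ⟨c, hc⟩ := h
  rw [show a = b + 2 * c by omega, zpow_add₀ (by simp), zpow_mul (-1 : 𝕜) 2]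
  simp

section Scale

variable {𝕜 : Type} [Field 𝕜] {M : Type u} [AddCommGroup M] [Module 𝕜 M]
  {ι : Type} [DecidableEq ι]

/-- The linear map acting on the homogeneous component `𝒲 i` as the scalar `c i`. -/
def scale (𝒲 : ι → Submodule 𝕜 M) [DirectSum.Decomposition 𝒲] (c : ι → 𝕜) : M →ₗ[𝕜] M :=
  (DirectSum.toModule 𝕜 ι M fun i => c i • (𝒲 i).subtype) ∘ₗ
    (DirectSum.decomposeLinearEquiv 𝒲).toLinearMap

variable (𝒲 : ι → Submodule 𝕜 M) [DirectSum.Decomposition 𝒲]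

theorem scale_of_mem (c : ι → 𝕜) {i : ι} {x : M} (hx : x ∈ 𝒲 i) : scale 𝒲 c x = c i • x := by
  have : DirectSum.decomposeLinearEquiv 𝒲 x = DirectSum.lof 𝕜 ι (fun i => 𝒲 i) i ⟨x, hx⟩ :=
    DirectSum.decompose_of_mem 𝒲 hx
  simp only [scale, LinearMap.comp_apply, LinearEquiv.coe_coe, this, DirectSum.toModule_lof]
  rfl

/-- Two linear maps agreeing on homogeneous elements agree. -/
theorem hom_ext_homog {N : Type*} [AddCommGroup N] [Module 𝕜 N] {f g : M →ₗ[𝕜] N}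
    (h : ∀ i, ∀ x ∈ 𝒲 i, f x = g x) : f = g := by
  ext x
  induction x using DirectSum.Decomposition.inductionOn 𝒲 with
  | zero => simp
  | homogeneous x => exact h _ _ x.2
  | add x y hx hy => simp [hx, hy]

end Scale

section GSym

variable {𝕜 : Type} [Field 𝕜] {W : Type u} [AddCommGroup W] [Module 𝕜 W]

/-- The defining relations of the graded symmetric algebra; an element of `𝒲 r` has
(shifted) degree `r - 1`. -/
inductive GRel (𝒲 : ℕ → Submodule 𝕜 W) : TensorAlgebra 𝕜 W → TensorAlgebra 𝕜 W → Prop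
  | comm {r s : ℕ} {v w : W} (hv : v ∈ 𝒲 r) (hw : w ∈ 𝒲 s) :
      GRel 𝒲 (TensorAlgebra.ι 𝕜 v * TensorAlgebra.ι 𝕜 w)
        ((-1 : 𝕜) ^ ((r + 1) * (s + 1)) • (TensorAlgebra.ι 𝕜 w * TensorAlgebra.ι 𝕜 v))

/-- The graded symmetric algebra `Sym(W[1])` of the graded module `W = ⨁ 𝒲 r`. -/
def GSym (𝒲 : ℕ → Submodule 𝕜 W) : Type u := RingQuot (GRel 𝒲)

variable (𝒲 : ℕ → Submodule 𝕜 W)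

instance : Ring (GSym 𝒲) := inferInstanceAs (Ring (RingQuot (GRel 𝒲)))
instance : Algebra 𝕜 (GSym 𝒲) := inferInstanceAs (Algebra 𝕜 (RingQuot (GRel 𝒲)))

namespace GSym

/-- The quotient map. -/
def mk : TensorAlgebra 𝕜 W →ₐ[𝕜] GSym 𝒲 := RingQuot.mkAlgHom 𝕜 (GRel 𝒲)

/-- The generators. -/
def gen : W →ₗ[𝕜] GSym 𝒲 := (mk 𝒲).toLinearMap ∘ₗ TensorAlgebra.ι 𝕜

theorem gen_comm {r s : ℕ} {v w : W} (hv : v ∈ 𝒲 r) (hw : w ∈ 𝒲 s) :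
    gen 𝒲 v * gen 𝒲 w = (-1 : 𝕜) ^ ((r + 1) * (s + 1)) • (gen 𝒲 w * gen 𝒲 v) := by
  have := RingQuot.mkAlgHom_rel 𝕜 (GRel.comm hv hw)
  rw [map_mul, map_smul, map_mul] at this
  exact this

/-- The universal property. -/
def lift {A : Type*} [Ring A] [Algebra 𝕜 A] (f : W →ₗ[𝕜] A)
    (hf : ∀ r s, ∀ v ∈ 𝒲 r, ∀ w ∈ 𝒲 s,
      f v * f w = (-1 : 𝕜) ^ ((r + 1) * (s + 1)) • (f w * f v)) : GSym 𝒲 →ₐ[𝕜] A :=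
  RingQuot.liftAlgHom 𝕜 ⟨TensorAlgebra.lift 𝕜 f, by
    rintro _ _ ⟨hv, hw⟩
    simpa using hf _ _ _ hv _ hw⟩

theorem lift_gen {A : Type*} [Ring A] [Algebra 𝕜 A] (f : W →ₗ[𝕜] A) (hf) (w : W) :
    lift 𝒲 f hf (gen 𝒲 w) = f w := by
  have := RingQuot.liftAlgHom_mkAlgHom_apply 𝕜 (TensorAlgebra.lift 𝕜 f) (s := GRel 𝒲) (by
    rintro _ _ ⟨hv, hw⟩
    simpa using hf _ _ _ hv _ hw) (TensorAlgebra.ι 𝕜 w)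
  exact this.trans (TensorAlgebra.lift_ι_apply f w)

variable {𝒲} in
theorem induction {N : Submodule 𝕜 (GSym 𝒲)} (h1 : (1 : GSym 𝒲) ∈ N)
    (hw : ∀ w : W, ∀ x ∈ N, gen 𝒲 w * x ∈ N) (x : GSym 𝒲) : x ∈ N := by
  obtain ⟨t, rfl⟩ : ∃ t, mk 𝒲 t = x := RingQuot.mkAlgHom_surjective 𝕜 (GRel 𝒲) x
  suffices h : ∀ t : TensorAlgebra 𝕜 W, ∀ y : GSym 𝒲, y ∈ N →
      mk 𝒲 t * y ∈ N by
    simpa using h t 1 h1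
  intro t
  induction t using TensorAlgebra.induction with
  | algebraMap c =>
    intro y hy
    rw [AlgHom.commutes]
    have := N.smul_mem c hy
    rwa [Algebra.smul_def] at this
  | ι w => exact fun y hy => hw w y hy
  | mul a b ha hb => intro y hy; rw [map_mul]; simpa [mul_assoc] using ha _ (hb _ hy)
  | add a b ha hb => intro y hy; rw [map_add, add_mul]; exact N.add_mem (ha _ hy) (hb _ hy)

/-- A linear map out of `Sym` prescribed by `D 1 = 0` and `D (w x) = Y w x + R w (D x)` exists as
soon as the right-hand side is compatible with graded commutativity. -/
theorem exists_rec [DirectSum.Decomposition 𝒲] {M : Type u} [AddCommGroup M] [Module 𝕜 M]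
    (Y : W →ₗ[𝕜] GSym 𝒲 →ₗ[𝕜] M)
    (R : W →ₗ[𝕜] M →ₗ[𝕜] M)
    (hY : ∀ r s, ∀ v ∈ 𝒲 r, ∀ w ∈ 𝒲 s, ∀ x, Y v (gen 𝒲 w * x) + R v (Y w x) =
      (-1 : 𝕜) ^ ((r + 1) * (s + 1)) • (Y w (gen 𝒲 v * x) + R w (Y v x)))
    (hR : ∀ r s, ∀ v ∈ 𝒲 r, ∀ w ∈ 𝒲 s, ∀ m, R v (R w m) =
      (-1 : 𝕜) ^ ((r + 1) * (s + 1)) • R w (R v m)) :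
    ∃ D : GSym 𝒲 →ₗ[𝕜] M, D 1 = 0 ∧ ∀ w x, D (gen 𝒲 w * x) = Y w x + R w (D x) := by
  let f : W →ₗ[𝕜] Module.End 𝕜 (GSym 𝒲 × M) :=
    { toFun := fun w =>
        (((LinearMap.mulLeft 𝕜 (gen 𝒲 w)) ∘ₗ LinearMap.fst 𝕜 _ _).prod
          (Y w ∘ₗ LinearMap.fst 𝕜 _ _ + R w ∘ₗ LinearMap.snd 𝕜 _ _))
      map_add' := by
        intro v w
        ext x <;> simp [add_mul]
      map_smul' := by
        intro c w
        ext x <;> simp }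
  have hf : ∀ w x m, f w (x, m) = (gen 𝒲 w * x, Y w x + R w m) := fun w x m => rfl
  let Φ := lift 𝒲 f (by
    intro r s v hv w hw
    refine LinearMap.ext fun p => ?_
    obtain ⟨x, m⟩ := p
    simp only [Module.End.mul_apply, LinearMap.smul_apply, hf]
    ext
    · simp only [← mul_assoc, Prod.smul_mk]
      rw [gen_comm 𝒲 hv hw, smul_mul_assoc]
    · simp only [Prod.smul_mk, map_add, ← add_assoc]
      rw [hY r s v hv w hw, hR r s v hv w hw, ← smul_add, add_assoc])
  have hΦ : ∀ w x, Φ (gen 𝒲 w * x) = f w * Φ x := fun w x => by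
    rw [map_mul, lift_gen]
  have hfst : ∀ x, (Φ x (1, 0)).1 = x := by
    intro x
    have : x ∈ LinearMap.ker ((LinearMap.fst 𝕜 (GSym 𝒲) M ∘ₗ (LinearMap.applyₗ ((1 : GSym 𝒲), (0:M)))
        ∘ₗ Φ.toLinearMap) - LinearMap.id) := by
      refine induction ?_ ?_ x
      · simp
      · intro w x hx
        simp only [LinearMap.mem_ker, LinearMap.sub_apply, sub_eq_zero, LinearMap.comp_apply,
          AlgHom.toLinearMap_apply, LinearMap.applyₗ_apply_apply, LinearMap.fst_apply,
          LinearMap.id_apply] at hx ⊢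
        rw [hΦ, Module.End.mul_apply, ← Prod.mk.eta (p := Φ x (1, 0)), hf, hx]
    simpa [sub_eq_zero] using this
  refine ⟨LinearMap.snd 𝕜 _ _ ∘ₗ LinearMap.applyₗ ((1 : GSym 𝒲), (0:M)) ∘ₗ Φ.toLinearMap, ?_, ?_⟩
  · simp
  · intro w x
    simp only [LinearMap.comp_apply,
          AlgHom.toLinearMap_apply, LinearMap.applyₗ_apply_apply, LinearMap.snd_apply]
    rw [hΦ, Module.End.mul_apply, ← Prod.mk.eta (p := Φ x (1, 0)), hf, hfst]

/-- Monomials in homogeneous generators, with their degree. -/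
inductive IsMon : ℤ → GSym 𝒲 → Prop
  | one : IsMon 0 1
  | mul {r : ℕ} {w : W} (hw : w ∈ 𝒲 r) {n : ℤ} {x : GSym 𝒲} (hx : IsMon n x) :
      IsMon ((r : ℤ) - 1 + n) (gen 𝒲 w * x)

/-- The grading of the graded symmetric algebra. -/
def gr (n : ℤ) : Submodule 𝕜 (GSym 𝒲) := Submodule.span 𝕜 {x | IsMon 𝒲 n x}

theorem one_mem : (1 : GSym 𝒲) ∈ gr 𝒲 0 := Submodule.subset_span IsMon.one

theorem gen_mul_mem {r : ℕ} {w : W} (hw : w ∈ 𝒲 r) {n : ℤ} {x : GSym 𝒲} (hx : x ∈ gr 𝒲 n) :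
    gen 𝒲 w * x ∈ gr 𝒲 ((r : ℤ) - 1 + n) := by
  have : gr 𝒲 n ≤ (gr 𝒲 ((r : ℤ) - 1 + n)).comap (LinearMap.mulLeft 𝕜 (gen 𝒲 w)) :=
    Submodule.span_le.2 fun y hy => Submodule.subset_span (IsMon.mul hw hy)
  exact this hx

/-- Induction over homogeneous elements: it suffices to treat `1` and left multiplication by a
homogeneous generator. -/
theorem gr_induction {N : ℤ → Submodule 𝕜 (GSym 𝒲)} (h1 : (1 : GSym 𝒲) ∈ N 0)
    (hw : ∀ r, ∀ w ∈ 𝒲 r, ∀ n, ∀ x ∈ gr 𝒲 n, x ∈ N n → gen 𝒲 w * x ∈ N ((r : ℤ) - 1 + n))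
    {n : ℤ} {x : GSym 𝒲} (hx : x ∈ gr 𝒲 n) : x ∈ N n := by
  have key : ∀ n y, IsMon 𝒲 n y → y ∈ N n := by
    intro n y hy
    induction hy with
    | one => exact h1
    | mul h hm ih => exact hw _ _ h _ _ (Submodule.subset_span hm) ih
  exact (Submodule.span_le.2 (key n) : gr 𝒲 n ≤ N n) hx

theorem mul_mem {p q : ℤ} {x y : GSym 𝒲} (hx : x ∈ gr 𝒲 p) (hy : y ∈ gr 𝒲 q) :
    x * y ∈ gr 𝒲 (p + q) := by
  refine gr_induction 𝒲 (N := fun n => (gr 𝒲 (n + q)).comap (LinearMap.mulRight 𝕜 y)) ?_ ?_ hx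
  · simpa using hy
  · intro r w hw n x _ hx
    simp only [Submodule.mem_comap, LinearMap.mulRight_apply] at hx ⊢
    rw [mul_assoc, add_assoc]
    exact gen_mul_mem 𝒲 hw hx

instance : SetLike.GradedMonoid (gr 𝒲) where
  one_mem := one_mem 𝒲
  mul_mem _ _ _ _ := mul_mem 𝒲

theorem gen_mem {r : ℕ} {w : W} (hw : w ∈ 𝒲 r) : gen 𝒲 w ∈ gr 𝒲 ((r : ℤ) - 1) := by
  simpa using gen_mul_mem 𝒲 hw (one_mem 𝒲)

theorem gen_mul_comm [DirectSum.Decomposition 𝒲] {r : ℕ} {w : W} (hw : w ∈ 𝒲 r) {q : ℤ}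
    {y : GSym 𝒲} (hy : y ∈ gr 𝒲 q) :
    gen 𝒲 w * y = (-1 : 𝕜) ^ (((r : ℤ) + 1) * q) • (y * gen 𝒲 w) := by
  have := gr_induction 𝒲 (N := fun q => LinearMap.ker (LinearMap.mulLeft 𝕜 (gen 𝒲 w) -
    (-1 : 𝕜) ^ (((r : ℤ) + 1) * q) • LinearMap.mulRight 𝕜 (gen 𝒲 w))) (by simp) (by
      intro s v hv n x _ hx
      simp only [LinearMap.mem_ker, LinearMap.sub_apply, sub_eq_zero, LinearMap.mulLeft_apply,
        LinearMap.smul_apply, LinearMap.mulRight_apply] at hx ⊢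
      rw [← mul_assoc, gen_comm 𝒲 hw hv, smul_mul_assoc, mul_assoc, hx, mul_smul_comm, smul_smul,
        mul_assoc]
      congr 1
      rw [← zpow_natCast, ← zpow_add₀ (by simp)]
      exact neg_one_zpow_congr ⟨(r + 1 : ℤ), by push_cast; ring⟩) hy
  simpa [sub_eq_zero] using this

/-- Graded commutativity. -/
theorem graded_comm [DirectSum.Decomposition 𝒲] {p q : ℤ} {x y : GSym 𝒲} (hx : x ∈ gr 𝒲 p)
    (hy : y ∈ gr 𝒲 q) : x * y = (-1 : 𝕜) ^ (p * q) • (y * x) := by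
  have := gr_induction 𝒲 (N := fun p => LinearMap.ker (LinearMap.mulRight 𝕜 y -
    (-1 : 𝕜) ^ (p * q) • LinearMap.mulLeft 𝕜 y)) (by simp) (by
      intro s v hv n x _ hx
      simp only [LinearMap.mem_ker, LinearMap.sub_apply, sub_eq_zero, LinearMap.mulLeft_apply,
        LinearMap.smul_apply, LinearMap.mulRight_apply] at hx ⊢
      rw [mul_assoc, hx, mul_smul_comm, ← mul_assoc, gen_mul_comm 𝒲 hv hy, smul_mul_assoc,
        smul_smul, mul_assoc, ← zpow_add₀ (by simp)]
      congr 1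
      exact neg_one_zpow_congr ⟨q, by ring⟩) hx
  simpa [sub_eq_zero] using this

end GSym
end GSym

section GSymGrading

variable {𝕜 : Type} [Field 𝕜] {W : Type u} [AddCommGroup W] [Module 𝕜 W]
  (𝒲 : ℕ → Submodule 𝕜 W) [DirectSum.Decomposition 𝒲]

namespace GSym

/-- The generators as elements of the external direct sum of the homogeneous components. -/
def genDecomp : W →ₗ[𝕜] ⨁ n, gr 𝒲 n :=
  (DirectSum.toModule 𝕜 ℕ _ fun r =>
    DirectSum.lof 𝕜 ℤ (fun n => gr 𝒲 n) ((r : ℤ) - 1) ∘ₗ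
      ((gen 𝒲).restrict fun _ h => gen_mem 𝒲 h)) ∘ₗ
    (DirectSum.decomposeLinearEquiv 𝒲).toLinearMap

theorem genDecomp_of_mem {r : ℕ} {w : W} (hw : w ∈ 𝒲 r) :
    genDecomp 𝒲 w = DirectSum.of (fun n => gr 𝒲 n) ((r : ℤ) - 1) ⟨gen 𝒲 w, gen_mem 𝒲 hw⟩ := by
  have : DirectSum.decomposeLinearEquiv 𝒲 w = DirectSum.lof 𝕜 ℕ (fun i => 𝒲 i) r ⟨w, hw⟩ :=
    DirectSum.decompose_of_mem 𝒲 hw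
  simp only [genDecomp, LinearMap.comp_apply, LinearEquiv.coe_coe, this, DirectSum.toModule_lof]
  rfl

theorem of_mem_congr {n m : ℤ} (h : n = m) {x y : GSym 𝒲} (hx : x ∈ gr 𝒲 n) (hy : y ∈ gr 𝒲 m)
    (hxy : x = y) : DirectSum.of (fun n => gr 𝒲 n) n ⟨x, hx⟩ =
      DirectSum.of (fun n => gr 𝒲 n) m ⟨y, hy⟩ := by
  subst h; subst hxy; rfl

/-- Decomposition of `Sym` into homogeneous components. -/
def decompAlg : GSym 𝒲 →ₐ[𝕜] ⨁ n, gr 𝒲 n := lift 𝒲 (A := ⨁ n, gr 𝒲 n) (genDecomp 𝒲) (by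
  intro r s v hv w hw
  rw [genDecomp_of_mem 𝒲 hv, genDecomp_of_mem 𝒲 hw, DirectSum.of_mul_of, DirectSum.of_mul_of,
    ← DirectSum.lof_eq_of 𝕜, ← DirectSum.lof_eq_of 𝕜, ← map_smul, DirectSum.lof_eq_of,
    DirectSum.lof_eq_of]
  exact of_mem_congr 𝒲 (add_comm _ _) _ _ (gen_comm 𝒲 hv hw))

instance instGradedAlgebra : GradedAlgebra (gr 𝒲) :=
  GradedAlgebra.ofAlgHom (gr 𝒲) (decompAlg 𝒲)
    (by
      have key : ∀ x : GSym 𝒲, x ∈ LinearMap.ker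
          (((DirectSum.coeAlgHom (gr 𝒲)).comp (decompAlg 𝒲)).toLinearMap - LinearMap.id) := by
        intro x
        refine induction (by simp) ?_ x
        intro w x hx
        simp only [LinearMap.mem_ker, LinearMap.sub_apply, sub_eq_zero, AlgHom.toLinearMap_apply,
          LinearMap.id_apply, map_mul] at hx ⊢
        rw [hx]
        congr 1
        induction w using DirectSum.Decomposition.inductionOn 𝒲 with
        | zero => simp
        | homogeneous w =>
          simp only [AlgHom.comp_apply, decompAlg, lift_gen, genDecomp_of_mem 𝒲 w.2,
            DirectSum.coeAlgHom_of]
        | add x y hx hy => rw [map_add, map_add, hx, hy]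
      ext x
      simpa [sub_eq_zero] using key x)
    (by
      have coe : ∀ x : GSym 𝒲, DirectSum.coeAlgHom (gr 𝒲) (decompAlg 𝒲 x) = x := by
        intro x
        have key : x ∈ LinearMap.ker
          (((DirectSum.coeAlgHom (gr 𝒲)).comp (decompAlg 𝒲)).toLinearMap - LinearMap.id) := by
          refine induction (by simp) ?_ x
          intro w x hx
          simp only [LinearMap.mem_ker, LinearMap.sub_apply, sub_eq_zero,
            AlgHom.toLinearMap_apply, LinearMap.id_apply, map_mul] at hx ⊢
          rw [hx]
          congr 1
          induction w using DirectSum.Decomposition.inductionOn 𝒲 with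
          | zero => simp
          | homogeneous w =>
            simp only [AlgHom.comp_apply, decompAlg, lift_gen, genDecomp_of_mem 𝒲 w.2,
              DirectSum.coeAlgHom_of]
          | add x y hx hy => rw [map_add, map_add, hx, hy]
        simpa [sub_eq_zero] using key
      rintro n ⟨x, hx⟩
      have h := gr_induction 𝒲 (N := fun n => (LinearMap.range
        (DirectSum.lof 𝕜 ℤ (fun n => gr 𝒲 n) n)).comap (decompAlg 𝒲).toLinearMap)
        ⟨⟨1, one_mem 𝒲⟩, by simp [DirectSum.lof_eq_of]; rfl⟩ (by
          rintro r w hw n x hx ⟨y, hy⟩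
          refine ⟨⟨gen 𝒲 w * y, gen_mul_mem 𝒲 hw y.2⟩, ?_⟩
          simp only [AlgHom.toLinearMap_apply, map_mul] at hy ⊢
          rw [← hy, decompAlg, lift_gen, genDecomp_of_mem 𝒲 hw, DirectSum.lof_eq_of,
            DirectSum.lof_eq_of, DirectSum.of_mul_of]
          rfl) hx
      obtain ⟨y, hy⟩ := h
      rw [AlgHom.toLinearMap_apply, DirectSum.lof_eq_of] at hy
      have := coe x
      rw [← hy, DirectSum.coeAlgHom_of] at this
      subst this
      exact hy.symm)

theorem isInternal : DirectSum.IsInternal (gr 𝒲) := DirectSum.Decomposition.isInternal _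

/-- The grading involution. -/
abbrev eps : GSym 𝒲 →ₗ[𝕜] GSym 𝒲 := scale (gr 𝒲) fun n => (-1) ^ n

theorem eps_gen_mul {r : ℕ} {w : W} (hw : w ∈ 𝒲 r) (x : GSym 𝒲) :
    eps 𝒲 (gen 𝒲 w * x) = (-1 : 𝕜) ^ (r + 1) • (gen 𝒲 w * eps 𝒲 x) := by
  have : eps 𝒲 ∘ₗ LinearMap.mulLeft 𝕜 (gen 𝒲 w) =
      (-1 : 𝕜) ^ (r + 1) • (LinearMap.mulLeft 𝕜 (gen 𝒲 w) ∘ₗ eps 𝒲) := by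
    refine hom_ext_homog (gr 𝒲) fun n x hx => ?_
    simp only [LinearMap.comp_apply, LinearMap.mulLeft_apply, LinearMap.smul_apply]
    rw [scale_of_mem _ _ hx, scale_of_mem _ _ (gen_mul_mem 𝒲 hw hx), mul_smul_comm, smul_smul,
      ← zpow_natCast, ← zpow_add₀ (by simp)]
    congr 1
    exact neg_one_zpow_congr ⟨-1, by push_cast; ring⟩
  exact LinearMap.congr_fun this x

theorem eps_one : eps 𝒲 1 = 1 := by
  rw [scale_of_mem _ _ (one_mem 𝒲)]; simp

end GSym

/-- The structure on `W` (a dg Lie algebra structure read on the shift `W[1]`, an element of `𝒲 r`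
having shifted degree `r - 1`) that induces the Chevalley–Eilenberg differential on `Sym(W[1])`:
a differential `δ` and a graded symmetric bracket `b` of degree one. -/
structure ShiftedLie where
  δ : W →ₗ[𝕜] W
  b : W →ₗ[𝕜] W →ₗ[𝕜] W
  δ_mem : ∀ r, ∀ w ∈ 𝒲 r, δ w ∈ 𝒲 (r + 1)
  b_mem : ∀ r s, ∀ w ∈ 𝒲 r, ∀ v ∈ 𝒲 s, b w v ∈ 𝒲 (r + s)
  δδ : ∀ w, δ (δ w) = 0
  b_symm : ∀ r s, ∀ w ∈ 𝒲 r, ∀ v ∈ 𝒲 s, b w v = (-1 : 𝕜) ^ ((r + 1) * (s + 1)) • b v w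
  δ_b : ∀ r s, ∀ w ∈ 𝒲 r, ∀ v ∈ 𝒲 s,
    δ (b w v) + b (δ w) v + (-1 : 𝕜) ^ (r + 1) • b w (δ v) = 0
  jacobi : ∀ r s t, ∀ w ∈ 𝒲 r, ∀ v ∈ 𝒲 s, ∀ u ∈ 𝒲 t,
    b (b w v) u + (-1 : 𝕜) ^ (r * (s + 1)) • b v (b w u) + (-1 : 𝕜) ^ (r + 1) • b w (b v u) = 0

namespace ShiftedLie

variable {𝒲} (L : ShiftedLie 𝒲)

/-- The same bracket with the differential discarded. -/
def noδ : ShiftedLie 𝒲 where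
  δ := 0
  b := L.b
  δ_mem _ _ _ := Submodule.zero_mem _
  b_mem := L.b_mem
  δδ _ := rfl
  b_symm := L.b_symm
  δ_b _ _ _ _ _ _ := by simp
  jacobi := L.jacobi

open GSym

/-- `v ↦ (m ↦ (w ↦ ± v * m w))` with the Koszul sign of moving an operator of degree `|w| + 1`
past `v`. -/
def brR : W →ₗ[𝕜] (W →ₗ[𝕜] GSym 𝒲) →ₗ[𝕜] (W →ₗ[𝕜] GSym 𝒲) :=
  LinearMap.mk₂ 𝕜 (fun v m =>
      LinearMap.mulLeft 𝕜 (gen 𝒲 (scale 𝒲 (fun s => if Even (s + 1) then 1 else 0) v)) ∘ₗ m +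
      LinearMap.mulLeft 𝕜 (gen 𝒲 (scale 𝒲 (fun s => if Even (s + 1) then 0 else 1) v)) ∘ₗ m ∘ₗ
        scale 𝒲 (fun r => (-1) ^ r))
    (by intro v v' m; ext w; simp [add_mul]; abel)
    (by intro c v m; ext w; simp)
    (by intro v m m'; ext w; simp [mul_add]; abel)
    (by intro c v m; ext w; simp)

theorem brR_apply {r s : ℕ} {v w : W} (hv : v ∈ 𝒲 s) (hw : w ∈ 𝒲 r) (m : W →ₗ[𝕜] GSym 𝒲) :
    brR v m w = (-1 : 𝕜) ^ (r * (s + 1)) • (gen 𝒲 v * m w) := by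
  simp only [brR, LinearMap.mk₂_apply, LinearMap.add_apply, LinearMap.comp_apply,
    scale_of_mem 𝒲 _ hv, scale_of_mem 𝒲 _ hw, map_smul, LinearMap.mulLeft_apply]
  rcases Nat.even_or_odd (s + 1) with h | h
  · simp [h, Even.neg_one_pow (h.mul_left r)]
  · simp only [Nat.not_even_iff_odd.2 h, if_false, zero_smul, zero_mul, zero_add, one_smul]
    rw [mul_comm r, pow_mul, h.neg_one_pow]

theorem exists_br : ∃ B : GSym 𝒲 →ₗ[𝕜] W →ₗ[𝕜] GSym 𝒲, B 1 = 0 ∧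
    ∀ v x, B (gen 𝒲 v * x) =
      (LinearMap.mulRight 𝕜 x ∘ₗ gen 𝒲 ∘ₗ L.b.flip v) + brR v (B x) := by
  refine exists_rec 𝒲 (LinearMap.mk₂ 𝕜 (fun v x => LinearMap.mulRight 𝕜 x ∘ₗ gen 𝒲 ∘ₗ L.b.flip v)
    ?_ ?_ ?_ ?_) brR ?_ ?_
  · intro v v' x; ext w; simp [add_mul]
  · intro c v x; ext w; simp
  · intro v x y; ext w; simp [mul_add]
  · intro c v x; ext w; simp
  · intro r s v hv u hu x
    refine hom_ext_homog 𝒲 fun t w hw => ?_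
    simp only [LinearMap.mk₂_apply, LinearMap.add_apply, LinearMap.smul_apply, brR_apply hv hw,
      brR_apply hu hw, LinearMap.comp_apply, LinearMap.mulRight_apply, LinearMap.flip_apply]
    rw [← mul_assoc, ← mul_assoc, ← mul_assoc, ← mul_assoc, gen_comm 𝒲 (L.b_mem _ _ _ hw _ hv) hu,
      gen_comm 𝒲 (L.b_mem _ _ _ hw _ hu) hv, smul_mul_assoc, smul_mul_assoc, smul_add,
      smul_smul, smul_smul, add_comm, ← pow_add, ← pow_add]
    congr 2
    · rw [← zpow_natCast, ← zpow_natCast]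
      exact neg_one_zpow_congr ⟨-(r:ℤ) * s - s - r  - 1, by push_cast; ring⟩
    · congr 1; ring
  · intro r s v hv u hu m
    refine hom_ext_homog 𝒲 fun t w hw => ?_
    simp only [brR_apply hv hw, brR_apply hu hw, LinearMap.smul_apply, mul_smul_comm, ← mul_assoc]
    rw [gen_comm 𝒲 hv hu]
    simp only [smul_mul_assoc, smul_smul]
    congr 1
    ring

/-- `br w x = B_w x`: bracketing the generator `w` into all factors of `x`. -/
def br : W →ₗ[𝕜] GSym 𝒲 →ₗ[𝕜] GSym 𝒲 := L.exists_br.choose.flip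

theorem br_one (w : W) : L.br w 1 = 0 := by
  simp [br, L.exists_br.choose_spec.1]

theorem br_gen_mul {r s : ℕ} {w v : W} (hw : w ∈ 𝒲 r) (hv : v ∈ 𝒲 s) (x : GSym 𝒲) :
    L.br w (gen 𝒲 v * x) = gen 𝒲 (L.b w v) * x + (-1 : 𝕜) ^ (r * (s + 1)) • (gen 𝒲 v * L.br w x) := by
  simp [br, L.exists_br.choose_spec.2, brR_apply hv hw]

theorem exists_d : ∃ D : GSym 𝒲 →ₗ[𝕜] GSym 𝒲, D 1 = 0 ∧
    ∀ w x, D (gen 𝒲 w * x) = (gen 𝒲 (L.δ w) * x + L.br w x) +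
      gen 𝒲 (scale 𝒲 (fun r => (-1) ^ (r + 1)) w) * D x := by
  refine exists_rec 𝒲 ((LinearMap.mul 𝕜 _ ∘ₗ gen 𝒲 ∘ₗ L.δ) + L.br)
    (LinearMap.mul 𝕜 _ ∘ₗ gen 𝒲 ∘ₗ scale 𝒲 (fun r => (-1) ^ (r + 1))) ?_ ?_
  · intro r s v hv u hu x
    simp only [LinearMap.add_apply, LinearMap.comp_apply, scale_of_mem 𝒲 _ hv, scale_of_mem 𝒲 _ hu,
      map_smul, LinearMap.smul_apply, LinearMap.mul_apply', L.br_gen_mul hv hu, L.br_gen_mul hu hv]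
    rw [L.b_symm _ _ _ hv _ hu]
    simp only [map_smul, smul_add, ← mul_assoc, smul_smul, mul_add]
    rw [gen_comm 𝒲 (L.δ_mem _ _ hv) hu, gen_comm 𝒲 hv (L.δ_mem _ _ hu)]
    simp only [smul_mul_assoc, smul_smul]
    rcases neg_one_pow_eq_or 𝕜 r with hr | hr <;> rcases neg_one_pow_eq_or 𝕜 s with hs | hs <;>
    · simp only [mul_add, add_mul, one_mul, mul_one, pow_add, pow_mul, hr, hs, pow_one, one_pow]
      module
  · intro r s v hv u hu m
    simp only [LinearMap.comp_apply, scale_of_mem 𝒲 _ hv, scale_of_mem 𝒲 _ hu,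
      map_smul, LinearMap.smul_apply, LinearMap.mul_apply', ← mul_assoc]
    rw [gen_comm 𝒲 hv hu]
    simp only [smul_mul_assoc, smul_smul]
    congr 1
    ring

/-- The differential on `Sym(W[1])` determined by `δ` and the bracket. On homogeneous generators,
`d (w x) = δ(w) x + (-1)^{|w|} w d(x) + B_w x`. -/
def d : GSym 𝒲 →ₗ[𝕜] GSym 𝒲 := L.exists_d.choose

theorem d_one : L.d 1 = 0 := L.exists_d.choose_spec.1

theorem d_gen_mul {r : ℕ} {w : W} (hw : w ∈ 𝒲 r) (x : GSym 𝒲) :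
    L.d (gen 𝒲 w * x) = gen 𝒲 (L.δ w) * x + L.br w x + (-1 : 𝕜) ^ (r + 1) • (gen 𝒲 w * L.d x) := by
  simp [d, L.exists_d.choose_spec.2, scale_of_mem 𝒲 _ hw]

theorem gr_cast {n m : ℤ} (h : n = m) {x : GSym 𝒲} (hx : x ∈ gr 𝒲 n) : x ∈ gr 𝒲 m := h ▸ hx

theorem br_mem {r : ℕ} {w : W} (hw : w ∈ 𝒲 r) {n : ℤ} {x : GSym 𝒲} (hx : x ∈ gr 𝒲 n) :
    L.br w x ∈ gr 𝒲 (n + r) := by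
  refine gr_induction 𝒲 (N := fun n => (gr 𝒲 (n + r)).comap (L.br w)) ?_ ?_ hx
  · simp [br_one]
  · intro s v hv n x hx ih
    rw [Submodule.mem_comap, L.br_gen_mul hw hv]
    refine Submodule.add_mem _ ?_ (Submodule.smul_mem _ _ ?_)
    · exact gr_cast (by push_cast; ring) (gen_mul_mem 𝒲 (L.b_mem _ _ _ hw _ hv) hx)
    · exact gr_cast (by push_cast; ring) (gen_mul_mem 𝒲 hv ih)

theorem d_mem {n : ℤ} {x : GSym 𝒲} (hx : x ∈ gr 𝒲 n) : L.d x ∈ gr 𝒲 (n + 1) := by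
  refine gr_induction 𝒲 (N := fun n => (gr 𝒲 (n + 1)).comap L.d) ?_ ?_ hx
  · simp [d_one]
  · intro s v hv n x hx ih
    rw [Submodule.mem_comap, L.d_gen_mul hv]
    refine Submodule.add_mem _ (Submodule.add_mem _ ?_ ?_) (Submodule.smul_mem _ _ ?_)
    · exact gr_cast (by push_cast; ring) (gen_mul_mem 𝒲 (L.δ_mem _ _ hv) hx)
    · exact gr_cast (by push_cast; ring) (L.br_mem hv hx)
    · exact gr_cast (by push_cast; ring) (gen_mul_mem 𝒲 hv ih)

/-- Linear extension of a vanishing statement for the span of monomials. -/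
theorem eq_zero_of_gen_mul {M : Type*} [AddCommGroup M] [Module 𝕜 M] (f : GSym 𝒲 →ₗ[𝕜] M)
    (h1 : f 1 = 0) (h : ∀ r, ∀ w ∈ 𝒲 r, ∀ x, f x = 0 → f (gen 𝒲 w * x) = 0) (x : GSym 𝒲) :
    f x = 0 := by
  refine induction (N := LinearMap.ker f) h1 ?_ x
  intro w x hx
  induction w using DirectSum.Decomposition.inductionOn 𝒲 with
  | zero => simp
  | homogeneous w => exact h _ _ w.2 x hx
  | add u v hu hv => rw [map_add, add_mul]; exact Submodule.add_mem _ hu hv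

theorem br_br {r s : ℕ} {w v : W} (hw : w ∈ 𝒲 r) (hv : v ∈ 𝒲 s) (x : GSym 𝒲) :
    L.br (L.b w v) x + (-1 : 𝕜) ^ (r * (s + 1)) • L.br v (L.br w x) +
      (-1 : 𝕜) ^ (r + 1) • L.br w (L.br v x) = 0 := by
  refine eq_zero_of_gen_mul (L.br (L.b w v) + (-1 : 𝕜) ^ (r * (s + 1)) • (L.br v ∘ₗ L.br w) +
      (-1 : 𝕜) ^ (r + 1) • (L.br w ∘ₗ L.br v)) (by simp [br_one]) ?_ x
  intro t u hu x hx
  simp only [LinearMap.add_apply, LinearMap.smul_apply, LinearMap.comp_apply] at hx ⊢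
  rw [L.br_gen_mul (L.b_mem _ _ _ hw _ hv) hu, L.br_gen_mul hw hu, L.br_gen_mul hv hu]
  simp only [map_add, map_smul]
  rw [L.br_gen_mul hv hu, L.br_gen_mul hw hu, L.br_gen_mul hv (L.b_mem _ _ _ hw _ hu),
    L.br_gen_mul hw (L.b_mem _ _ _ hv _ hu)]
  have hj := congrArg (fun z => gen 𝒲 z * x) (L.jacobi _ _ _ _ hw _ hv _ hu)
  simp only [map_add, map_smul, add_mul, smul_mul_assoc, map_zero, zero_mul] at hj
  have hx' := congrArg (fun z => gen 𝒲 u * z) hx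
  simp only [mul_add, mul_smul_comm, mul_zero] at hx'
  rcases neg_one_pow_eq_or 𝕜 r with hr | hr <;> rcases neg_one_pow_eq_or 𝕜 s with hs | hs <;>
  rcases neg_one_pow_eq_or 𝕜 t with ht | ht <;>
  · simp only [mul_add, add_mul, one_mul, mul_one, pow_add, pow_mul, hr, hs, ht, pow_one, one_pow, smul_add, smul_smul] at hj hx' ⊢
    first
    | linear_combination (norm := module) hj + hx'
    | linear_combination (norm := module) hj - hx'

theorem d_br {r : ℕ} {w : W} (hw : w ∈ 𝒲 r) (x : GSym 𝒲) :
    L.d (L.br w x) + (-1 : 𝕜) ^ (r + 1) • L.br w (L.d x) + L.br (L.δ w) x = 0 := by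
  refine eq_zero_of_gen_mul (L.d ∘ₗ L.br w + (-1 : 𝕜) ^ (r + 1) • (L.br w ∘ₗ L.d) +
    L.br (L.δ w)) (by simp [br_one, d_one]) ?_ x
  intro s v hv x hx
  simp only [LinearMap.add_apply, LinearMap.smul_apply, LinearMap.comp_apply] at hx ⊢
  rw [L.br_gen_mul hw hv, L.d_gen_mul hv, L.br_gen_mul (L.δ_mem _ _ hw) hv]
  simp only [map_add, map_smul]
  rw [L.d_gen_mul (L.b_mem _ _ _ hw _ hv), L.d_gen_mul hv, L.br_gen_mul hw (L.δ_mem _ _ hv),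
    L.br_gen_mul hw hv]
  have hj := congrArg (fun z => gen 𝒲 z * x) (L.δ_b _ _ _ hw _ hv)
  simp only [map_add, map_smul, add_mul, smul_mul_assoc, map_zero, zero_mul] at hj
  have hx' := congrArg (fun z => gen 𝒲 v * z) hx
  simp only [mul_add, mul_smul_comm, mul_zero] at hx'
  have hb := L.br_br hw hv x
  rcases neg_one_pow_eq_or 𝕜 r with hr | hr <;> rcases neg_one_pow_eq_or 𝕜 s with hs | hs <;>
  · simp only [mul_add, add_mul, one_mul, mul_one, pow_add, pow_mul, hr, hs, pow_one, one_pow, smul_add, smul_smul] at hj hx' hb ⊢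
    first
    | linear_combination (norm := module) hj + hx' + hb
    | linear_combination (norm := module) hj - hx' + hb

theorem d_d (x : GSym 𝒲) : L.d (L.d x) = 0 := by
  refine eq_zero_of_gen_mul (L.d ∘ₗ L.d) (by simp [d_one]) ?_ x
  intro s v hv x hx
  simp only [LinearMap.comp_apply] at hx ⊢
  rw [L.d_gen_mul hv]
  simp only [map_add, map_smul]
  rw [L.d_gen_mul hv, L.d_gen_mul (L.δ_mem _ _ hv), hx, L.δδ]
  have hd := L.d_br hv x
  simp only [map_zero, zero_mul, mul_zero, smul_zero, add_zero, zero_add]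
  rcases neg_one_pow_eq_or 𝕜 s with hs | hs <;>
  · simp only [pow_add, hs, pow_one, one_mul] at hd ⊢
    linear_combination (norm := module) hd

theorem br_mul_of_br_eq_zero {r : ℕ} {w : W} (hw : w ∈ 𝒲 r) {y : GSym 𝒲} (hy : L.br w y = 0)
    (z : GSym 𝒲) : L.br w (z * y) = L.br w z * y := by
  have := eq_zero_of_gen_mul (L.br w ∘ₗ LinearMap.mulRight 𝕜 y - LinearMap.mulRight 𝕜 y ∘ₗ L.br w)
    (by simp [br_one, hy]) ?_ z
  · simpa [sub_eq_zero] using this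
  · intro s v hv z hz
    simp only [LinearMap.sub_apply, LinearMap.comp_apply, LinearMap.mulRight_apply,
      sub_eq_zero] at hz ⊢
    rw [mul_assoc, L.br_gen_mul hw hv, L.br_gen_mul hw hv, hz, add_mul, smul_mul_assoc,
      mul_assoc, mul_assoc]

end ShiftedLie

section Functoriality

variable {W' : Type u} [AddCommGroup W'] [Module 𝕜 W'] (𝒲' : ℕ → Submodule 𝕜 W')
  [DirectSum.Decomposition 𝒲']

namespace GSym

variable {𝒲} in
/-- The algebra map induced by a degree-preserving linear map of generators. -/
def map (f : W →ₗ[𝕜] W') (hf : ∀ r, ∀ w ∈ 𝒲 r, f w ∈ 𝒲' r) : GSym 𝒲 →ₐ[𝕜] GSym 𝒲' :=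
  lift 𝒲 (gen 𝒲' ∘ₗ f) fun r s v hv w hw => gen_comm 𝒲' (hf r v hv) (hf s w hw)

variable {𝒲 𝒲'} {f : W →ₗ[𝕜] W'} (hf : ∀ r, ∀ w ∈ 𝒲 r, f w ∈ 𝒲' r)

theorem map_gen (w : W) : map 𝒲' f hf (gen 𝒲 w) = gen 𝒲' (f w) := lift_gen 𝒲 _ _ w

theorem map_mem {n : ℤ} {x : GSym 𝒲} (hx : x ∈ gr 𝒲 n) : map 𝒲' f hf x ∈ gr 𝒲' n := by
  refine gr_induction 𝒲 (N := fun n => (gr 𝒲' n).comap (map 𝒲' f hf).toLinearMap) ?_ ?_ hx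
  · simpa using one_mem 𝒲'
  · intro r w hw n x _ hx
    simp only [Submodule.mem_comap, AlgHom.toLinearMap_apply, map_mul, map_gen] at hx ⊢
    exact gen_mul_mem 𝒲' (hf r w hw) hx

theorem algHom_ext' {A : Type*} [Ring A] [Algebra 𝕜 A] {F G : GSym 𝒲 →ₐ[𝕜] A}
    (h : ∀ w, F (gen 𝒲 w) = G (gen 𝒲 w)) : F = G := by
  ext x
  have := induction (𝒲 := 𝒲) (N := LinearMap.ker (F.toLinearMap - G.toLinearMap)) (by simp) (by
    intro w x hx
    simp only [LinearMap.mem_ker, LinearMap.sub_apply, sub_eq_zero, AlgHom.toLinearMap_apply,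
      map_mul] at hx ⊢
    rw [hx, h]) x
  simpa [sub_eq_zero] using this

end GSym

open GSym

variable {𝒲 𝒲'} {f : W →ₗ[𝕜] W'} (hf : ∀ r, ∀ w ∈ 𝒲 r, f w ∈ 𝒲' r)

namespace ShiftedLie

variable {L : ShiftedLie 𝒲} {L' : ShiftedLie 𝒲'}

theorem map_br (hb : ∀ v w, f (L.b v w) = L'.b (f v) (f w)) {r : ℕ} {w : W} (hw : w ∈ 𝒲 r)
    (x : GSym 𝒲) : map 𝒲' f hf (L.br w x) = L'.br (f w) (map 𝒲' f hf x) := by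
  have := eq_zero_of_gen_mul ((map 𝒲' f hf).toLinearMap ∘ₗ L.br w -
    L'.br (f w) ∘ₗ (map 𝒲' f hf).toLinearMap) (by simp [br_one]) ?_ x
  · simpa [sub_eq_zero] using this
  · intro s v hv z hz
    simp only [LinearMap.sub_apply, LinearMap.comp_apply, AlgHom.toLinearMap_apply,
      sub_eq_zero] at hz ⊢
    simp only [L.br_gen_mul hw hv, map_mul, map_add, map_smul, map_gen,
      L'.br_gen_mul (hf r w hw) (hf s v hv), hz, hb]

/-- If all brackets of `w` with the image of `f` vanish, then `w` brackets to zero with the image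
of the induced map. -/
theorem br_map_eq_zero {r : ℕ} {w : W'} (hw : w ∈ 𝒲' r) (h : ∀ v, L'.b w (f v) = 0) (x : GSym 𝒲) :
    L'.br w (map 𝒲' f hf x) = 0 := by
  refine eq_zero_of_gen_mul (L'.br w ∘ₗ (map 𝒲' f hf).toLinearMap) (by simp [br_one]) ?_ x
  intro s v hv z hz
  simp only [LinearMap.comp_apply, AlgHom.toLinearMap_apply] at hz ⊢
  rw [map_mul, map_gen, L'.br_gen_mul hw (hf s v hv), hz, h]
  simp

/-- The Leibniz rule for a product whose right factor is annihilated by all the brackets with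
generators occurring in the left factor. -/
theorem d_map_mul (hδ : ∀ w, f (L.δ w) = L'.δ (f w)) (hb : ∀ v w, f (L.b v w) = L'.b (f v) (f w))
    {y : GSym 𝒲'} (hy : ∀ r, ∀ w ∈ 𝒲 r, L'.br (f w) y = 0) (x : GSym 𝒲) :
    L'.d (map 𝒲' f hf x * y) =
      map 𝒲' f hf (L.d x) * y + map 𝒲' f hf (eps 𝒲 x) * L'.d y := by
  have := eq_zero_of_gen_mul (L'.d ∘ₗ LinearMap.mulRight 𝕜 y ∘ₗ (map 𝒲' f hf).toLinearMap -
    LinearMap.mulRight 𝕜 y ∘ₗ (map 𝒲' f hf).toLinearMap ∘ₗ L.d -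
    LinearMap.mulRight 𝕜 (L'.d y) ∘ₗ (map 𝒲' f hf).toLinearMap ∘ₗ eps 𝒲)
    (by simp [d_one, eps_one]) ?_ x
  · simp only [LinearMap.sub_apply, LinearMap.comp_apply, AlgHom.toLinearMap_apply,
      LinearMap.mulRight_apply] at this
    rwa [sub_sub, sub_eq_zero] at this
  · intro s v hv z hz
    simp only [LinearMap.sub_apply, LinearMap.comp_apply, AlgHom.toLinearMap_apply,
      LinearMap.mulRight_apply] at hz ⊢
    rw [sub_sub, sub_eq_zero] at hz ⊢
    rw [L.d_gen_mul hv, eps_gen_mul 𝒲 hv]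
    simp only [map_mul, map_add, map_smul, map_gen]
    rw [mul_assoc, L'.d_gen_mul (hf s v hv), L'.br_mul_of_br_eq_zero (hf s v hv) (hy s v hv), hz,
      map_br hf hb hv, hδ]
    simp only [add_mul, mul_add, smul_add, smul_mul_assoc, mul_assoc]
    abel

theorem map_d (hδ : ∀ w, f (L.δ w) = L'.δ (f w)) (hb : ∀ v w, f (L.b v w) = L'.b (f v) (f w))
    (x : GSym 𝒲) : L'.d (map 𝒲' f hf x) = map 𝒲' f hf (L.d x) := by
  simpa [d_one] using d_map_mul hf hδ hb (y := 1) (fun r w _ => br_one _ _) x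

end ShiftedLie

end Functoriality

end GSymGrading

/-! ## Compactly supported differential forms on open subsets of `ℝ^m` -/

section Forms

variable (𝕜 : Type) [RCLike 𝕜] {m : ℕ}

/-- Smooth `𝕜`-valued functions on `ℝ^m` with compact support contained in `U`. -/
def Cc (U : Set (Fin m → ℝ)) : Submodule 𝕜 ((Fin m → ℝ) → 𝕜) where
  carrier := {f | ContDiff ℝ ∞ f ∧ HasCompactSupport f ∧ tsupport f ⊆ U}
  zero_mem' := ⟨contDiff_const, HasCompactSupport.zero, by simp [tsupport_eq_empty_iff.2 rfl]⟩
  add_mem' := fun hf hg =>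
    ⟨hf.1.add hg.1, hf.2.1.add hg.2.1,
      (tsupport_add _ _).trans (Set.union_subset hf.2.2 hg.2.2)⟩
  smul_mem' := fun c f hf =>
    ⟨contDiff_const.smul hf.1, hf.2.1.smul_left (f := fun _ => c),
      (tsupport_smul_subset_right (fun _ => c) f).trans hf.2.2⟩

variable {𝕜}

namespace Cc

variable {U : Set (Fin m → ℝ)}

theorem differentiable (f : Cc 𝕜 U) : Differentiable ℝ f.1 := f.2.1.differentiable (by simp)

/-- The partial derivative `∂_j`. -/
def pd (j : Fin m) : Cc 𝕜 U →ₗ[𝕜] Cc 𝕜 U where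
  toFun f := ⟨fun x => fderiv ℝ f.1 x (Pi.single j 1),
    (f.2.1.fderiv_right (m := ∞) (by simp)).clm_apply contDiff_const,
    f.2.2.1.fderiv_apply ℝ _, (tsupport_fderiv_apply_subset ℝ _).trans f.2.2.2⟩
  map_add' f g := by
    ext x
    simp [fderiv_add (differentiable f x) (differentiable g x)]
  map_smul' c f := by
    ext x
    simp [fderiv_const_smul (differentiable f x)]

theorem pd_comm (i j : Fin m) (f : Cc 𝕜 U) : pd i (pd j f) = pd j (pd i f) := by
  ext x
  have h2 : Differentiable ℝ (fderiv ℝ f.1) :=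
    (f.2.1.fderiv_right (m := ∞) (by simp)).differentiable (by simp)
  have key : ∀ k l : Fin m, (pd k (pd l f)).1 x =
      fderiv ℝ (fderiv ℝ f.1) x (Pi.single k 1) (Pi.single l 1) := by
    intro k l
    simp only [pd, LinearMap.coe_mk, AddHom.coe_mk]
    rw [fderiv_clm_apply (h2 x) (differentiableAt_const _)]
    simp
  rw [key, key]
  exact (f.2.1.contDiffAt.isSymmSndFDerivAt (by simp; exact WithTop.coe_le_coe.2 le_top)) _ _

/-- Multiplication. -/
def mul : Cc 𝕜 U →ₗ[𝕜] Cc 𝕜 U →ₗ[𝕜] Cc 𝕜 U :=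
  LinearMap.mk₂ 𝕜 (fun f g => ⟨f.1 * g.1, f.2.1.mul g.2.1, f.2.2.1.mul_right,
      (tsupport_mul_subset_left).trans f.2.2.2⟩)
    (by intro f f' g; ext x; simp [add_mul])
    (by intro c f g; ext x; simp [mul_assoc])
    (by intro f g g'; ext x; simp [mul_add])
    (by intro c f g; ext x; simp [mul_left_comm])

theorem mul_apply (f g : Cc 𝕜 U) (x : Fin m → ℝ) : (mul f g).1 x = f.1 x * g.1 x := rfl

theorem mul_comm' (f g : Cc 𝕜 U) : mul f g = mul g f := by
  ext x; simp [mul_apply, mul_comm]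

theorem mul_assoc' (f g h : Cc 𝕜 U) : mul (mul f g) h = mul f (mul g h) := by
  ext x; simp [mul_apply, mul_assoc]

theorem pd_mul (j : Fin m) (f g : Cc 𝕜 U) : pd j (mul f g) = mul (pd j f) g + mul f (pd j g) := by
  ext x
  simp only [pd, LinearMap.coe_mk, AddHom.coe_mk, Submodule.coe_add, Pi.add_apply, mul_apply]
  have : (mul f g).1 = fun x => f.1 x * g.1 x := rfl
  rw [this, fderiv_fun_mul (differentiable f x) (differentiable g x)]
  simp
  ring

/-- Integration. -/
def integral : Cc 𝕜 U →ₗ[𝕜] 𝕜 where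
  toFun f := ∫ x, f.1 x
  map_add' f g := integral_add (f.2.1.continuous.integrable_of_hasCompactSupport f.2.2.1)
    (g.2.1.continuous.integrable_of_hasCompactSupport g.2.2.1)
  map_smul' c _ := integral_const_mul c _

/-- Extension by zero. -/
def incl {U V : Set (Fin m → ℝ)} (h : U ⊆ V) : Cc 𝕜 U →ₗ[𝕜] Cc 𝕜 V :=
  Submodule.inclusion fun _ hf => ⟨hf.1, hf.2.1, hf.2.2.trans h⟩

theorem incl_pd {U V : Set (Fin m → ℝ)} (h : U ⊆ V) (j : Fin m) (f : Cc 𝕜 U) :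
    incl h (pd j f) = pd j (incl h f) := rfl

theorem incl_mul {U V : Set (Fin m → ℝ)} (h : U ⊆ V) (f k : Cc 𝕜 U) :
    incl h (mul f k) = mul (incl h f) (incl h k) := rfl

theorem incl_coe {U V : Set (Fin m → ℝ)} (h : U ⊆ V) (f : Cc 𝕜 U) : (incl h f).1 = f.1 := rfl

end Cc

variable (𝕜) (m) in
/-- The constant-coefficient forms: the exterior algebra on `dx_1, …, dx_m`. -/
abbrev CForm := ExteriorAlgebra 𝕜 (Fin m → 𝕜)

variable (𝕜) (m) in
/-- The degree of constant-coefficient forms. -/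
abbrev cgr (r : ℕ) : Submodule 𝕜 (CForm 𝕜 m) := ⋀[𝕜]^r (Fin m → 𝕜)

variable (𝕜) in
/-- The one-form `dx_j`. -/
def dx (j : Fin m) : CForm 𝕜 m := ExteriorAlgebra.ι 𝕜 (Pi.single j 1)

theorem cgr_mul {r s : ℕ} {a b : CForm 𝕜 m} (ha : a ∈ cgr 𝕜 m r) (hb : b ∈ cgr 𝕜 m s) :
    a * b ∈ cgr 𝕜 m (r + s) := SetLike.mul_mem_graded ha hb

theorem dx_mem (j : Fin m) : dx 𝕜 j ∈ cgr 𝕜 m 1 := by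
  simp [dx, cgr]

theorem ι_mul_comm {s : ℕ} {b : CForm 𝕜 m} (hb : b ∈ cgr 𝕜 m s) (v : Fin m → 𝕜) :
    ExteriorAlgebra.ι 𝕜 v * b = (-1 : 𝕜) ^ s • (b * ExteriorAlgebra.ι 𝕜 v) := by
  induction s generalizing b with
  | zero =>
    simp only [cgr, pow_zero, Submodule.one_eq_range, LinearMap.mem_range] at hb
    obtain ⟨c, rfl⟩ := hb
    simpa using (Algebra.commutes c _).symm
  | succ s ih =>
    rw [cgr, ExteriorAlgebra.exteriorPower, pow_succ] at hb
    refine Submodule.mul_induction_on hb ?_ ?_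
    · rintro b hb _ ⟨w, rfl⟩
      have hvw : ExteriorAlgebra.ι 𝕜 v * ExteriorAlgebra.ι 𝕜 w =
          -(ExteriorAlgebra.ι 𝕜 w * ExteriorAlgebra.ι 𝕜 v) :=
        eq_neg_of_add_eq_zero_left (ExteriorAlgebra.ι_add_mul_swap (R := 𝕜) v w)
      rw [← mul_assoc, ih hb, smul_mul_assoc, mul_assoc, mul_assoc, pow_succ, mul_smul,
        neg_one_smul, hvw, mul_neg]
    · intro x y hx hy
      rw [mul_add, hx, hy, add_mul, smul_add]

theorem c_mul_comm {r s : ℕ} {a b : CForm 𝕜 m} (ha : a ∈ cgr 𝕜 m r) (hb : b ∈ cgr 𝕜 m s) :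
    a * b = (-1 : 𝕜) ^ (r * s) • (b * a) := by
  induction r generalizing a with
  | zero =>
    simp only [cgr, pow_zero, Submodule.one_eq_range, LinearMap.mem_range] at ha
    obtain ⟨c, rfl⟩ := ha
    simpa using Algebra.commutes c _
  | succ r ih =>
    rw [cgr, ExteriorAlgebra.exteriorPower, pow_succ] at ha
    refine Submodule.mul_induction_on ha ?_ ?_
    · rintro a ha _ ⟨w, rfl⟩
      rw [mul_assoc, ι_mul_comm hb, mul_smul_comm, ← mul_assoc, ih ha, smul_mul_assoc, smul_smul,
        mul_assoc, add_mul, pow_add, one_mul, mul_comm]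
    · intro x y hx hy
      rw [add_mul, hx, hy, mul_add, smul_add]

theorem dx_mul_dx (i j : Fin m) : dx 𝕜 i * dx 𝕜 j = -(dx 𝕜 j * dx 𝕜 i) :=
  eq_neg_of_add_eq_zero_left (ExteriorAlgebra.ι_add_mul_swap _ _)

/-- Forms `∑ a ⊗ n` with constant-coefficient `a` and coefficients `n` in the module `N`. -/
def CT (𝕜 : Type) [RCLike 𝕜] (m : ℕ) (N : Type u) [AddCommGroup N] [Module 𝕜 N] : Type u :=
  CForm 𝕜 m ⊗[𝕜] N

namespace CT

section Basic

variable {N N' N'' : Type u} [AddCommGroup N] [Module 𝕜 N] [AddCommGroup N'] [Module 𝕜 N']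
  [AddCommGroup N''] [Module 𝕜 N'']

instance : AddCommGroup (CT 𝕜 m N) := inferInstanceAs (AddCommGroup (CForm 𝕜 m ⊗[𝕜] N))
instance : Module 𝕜 (CT 𝕜 m N) := inferInstanceAs (Module 𝕜 (CForm 𝕜 m ⊗[𝕜] N))

/-- The pure tensor `a ⊗ n`. -/
def tm : CForm 𝕜 m →ₗ[𝕜] N →ₗ[𝕜] CT 𝕜 m N := TensorProduct.mk 𝕜 (CForm 𝕜 m) N

/-- Linear maps out of `CT`. -/
def lift {M : Type*} [AddCommGroup M] [Module 𝕜 M] (F : CForm 𝕜 m →ₗ[𝕜] N →ₗ[𝕜] M) :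
    CT 𝕜 m N →ₗ[𝕜] M := TensorProduct.lift F

@[simp] theorem lift_tm {M : Type*} [AddCommGroup M] [Module 𝕜 M]
    (F : CForm 𝕜 m →ₗ[𝕜] N →ₗ[𝕜] M) (a : CForm 𝕜 m) (n : N) : lift F (tm a n) = F a n := rfl

/-- Forms of degree `r`. -/
def gr (𝕜 : Type) [RCLike 𝕜] (m : ℕ) (N : Type u) [AddCommGroup N] [Module 𝕜 N] (r : ℕ) :
    Submodule 𝕜 (CT 𝕜 m N) := DirectSum.decomposeTensor (cgr 𝕜 m) N r

instance : DirectSum.Decomposition (gr 𝕜 m N) := DirectSum.tensorDecomposition (cgr 𝕜 m) N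

theorem tm_mem {r : ℕ} {a : CForm 𝕜 m} (ha : a ∈ cgr 𝕜 m r) (n : N) : tm a n ∈ gr 𝕜 m N r :=
  ⟨(⟨a, ha⟩ : cgr 𝕜 m r) ⊗ₜ n, rfl⟩

theorem gr_le {r : ℕ} {P : Submodule 𝕜 (CT 𝕜 m N)} (h : ∀ a ∈ cgr 𝕜 m r, ∀ n : N, tm a n ∈ P) :
    gr 𝕜 m N r ≤ P := by
  rintro _ ⟨t, rfl⟩
  induction t using TensorProduct.induction_on with
  | zero => rw [map_zero]; exact P.zero_mem
  | tmul a n => exact h a.1 a.2 n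
  | add x y hx hy => rw [map_add]; exact P.add_mem hx hy

theorem ext_tm {M : Type*} [AddCommGroup M] [Module 𝕜 M] {F G : CT 𝕜 m N →ₗ[𝕜] M}
    (h : ∀ r, ∀ a ∈ cgr 𝕜 m r, ∀ n : N, F (tm a n) = G (tm a n)) : F = G := by
  refine hom_ext_homog (gr 𝕜 m N) fun r x hx => ?_
  have := gr_le (P := LinearMap.ker (F - G)) (fun a ha n => by simp [h r a ha n]) hx
  simpa [sub_eq_zero] using this

/-- Applying a linear map to the coefficients. -/
def map (F : N →ₗ[𝕜] N') : CT 𝕜 m N →ₗ[𝕜] CT 𝕜 m N' := lift (tm.compl₂ F)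

@[simp] theorem map_tm (F : N →ₗ[𝕜] N') (a : CForm 𝕜 m) (n : N) : map F (tm a n) = tm a (F n) := rfl

theorem map_mem (F : N →ₗ[𝕜] N') (r : ℕ) (x : CT 𝕜 m N) (hx : x ∈ gr 𝕜 m N r) :
    map F x ∈ gr 𝕜 m N' r :=
  gr_le (P := (gr 𝕜 m N' r).comap (map F)) (fun a ha n => tm_mem ha (F n)) hx

/-- The differential `d (a ⊗ n) = ∑ j, dx_j a ⊗ ∂_j n`. -/
def d (pd : Fin m → N →ₗ[𝕜] N) : CT 𝕜 m N →ₗ[𝕜] CT 𝕜 m N :=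
  lift (∑ j, (tm ∘ₗ LinearMap.mulLeft 𝕜 (dx 𝕜 j)).compl₂ (pd j))

theorem d_tm (pd : Fin m → N →ₗ[𝕜] N) (a : CForm 𝕜 m) (n : N) :
    d pd (tm a n) = ∑ j, tm (dx 𝕜 j * a) (pd j n) := by
  simp [d]

theorem d_d {pd : Fin m → N →ₗ[𝕜] N} (hpd : ∀ i j n, pd i (pd j n) = pd j (pd i n))
    (x : CT 𝕜 m N) : d pd (d pd x) = 0 := by
  refine LinearMap.congr_fun (f := d pd ∘ₗ d pd) (g := 0) (ext_tm fun r a _ n => ?_) x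
  simp only [LinearMap.comp_apply, d_tm, map_sum, LinearMap.zero_apply]
  have h : ∀ i j : Fin m, tm (dx 𝕜 j * (dx 𝕜 i * a)) (pd j (pd i n)) =
      -(tm (dx 𝕜 i * (dx 𝕜 j * a)) (pd i (pd j n))) := by
    intro i j
    rw [← mul_assoc, dx_mul_dx, hpd, neg_mul, map_neg, LinearMap.neg_apply, mul_assoc]
  have hs := Finset.sum_comm (s := (Finset.univ : Finset (Fin m))) (t := Finset.univ)
    (f := fun i j => tm (dx 𝕜 j * (dx 𝕜 i * a)) (pd j (pd i n)))
  rw [Finset.sum_congr rfl fun j _ => Finset.sum_congr rfl fun i _ => h i j] at hs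
  simp only [Finset.sum_neg_distrib] at hs
  rw [eq_neg_iff_add_eq_zero, ← two_smul 𝕜] at hs
  exact (smul_eq_zero.1 hs).resolve_left two_ne_zero

theorem d_mem (pd : Fin m → N →ₗ[𝕜] N) (r : ℕ) (x : CT 𝕜 m N) (hx : x ∈ gr 𝕜 m N r) :
    d pd x ∈ gr 𝕜 m N (r + 1) := by
  refine gr_le (P := (gr 𝕜 m N (r + 1)).comap (d pd)) (fun a ha n => ?_) hx
  rw [Submodule.mem_comap, d_tm, add_comm]
  exact Submodule.sum_mem _ fun j _ => tm_mem (cgr_mul (dx_mem j) ha) _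

/-- The shifted product `(a ⊗ n, b ⊗ k) ↦ (-1)^{|a|} a b ⊗ β(n, k)`. -/
def prod (β : N →ₗ[𝕜] N' →ₗ[𝕜] N'') : CT 𝕜 m N →ₗ[𝕜] CT 𝕜 m N' →ₗ[𝕜] CT 𝕜 m N'' :=
  TensorProduct.map₂ (LinearMap.mul 𝕜 (CForm 𝕜 m) ∘ₗ scale (cgr 𝕜 m) fun r => (-1) ^ r) β

theorem prod_tm (β : N →ₗ[𝕜] N' →ₗ[𝕜] N'') {r : ℕ} {a : CForm 𝕜 m} (ha : a ∈ cgr 𝕜 m r)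
    (b : CForm 𝕜 m) (n : N) (k : N') :
    prod β (tm a n) (tm b k) = (-1 : 𝕜) ^ r • tm (a * b) (β n k) := by
  have : prod β (tm a n) (tm b k) =
    tm ((scale (cgr 𝕜 m) fun r => (-1 : 𝕜) ^ r) a * b) (β n k) := rfl
  rw [this, scale_of_mem _ _ ha, smul_mul_assoc, map_smul, LinearMap.smul_apply]

theorem prod_mem (β : N →ₗ[𝕜] N' →ₗ[𝕜] N'') (r s : ℕ) (w : CT 𝕜 m N) (hw : w ∈ gr 𝕜 m N r)
    (v : CT 𝕜 m N') (hv : v ∈ gr 𝕜 m N' s) : prod β w v ∈ gr 𝕜 m N'' (r + s) := by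
  refine gr_le (P := (gr 𝕜 m N'' (r + s)).comap ((prod β).flip v)) (fun a ha n => ?_) hw
  rw [Submodule.mem_comap, LinearMap.flip_apply]
  refine gr_le (P := (gr 𝕜 m N'' (r + s)).comap (prod β _)) (fun b hb k => ?_) hv
  rw [Submodule.mem_comap, prod_tm β ha]
  exact Submodule.smul_mem _ _ (tm_mem (cgr_mul ha hb) _)

/-- The shifted differential and bracket on forms with coefficients in a module with commuting
derivations `pd j` of a Lie bracket `β`. -/
def shifted (pd : Fin m → N →ₗ[𝕜] N) (β : N →ₗ[𝕜] N →ₗ[𝕜] N)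
    (hpd : ∀ i j n, pd i (pd j n) = pd j (pd i n))
    (hder : ∀ j n k, pd j (β n k) = β (pd j n) k + β n (pd j k))
    (hsk : ∀ n k, β n k = -β k n)
    (hjac : ∀ n k l, β (β n k) l = β n (β k l) - β k (β n l)) : ShiftedLie (gr 𝕜 m N) where
  δ := -d pd
  b := prod β
  δ_mem r x hx := Submodule.neg_mem _ (d_mem pd r x hx)
  b_mem := prod_mem β
  δδ x := by simp [d_d hpd]
  b_symm r s w hw v hv := by
    have := gr_le (P := LinearMap.ker ((prod β).flip v -
      (-1 : 𝕜) ^ ((r + 1) * (s + 1)) • prod β v)) (fun a ha n => ?_) hw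
    · simpa [sub_eq_zero] using this
    have := gr_le (P := LinearMap.ker (prod β (tm a n) -
      (-1 : 𝕜) ^ ((r + 1) * (s + 1)) • (prod β).flip (tm a n))) (fun b hb k => ?_) hv
    · simpa [sub_eq_zero] using this
    simp only [LinearMap.mem_ker, LinearMap.sub_apply, LinearMap.smul_apply, LinearMap.flip_apply,
      sub_eq_zero]
    rw [prod_tm β ha, prod_tm β hb, c_mul_comm ha hb, hsk n k, map_neg, map_smul,
      LinearMap.smul_apply]
    rcases neg_one_pow_eq_or 𝕜 r with hr | hr <;> rcases neg_one_pow_eq_or 𝕜 s with hs | hs <;>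
    · simp only [mul_add, add_mul, one_mul, mul_one, pow_add, pow_mul, hr, hs, pow_one, one_pow]
      module
  δ_b r s w hw v hv := by
    have := gr_le (P := LinearMap.ker (-d pd ∘ₗ (prod β).flip v + (prod β).flip v ∘ₗ (-d pd) +
      (-1 : 𝕜) ^ (r + 1) • (prod β).flip ((-d pd) v))) (fun a ha n => ?_) hw
    · simpa using this
    have := gr_le (P := LinearMap.ker (-d pd ∘ₗ prod β (tm a n) + prod β ((-d pd) (tm a n)) +
      (-1 : 𝕜) ^ (r + 1) • prod β (tm a n) ∘ₗ (-d pd))) (fun b hb k => ?_) hv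
    · simpa using this
    have h1 : ∀ j : Fin m, a * (dx 𝕜 j * b) = (-1 : 𝕜) ^ r • (dx 𝕜 j * (a * b)) := by
      intro j
      rw [← mul_assoc, c_mul_comm ha (dx_mem j), smul_mul_assoc, mul_assoc, mul_one]
    simp only [LinearMap.mem_ker, LinearMap.add_apply, LinearMap.smul_apply, LinearMap.comp_apply,
      LinearMap.neg_apply, d_tm, prod_tm β ha, map_neg, map_smul, map_sum, LinearMap.sum_apply,
      prod_tm β (cgr_mul (dx_mem _) ha), hder, map_add, Finset.sum_add_distrib, h1, mul_assoc,
      ← Finset.smul_sum]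
    rcases neg_one_pow_eq_or 𝕜 r with hr | hr <;>
    · simp only [pow_add, hr, pow_one]
      module
  jacobi r s t w hw v hv u hu := by
    have := gr_le (P := LinearMap.ker ((prod β).flip u ∘ₗ (prod β).flip v +
      (-1 : 𝕜) ^ (r * (s + 1)) • prod β v ∘ₗ (prod β).flip u +
      (-1 : 𝕜) ^ (r + 1) • (prod β).flip (prod β v u))) (fun a ha n => ?_) hw
    · simpa using this
    have := gr_le (P := LinearMap.ker ((prod β).flip u ∘ₗ prod β (tm a n) +
      (-1 : 𝕜) ^ (r * (s + 1)) • (prod β).flip (prod β (tm a n) u) +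
      (-1 : 𝕜) ^ (r + 1) • prod β (tm a n) ∘ₗ (prod β).flip u)) (fun b hb k => ?_) hv
    · simpa using this
    have := gr_le (P := LinearMap.ker (prod β (prod β (tm a n) (tm b k)) +
      (-1 : 𝕜) ^ (r * (s + 1)) • prod β (tm b k) ∘ₗ prod β (tm a n) +
      (-1 : 𝕜) ^ (r + 1) • prod β (tm a n) ∘ₗ prod β (tm b k))) (fun c hc l => ?_) hu
    · simpa using this
    have h1 : b * (a * c) = (-1 : 𝕜) ^ (r * s) • (a * (b * c)) := by
      rw [← mul_assoc, c_mul_comm hb ha, smul_mul_assoc, mul_assoc, mul_comm s]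
    simp only [LinearMap.mem_ker, LinearMap.add_apply, LinearMap.smul_apply, LinearMap.comp_apply,
      prod_tm β ha, prod_tm β hb, prod_tm β (cgr_mul ha hb), map_smul, h1, mul_assoc, hjac, map_sub]
    rcases neg_one_pow_eq_or 𝕜 r with hr | hr <;> rcases neg_one_pow_eq_or 𝕜 s with hs | hs <;>
    · simp only [mul_add, one_mul, mul_one, pow_add, pow_mul, hr, hs, pow_one, one_pow]
      module

theorem map_d {pd : Fin m → N →ₗ[𝕜] N} {pd' : Fin m → N' →ₗ[𝕜] N'} {F : N →ₗ[𝕜] N'}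
    (h : ∀ j n, F (pd j n) = pd' j (F n)) (x : CT 𝕜 m N) : map F (d pd x) = d pd' (map F x) := by
  refine LinearMap.congr_fun (f := map F ∘ₗ d pd) (g := d pd' ∘ₗ map F)
    (ext_tm fun r a _ n => ?_) x
  simp [d_tm, h]

theorem map_prod {M M' M'' : Type u} [AddCommGroup M] [Module 𝕜 M] [AddCommGroup M'] [Module 𝕜 M']
    [AddCommGroup M''] [Module 𝕜 M''] {β : N →ₗ[𝕜] N' →ₗ[𝕜] N''} {β' : M →ₗ[𝕜] M' →ₗ[𝕜] M''}
    {F : N →ₗ[𝕜] M} {F' : N' →ₗ[𝕜] M'} {F'' : N'' →ₗ[𝕜] M''}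
    (h : ∀ n k, F'' (β n k) = β' (F n) (F' k)) (x : CT 𝕜 m N) (y : CT 𝕜 m N') :
    map F'' (prod β x y) = prod β' (map F x) (map F' y) := by
  have : (prod β).compr₂ (map F'') = (prod β').compl₁₂ (map (m := m) F) (map F') := by
    refine ext_tm fun r a ha n => ext_tm fun s b hb k => ?_
    simp only [LinearMap.compr₂_apply, LinearMap.compl₁₂_apply, prod_tm _ ha, map_tm, map_smul, h]
  exact LinearMap.congr_fun₂ this x y

theorem map_map (F : N →ₗ[𝕜] N') (G : N' →ₗ[𝕜] N'') (x : CT 𝕜 m N) :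
    map G (map F x) = map (G ∘ₗ F) x := by
  refine LinearMap.congr_fun (f := map G ∘ₗ map F) (g := map (G ∘ₗ F)) (ext_tm fun r a _ n => ?_) x
  rfl

theorem map_id (x : CT 𝕜 m N) : map (LinearMap.id : N →ₗ[𝕜] N) x = x :=
  LinearMap.congr_fun (f := map LinearMap.id) (g := LinearMap.id) (ext_tm fun r a _ n => rfl) x

end Basic

end CT

variable {U V : Set (Fin m → ℝ)}

variable (𝕜) in
/-- Compactly supported differential forms `∑ a ⊗ f` on `U`. -/
abbrev Form (U : Set (Fin m → ℝ)) := CT 𝕜 m (Cc 𝕜 U)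

/-- The de Rham differential. -/
def dR : Form 𝕜 U →ₗ[𝕜] Form 𝕜 U := CT.d Cc.pd

/-- The coefficient of `dx_1 ∧ ⋯ ∧ dx_m` (zero on forms of degree different from `m`). -/
def topCoeff : CForm 𝕜 m →ₗ[𝕜] 𝕜 :=
  ExteriorAlgebra.liftAlternating (Pi.single m Matrix.detRowAlternating)

/-- Integration of forms (zero on forms of degree different from `m`). -/
def formInt : Form 𝕜 U →ₗ[𝕜] 𝕜 :=
  CT.lift ((LinearMap.mul 𝕜 𝕜).compl₁₂ topCoeff Cc.integral)

section Lie

variable (𝕜) in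
/-- Compactly supported `g`-valued functions `∑ f ⊗ X` on `U`. -/
def CG (g : Type u) [AddCommGroup g] [Module 𝕜 g] (U : Set (Fin m → ℝ)) : Type u := Cc 𝕜 U ⊗[𝕜] g

variable {g : Type u} [LieRing g] [LieAlgebra 𝕜 g]

instance : AddCommGroup (CG 𝕜 g U) := inferInstanceAs (AddCommGroup (Cc 𝕜 U ⊗[𝕜] g))
instance : Module 𝕜 (CG 𝕜 g U) := inferInstanceAs (Module 𝕜 (Cc 𝕜 U ⊗[𝕜] g))

namespace CG

/-- The pure tensor `f ⊗ X`. -/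
def tm : Cc 𝕜 U →ₗ[𝕜] g →ₗ[𝕜] CG 𝕜 g U := TensorProduct.mk 𝕜 (Cc 𝕜 U) g

theorem ext_tm {M : Type*} [AddCommGroup M] [Module 𝕜 M] {F G : CG 𝕜 g U →ₗ[𝕜] M}
    (h : ∀ f X, F (tm f X) = G (tm f X)) : F = G :=
  TensorProduct.ext' h

variable (U g) in
/-- `∂_j (f ⊗ X) = ∂_j f ⊗ X`. -/
def pd (j : Fin m) : CG 𝕜 g U →ₗ[𝕜] CG 𝕜 g U := (Cc.pd j).rTensor g

variable (U g) in
/-- The bracket `[f ⊗ X, h ⊗ Y] = f h ⊗ [X, Y]`. -/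
def bracket : CG 𝕜 g U →ₗ[𝕜] CG 𝕜 g U →ₗ[𝕜] CG 𝕜 g U :=
  TensorProduct.map₂ Cc.mul (LieModule.toEnd 𝕜 g g : g →ₗ[𝕜] Module.End 𝕜 g)

theorem pd_tm (j : Fin m) (f : Cc 𝕜 U) (X : g) : pd U g j (tm f X) = tm (Cc.pd j f) X := rfl

theorem bracket_tm (f h : Cc 𝕜 U) (X Y : g) :
    bracket U g (tm f X) (tm h Y) = tm (Cc.mul f h) ⁅X, Y⁆ := rfl

theorem pd_comm (i j : Fin m) (n : CG 𝕜 g U) : pd U g i (pd U g j n) = pd U g j (pd U g i n) := by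
  refine LinearMap.congr_fun (f := pd U g i ∘ₗ pd U g j) (g := pd U g j ∘ₗ pd U g i)
    (ext_tm fun f X => ?_) n
  simp [pd_tm, Cc.pd_comm i j]

theorem pd_bracket (j : Fin m) (n k : CG 𝕜 g U) :
    pd U g j (bracket U g n k) = bracket U g (pd U g j n) k + bracket U g n (pd U g j k) := by
  refine LinearMap.congr_fun₂ (f := (bracket U g).compr₂ (pd U g j))
    (g := bracket U g ∘ₗ pd U g j + (bracket U g).compl₂ (pd U g j))
    (ext_tm fun f X => ext_tm fun h Y => ?_) n k
  simp [pd_tm, bracket_tm, Cc.pd_mul]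

theorem bracket_skew (n k : CG 𝕜 g U) : bracket U g n k = -bracket U g k n := by
  refine LinearMap.congr_fun₂ (f := bracket U g) (g := -(bracket U g).flip)
    (ext_tm fun f X => ext_tm fun h Y => ?_) n k
  simp only [LinearMap.neg_apply, LinearMap.flip_apply, bracket_tm]
  rw [Cc.mul_comm' f, ← lie_skew X Y, map_neg]

theorem bracket_jacobi (n k l : CG 𝕜 g U) : bracket U g (bracket U g n k) l =
    bracket U g n (bracket U g k l) - bracket U g k (bracket U g n l) := by
  have h2 : ∀ f h e : Cc 𝕜 U, Cc.mul h (Cc.mul f e) = Cc.mul f (Cc.mul h e) := by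
    intro f h e
    rw [← Cc.mul_assoc', Cc.mul_comm' h, Cc.mul_assoc']
  have h1 : ∀ (f h : Cc 𝕜 U) (X Y : g), bracket U g (bracket U g (tm f X) (tm h Y)) =
      bracket U g (tm f X) ∘ₗ bracket U g (tm h Y) - bracket U g (tm h Y) ∘ₗ bracket U g (tm f X) := by
    intro f h X Y
    refine ext_tm fun e Z => ?_
    simp only [bracket_tm, LinearMap.sub_apply, LinearMap.comp_apply, Cc.mul_assoc', lie_lie,
      map_sub, h2 f h]
  have h3 := LinearMap.congr_fun₂ (f := (bracket U g).compr₂ (bracket U g))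
    (g := (LinearMap.mul 𝕜 (Module.End 𝕜 (CG 𝕜 g U))).compl₁₂ (bracket U g) (bracket U g) -
      ((LinearMap.mul 𝕜 (Module.End 𝕜 (CG 𝕜 g U))).compl₁₂ (bracket U g) (bracket U g)).flip)
    (ext_tm fun f X => ext_tm fun h Y => h1 f h X Y) n k
  exact LinearMap.congr_fun h3 l

variable (g) in
/-- Extension by zero. -/
def incl (h : U ⊆ V) : CG 𝕜 g U →ₗ[𝕜] CG 𝕜 g V := (Cc.incl h).rTensor g

theorem incl_tm (h : U ⊆ V) (f : Cc 𝕜 U) (X : g) : incl g h (tm f X) = tm (Cc.incl h f) X := rfl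

theorem incl_pd (h : U ⊆ V) (j : Fin m) (n : CG 𝕜 g U) :
    incl g h (pd U g j n) = pd V g j (incl g h n) :=
  LinearMap.congr_fun (f := incl g h ∘ₗ pd U g j) (g := pd V g j ∘ₗ incl g h)
    (ext_tm fun f X => by
      simp only [LinearMap.comp_apply, pd_tm, incl_tm, Cc.incl_pd]) n

theorem incl_bracket (h : U ⊆ V) (n k : CG 𝕜 g U) :
    incl g h (bracket U g n k) = bracket V g (incl g h n) (incl g h k) :=
  LinearMap.congr_fun₂ (f := (bracket U g).compr₂ (incl g h))
    (g := (bracket V g).compl₁₂ (incl g h) (incl g h))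
    (ext_tm fun f X => ext_tm fun k Y => by
      simp only [LinearMap.compr₂_apply, LinearMap.compl₁₂_apply, bracket_tm, incl_tm,
        Cc.incl_mul]) n k

theorem bracket_disjoint {U' : Set (Fin m → ℝ)} (hd : Disjoint U U') (h : U ⊆ V) (h' : U' ⊆ V)
    (n : CG 𝕜 g U) (k : CG 𝕜 g U') : bracket V g (incl g h n) (incl g h' k) = 0 := by
  refine LinearMap.congr_fun₂ (f := (bracket V g).compl₁₂ (incl g h) (incl g h')) (g := 0)
    (ext_tm fun f X => ext_tm fun e Y => ?_) n k
  have : Cc.mul (Cc.incl h f) (Cc.incl h' e) = 0 := by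
    ext x
    simp only [Cc.mul_apply, Cc.incl_coe]
    by_cases hx : x ∈ U
    · have : e.1 x = 0 := image_eq_zero_of_notMem_tsupport fun hk =>
        Set.disjoint_left.1 hd hx (e.2.2.2 hk)
      simp [this]
    · have : f.1 x = 0 := image_eq_zero_of_notMem_tsupport fun hk => hx (f.2.2.2 hk)
      simp [this]
  simp [incl_tm, bracket_tm, this]

end CG

variable (𝕜) in
/-- Compactly supported `g`-valued forms, `Ω_c(U) ⊗ g`. -/
abbrev GForm (g : Type u) [LieRing g] [LieAlgebra 𝕜 g] (U : Set (Fin m → ℝ)) := CT 𝕜 m (CG 𝕜 g U)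

variable (𝕜) in
/-- The grading of `Ω_c(U) ⊗ g` by form degree. -/
abbrev GForm.gr (g : Type u) [LieRing g] [LieAlgebra 𝕜 g] (U : Set (Fin m → ℝ)) (r : ℕ) :
    Submodule 𝕜 (GForm 𝕜 g U) := CT.gr 𝕜 m (CG 𝕜 g U) r

namespace GForm

variable (𝕜 g) in
/-- The differential `-d_dR` and the bracket `(α ⊗ X, η ⊗ Y) ↦ (-1)^{|α|} (α ∧ η) ⊗ [X, Y]` on
`(Ω_c(U) ⊗ g)[1]`. -/
def shifted (U : Set (Fin m → ℝ)) : ShiftedLie (GForm.gr 𝕜 g U) :=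
  CT.shifted (CG.pd U g) (CG.bracket U g) CG.pd_comm CG.pd_bracket CG.bracket_skew CG.bracket_jacobi

variable (g) in
/-- Extension by zero of `g`-valued forms. -/
def ext (h : U ⊆ V) : GForm 𝕜 g U →ₗ[𝕜] GForm 𝕜 g V := CT.map (CG.incl g h)

theorem ext_mem (h : U ⊆ V) : ∀ r, ∀ w ∈ GForm.gr 𝕜 g U r, ext g h w ∈ GForm.gr 𝕜 g V r :=
  CT.map_mem _

theorem ext_δ (h : U ⊆ V) (w : GForm 𝕜 g U) :
    ext g h ((shifted 𝕜 g U).δ w) = (shifted 𝕜 g V).δ (ext g h w) := by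
  have := CT.map_d (CG.incl_pd (g := g) h) w
  simp only [shifted, CT.shifted, LinearMap.neg_apply, map_neg, ext, this]

theorem ext_b (h : U ⊆ V) (v w : GForm 𝕜 g U) :
    ext g h ((shifted 𝕜 g U).b v w) = (shifted 𝕜 g V).b (ext g h v) (ext g h w) :=
  CT.map_prod (CG.incl_bracket h) v w

theorem ext_disjoint {U' : Set (Fin m → ℝ)} (hd : Disjoint U U') (h : U ⊆ V) (h' : U' ⊆ V)
    (v : GForm 𝕜 g U) (w : GForm 𝕜 g U') : (shifted 𝕜 g V).b (ext g h v) (ext g h' w) = 0 := by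
  refine LinearMap.congr_fun₂ (f := ((shifted 𝕜 g V).b).compl₁₂ (ext g h) (ext g h')) (g := 0)
    (CT.ext_tm fun r a ha n => CT.ext_tm fun s b hb k => ?_) v w
  have := CT.prod_tm (CG.bracket V g) ha b (CG.incl g h n) (CG.incl g h' k)
  rw [CG.bracket_disjoint hd, map_zero, smul_zero] at this
  exact this

theorem ext_ext {U' : Set (Fin m → ℝ)} (h : U ⊆ V) (h' : V ⊆ U') (w : GForm 𝕜 g U) :
    ext g h' (ext g h w) = ext g (h.trans h') w := by
  rw [ext, ext, CT.map_map]
  congr 2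
  exact CG.ext_tm fun _ _ => rfl

theorem ext_self (h : U ⊆ U) (w : GForm 𝕜 g U) : ext g h w = w := by
  have : CG.incl (𝕜 := 𝕜) g h = LinearMap.id := CG.ext_tm fun _ _ => rfl
  rw [ext, this, CT.map_id]

end GForm

end Lie
end Forms

/-! ## Disks and prefactorization algebras -/

/-- A disk in `ℝ^m`: an open subset diffeomorphic to `ℝ^m`. -/
structure Disk (m : ℕ) where
  carrier : Set (Fin m → ℝ)
  isOpen : IsOpen carrier
  diffeo : ∃ φ ψ : (Fin m → ℝ) → (Fin m → ℝ), ContDiffOn ℝ ∞ φ carrier ∧ ContDiff ℝ ∞ ψ ∧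
    (∀ x ∈ carrier, ψ (φ x) = x) ∧ ∀ y, ψ y ∈ carrier ∧ φ (ψ y) = y

/-- The disk `ℝ^m` itself. -/
def Disk.whole (m : ℕ) : Disk m where
  carrier := Set.univ
  isOpen := isOpen_univ
  diffeo := ⟨id, id, contDiffOn_id, contDiff_id, fun _ _ => rfl, fun _ => ⟨trivial, rfl⟩⟩

/-- The operation `ι_{Ds}^D` exists: the disks `Ds` are pairwise disjoint and contained in `D`. -/
def Adm {m : ℕ} (Ds : List (Disk m)) (D : Disk m) : Prop :=
  (∀ D' ∈ Ds, D'.carrier ⊆ D.carrier) ∧ Ds.Pairwise fun D' D'' => Disjoint D'.carrier D''.carrier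

/-- Tuples whose entries have the types prescribed by a list of indices. -/
inductive HL {ι : Type} (A : ι → Type u) : List ι → Type u
  | nil : HL A []
  | cons {i : ι} {is : List ι} : A i → HL A is → HL A (i :: is)

namespace HL

variable {ι : Type} {A A' : ι → Type u}

/-- Concatenation. -/
def append : {l r : List ι} → HL A l → HL A r → HL A (l ++ r)
  | _, _, nil, ys => ys
  | _, _, cons x xs, ys => cons x (append xs ys)

/-- Entrywise application of a family of maps. -/
def map (f : ∀ i, A i → A' i) : {l : List ι} → HL A l → HL A' l
  | _, nil => nil
  | _, cons x xs => cons (f _ x) (map f xs)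

end HL

/-- Cochain complexes over `𝕜` (cohomological grading by `ℤ`). -/
structure DGMod (𝕜 : Type) [Field 𝕜] where
  carrier : Type u
  [acg : AddCommGroup carrier]
  [mod : Module 𝕜 carrier]
  gr : ℤ → Submodule 𝕜 carrier
  internal : DirectSum.IsInternal gr
  d : carrier →ₗ[𝕜] carrier
  d_mem : ∀ n, ∀ x ∈ gr n, d x ∈ gr (n + 1)
  d_d : ∀ x, d (d x) = 0

attribute [instance] DGMod.acg DGMod.mod

instance (𝕜 : Type) [Field 𝕜] : CoeSort (DGMod.{u} 𝕜) (Type u) := ⟨DGMod.carrier⟩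

section DG

variable {𝕜 : Type} [Field 𝕜] {m : ℕ}

/-- The sign involution `x ↦ (-1)^{|x|} x`. -/
def DGMod.ε (V : DGMod.{u} 𝕜) : V →ₗ[𝕜] V :=
  letI := V.internal.chooseDecomposition
  scale V.gr fun n => (-1) ^ n

/-- A family of cochain complexes indexed by disks. -/
abbrev Fam (m : ℕ) (𝕜 : Type) [Field 𝕜] := Disk m → DGMod.{u} 𝕜

/-- Tuples of elements of a family. -/
abbrev Tup (A : Fam.{u} m 𝕜) (Ds : List (Disk m)) := HL (fun D => (A D).carrier) Ds

/-- The tuple `xs` consists of homogeneous elements of total degree `n`. -/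
def Tup.HasDeg {A : Fam.{u} m 𝕜} : {Ds : List (Disk m)} → Tup A Ds → ℤ → Prop
  | _, .nil, n => n = 0
  | D :: _, .cons x xs, n => ∃ p q, n = p + q ∧ x ∈ (A D).gr p ∧ Tup.HasDeg xs q

/-- Signs `(-1)^{|xs|}` applied to a tuple. -/
def Tup.twist {A : Fam.{u} m 𝕜} {Ds : List (Disk m)} (xs : Tup A Ds) : Tup A Ds :=
  xs.map fun D => (A D).ε

/-- `∑ ± g (x_1, …, d x_j, …, x_n)` with the Koszul signs of moving `d` to position `j`. -/
def Tup.dsum {A : Fam.{u} m 𝕜} {M : Type u} [AddCommGroup M] :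
    {Ds : List (Disk m)} → (Tup A Ds → M) → Tup A Ds → M
  | _, _, .nil => 0
  | D :: _, g, .cons x xs =>
      g (.cons ((A D).d x) xs) + Tup.dsum (fun ys => g (.cons ((A D).ε x) ys)) xs

/-- Prefactorization algebras on `ℝ^m` (algebras over the operad with one operation `ι_{Ds}^D` for
every tuple `Ds` of pairwise disjoint subdisks of `D`). The operation is set to zero on tuples of
disks for which `ι_{Ds}^D` does not exist. -/
structure PFA (m : ℕ) (𝕜 : Type) [Field 𝕜] where
  obj : Fam.{u} m 𝕜
  act : ∀ {Ds : List (Disk m)} (D : Disk m), Tup obj Ds → obj D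
  act_not_adm : ∀ {Ds : List (Disk m)} (D : Disk m) (xs : Tup obj Ds), ¬ Adm Ds D → act D xs = 0
  act_add : ∀ {l r : List (Disk m)} {D' : Disk m} (D : Disk m) (xs : Tup obj l) (a b : obj D')
    (ys : Tup obj r), act D (xs.append (.cons (a + b) ys)) =
      act D (xs.append (.cons a ys)) + act D (xs.append (.cons b ys))
  act_smul : ∀ {l r : List (Disk m)} {D' : Disk m} (D : Disk m) (xs : Tup obj l) (c : 𝕜)
    (a : obj D') (ys : Tup obj r),
      act D (xs.append (.cons (c • a) ys)) = c • act D (xs.append (.cons a ys))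
  act_mem : ∀ {Ds : List (Disk m)} (D : Disk m) (xs : Tup obj Ds) (n : ℤ), Tup.HasDeg xs n →
    act D xs ∈ (obj D).gr n
  act_d : ∀ {Ds : List (Disk m)} (D : Disk m) (xs : Tup obj Ds),
    (obj D).d (act D xs) = Tup.dsum (fun ys => act D ys) xs
  act_one : ∀ {D : Disk m} (x : obj D), act D (.cons x .nil) = x
  act_act : ∀ {l r Es : List (Disk m)} {D' : Disk m} (D : Disk m) (xs : Tup obj l)
    (es : Tup obj Es) (ys : Tup obj r), Adm (l ++ D' :: r) D → Adm Es D' →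
      act D (xs.append (.cons (act D' es) ys)) = act D (xs.append (es.append ys))
  act_swap : ∀ {l r : List (Disk m)} {D₁ D₂ : Disk m} (D : Disk m) (xs : Tup obj l)
    (a : obj D₁) (b : obj D₂) (ys : Tup obj r) (p q : ℤ), a ∈ (obj D₁).gr p → b ∈ (obj D₂).gr q →
      act D (xs.append (.cons a (.cons b ys))) =
        (-1 : 𝕜) ^ (p * q) • act D (xs.append (.cons b (.cons a ys)))

/-! ## Decorated trees -/

mutual
/-- Planar trees whose vertices are operations `ι_{Ds}^D` and whose leaves are decorated by
elements of `A`. -/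
inductive Tr (A : Disk m → Type u) : Disk m → Type u
  | leaf {D : Disk m} : A D → Tr A D
  | node {Ds : List (Disk m)} (D : Disk m) : Fo A Ds → Tr A D
/-- Lists of such trees. -/
inductive Fo (A : Disk m → Type u) : List (Disk m) → Type u
  | nil : Fo A []
  | cons {D : Disk m} {Ds : List (Disk m)} : Tr A D → Fo A Ds → Fo A (D :: Ds)
end

section Plain

variable {A A' : Disk m → Type u}

mutual
/-- The number of vertices. -/
def Tr.verts : {D : Disk m} → Tr A D → ℕ
  | _, .leaf _ => 0
  | _, .node _ xs => Fo.verts xs + 1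
/-- The number of vertices. -/
def Fo.verts : {Ds : List (Disk m)} → Fo A Ds → ℕ
  | _, .nil => 0
  | _, .cons x xs => Tr.verts x + Fo.verts xs
end

mutual
/-- Every vertex is an existing, non-identity operation. -/
def Tr.Valid : {D : Disk m} → Tr A D → Prop
  | _, .leaf _ => True
  | _, .node (Ds := Ds) D xs => Adm Ds D ∧ Ds ≠ [D] ∧ Fo.Valid xs
/-- Every vertex is an existing, non-identity operation. -/
def Fo.Valid : {Ds : List (Disk m)} → Fo A Ds → Prop
  | _, .nil => True
  | _, .cons x xs => Tr.Valid x ∧ Fo.Valid xs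
end

mutual
/-- Application of a family of maps to all decorations. -/
def Tr.map (f : ∀ D, A D → A' D) : {D : Disk m} → Tr A D → Tr A' D
  | _, .leaf a => .leaf (f _ a)
  | _, .node D xs => .node D (Fo.map f xs)
/-- Application of a family of maps to all decorations. -/
def Fo.map (f : ∀ D, A D → A' D) : {Ds : List (Disk m)} → Fo A Ds → Fo A' Ds
  | _, .nil => .nil
  | _, .cons x xs => .cons (Tr.map f x) (Fo.map f xs)
end

/-- Concatenation. -/
def Fo.append : {l r : List (Disk m)} → Fo A l → Fo A r → Fo A (l ++ r)
  | _, _, .nil, ys => ys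
  | _, _, .cons x xs, ys => .cons x (Fo.append xs ys)

/-- A tuple of decorations as a list of trees without vertices. -/
def Fo.leaves : {Ds : List (Disk m)} → HL A Ds → Fo A Ds
  | _, .nil => .nil
  | _, .cons a as => .cons (.leaf a) (Fo.leaves as)

/-- The tuple of decorations, if no tree in the list has a vertex. -/
def Fo.vals : {Ds : List (Disk m)} → Fo A Ds → Option (HL A Ds)
  | _, .nil => some .nil
  | _, .cons (.leaf a) xs => (Fo.vals xs).map (HL.cons a)
  | _, .cons (.node _ _) _ => none

/-- Evaluation of each tree in a list. -/
def Fo.eval (f : ∀ D, Tr A D → A' D) : {Ds : List (Disk m)} → Fo A Ds → HL A' Ds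
  | _, .nil => .nil
  | _, .cons x xs => .cons (f _ x) (Fo.eval f xs)

end Plain

/-- Trees decorated by a family of complexes. -/
abbrev DTr (A : Fam.{u} m 𝕜) (D : Disk m) := Tr (fun D => (A D).carrier) D

/-- Lists of trees decorated by a family of complexes. -/
abbrev DFo (A : Fam.{u} m 𝕜) (Ds : List (Disk m)) := Fo (fun D => (A D).carrier) Ds

section Decorated

variable {A : Fam.{u} m 𝕜}

mutual
/-- The decorations are homogeneous and the total degree (each vertex having degree `-1`) is
`n`. -/
def DTr.HasDeg : {D : Disk m} → DTr A D → ℤ → Prop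
  | D, .leaf a, n => a ∈ (A D).gr n
  | _, .node _ xs, n => DFo.HasDeg xs (n + 1)
/-- The decorations are homogeneous and the total degree is `n`. -/
def DFo.HasDeg : {Ds : List (Disk m)} → DFo A Ds → ℤ → Prop
  | _, .nil, n => n = 0
  | _, .cons x xs, n => ∃ p q, n = p + q ∧ DTr.HasDeg x p ∧ DFo.HasDeg xs q
end

mutual
/-- `z` arises from `x` and `y`, which differ in one decoration only, by replacing this decoration
by `a + c b`. -/
inductive DTr.Lin (c : 𝕜) : {D : Disk m} → DTr A D → DTr A D → DTr A D → Prop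
  | leaf {D : Disk m} (a b : A D) : DTr.Lin c (.leaf a) (.leaf b) (.leaf (a + c • b))
  | node {Ds : List (Disk m)} (D : Disk m) {xs ys zs : DFo A Ds} :
      DFo.Lin c xs ys zs → DTr.Lin c (.node D xs) (.node D ys) (.node D zs)
/-- The corresponding relation on lists of trees. -/
inductive DFo.Lin (c : 𝕜) : {Ds : List (Disk m)} → DFo A Ds → DFo A Ds → DFo A Ds → Prop
  | head {D : Disk m} {Ds : List (Disk m)} {x y z : DTr A D} (xs : DFo A Ds) :
      DTr.Lin c x y z → DFo.Lin c (.cons x xs) (.cons y xs) (.cons z xs)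
  | tail {D : Disk m} {Ds : List (Disk m)} (x : DTr A D) {xs ys zs : DFo A Ds} :
      DFo.Lin c xs ys zs → DFo.Lin c (.cons x xs) (.cons x ys) (.cons x zs)
end

mutual
/-- `x'` arises from `x` by exchanging two neighbouring subtrees at a vertex, with Koszul sign
`(-1)^s`. -/
inductive DTr.Swap (s : ℤ) : {D : Disk m} → DTr A D → DTr A D → Prop
  | node {Ds Ds' : List (Disk m)} (D : Disk m) {xs : DFo A Ds} {xs' : DFo A Ds'} :
      DFo.Swap s xs xs' → DTr.Swap s (.node D xs) (.node D xs')
/-- The corresponding relation on lists of trees. -/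
inductive DFo.Swap (s : ℤ) : {Ds Ds' : List (Disk m)} → DFo A Ds → DFo A Ds' → Prop
  | here {D D' : Disk m} {Ds : List (Disk m)} (x : DTr A D) (y : DTr A D') (xs : DFo A Ds)
      (p q : ℤ) : DTr.HasDeg x p → DTr.HasDeg y q → s = p * q →
      DFo.Swap s (.cons x (.cons y xs)) (.cons y (.cons x xs))
  | head {D : Disk m} {Ds : List (Disk m)} {x x' : DTr A D} (xs : DFo A Ds) :
      DTr.Swap s x x' → DFo.Swap s (.cons x xs) (.cons x' xs)
  | tail {D : Disk m} {Ds Ds' : List (Disk m)} (x : DTr A D) {xs : DFo A Ds} {xs' : DFo A Ds'} :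
      DFo.Swap s xs xs' → DFo.Swap s (.cons x xs) (.cons x xs')
end

/-- Signs of the decorations. -/
def DTr.twist {D : Disk m} (x : DTr A D) : DTr A D := Tr.map (fun D => (A D).ε) x

end Decorated

/-! ## The bar differential and ∞-morphisms -/

section Infty

variable (A : PFA.{u} m 𝕜) {M : Type u} [AddCommGroup M] [Module 𝕜 M]

/-- `∑ ± g (x_1, …, children of x_j, …, x_n)`: contraction of the edges ending in a root of `xs`.
The sign is the Koszul sign of moving an operator of degree one to position `j`. -/
def splice : {Ds : List (Disk m)} → ({Ds' : List (Disk m)} → DFo A.obj Ds' → M) →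
    DFo A.obj Ds → M
  | _, _, .nil => 0
  | _, g, .cons x xs =>
      (match x with
        | .leaf _ => 0
        | .node _ ys => g (ys.append xs)) +
      (-1 : 𝕜) ^ x.verts • splice (fun ys => g (.cons (DTr.twist x) ys)) xs

mutual
/-- `f` composed with the differential of the bar construction: the sum of the internal
differentials, of the applications of vertices all of whose inputs are leaves, and of the
contractions of internal edges. A vertex has degree `-1` and precedes its inputs. -/
def codiff : {D : Disk m} → (DTr A.obj D → M) → DTr A.obj D → M
  | D, f, .leaf a => f (.leaf ((A.obj D).d a))
  | D, f, .node _ xs =>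
      (match xs.vals with
        | some as => f (.leaf (A.act D as))
        | none => 0)
      - codiffs (fun ys => f (.node D ys)) xs + splice A (fun ys => f (.node D ys)) xs
/-- `∑ ± g (x_1, …, differential of x_j, …, x_n)`. -/
def codiffs : {Ds : List (Disk m)} → (DFo A.obj Ds → M) → DFo A.obj Ds → M
  | _, _, .nil => 0
  | _, g, .cons x xs => codiff (fun y => g (.cons y xs)) x +
      (-1 : 𝕜) ^ x.verts • codiffs (fun ys => g (.cons (DTr.twist x) ys)) xs
end

/-- The structure map of `B` applied at the root to the values of `f` on the subtrees. -/
def rootAct {A : Fam.{u} m 𝕜} (B : PFA.{u} m 𝕜) (f : ∀ D, DTr A D → B.obj D) :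
    {D : Disk m} → DTr A D → B.obj D
  | _, .leaf _ => 0
  | _, .node D xs => B.act D (xs.eval f)

/-- An ∞-morphism `A ⇝ B` of prefactorization algebras: a degree-zero twisting map from the bar
construction of `A` to `B`. -/
structure InftyHom (A B : PFA.{u} m 𝕜) where
  toFun : ∀ D : Disk m, DTr A.obj D → B.obj D
  lin : ∀ (c : 𝕜) {D : Disk m} (x y z : DTr A.obj D), x.Valid → DTr.Lin c x y z →
    toFun D z = toFun D x + c • toFun D y
  mem : ∀ {D : Disk m} (x : DTr A.obj D) (n : ℤ), x.Valid → DTr.HasDeg x n →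
    toFun D x ∈ (B.obj D).gr n
  swap : ∀ (s : ℤ) {D : Disk m} (x x' : DTr A.obj D), x.Valid → DTr.Swap s x x' →
    toFun D x = (-1 : 𝕜) ^ s • toFun D x'
  eqn : ∀ {D : Disk m} (x : DTr A.obj D), x.Valid →
    (B.obj D).d (toFun D x) + rootAct B toFun x = codiff A (toFun D) x

/-- An ∞-quasi-isomorphism: the linear part induces bijections on cohomology. -/
def InftyHom.IsQuasiIso {A B : PFA.{u} m 𝕜} (f : InftyHom A B) : Prop :=
  ∀ D : Disk m,
    (∀ z, (A.obj D).d z = 0 → (∃ b, (B.obj D).d b = f.toFun D (.leaf z)) →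
      ∃ a, (A.obj D).d a = z) ∧
    (∀ w, (B.obj D).d w = 0 → ∃ z b, (A.obj D).d z = 0 ∧
      f.toFun D (.leaf z) = w + (B.obj D).d b)

/-- `H` is the cohomology prefactorization algebra of `F`: its complexes have zero differential, and
`H` is identified with cocycles modulo coboundaries, with the induced grading and the induced
structure maps. -/
def IsCohomology (H F : PFA.{u} m 𝕜) : Prop :=
  ∃ cl : ∀ D : Disk m, LinearMap.ker (F.obj D).d →ₗ[𝕜] H.obj D,
    (∀ D, (H.obj D).d = 0) ∧
    (∀ D, Function.Surjective (cl D)) ∧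
    (∀ D, ∀ z : LinearMap.ker (F.obj D).d, cl D z = 0 ↔ ∃ b, (F.obj D).d b = z.1) ∧
    (∀ D n, ∀ z : LinearMap.ker (F.obj D).d, z.1 ∈ (F.obj D).gr n → cl D z ∈ (H.obj D).gr n) ∧
    ∀ {Ds : List (Disk m)} (D : Disk m) (zs : HL (fun D => LinearMap.ker (F.obj D).d) Ds)
      (y : LinearMap.ker (F.obj D).d),
      y.1 = F.act D (zs.map (A' := fun D => (F.obj D).carrier) fun _ z => z.1) →
      H.act D (zs.map (A' := fun D => (H.obj D).carrier) fun D z => cl D z) = cl D y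

/-- A prefactorization algebra is formal if it is ∞-quasi-isomorphic to its cohomology with the
induced strict structure. -/
def Formal (F : PFA.{u} m 𝕜) : Prop :=
  ∃ H : PFA.{u} m 𝕜, IsCohomology H F ∧ ∃ f : InftyHom H F, f.IsQuasiIso

end Infty

/-! ## Homotopy transfer and the universal first-order Massey product -/

/-- Families of linear maps `i : B → F`, `p : F → B`, `h : F → F`. -/
structure Retract (B : Fam.{u} m 𝕜) (F : PFA.{u} m 𝕜) where
  i : ∀ D : Disk m, B D →ₗ[𝕜] F.obj D
  p : ∀ D : Disk m, F.obj D →ₗ[𝕜] B D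
  h : ∀ D : Disk m, F.obj D →ₗ[𝕜] F.obj D

namespace Retract

variable {B : Fam.{u} m 𝕜} {F : PFA.{u} m 𝕜} (R : Retract B F)

/-- Strong deformation retracts onto a family with zero differential (hence onto the cohomology),
with `d h + h d = i p - 1` and the side conditions. -/
structure IsSDR : Prop where
  d_zero : ∀ D b, (B D).d b = 0
  i_mem : ∀ D n b, b ∈ (B D).gr n → R.i D b ∈ (F.obj D).gr n
  p_mem : ∀ D n x, x ∈ (F.obj D).gr n → R.p D x ∈ (B D).gr n
  h_mem : ∀ D n x, x ∈ (F.obj D).gr n → R.h D x ∈ (F.obj D).gr (n - 1)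
  d_i : ∀ D b, (F.obj D).d (R.i D b) = 0
  p_d : ∀ D x, R.p D ((F.obj D).d x) = 0
  p_i : ∀ D b, R.p D (R.i D b) = b
  homotopy : ∀ D x, (F.obj D).d (R.h D x) + R.h D ((F.obj D).d x) = R.i D (R.p D x) - x
  h_i : ∀ D b, R.h D (R.i D b) = 0
  p_h : ∀ D x, R.p D (R.h D x) = 0
  h_h : ∀ D x, R.h D (R.h D x) = 0

mutual
/-- Decorate the leaves of a tree by `i`, its vertices by the structure maps of `F`, and the edges
leaving its vertices (including the root) by `h`. -/
def ev : {D : Disk m} → DTr B D → F.obj D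
  | D, .leaf b => R.i D b
  | _, .node D xs => R.h D (F.act D (evs xs))
/-- Entrywise evaluation of a list of trees. -/
def evs : {Ds : List (Disk m)} → DFo B Ds → Tup F.obj Ds
  | _, .nil => .nil
  | _, .cons x xs => .cons (ev x) (evs xs)
end

/-- The transferred operations `β`: as `ev`, but with `p` instead of `h` at the root. The value on
a tree without vertices is the transferred differential, i.e. zero. -/
def beta : {D : Disk m} → DTr B D → B D
  | _, .leaf _ => 0
  | _, .node D xs => R.p D (F.act D (R.evs xs))

/-- The induced strict structure maps on `B`. -/
def act {Ds : List (Disk m)} (D : Disk m) (bs : Tup B Ds) : B D := R.beta (.node D (Fo.leaves bs))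

end Retract

/-- The tree with two vertices `ι_{l D' r}^D` and `ι_{Es}^{D'}`. -/
def twoVertex {B : Fam.{u} m 𝕜} {l r Es : List (Disk m)} (D D' : Disk m) (xs : Tup B l)
    (es : Tup B Es) (ys : Tup B r) : DTr B D :=
  .node D ((Fo.leaves xs).append (.cons (.node D' (Fo.leaves es)) (Fo.leaves ys)))

/-- Multilinear, equivariant maps of degree `-1` on one-vertex trees: the cochains whose coboundaries
are divided out in the definition of the universal first-order Massey product. -/
structure ZeroCochain (B : Fam.{u} m 𝕜) where
  toFun : ∀ {Ds : List (Disk m)} (D : Disk m), Tup B Ds → B D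
  map_add : ∀ {l r : List (Disk m)} {D' : Disk m} (D : Disk m) (xs : Tup B l) (a b : B D')
    (ys : Tup B r), toFun D (xs.append (.cons (a + b) ys)) =
      toFun D (xs.append (.cons a ys)) + toFun D (xs.append (.cons b ys))
  map_smul : ∀ {l r : List (Disk m)} {D' : Disk m} (D : Disk m) (xs : Tup B l) (c : 𝕜)
    (a : B D') (ys : Tup B r),
      toFun D (xs.append (.cons (c • a) ys)) = c • toFun D (xs.append (.cons a ys))
  mem : ∀ {Ds : List (Disk m)} (D : Disk m) (xs : Tup B Ds) (n : ℤ), Tup.HasDeg xs n →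
    toFun D xs ∈ (B D).gr (n - 1)
  swap : ∀ {l r : List (Disk m)} {D₁ D₂ : Disk m} (D : Disk m) (xs : Tup B l)
    (a : B D₁) (b : B D₂) (ys : Tup B r) (p q : ℤ), a ∈ (B D₁).gr p → b ∈ (B D₂).gr q →
      toFun D (xs.append (.cons a (.cons b ys))) =
        (-1 : 𝕜) ^ (p * q) • toFun D (xs.append (.cons b (.cons a ys)))

/-- The universal first-order Massey product of `F` is trivial: for every strong deformation retract
of `F` onto its cohomology, the cocycle given by the transferred operations on trees with two
vertices is a coboundary. -/
def MasseyTrivial (F : PFA.{u} m 𝕜) : Prop :=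
  ∀ (B : Fam.{u} m 𝕜) (R : Retract B F), R.IsSDR → ∃ χ : ZeroCochain B,
    ∀ {l r Es : List (Disk m)} (D D' : Disk m) (xs : Tup B l) (es : Tup B Es) (ys : Tup B r),
      (twoVertex D D' xs es ys).Valid →
      R.beta (twoVertex D D' xs es ys) =
        χ.toFun D (xs.twist.append (es.append ys))
        - χ.toFun D (xs.twist.append (.cons (R.act D' es) ys))
        - R.act D (xs.append (.cons (χ.toFun D' es) ys))

end DG

/-! ## The factorization envelope -/

section Envelope

variable (𝕜 : Type) [RCLike 𝕜] (g : Type u) [LieRing g] [LieAlgebra 𝕜 g] {m : ℕ}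

/-- The complex `(Sym(g ⊗ Ω_c(D)[1]), d_dR[1] + d_CE)`. -/
def envObj : Fam.{u} m 𝕜 := fun D =>
  { carrier := GSym (GForm.gr 𝕜 g D.carrier)
    gr := GSym.gr (GForm.gr 𝕜 g D.carrier)
    internal := GSym.isInternal _
    d := (GForm.shifted 𝕜 g D.carrier).d
    d_mem := fun _ _ hx => ShiftedLie.d_mem _ hx
    d_d := ShiftedLie.d_d _ }

variable {g}

/-- Multiplication of `Sym(g ⊗ Ω_c(D)[1])`. -/
def envMul (D : Disk m) : envObj 𝕜 g D →ₗ[𝕜] envObj 𝕜 g D →ₗ[𝕜] envObj 𝕜 g D :=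
  LinearMap.mul 𝕜 (GSym (GForm.gr 𝕜 g D.carrier))

open Classical in
/-- Extension by zero along an inclusion `D ⊆ D'` of disks (zero if `D` is not contained in `D'`). -/
def envExt (D D' : Disk m) : envObj 𝕜 g D →ₗ[𝕜] envObj 𝕜 g D' :=
  if h : D.carrier ⊆ D'.carrier then
    (GSym.map (GForm.gr 𝕜 g D'.carrier) (GForm.ext g h) (GForm.ext_mem h)).toLinearMap
  else 0

/-- The product in `Sym(g ⊗ Ω_c(D)[1])` of the extensions by zero of the entries of a tuple. -/
def envProd (D : Disk m) : {Ds : List (Disk m)} → Tup (envObj 𝕜 g) Ds → envObj 𝕜 g D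
  | _, .nil => (1 : GSym (GForm.gr 𝕜 g D.carrier))
  | D' :: _, .cons x xs => envMul 𝕜 D (envExt 𝕜 D' D x) (envProd D xs)

open Classical in
/-- The structure maps of the factorization envelope. -/
def envAct {Ds : List (Disk m)} (D : Disk m) (xs : Tup (envObj 𝕜 g) Ds) : envObj 𝕜 g D :=
  if Adm Ds D then envProd 𝕜 D xs else 0

variable {𝕜}

theorem envExt_of_le {D D' : Disk m} (h : D.carrier ⊆ D'.carrier) :
    envExt 𝕜 (g := g) D D' = (GSym.map (GForm.gr 𝕜 g D'.carrier) (GForm.ext g h)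
      (GForm.ext_mem h)).toLinearMap := dif_pos h

theorem envExt_mem {D D' : Disk m} {n : ℤ} {x : envObj 𝕜 g D} (hx : x ∈ (envObj 𝕜 g D).gr n) :
    envExt 𝕜 D D' x ∈ (envObj 𝕜 g D').gr n := by
  by_cases h : D.carrier ⊆ D'.carrier
  · rw [envExt_of_le h]
    exact GSym.map_mem _ hx
  · have : envExt 𝕜 (g := g) D D' = 0 := dif_neg h
    rw [this]
    exact Submodule.zero_mem _

theorem envMul_assoc (D : Disk m) (x y z : envObj 𝕜 g D) :
    envMul 𝕜 D (envMul 𝕜 D x y) z = envMul 𝕜 D x (envMul 𝕜 D y z) :=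
  mul_assoc (G := GSym (GForm.gr 𝕜 g D.carrier)) x y z

theorem envProd_append (D : Disk m) {l r : List (Disk m)} (xs : Tup (envObj 𝕜 g) l)
    (ys : Tup (envObj 𝕜 g) r) :
    envProd 𝕜 D (xs.append ys) = envMul 𝕜 D (envProd 𝕜 D xs) (envProd 𝕜 D ys) := by
  induction xs with
  | nil => exact (one_mul (M := GSym (GForm.gr 𝕜 g D.carrier)) _).symm
  | cons x xs ih =>
    simp only [HL.append, envProd, ih, envMul_assoc]

theorem envProd_mem (D : Disk m) {Ds : List (Disk m)} (xs : Tup (envObj 𝕜 g) Ds) (n : ℤ)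
    (h : Tup.HasDeg xs n) : envProd 𝕜 D xs ∈ (envObj 𝕜 g D).gr n := by
  induction xs generalizing n with
  | nil =>
    have h : n = 0 := h
    subst h
    exact GSym.one_mem _
  | cons x xs ih =>
    obtain ⟨p, q, rfl, hx, hxs⟩ := h
    exact GSym.mul_mem _ (envExt_mem hx) (ih q hxs)

theorem envObj_ε (D : Disk m) (x : envObj 𝕜 g D) :
    (envObj 𝕜 g D).ε x = GSym.eps (GForm.gr 𝕜 g D.carrier) x := by
  have : (envObj 𝕜 g D).ε = GSym.eps (GForm.gr 𝕜 g D.carrier) := by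
    refine hom_ext_homog (GSym.gr (GForm.gr 𝕜 g D.carrier)) fun n x hx => ?_
    let _ := (envObj 𝕜 g D).internal.chooseDecomposition
    exact (scale_of_mem (envObj 𝕜 g D).gr _ hx).trans (scale_of_mem _ _ hx).symm
  exact LinearMap.congr_fun this x

theorem br_envProd {D D' : Disk m} (h : D'.carrier ⊆ D.carrier) {Ds : List (Disk m)}
    (xs : Tup (envObj 𝕜 g) Ds)
    (hd : ∀ D'' ∈ Ds, D''.carrier ⊆ D.carrier ∧ Disjoint D'.carrier D''.carrier) (r : ℕ)
    (w : GForm 𝕜 g D'.carrier) (hw : w ∈ GForm.gr 𝕜 g D'.carrier r) :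
    (GForm.shifted 𝕜 g D.carrier).br (GForm.ext g h w) (envProd 𝕜 D xs) = 0 := by
  induction xs with
  | nil => exact ShiftedLie.br_one _ _
  | @cons D'' _ x xs ih =>
    obtain ⟨h1, h2⟩ := hd D'' (by simp)
    have hw' := GForm.ext_mem h r w hw
    refine (ShiftedLie.br_mul_of_br_eq_zero _ hw' (ih fun E hE => hd E (by simp [hE])) _).trans ?_
    rw [envExt_of_le h1]
    have := ShiftedLie.br_map_eq_zero (L' := GForm.shifted 𝕜 g D.carrier) (GForm.ext_mem h1) hw'
      (fun v => GForm.ext_disjoint h2 h h1 w v) x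
    exact (congrArg (fun z => envMul 𝕜 D z (envProd 𝕜 D xs)) this).trans
      (LinearMap.map_zero₂ (envMul 𝕜 D) _)

theorem dsum_map {A : Fam.{u} m 𝕜} {M M' : Type u} [AddCommGroup M] [AddCommGroup M']
    (f : M →+ M') {Ds : List (Disk m)} (G : Tup A Ds → M) (xs : Tup A Ds) :
    Tup.dsum (fun ys => f (G ys)) xs = f (Tup.dsum G xs) := by
  induction xs with
  | nil => exact (map_zero f).symm
  | cons x xs ih =>
    simp only [Tup.dsum, map_add]
    rw [ih fun ys => G (.cons _ ys)]

theorem envProd_d (D : Disk m) {Ds : List (Disk m)} (xs : Tup (envObj 𝕜 g) Ds) (h : Adm Ds D) :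
    (envObj 𝕜 g D).d (envProd 𝕜 D xs) = Tup.dsum (fun ys => envProd 𝕜 D ys) xs := by
  induction xs with
  | nil => exact ShiftedLie.d_one _
  | @cons D' Ds x xs ih =>
    obtain ⟨h1, h2⟩ := h
    rw [List.pairwise_cons] at h2
    have hD' := h1 D' (by simp)
    have hxs : ∀ E ∈ Ds, E.carrier ⊆ D.carrier := fun E hE => h1 E (by simp [hE])
    have key := ShiftedLie.d_map_mul (L := GForm.shifted 𝕜 g D'.carrier)
      (L' := GForm.shifted 𝕜 g D.carrier) (GForm.ext_mem hD') (GForm.ext_δ hD') (GForm.ext_b hD')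
      (y := envProd 𝕜 D xs)
      (fun r w hw => br_envProd hD' xs (fun E hE => ⟨hxs E hE, h2.1 E hE⟩) r w hw) x
    have hs := dsum_map (envMul 𝕜 D (envExt 𝕜 D' D ((envObj 𝕜 g D').ε x))).toAddMonoidHom
      (fun ys => envProd 𝕜 D ys) xs
    rw [← ih ⟨hxs, h2.2⟩] at hs
    simp only [Tup.dsum, envProd]
    refine Eq.trans ?_ (congrArg₂ (· + ·) rfl hs.symm)
    rw [envObj_ε, envExt_of_le hD']
    exact key

theorem Adm.append_left {l r : List (Disk m)} {D D' : Disk m} (h : Adm (l ++ D' :: r) D) :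
    D'.carrier ⊆ D.carrier := h.1 D' (by simp)

theorem Adm.insert {l r Es : List (Disk m)} {D D' : Disk m} (h : Adm (l ++ D' :: r) D)
    (h' : Adm Es D') : Adm (l ++ (Es ++ r)) D := by
  obtain ⟨h1, h2⟩ := h
  obtain ⟨h3, h4⟩ := h'
  simp only [List.pairwise_append, List.pairwise_cons, List.mem_append, List.mem_cons] at h1 h2 ⊢
  refine ⟨?_, ?_⟩
  · intro E hE
    simp only [List.mem_append] at hE
    rcases hE with hE | hE | hE
    · exact h1 E (Or.inl hE)
    · exact (h3 E hE).trans (h1 D' (Or.inr (Or.inl rfl)))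
    · exact h1 E (Or.inr (Or.inr hE))
  · simp only [List.pairwise_append, List.mem_append]
    refine ⟨h2.1, ⟨h4, h2.2.1.2, fun E hE E' hE' => (h2.2.1.1 E' hE').mono_left (h3 E hE)⟩, ?_⟩
    rintro E hE E' (hE' | hE')
    · exact (h2.2.2 E hE D' (Or.inl rfl)).mono_right (h3 E' hE')
    · exact h2.2.2 E hE E' (Or.inr hE')

theorem Adm.swap {l r : List (Disk m)} {D D₁ D₂ : Disk m} :
    Adm (l ++ D₁ :: D₂ :: r) D ↔ Adm (l ++ D₂ :: D₁ :: r) D := by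
  have hp : (l ++ D₁ :: D₂ :: r).Perm (l ++ D₂ :: D₁ :: r) :=
    List.Perm.append_left _ (List.Perm.swap _ _ _)
  refine and_congr ⟨fun h E hE => h E (hp.mem_iff.2 hE), fun h E hE => h E (hp.mem_iff.1 hE)⟩ ?_
  exact hp.pairwise_iff fun h => Disjoint.symm h

theorem envExt_envProd {D D' : Disk m} (h : D'.carrier ⊆ D.carrier) {Es : List (Disk m)}
    (es : Tup (envObj 𝕜 g) Es) (hE : ∀ E ∈ Es, E.carrier ⊆ D'.carrier) :
    envExt 𝕜 D' D (envProd 𝕜 D' es) = envProd 𝕜 D es := by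
  induction es with
  | nil =>
    rw [envExt_of_le h]
    exact map_one (GSym.map (GForm.gr 𝕜 g D.carrier) (GForm.ext g h) (GForm.ext_mem h))
  | @cons E Es x es ih =>
    have hE1 := hE E (by simp)
    have ih := ih fun E hE' => hE E (by simp [hE'])
    simp only [envProd]
    rw [← ih, envExt_of_le h, envExt_of_le hE1, envExt_of_le (hE1.trans h)]
    have key : (GSym.map (GForm.gr 𝕜 g D.carrier) (GForm.ext g h) (GForm.ext_mem h)).comp
        (GSym.map (GForm.gr 𝕜 g D'.carrier) (GForm.ext g hE1) (GForm.ext_mem hE1)) =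
        GSym.map (GForm.gr 𝕜 g D.carrier) (GForm.ext g (hE1.trans h))
          (GForm.ext_mem (hE1.trans h)) := by
      refine GSym.algHom_ext' fun w => ?_
      rw [AlgHom.comp_apply, GSym.map_gen, GSym.map_gen, GSym.map_gen, GForm.ext_ext]
    have := map_mul (GSym.map (GForm.gr 𝕜 g D.carrier) (GForm.ext g h) (GForm.ext_mem h))
      (GSym.map (GForm.gr 𝕜 g D'.carrier) (GForm.ext g hE1) (GForm.ext_mem hE1) x)
      (envProd 𝕜 D' es)
    refine this.trans ?_
    have k2 := DFunLike.congr_fun key x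
    exact congrArg (fun z : GSym (GForm.gr 𝕜 g D.carrier) => z * _) k2

theorem envExt_self (D : Disk m) (x : envObj 𝕜 g D) : envExt 𝕜 D D x = x := by
  have h : D.carrier ⊆ D.carrier := subset_rfl
  have key : GSym.map (GForm.gr 𝕜 g D.carrier) (GForm.ext g h) (GForm.ext_mem h) =
      AlgHom.id 𝕜 (GSym (GForm.gr 𝕜 g D.carrier)) := by
    refine GSym.algHom_ext' fun w => ?_
    rw [GSym.map_gen, GForm.ext_self]
    rfl
  rw [envExt_of_le h, key]
  rfl

variable (𝕜 g m) in
/-- The factorization envelope `U g^{ℝ^m}`. -/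
def envelope : PFA.{u} m 𝕜 where
  obj := envObj 𝕜 g
  act := envAct 𝕜
  act_not_adm _ _ h := if_neg h
  act_add D xs a b ys := by
    unfold envAct
    split_ifs
    · simp only [envProd_append, envProd, map_add, LinearMap.add_apply]
    · rw [add_zero]
  act_smul D xs c a ys := by
    unfold envAct
    split_ifs
    · simp only [envProd_append, envProd, map_smul, LinearMap.smul_apply]
    · rw [smul_zero]
  act_mem D xs n h := by
    unfold envAct
    split_ifs
    · exact envProd_mem D xs n h
    · exact Submodule.zero_mem _
  act_d {Ds} D xs := by
    unfold envAct
    split_ifs with h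
    · exact envProd_d D xs h
    · rw [map_zero]
      exact (dsum_map (0 : envObj 𝕜 g D →+ envObj 𝕜 g D) (fun _ => 0) xs).symm
  act_one {D} x := by
    have : Adm [D] D := ⟨by simp, by simp⟩
    unfold envAct
    rw [if_pos this]
    refine (mul_one (M := GSym (GForm.gr 𝕜 g D.carrier)) _).trans (envExt_self D x)
  act_act D xs es ys h h' := by
    unfold envAct
    rw [if_pos h, if_pos h', if_pos (h.insert h')]
    simp only [envProd_append, envProd]
    rw [envExt_envProd h.append_left es h'.1]
  act_swap {l r D₁ D₂} D xs a b ys p q ha hb := by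
    unfold envAct
    by_cases h : Adm (l ++ D₁ :: D₂ :: r) D
    · rw [if_pos h, if_pos (Adm.swap.1 h)]
      simp only [envProd_append, envProd]
      rw [← map_smul]
      congr 1
      rw [← envMul_assoc, ← envMul_assoc, ← LinearMap.smul_apply, ← map_smul]
      congr 2
      exact GSym.graded_comm _ (envExt_mem ha) (envExt_mem hb)
    · rw [if_neg h, if_neg fun h' => h (Adm.swap.2 h'), smul_zero]

end Envelope

/-! ## Explicit strong deformation retracts of the factorization envelope -/

section Explicit

variable {𝕜 : Type} [RCLike 𝕜] {m : ℕ}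

/-- For every disk `D`, a top form `vol D` of integral one and complements `K D r` of the exact forms
in the compactly supported `r`-forms. -/
structure Choices (𝕜 : Type) [RCLike 𝕜] (m : ℕ) where
  vol : ∀ D : Disk m, Form 𝕜 D.carrier
  vol_mem : ∀ D, vol D ∈ CT.gr 𝕜 m _ m
  vol_int : ∀ D, formInt (vol D) = 1
  K : ∀ D : Disk m, ℕ → Submodule 𝕜 (Form 𝕜 D.carrier)
  K_zero : ∀ D, K D 0 = CT.gr 𝕜 m _ 0
  K_top : ∀ D, K D m = Submodule.span 𝕜 {vol D}
  K_le : ∀ D r, r + 1 < m → K D (r + 1) ≤ CT.gr 𝕜 m _ (r + 1)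
  K_inf : ∀ D r, r + 1 < m → K D (r + 1) ⊓ (CT.gr 𝕜 m _ r).map dR = ⊥
  K_sup : ∀ D r, r + 1 < m → K D (r + 1) ⊔ (CT.gr 𝕜 m _ r).map dR = CT.gr 𝕜 m _ (r + 1)

/-- The map `f` vanishes on the chosen complements and inverts the isomorphisms
`d_dR : K D r → d_dR Ω^r`. These conditions determine `f`, since `Ω^r` is the sum of `K D r` and
the exact forms. -/
def IsFormHomotopy (c : Choices 𝕜 m) (D : Disk m) (f : Form 𝕜 D.carrier →ₗ[𝕜] Form 𝕜 D.carrier) :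
    Prop :=
  (∀ r < m, ∀ κ ∈ c.K D r, f (dR κ) = κ) ∧ ∀ r ≤ m, ∀ κ ∈ c.K D r, f κ = 0

open Classical in
/-- The maps `h^r_D : Ω^r_c(D) → K D (r - 1)`. -/
def formHomotopy (c : Choices 𝕜 m) (D : Disk m) : Form 𝕜 D.carrier →ₗ[𝕜] Form 𝕜 D.carrier :=
  if h : ∃ f, IsFormHomotopy c D f then h.choose else 0

section

variable (𝕜 : Type) [RCLike 𝕜] (g : Type u) [AddCommGroup g] [Module 𝕜 g] (m : ℕ)

/-- The module `g` placed in (unshifted) degree `m`. -/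
def conc (r : ℕ) : Submodule 𝕜 g := if r = m then ⊤ else ⊥

variable {𝕜 g m} in
theorem mem_conc (x : g) : x ∈ conc 𝕜 g m m := by simp [conc]

instance : DirectSum.Decomposition (conc 𝕜 g m) where
  decompose' x := DirectSum.of (fun r => conc 𝕜 g m r) m ⟨x, mem_conc x⟩
  left_inv x := by simp
  right_inv x := by
    induction x using DirectSum.induction_on with
    | zero =>
      rw [map_zero]
      exact map_zero (DirectSum.of (fun r => conc 𝕜 g m r) m)
    | of r y =>
      obtain ⟨y, hy⟩ := y
      by_cases h : r = m
      · subst h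
        simp
      · have h0 : y = 0 := by simpa [conc, h] using hy
        subst h0
        have h1 : (⟨0, hy⟩ : conc 𝕜 g m r) = 0 := rfl
        rw [h1, map_zero, map_zero]
        exact map_zero (DirectSum.of (fun r => conc 𝕜 g m r) m)
    | add x y hx hy =>
      rw [map_add]
      refine Eq.trans ?_ (congrArg₂ (· + ·) hx hy)
      exact map_add (DirectSum.of (fun r => conc 𝕜 g m r) m) ⟨_, mem_conc _⟩ ⟨_, mem_conc _⟩

/-- The constant family `Sym(g[1-m])` with zero differential. -/
def modelObj : Fam.{u} m 𝕜 := fun _ =>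
  { carrier := GSym (conc 𝕜 g m)
    gr := GSym.gr (conc 𝕜 g m)
    internal := GSym.isInternal _
    d := 0
    d_mem := fun _ _ _ => Submodule.zero_mem _
    d_d := fun _ => rfl }

end

section

variable {g : Type u} [LieRing g] [LieAlgebra 𝕜 g] {U : Set (Fin m → ℝ)}

variable (𝕜 g) in
/-- The form `α ⊗ X`. -/
def GForm.ins : Form 𝕜 U →ₗ[𝕜] g →ₗ[𝕜] GForm 𝕜 g U :=
  CT.lift ((LinearMap.llcomp 𝕜 g (CG 𝕜 g U) (GForm 𝕜 g U)).compl₁₂ CT.tm CG.tm)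

theorem GForm.ins_tm (a : CForm 𝕜 m) (f : Cc 𝕜 U) (X : g) :
    GForm.ins 𝕜 g (CT.tm a f) X = CT.tm a (CG.tm f X) := rfl

theorem GForm.ins_mem {r : ℕ} {α : Form 𝕜 U} (hα : α ∈ CT.gr 𝕜 m _ r) (X : g) :
    GForm.ins 𝕜 g α X ∈ GForm.gr 𝕜 g U r :=
  CT.gr_le (P := (GForm.gr 𝕜 g U r).comap ((GForm.ins 𝕜 g).flip X))
    (fun _ ha f => CT.tm_mem ha (CG.tm f X)) hα

/-- Linear maps out of `CG`. -/
def CG.lift {M : Type*} [AddCommGroup M] [Module 𝕜 M] :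
    (Cc 𝕜 U →ₗ[𝕜] g →ₗ[𝕜] M) →ₗ[𝕜] CG 𝕜 g U →ₗ[𝕜] M :=
  TensorProduct.uncurry (.id 𝕜) (Cc 𝕜 U) g M

theorem CG.lift_tm {M : Type*} [AddCommGroup M] [Module 𝕜 M] (F : Cc 𝕜 U →ₗ[𝕜] g →ₗ[𝕜] M)
    (f : Cc 𝕜 U) (X : g) : CG.lift F (CG.tm f X) = F f X := rfl

/-- The operator `α ⊗ X ↦ f(α) ⊗ X`. -/
def GForm.onForms (f : Form 𝕜 U →ₗ[𝕜] Form 𝕜 U) : GForm 𝕜 g U →ₗ[𝕜] GForm 𝕜 g U :=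
  CT.lift (CG.lift ∘ₗ CT.tm.compr₂ (GForm.ins 𝕜 g ∘ₗ f))

theorem GForm.onForms_ins (f : Form 𝕜 U →ₗ[𝕜] Form 𝕜 U) (α : Form 𝕜 U) (X : g) :
    GForm.onForms f (GForm.ins 𝕜 g α X) = GForm.ins 𝕜 g (f α) X := by
  refine LinearMap.congr_fun (f := GForm.onForms f ∘ₗ (GForm.ins 𝕜 g).flip X)
    (g := (GForm.ins 𝕜 g).flip X ∘ₗ f) (CT.ext_tm fun r a _ k => ?_) α
  rfl

theorem topCoeff_of_mem {r : ℕ} (h : r ≠ m) {a : CForm 𝕜 m} (ha : a ∈ cgr 𝕜 m r) :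
    topCoeff a = 0 := by
  have hspan := ExteriorAlgebra.ιMulti_span_fixedDegree 𝕜 (M := Fin m → 𝕜) r
  rw [cgr, ← hspan] at ha
  refine (Submodule.span_le.2 ?_ : _ ≤ LinearMap.ker (topCoeff (𝕜 := 𝕜) (m := m))) ha
  rintro _ ⟨v, rfl⟩
  rw [SetLike.mem_coe, LinearMap.mem_ker, topCoeff, ExteriorAlgebra.liftAlternating_apply_ιMulti,
    Pi.single_eq_of_ne h]
  rfl

/-- Integration of `g`-valued forms, `α ⊗ X ↦ (∫ α) X`. -/
def GForm.integral : GForm 𝕜 g U →ₗ[𝕜] g :=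
  CT.lift ((LinearMap.lsmul 𝕜 g).compl₁₂ topCoeff
    (CG.lift (LinearMap.lsmul 𝕜 g ∘ₗ Cc.integral)))

theorem GForm.integral_ins (α : Form 𝕜 U) (X : g) :
    GForm.integral (GForm.ins 𝕜 g α X) = formInt α • X := by
  refine LinearMap.congr_fun (f := GForm.integral ∘ₗ (GForm.ins 𝕜 g).flip X)
    (g := formInt.smulRight X) (CT.ext_tm fun r a _ k => ?_) α
  exact smul_smul (topCoeff a) (Cc.integral k) X

theorem GForm.integral_mem : ∀ r, ∀ w ∈ GForm.gr 𝕜 g U r, GForm.integral w ∈ conc 𝕜 g m r := by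
  intro r w hw
  by_cases h : r = m
  · subst h
    exact mem_conc _
  · have := CT.gr_le (P := LinearMap.ker (GForm.integral (𝕜 := 𝕜) (g := g) (U := U)))
      (fun a ha n => ?_) hw
    · rw [LinearMap.mem_ker.1 this]
      exact Submodule.zero_mem _
    · rw [LinearMap.mem_ker, GForm.integral, CT.lift_tm, LinearMap.compl₁₂_apply,
        topCoeff_of_mem h ha, map_zero, LinearMap.zero_apply]

end

variable {g : Type u} [LieRing g] [LieAlgebra 𝕜 g] (c : Choices 𝕜 m)

namespace Choices

variable (g) in
/-- The map `i[1]`, `X ↦ vol ⊗ X`. -/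
def genI (D : Disk m) : g →ₗ[𝕜] GForm 𝕜 g D.carrier := GForm.ins 𝕜 g (c.vol D)

theorem genI_mem (D : Disk m) : ∀ r, ∀ X ∈ conc 𝕜 g m r, c.genI g D X ∈ GForm.gr 𝕜 g D.carrier r := by
  intro r X hX
  by_cases h : r = m
  · subst h
    exact GForm.ins_mem (c.vol_mem D) X
  · have : X = 0 := by simpa [conc, h] using hX
    rw [this, map_zero]
    exact Submodule.zero_mem _

variable (g) in
/-- The inclusion `i : Sym(g[1-m]) → Sym(g ⊗ Ω_c(D)[1])`. -/
def symI (D : Disk m) : GSym (conc 𝕜 g m) →ₐ[𝕜] GSym (GForm.gr 𝕜 g D.carrier) :=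
  GSym.map _ (c.genI g D) (c.genI_mem D)

variable (𝕜 g) in
/-- The projection `p : Sym(g ⊗ Ω_c(D)[1]) → Sym(g[1-m])`. -/
def _root_.FactEnv.symP (D : Disk m) : GSym (GForm.gr 𝕜 g D.carrier) →ₐ[𝕜] GSym (conc 𝕜 g m) :=
  GSym.map _ GForm.integral GForm.integral_mem

variable (g) in
/-- The map `h[1]`, `α ⊗ X ↦ h(α) ⊗ X`. -/
def genH (D : Disk m) : GForm 𝕜 g D.carrier →ₗ[𝕜] GForm 𝕜 g D.carrier :=
  GForm.onForms (formHomotopy c D)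

/-- The exponent of the Koszul sign of permuting elements of shifted degrees `r k - 1` by `σ`. -/
def _root_.FactEnv.koszul {n : ℕ} (r : Fin n → ℕ) (σ : Equiv.Perm (Fin n)) : ℕ :=
  ∑ a : Fin n, ∑ b : Fin n, if a < b ∧ σ b < σ a then (r (σ a) + 1) * (r (σ b) + 1) else 0

/-- The map `H` is the symmetrization
`(1 / n!) ∑_j ∑_σ τ_σ (id^{⊗ (j-1)} ⊗ h[1] ⊗ (i[1] p[1])^{⊗ (n-j)}) τ_{σ⁻¹}` on monomials of
length `n`. -/
def IsSymHomotopy (D : Disk m)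
    (H : GSym (GForm.gr 𝕜 g D.carrier) →ₗ[𝕜] GSym (GForm.gr 𝕜 g D.carrier)) : Prop :=
  ∀ (n : ℕ) (r : Fin n → ℕ) (w : Fin n → GForm 𝕜 g D.carrier),
    (∀ k, w k ∈ GForm.gr 𝕜 g D.carrier (r k)) →
    H (List.ofFn fun k => GSym.gen (GForm.gr 𝕜 g D.carrier) (w k)).prod =
      (n.factorial : 𝕜)⁻¹ • ∑ j : Fin n, ∑ σ : Equiv.Perm (Fin n),
        (-1 : 𝕜) ^ (koszul r σ + ∑ l : Fin n, if l < j then r (σ l) + 1 else 0) •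
          (List.ofFn fun l => GSym.gen (GForm.gr 𝕜 g D.carrier)
            (if l < j then w (σ l) else if l = j then c.genH g D (w (σ l))
              else c.genI g D (GForm.integral (w (σ l))))).prod

open Classical in
variable (g) in
/-- The homotopy on `Sym(g ⊗ Ω_c(D)[1])`. It is determined by its values on monomials. -/
def symH (D : Disk m) :
    GSym (GForm.gr 𝕜 g D.carrier) →ₗ[𝕜] GSym (GForm.gr 𝕜 g D.carrier) :=
  if h : ∃ H, c.IsSymHomotopy (g := g) D H then h.choose else 0

end Choices

open Classical in
/-- The geometric series `∑_j T^j` of a locally nilpotent operator (zero if `T` is not locally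
nilpotent). -/
def geom {M : Type u} [AddCommGroup M] [Module 𝕜 M] (T : M →ₗ[𝕜] M) : M →ₗ[𝕜] M :=
  if h : ∀ x, ∃ N, (T ^ N) x = 0 then
    have hf : ∀ x, (Function.support fun j : ℕ => (T ^ j) x).Finite := fun x => by
      obtain ⟨N, hN⟩ := h x
      refine (Set.finite_lt_nat N).subset fun j hj => ?_
      by_contra hjN
      refine hj ?_
      obtain ⟨k, rfl⟩ := Nat.exists_eq_add_of_le (not_lt.1 hjN)
      change (T ^ (N + k)) x = 0
      rw [add_comm, pow_add, Module.End.mul_apply, hN, map_zero]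
    { toFun := fun x => ∑ᶠ j : ℕ, (T ^ j) x
      map_add' := fun x y => by
        simp only [map_add]
        exact finsum_add_distrib (hf x) (hf y)
      map_smul' := fun a x => by
        simp only [map_smul, RingHom.id_apply]
        exact (smul_finsum' a (hf x)).symm }
  else 0

namespace Choices

variable (𝕜 g) in
/-- The Chevalley–Eilenberg differential `d_CE` on `Sym(g ⊗ Ω_c(D)[1])`. -/
def _root_.FactEnv.dCE (D : Disk m) :
    GSym (GForm.gr 𝕜 g D.carrier) →ₗ[𝕜] GSym (GForm.gr 𝕜 g D.carrier) :=
  (GForm.shifted 𝕜 g D.carrier).noδ.d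

variable (g)

/-- The perturbed homotopy `ĥ = ∑_j h (d_CE h)^j`. -/
def hatH (D : Disk m) :
    GSym (GForm.gr 𝕜 g D.carrier) →ₗ[𝕜] GSym (GForm.gr 𝕜 g D.carrier) :=
  c.symH g D ∘ₗ geom (dCE 𝕜 g D ∘ₗ c.symH g D)

/-- The perturbed retract `(i, p̂, ĥ)` with `p̂ = ∑_j p (d_CE h)^j` and `ĥ = ∑_j h (d_CE h)^j`. -/
def hatRetract : Retract (modelObj 𝕜 g m) (envelope 𝕜 g m) where
  i D := (c.symI g D).toLinearMap
  p D := (symP 𝕜 g D).toLinearMap ∘ₗ geom (dCE 𝕜 g D ∘ₗ c.symH g D)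
  h D := c.hatH g D

/-- The projection `p̂` on `ℝ^m` composed with the extension by zero from `D` to `ℝ^m`. -/
def extP (D : Disk m) : GSym (GForm.gr 𝕜 g D.carrier) →ₗ[𝕜] GSym (conc 𝕜 g m) :=
  (symP 𝕜 g (Disk.whole m)).toLinearMap ∘ₗ
    geom (dCE 𝕜 g (Disk.whole m) ∘ₗ c.symH g (Disk.whole m)) ∘ₗ envExt 𝕜 D (Disk.whole m)

/-- The improved retract `(i, p̃, h̃)`, whose projections `p̃_D = p̂_{ℝ^m} ∘ Ug(ι_D^{ℝ^m})` are
strictly compatible with inclusions of disks. -/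
def improvedRetract : Retract (modelObj 𝕜 g m) (envelope 𝕜 g m) where
  i D := (c.symI g D).toLinearMap
  p D := c.extP g D
  h D := c.hatH g D - (c.symI g D).toLinearMap ∘ₗ c.extP g D ∘ₗ c.hatH g D

end Choices

variable (𝕜 g) in
/-- The cohomology of `Ug^ℝ` on the interval `D` is `Sym(g)`, concentrated in degree zero: for every
one-form `α` of integral one, `X_1 ⋯ X_n ↦ (α ⊗ X_1) ⋯ (α ⊗ X_n)` is a well-defined linear map
from `Sym(g)` to the cocycles of degree zero which induces an isomorphism onto the cohomology in
degree zero, and the cohomology vanishes in all other degrees. -/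
def CohomologyIsSym (D : Disk 1) : Prop :=
  (∀ α ∈ CT.gr 𝕜 1 (Cc 𝕜 D.carrier) 1, formInt α = 1 →
    ∃ s : SymmetricAlgebra 𝕜 g →ₗ[𝕜] envObj 𝕜 g D,
      (∀ Xs : List g, s (Xs.map (SymmetricAlgebra.ι 𝕜 g)).prod =
        (Xs.map fun X => GSym.gen (GForm.gr 𝕜 g D.carrier) (GForm.ins 𝕜 g α X)).prod) ∧
      (∀ x, s x ∈ (envObj 𝕜 g D).gr 0 ∧ (envObj 𝕜 g D).d (s x) = 0) ∧
      (∀ x, (∃ y, (envObj 𝕜 g D).d y = s x) → x = 0) ∧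
      ∀ z ∈ (envObj 𝕜 g D).gr 0, (envObj 𝕜 g D).d z = 0 →
        ∃ x y, z = s x + (envObj 𝕜 g D).d y) ∧
  ∀ n ≠ 0, ∀ z ∈ (envObj 𝕜 g D).gr n, (envObj 𝕜 g D).d z = 0 → ∃ y, (envObj 𝕜 g D).d y = z

end Explicit

end

end FactEnv

/-!
Why the theorem holds.

*Poincaré lemma.* On compactly supported forms on `ℝ^m`, integration along a coordinate line
against a bump function gives, one coordinate at a time, an explicit contraction: every closed
form of degree `< m` is exact, and a form of degree `m` is exact exactly when its integral
vanishes. Both facts pass to an arbitrary disk by pulling back along a diffeomorphism; exactness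
implies vanishing integral by Stokes, and the kernel of the integral is then the space of exact
top forms for dimension reasons, so no change of variables formula is needed. Hence choices
exist, and each choice turns `𝔤 ⊗ Ω_c(D)[1]` into a deformation retract of `𝔤[1-m]`
(`genRetract`).

*Symmetric powers.* The symmetrized homotopy has a closed form (`H_prod`, `symH_eq`): on a product
of letters, some in the image of `i[1]` and `k` of them in the kernel of `p[1]`, it is the
derivation extending `h[1]`, divided by `k`, and zero if `k = 0`. The side conditions `hi = 0`,
`ph = 0`, `h² = 0` and the homotopy identity can be read off from that form.

*Perturbation.* The differential `d_CE` lowers the number of letters, so the series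
`A = ∑ (d_CE h)^j` is finite on every element. It intertwines the full differential with its linear
part (`A_d`), which is what makes `(i, p A, h A)` a retract again (`homotopy_hat`). The inclusion `i`
is not perturbed, because `d_CE` vanishes on its image: the wedge product of two top forms is zero
(`noδ_d_I`).

*Dimension at least three.* Give `X ⊗ ω` with `ω` of degree `r` the codegree `m - r`, extended
additively to products. It is never negative. The map `i` lands in codegree `0`, `h` raises the
codegree by `1`, `d_CE` lowers it by `m`, structure maps preserve it, and `p` kills everything of
nonzero codegree. For `m ≥ 3` this makes `A` the identity in codegrees `0` and `1`. A tree with two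
vertices applies one homotopy to a product of elements of codegree `0`, so what reaches the root has
codegree `1` and is killed by the projection: the Massey cocycles vanish (`hatRetract_beta`,
`improvedRetract_beta`). For any other retract the Massey cocycle is then the coboundary of an
explicit cochain, built from the comparison of the two retracts (`beta_eq_coboundary`), so the class
is trivial (`massey_trivial`).

*Dimension one.* The cohomology is concentrated in degree `0`, while a tree with more than one
vertex has an operation of negative degree, so every such operation is zero
(`beta_eq_zero_of_acyclic`). The transferred structure is then strict, and evaluating trees
with leaves decorated by `i` and all edges, the root included, by `h` is an `∞`-quasi-isomorphism
from the cohomology (`formal`).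
-/

namespace FactEnv

noncomputable section

/-! ### Multilinear functionals on tuples of cochains -/

section Tuples

variable {𝕜 : Type} [Field 𝕜] {m : ℕ}

namespace DGMod

variable (V : DGMod.{u} 𝕜)

theorem ε_of_mem {n : ℤ} {x : V} (hx : x ∈ V.gr n) : V.ε x = (-1 : 𝕜) ^ n • x := by
  let _ := V.internal.chooseDecomposition
  exact scale_of_mem V.gr _ hx

theorem hom_ext {N : Type*} [AddCommGroup N] [Module 𝕜 N] {f g : V →ₗ[𝕜] N}
    (h : ∀ n, ∀ x ∈ V.gr n, f x = g x) : f = g := by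
  let _ := V.internal.chooseDecomposition
  exact hom_ext_homog V.gr h

theorem ε_mem {n : ℤ} {x : V} (hx : x ∈ V.gr n) : V.ε x ∈ V.gr n := by
  rw [V.ε_of_mem hx]
  exact Submodule.smul_mem _ _ hx

/-- A homogeneous map of degree `k` commutes with the sign involution up to `(-1)^k`. -/
theorem ε_map {V W : DGMod.{u} 𝕜} (f : V →ₗ[𝕜] W) (k : ℤ)
    (hf : ∀ n, ∀ x ∈ V.gr n, f x ∈ W.gr (n + k)) (x : V) :
    W.ε (f x) = (-1 : 𝕜) ^ k • f (V.ε x) := by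
  refine LinearMap.congr_fun (f := W.ε ∘ₗ f) (g := (-1 : 𝕜) ^ k • (f ∘ₗ V.ε))
    (V.hom_ext fun n x hx => ?_) x
  simp only [LinearMap.comp_apply, LinearMap.smul_apply]
  rw [W.ε_of_mem (hf n x hx), V.ε_of_mem hx, map_smul, smul_smul, ← zpow_add₀ (by simp), add_comm]

theorem ε_ε (x : V) : V.ε (V.ε x) = x := by
  refine LinearMap.congr_fun (f := V.ε ∘ₗ V.ε) (g := LinearMap.id) (V.hom_ext fun n x hx => ?_) x
  simp only [LinearMap.comp_apply, LinearMap.id_apply]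
  rw [V.ε_of_mem hx, map_smul, V.ε_of_mem hx, smul_smul, ← zpow_add₀ (by simp),
    neg_one_zpow_congr (b := 0) ⟨n, by ring⟩, zpow_zero, one_smul]

theorem ε_d (x : V) : V.ε (V.d x) = -V.d (V.ε x) := by
  rw [ε_map V.d 1 V.d_mem, zpow_one, neg_one_smul]

theorem d_ε (x : V) : V.d (V.ε x) = -V.ε (V.d x) := by rw [ε_d, neg_neg]

end DGMod

variable {A A' A'' : Fam.{u} m 𝕜} {M N : Type u} [AddCommGroup M] [Module 𝕜 M]
  [AddCommGroup N] [Module 𝕜 N]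

namespace Tup

/-- Entrywise application of a family of linear maps. -/
def mapL (f : ∀ D, A D →ₗ[𝕜] A' D) {Ds : List (Disk m)} (xs : Tup A Ds) : Tup A' Ds :=
  HL.map (A' := fun D => (A' D).carrier) (fun D => f D) xs

@[simp] theorem mapL_cons (f : ∀ D, A D →ₗ[𝕜] A' D) {D : Disk m} {Ds : List (Disk m)} (x : A D)
    (xs : Tup A Ds) : mapL f (.cons x xs : Tup A (D :: Ds)) = .cons (f D x) (mapL f xs) := rfl

theorem mapL_append (f : ∀ D, A D →ₗ[𝕜] A' D) {l r : List (Disk m)} (xs : Tup A l)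
    (ys : Tup A r) : mapL f (xs.append ys) = HL.append (mapL f xs) (mapL f ys) := by
  induction xs with
  | nil => rfl
  | cons x xs ih => simp only [HL.append, mapL_cons, ih]

theorem mapL_congr {f f' : ∀ D, A D →ₗ[𝕜] A' D} (h : ∀ D x, f D x = f' D x)
    {Ds : List (Disk m)} (xs : Tup A Ds) : mapL f xs = mapL f' xs := by
  induction xs with
  | nil => rfl
  | cons x xs ih => simp only [mapL_cons, ih, h]

theorem mapL_mapL (f : ∀ D, A D →ₗ[𝕜] A' D) (f' : ∀ D, A' D →ₗ[𝕜] A'' D)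
    {Ds : List (Disk m)} (xs : Tup A Ds) :
    mapL f' (mapL f xs) = mapL (fun D => f' D ∘ₗ f D) xs := by
  induction xs with
  | nil => rfl
  | cons x xs ih => simp only [mapL_cons, ih, LinearMap.comp_apply]

@[simp] theorem twist_cons {D : Disk m} {Ds : List (Disk m)} (x : A D) (xs : Tup A Ds) :
    Tup.twist (.cons x xs : Tup A (D :: Ds)) = .cons ((A D).ε x) xs.twist := rfl

theorem twist_twist {Ds : List (Disk m)} (xs : Tup A Ds) : xs.twist.twist = xs := by
  induction xs with
  | nil => rfl
  | cons x xs ih => simp only [twist_cons, ih, DGMod.ε_ε]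

theorem twist_mapL {f : ∀ D, A D →ₗ[𝕜] A' D} (h : ∀ D x, (A' D).ε (f D x) = f D ((A D).ε x))
    {Ds : List (Disk m)} (xs : Tup A Ds) : (mapL f xs).twist = mapL f xs.twist := by
  induction xs with
  | nil => rfl
  | cons x xs ih => simp only [mapL_cons, twist_cons, ih, h]

/-- All entries are cocycles. -/
def Closed : {Ds : List (Disk m)} → Tup A Ds → Prop
  | _, .nil => True
  | D :: _, .cons x xs => (A D).d x = 0 ∧ Closed xs

theorem closed_mapL {f : ∀ D, A D →ₗ[𝕜] A' D} (h : ∀ D x, (A' D).d (f D x) = 0)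
    {Ds : List (Disk m)} (xs : Tup A Ds) : Closed (mapL f xs) := by
  induction xs with
  | nil => trivial
  | cons x xs ih => exact ⟨h _ _, ih⟩

theorem Closed.cons {D : Disk m} {Ds : List (Disk m)} {x : A D} (hx : (A D).d x = 0)
    {xs : Tup A Ds} (h : Closed xs) : Closed (.cons x xs : Tup A (D :: Ds)) := ⟨hx, h⟩

theorem Closed.append {l r : List (Disk m)} {xs : Tup A l} {ys : Tup A r} (hx : Closed xs)
    (hy : Closed ys) : Closed (A := A) (xs.append ys) := by
  induction xs with
  | nil => exact hy
  | cons x xs ih => exact ⟨hx.1, ih hx.2⟩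

variable (𝕜) in
/-- Multilinearity of a functional on tuples, entry by entry. -/
def ML : {Ds : List (Disk m)} → (Tup A Ds → M) → Prop
  | [], _ => True
  | D :: _, g => (∀ (c : 𝕜) (a b : A D) xs,
      g (.cons (a + c • b) xs) = g (.cons a xs) + c • g (.cons b xs)) ∧
      ∀ a, ML fun xs => g (.cons a xs)

/-- The functional as a linear map in its first entry. -/
def ML.head {D : Disk m} {Ds : List (Disk m)} {g : Tup A (D :: Ds) → M} (hg : ML 𝕜 g)
    (xs : Tup A Ds) : A D →ₗ[𝕜] M :=
  IsLinearMap.mk' (fun a => g (.cons a xs))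
    { map_add := fun a b => by simpa using hg.1 1 a b xs
      map_smul := fun c a => by
        have h0 := hg.1 1 0 0 xs
        simp only [smul_zero, add_zero, one_smul, left_eq_add] at h0
        simpa [h0] using hg.1 c 0 a xs }

theorem ML.head_apply {D : Disk m} {Ds : List (Disk m)} {g : Tup A (D :: Ds) → M} (hg : ML 𝕜 g)
    (xs : Tup A Ds) (a : A D) : hg.head xs a = g (.cons a xs) := rfl

theorem ML.comp {Ds : List (Disk m)} {g : Tup A Ds → M} (hg : ML 𝕜 g) (f : M →ₗ[𝕜] N) :
    ML 𝕜 fun xs => f (g xs) := by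
  induction Ds with
  | nil => trivial
  | cons D Ds ih =>
    refine ⟨fun c a b xs => ?_, fun a => ih (hg.2 a)⟩
    change f (g _) = f (g _) + c • f (g _)
    rw [hg.1, map_add, map_smul]

theorem ML.add {Ds : List (Disk m)} {g g' : Tup A Ds → M} (hg : ML 𝕜 g) (hg' : ML 𝕜 g') :
    ML 𝕜 fun xs => g xs + g' xs := by
  induction Ds with
  | nil => trivial
  | cons D Ds ih =>
    refine ⟨fun c a b xs => ?_, fun a => ih (hg.2 a) (hg'.2 a)⟩
    simp only [hg.1, hg'.1]
    module

theorem ML.compMap {Ds : List (Disk m)} {g : Tup A' Ds → M} (hg : ML 𝕜 g)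
    (f : ∀ D, A D →ₗ[𝕜] A' D) : ML 𝕜 fun xs => g (mapL f xs) := by
  induction Ds with
  | nil => trivial
  | cons D Ds ih =>
    exact ⟨fun c a b xs => by simp only [mapL_cons, map_add, map_smul, hg.1],
      fun a => ih (hg.2 _)⟩

theorem ML.suffix {l r : List (Disk m)} {g : Tup A (l ++ r) → M} (hg : ML 𝕜 g) (ys : Tup A r) :
    ML 𝕜 fun xs : Tup A l => g (xs.append ys) := by
  induction l with
  | nil => trivial
  | cons D l ih => exact ⟨fun c a b xs => hg.1 c a b _, fun a => ih (hg.2 a)⟩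

theorem ML.prefix {l r : List (Disk m)} {g : Tup A (l ++ r) → M} (hg : ML 𝕜 g) (xs : Tup A l) :
    ML 𝕜 fun ys : Tup A r => g (xs.append ys) := by
  induction xs with
  | nil => exact hg
  | cons x xs ih => exact ih (hg.2 x)

/-- Multilinearity from linearity in all positions of a concatenation. -/
theorem ML.of_append {g : ∀ Ds : List (Disk m), Tup A Ds → M}
    (h : ∀ (c : 𝕜) {l r : List (Disk m)} {D : Disk m} (xs : Tup A l) (a b : A D) (ys : Tup A r),
      g _ (xs.append (.cons (a + c • b) ys)) =
        g _ (xs.append (.cons a ys)) + c • g _ (xs.append (.cons b ys)))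
    (Ds : List (Disk m)) : ML 𝕜 (g Ds) := by
  induction Ds generalizing g with
  | nil => trivial
  | cons D Ds ih =>
    refine ⟨fun c a b xs => h c .nil a b xs, fun a => ?_⟩
    exact ih (g := fun Ds xs => g (D :: Ds) (.cons a xs)) fun c _ _ _ xs => h c (.cons a xs)

section Middle

variable {l r : List (Disk m)} {D : Disk m} {g : Tup A (l ++ D :: r) → M}

/-- The functional as a linear map in one of its entries. -/
def ML.at (hg : ML 𝕜 g) (xs : Tup A l) (ys : Tup A r) : A D →ₗ[𝕜] M := (hg.prefix xs).head ys

theorem ML.at_apply (hg : ML 𝕜 g) (xs : Tup A l) (ys : Tup A r) (a : A D) :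
    hg.at xs ys a = g (xs.append (.cons a ys)) := rfl

end Middle

theorem dsum_comp (f : M →+ N) {Ds : List (Disk m)} (g : Tup A Ds → M) (xs : Tup A Ds) :
    Tup.dsum (fun ys => f (g ys)) xs = f (Tup.dsum g xs) := by
  induction xs with
  | nil => exact (map_zero f).symm
  | cons x xs ih =>
    simp only [Tup.dsum, map_add]
    rw [ih fun ys => g (.cons _ ys)]

theorem dsum_of_closed {Ds : List (Disk m)} {g : Tup A Ds → M} (hg : ML 𝕜 g) {xs : Tup A Ds}
    (hx : Closed xs) : Tup.dsum g xs = 0 := by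
  induction xs with
  | nil => rfl
  | cons x xs ih =>
    have h1 : g (.cons ((A _).d x) xs) = 0 := by
      rw [hx.1, ← hg.head_apply, map_zero]
    simp only [Tup.dsum]
    rw [h1, ih (hg.2 _) hx.2, add_zero]

theorem dsum_append {l r : List (Disk m)} (g : Tup A (l ++ r) → M) (xs : Tup A l) (ys : Tup A r) :
    Tup.dsum g (xs.append ys) = Tup.dsum (fun xs' : Tup A l => g (xs'.append ys)) xs +
      Tup.dsum (fun ys' => g (HL.append xs.twist ys')) ys := by
  induction xs with
  | nil => exact (zero_add _).symm
  | @cons D _ x xs ih =>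
    simp only [HL.append, Tup.dsum, twist_cons, add_assoc]
    exact congrArg (_ + ·) (ih fun ys => g (.cons ((A D).ε x) ys))

theorem dsum_cons_eq_zero {D : Disk m} {Ds : List (Disk m)} {g : Tup A (D :: Ds) → M}
    (hg : ML 𝕜 g) (h : ∀ xs, Tup.dsum g xs = 0) {a : A D} (ha : (A D).d a = 0) (xs : Tup A Ds) :
    Tup.dsum (fun ys => g (.cons a ys)) xs = 0 := by
  have := h (.cons ((A D).ε a) xs)
  simp only [Tup.dsum, DGMod.ε_ε, DGMod.d_ε, ha, map_zero, neg_zero] at this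
  rwa [← hg.head_apply, map_zero, zero_add] at this

theorem dsum_prefix_eq_zero {l r : List (Disk m)} {g : Tup A (l ++ r) → M}
    (hg : ML 𝕜 g) (h : ∀ xs, Tup.dsum g xs = 0) {xs : Tup A l} (hx : Closed xs) (ys : Tup A r) :
    Tup.dsum (fun ys => g (xs.append ys)) ys = 0 := by
  induction xs with
  | nil => exact h ys
  | cons x xs ih => exact ih (hg.2 x) (dsum_cons_eq_zero hg h hx.1) hx.2

theorem dsum_middle {l r : List (Disk m)} {D : Disk m} {g : Tup A (l ++ D :: r) → M}
    (hg : ML 𝕜 g) {xs : Tup A l} (hx : Closed xs) (a : A D) {ys : Tup A r} (hy : Closed ys) :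
    Tup.dsum g (xs.append (.cons a ys)) = g (HL.append xs.twist (.cons ((A D).d a) ys)) := by
  rw [dsum_append, dsum_of_closed (hg.suffix _) hx, zero_add]
  simp only [dsum]
  rw [dsum_of_closed ((hg.prefix _).2 _) hy, add_zero]

/-- A multilinear functional which is invariant under the differential depends on cocycles only
through their cohomology classes. -/
theorem eq_of_cohomologous {Ds : List (Disk m)} {g : Tup A Ds → M} (hg : ML 𝕜 g)
    (h : ∀ xs, Tup.dsum g xs = 0) (e k : ∀ D, A D →ₗ[𝕜] A D)
    (hek : ∀ D x, (A D).d x = 0 → e D x = x + (A D).d (k D x))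
    {zs : Tup A Ds} (hz : Closed zs) : g (mapL e zs) = g zs := by
  induction zs with
  | nil => rfl
  | @cons D Ds z zs ih =>
    obtain ⟨hz1, hz2⟩ := hz
    have he : (A D).d (e D z) = 0 := by rw [hek D z hz1, map_add, hz1, DGMod.d_d, add_zero]
    rw [mapL_cons, ih (g := fun ys => g (.cons (e D z) ys)) (hg.2 _)
      (dsum_cons_eq_zero hg h he) hz2, hek D z hz1, ← hg.head_apply, map_add]
    have := h (.cons (k D z) zs)
    simp only [Tup.dsum] at this
    rw [dsum_of_closed (hg.2 _) hz2, add_zero] at this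
    rw [hg.head_apply, hg.head_apply, this, add_zero]

/-- A homogeneous multilinear functional commutes with the sign involutions. -/
theorem ε_of_mem {V : DGMod.{u} 𝕜} {Ds : List (Disk m)} {g : Tup A Ds → V} (hg : ML 𝕜 g) (k : ℤ)
    (h : ∀ xs n, Tup.HasDeg xs n → g xs ∈ V.gr (n + k)) (xs : Tup A Ds) :
    V.ε (g xs) = (-1 : 𝕜) ^ k • g xs.twist := by
  induction xs generalizing k with
  | nil =>
    have := h .nil 0 rfl
    rw [zero_add] at this
    exact V.ε_of_mem this
  | @cons D Ds x xs ih =>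
    have key : V.ε ∘ₗ hg.head xs = (-1 : 𝕜) ^ k • (hg.head (Tup.twist xs) ∘ₗ (A D).ε) := by
      refine (A D).hom_ext fun p x hx => ?_
      have := ih (hg.2 x) (k + p) fun ys n hy => by
        have := h (.cons x ys) (p + n) ⟨p, n, rfl, hx, hy⟩
        rwa [show n + (k + p) = p + n + k by ring]
      simp only [LinearMap.comp_apply, LinearMap.smul_apply, ML.head_apply]
      rw [this, (A D).ε_of_mem hx, ← hg.head_apply _ ((-1 : 𝕜) ^ p • x), map_smul, smul_smul,
        ← zpow_add₀ (by simp)]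
      rfl
    exact LinearMap.congr_fun key x

/-- `∑ ± g (i' x_1, …, i' x_{j-1}, s x_j, i x_{j+1}, …, i x_n)`: the homotopy between
`g (i' x_1, …, i' x_n)` and `g (i x_1, …, i x_n)` induced by a homotopy `s` between `i'` and `i`. -/
def hsum (i i' s : ∀ D, A D →ₗ[𝕜] A' D) : {Ds : List (Disk m)} → (Tup A' Ds → M) → Tup A Ds → M
  | _, _, .nil => 0
  | _, g, .cons x xs => g (.cons (s _ x) (mapL i xs)) +
      hsum i i' s (fun ys => g (.cons (i' _ ((A _).ε x)) ys)) xs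

section Hsum

variable {i i' s : ∀ D, A D →ₗ[𝕜] A' D}

theorem hsum_comp {Ds : List (Disk m)} (f : M →+ N) (g : Tup A' Ds → M) (xs : Tup A Ds) :
    hsum i i' s (fun ys => f (g ys)) xs = f (hsum i i' s g xs) := by
  induction xs with
  | nil => exact (map_zero f).symm
  | cons x xs ih =>
    simp only [hsum, map_add]
    rw [ih fun ys => g (.cons _ ys)]

theorem hsum_add {Ds : List (Disk m)} (g g' : Tup A' Ds → M) (xs : Tup A Ds) :
    hsum i i' s (fun ys => g ys + g' ys) xs = hsum i i' s g xs + hsum i i' s g' xs := by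
  induction xs with
  | nil => exact (add_zero 0).symm
  | cons x xs ih =>
    simp only [hsum]
    rw [ih (fun ys => g (.cons _ ys)) (fun ys => g' (.cons _ ys))]
    abel

theorem hsum_sub {Ds : List (Disk m)} (g g' : Tup A' Ds → M) (xs : Tup A Ds) :
    hsum i i' s (fun ys => g ys - g' ys) xs = hsum i i' s g xs - hsum i i' s g' xs := by
  induction xs with
  | nil => exact (sub_zero 0).symm
  | cons x xs ih =>
    simp only [hsum]
    rw [ih (fun ys => g (.cons _ ys)) (fun ys => g' (.cons _ ys))]
    abel

theorem hsum_neg {Ds : List (Disk m)} (g : Tup A' Ds → M) (xs : Tup A Ds) :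
    hsum i i' s (fun ys => -g ys) xs = -hsum i i' s g xs :=
  hsum_comp (-AddMonoidHom.id M) g xs

theorem hsum_congr {Ds : List (Disk m)} {g g' : Tup A' Ds → M} (h : ∀ ys, g ys = g' ys)
    (xs : Tup A Ds) : hsum i i' s g xs = hsum i i' s g' xs := by
  rw [show g = g' from funext h]

theorem hsum_append {l r : List (Disk m)} (g : Tup A' (l ++ r) → M) (xs : Tup A l) (ys : Tup A r) :
    hsum i i' s g (xs.append ys) =
      hsum i i' s (fun xs' : Tup A' l => g (xs'.append (mapL i ys))) xs +
      hsum i i' s (fun ys' => g (HL.append (mapL i' xs.twist) ys')) ys := by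
  induction xs with
  | nil => exact (zero_add _).symm
  | @cons D _ x xs ih =>
    simp only [HL.append, hsum, twist_cons, mapL_append, mapL_cons, add_assoc]
    exact congrArg (_ + ·) (ih fun ys => g (.cons (i' D ((A D).ε x)) ys))

theorem hsum_dsum (di : ∀ D x, (A' D).d (i D x) = 0) (di' : ∀ D x, (A' D).d (i' D x) = 0)
    (hi : ∀ D x, (A' D).ε (i' D x) = i' D ((A D).ε x))
    (ds : ∀ D x, (A' D).d (s D x) = i' D x - i D x) {Ds : List (Disk m)} {g : Tup A' Ds → M}
    (hg : ML 𝕜 g) (xs : Tup A Ds) :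
    hsum i i' s (fun ys => Tup.dsum g ys) xs = g (mapL i' xs) - g (mapL i xs) := by
  induction xs with
  | nil => exact (sub_self _).symm
  | cons x xs ih =>
    simp only [hsum, Tup.dsum, mapL_cons, ds, di', hi, DGMod.ε_ε]
    rw [dsum_of_closed (hg.2 _) (closed_mapL di xs), hsum_congr (g' := fun ys =>
      Tup.dsum (fun zs => g (.cons (i' _ x) zs)) ys), ih (hg.2 _), ← hg.head_apply, map_sub]
    · simp only [ML.head_apply]; abel
    · intro ys
      rw [← hg.head_apply, map_zero, zero_add]

theorem hsum_twist (hi : ∀ D x, (A' D).ε (i D x) = i D ((A D).ε x))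
    (hi' : ∀ D x, (A' D).ε (i' D x) = i' D ((A D).ε x))
    (hs : ∀ D x, (A' D).ε (s D x) = -s D ((A D).ε x)) {Ds : List (Disk m)} {g : Tup A' Ds → M}
    (hg : ML 𝕜 g) (xs : Tup A Ds) :
    hsum i i' s (fun ys => g ys.twist) xs = -hsum i i' s g xs.twist := by
  induction xs with
  | nil => exact neg_zero.symm
  | cons x xs ih =>
    simp only [hsum, twist_cons, hs, hi', twist_mapL hi]
    rw [ih (hg.2 _), ← hg.head_apply, map_neg, neg_add]
    rfl

theorem ML.hsum {Ds : List (Disk m)} {g : Tup A' Ds → M} (hg : ML 𝕜 g) :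
    ML 𝕜 fun xs => hsum i i' s g xs := by
  induction Ds with
  | nil => trivial
  | cons D Ds ih =>
    refine ⟨fun c a b xs => ?_, fun a => ?_⟩
    · have h1 : ∀ ys, g (.cons (i' D ((A D).ε (a + c • b))) ys) =
          g (.cons (i' D ((A D).ε a)) ys) + c • g (.cons (i' D ((A D).ε b)) ys) := by
        intro ys
        rw [map_add, map_smul, map_add, map_smul, hg.1]
      simp only [Tup.hsum, map_add, map_smul, hg.1]
      have h2 := hsum_comp (i := i) (i' := i') (s := s) (DistribSMul.toAddMonoidHom M c)
        (fun ys => g (.cons (i' D ((A D).ε b)) ys)) xs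
      simp only [DistribSMul.toAddMonoidHom_apply] at h2
      rw [hsum_add, h2, smul_add]
      abel
    · exact ML.add (ML.compMap (hg.2 (s D a)) i) (ih (hg.2 _))

theorem hasDeg_mapL (hi : ∀ D n x, x ∈ (A D).gr n → i D x ∈ (A' D).gr n) {Es : List (Disk m)}
    (ys : Tup A Es) (n : ℤ) (h : Tup.HasDeg ys n) : Tup.HasDeg (mapL i ys) n := by
  induction ys generalizing n with
  | nil => exact h
  | cons y ys ih =>
    obtain ⟨p, q, rfl, hp, hq⟩ := h
    exact ⟨p, q, rfl, hi _ _ _ hp, ih _ hq⟩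

theorem hsum_mem {P : ℤ → Submodule 𝕜 M} (k : ℤ)
    (hi : ∀ D n x, x ∈ (A D).gr n → i D x ∈ (A' D).gr n)
    (hi' : ∀ D n x, x ∈ (A D).gr n → i' D x ∈ (A' D).gr n)
    (hs : ∀ D n x, x ∈ (A D).gr n → s D x ∈ (A' D).gr (n - 1)) {Ds : List (Disk m)}
    {g : Tup A' Ds → M} (hg : ∀ xs n, Tup.HasDeg xs n → g xs ∈ P (n + k)) (xs : Tup A Ds) (n : ℤ)
    (hx : Tup.HasDeg xs n) : hsum i i' s g xs ∈ P (n - 1 + k) := by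
  induction xs generalizing n k with
  | nil => exact Submodule.zero_mem _
  | @cons D _ x xs ih =>
    obtain ⟨p, q, rfl, hp, hq⟩ := hx
    refine Submodule.add_mem _ ?_ ?_
    · have := hg (.cons (s D x) (mapL i xs)) (p - 1 + q)
        ⟨p - 1, q, rfl, hs _ _ _ hp, hasDeg_mapL hi _ _ hq⟩
      convert this using 2; ring
    · have := ih (k + p) (g := fun ys => g (.cons (i' D ((A D).ε x)) ys)) (fun ys n hy => ?_) q hq
      · convert this using 2; ring
      · have := hg (.cons (i' D ((A D).ε x)) ys) (p + n)
          ⟨p, n, rfl, hi' _ _ _ (DGMod.ε_mem _ hp), hy⟩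
        convert this using 2; ring

end Hsum

end Tup

end Tuples

/-! ### The universal first-order Massey product is independent of the retract -/

section Transfer

variable {𝕜 : Type} [Field 𝕜] {m : ℕ} {B : Fam.{u} m 𝕜} {F : PFA.{u} m 𝕜}

namespace PFA

theorem act_ml (F : PFA.{u} m 𝕜) (D : Disk m) (Ds : List (Disk m)) :
    Tup.ML 𝕜 fun xs : Tup F.obj Ds => F.act D xs :=
  Tup.ML.of_append (g := fun _ xs => F.act D xs)
    (fun c _ _ _ xs a b ys => by rw [F.act_add, F.act_smul]) Ds

theorem ε_act (F : PFA.{u} m 𝕜) (D : Disk m) {Ds : List (Disk m)} (xs : Tup F.obj Ds) :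
    (F.obj D).ε (F.act D xs) = F.act D xs.twist := by
  simpa using Tup.ε_of_mem (F.act_ml D Ds) 0 (fun xs n h => by simpa using F.act_mem D xs n h) xs

end PFA

section TwoVertex

variable {A : Disk m → Type u}

theorem Fo.valid_leaves {Ds : List (Disk m)} (xs : HL A Ds) : (Fo.leaves xs).Valid := by
  induction xs with
  | nil => exact trivial
  | cons x xs ih => exact ⟨trivial, ih⟩

theorem Fo.valid_append {l r : List (Disk m)} (xs : HL A l) (ys : Fo A r) :
    ((Fo.leaves xs).append ys).Valid ↔ ys.Valid := by
  induction xs with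
  | nil => exact Iff.rfl
  | cons x xs ih => exact (and_iff_right trivial).trans ih

theorem valid_twoVertex {l r Es : List (Disk m)} {D D' : Disk m} {xs : Tup B l} {es : Tup B Es}
    {ys : Tup B r} : (twoVertex D D' xs es ys).Valid ↔
      Adm (l ++ D' :: r) D ∧ l ++ D' :: r ≠ [D] ∧ Adm Es D' ∧ Es ≠ [D'] := by
  refine and_congr_right' (and_congr_right' ((Fo.valid_append _ _).trans ?_))
  exact ⟨fun h => ⟨h.1.1, h.1.2.1⟩,
    fun h => ⟨⟨h.1, h.2, Fo.valid_leaves _⟩, Fo.valid_leaves _⟩⟩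

theorem Fo.verts_append {l r : List (Disk m)} (xs : HL A l) (ys : Fo A r) :
    ((Fo.leaves xs).append ys).verts = ys.verts := by
  induction xs with
  | nil => exact rfl
  | cons x xs ih => exact (zero_add _).trans ih

theorem Fo.verts_leaves {Ds : List (Disk m)} (xs : HL A Ds) : (Fo.leaves xs).verts = 0 := by
  induction xs with
  | nil => exact rfl
  | cons x xs ih => exact (zero_add _).trans ih

theorem verts_twoVertex {l r Es : List (Disk m)} (D D' : Disk m) (xs : Tup B l) (es : Tup B Es)
    (ys : Tup B r) : (twoVertex D D' xs es ys).verts = 2 := by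
  have : (twoVertex D D' xs es ys).verts =
    ((Fo.leaves xs).append (.cons (.node D' (Fo.leaves es)) (Fo.leaves ys))).verts + 1 := rfl
  rw [this, Fo.verts_append]
  change (Fo.leaves es).verts + 1 + (Fo.leaves ys).verts + 1 = 2
  rw [Fo.verts_leaves, Fo.verts_leaves]

end TwoVertex

namespace Retract

variable (R : Retract B F)

theorem evs_leaves {Ds : List (Disk m)} (xs : Tup B Ds) :
    R.evs (Fo.leaves xs) = Tup.mapL R.i xs := by
  induction xs with
  | nil => rfl
  | cons x xs ih =>
    rw [Tup.mapL_cons, ← ih]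
    rfl

theorem evs_append {l r : List (Disk m)} (xs : Tup B l) (ys : DFo B r) :
    R.evs ((Fo.leaves xs).append ys) = HL.append (Tup.mapL R.i xs) (R.evs ys) := by
  induction xs with
  | nil => rfl
  | cons x xs ih =>
    rw [Tup.mapL_cons, HL.append, ← ih]
    rfl

/-- The functional `p ∘ act` at the disk `D`. -/
def pAct (D : Disk m) {Ds : List (Disk m)} (xs : Tup F.obj Ds) : B D := R.p D (F.act D xs)

theorem act_eq {Ds : List (Disk m)} (D : Disk m) (xs : Tup B Ds) :
    R.act D xs = R.pAct D (Tup.mapL R.i xs) := by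
  rw [pAct, ← evs_leaves]
  rfl

theorem beta_twoVertex {l r Es : List (Disk m)} (D D' : Disk m) (xs : Tup B l) (es : Tup B Es)
    (ys : Tup B r) : R.beta (twoVertex D D' xs es ys) =
      R.pAct D (HL.append (Tup.mapL R.i xs)
        (.cons (R.h D' (F.act D' (Tup.mapL R.i es))) (Tup.mapL R.i ys))) := by
  have : R.beta (twoVertex D D' xs es ys) = R.pAct D (R.evs ((Fo.leaves xs).append
    (.cons (.node D' (Fo.leaves es)) (Fo.leaves ys)))) := rfl
  rw [this, evs_append, ← evs_leaves, ← evs_leaves, ← evs_leaves]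
  rfl

theorem pAct_ml (D : Disk m) (Ds : List (Disk m)) :
    Tup.ML 𝕜 fun xs : Tup F.obj Ds => R.pAct D xs := (F.act_ml D Ds).comp (R.p D)

theorem pAct_swap {l r : List (Disk m)} {D₁ D₂ : Disk m} (D : Disk m) (xs : Tup F.obj l)
    {a : F.obj D₁} {b : F.obj D₂} (ys : Tup F.obj r) {p q : ℤ} (ha : a ∈ (F.obj D₁).gr p)
    (hb : b ∈ (F.obj D₂).gr q) : R.pAct D (xs.append (.cons a (.cons b ys))) =
        (-1 : 𝕜) ^ (p * q) • R.pAct D (xs.append (.cons b (.cons a ys))) := by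
  rw [pAct, F.act_swap D xs a b ys p q ha hb, map_smul]
  rfl

theorem pAct_act {l r Es : List (Disk m)} {D D' : Disk m} (xs : Tup F.obj l)
    (es : Tup F.obj Es) (ys : Tup F.obj r) (h : Adm (l ++ D' :: r) D) (h' : Adm Es D') :
    R.pAct D (xs.append (.cons (F.act D' es) ys)) = R.pAct D (xs.append (es.append ys)) :=
  congrArg (R.p D) (F.act_act D xs es ys h h')

variable {R} (hR : R.IsSDR)
include hR

namespace IsSDR

theorem dsum_pAct (D : Disk m) {Ds : List (Disk m)} (xs : Tup F.obj Ds) :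
    Tup.dsum (fun ys => R.pAct D ys) xs = 0 :=
  (Tup.dsum_comp (R.p D).toAddMonoidHom (fun ys => F.act D ys) xs).trans
    ((congrArg (R.p D) (F.act_d D xs).symm).trans (hR.p_d D _))

theorem ε_i (D : Disk m) (b : B D) : (F.obj D).ε (R.i D b) = R.i D ((B D).ε b) := by
  simpa using DGMod.ε_map (R.i D) 0 (fun n x hx => by simpa using hR.i_mem D n x hx) b

theorem ε_p (D : Disk m) (x : F.obj D) : (B D).ε (R.p D x) = R.p D ((F.obj D).ε x) := by
  simpa using DGMod.ε_map (R.p D) 0 (fun n x hx => by simpa using hR.p_mem D n x hx) x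

theorem ε_h (D : Disk m) (x : F.obj D) : (F.obj D).ε (R.h D x) = -R.h D ((F.obj D).ε x) := by
  simpa using DGMod.ε_map (R.h D) (-1) (fun n x hx => hR.h_mem D n x hx) x

theorem i_p (D : Disk m) (x : F.obj D) (hx : (F.obj D).d x = 0) :
    R.i D (R.p D x) = x + (F.obj D).d (R.h D x) := by
  have := hR.homotopy D x
  rw [hx, map_zero, add_zero] at this
  rw [this, add_sub_cancel]

/-- The cohomology class of a product of cocycles depends on their cohomology classes only. -/
theorem pAct_ip (D : Disk m) {Ds : List (Disk m)} {zs : Tup F.obj Ds} (hz : zs.Closed) :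
    R.pAct D (Tup.mapL (fun D => R.i D ∘ₗ R.p D) zs) = R.pAct D zs :=
  Tup.eq_of_cohomologous (R.pAct_ml D Ds) (hR.dsum_pAct D) _ R.h (hR.i_p) hz

theorem pAct_exact (D : Disk m) {l r : List (Disk m)} {D' : Disk m} {xs : Tup F.obj l}
    (hx : xs.Closed) (a : F.obj D') {ys : Tup F.obj r} (hy : ys.Closed) :
    R.pAct D (xs.append (.cons ((F.obj D').d a) ys)) = 0 := by
  rw [← hR.pAct_ip D (hx.append (.cons (DGMod.d_d _ a) hy)), Tup.mapL_append, Tup.mapL_cons,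
    LinearMap.comp_apply, hR.p_d, map_zero]
  exact map_zero ((R.pAct_ml D (l ++ D' :: r)).at _ _)

/-! The comparison of two retracts: `i' = i₀ p₀ i` and the homotopy `s` between `i'` and `i`. -/

variable {B₀ : Fam.{u} m 𝕜} (R₀ : Retract B₀ F) (R)

omit hR in
/-- The inclusion `i₀ p₀ i : B → F`, homotopic to `i`. -/
def cmpI (D : Disk m) : B D →ₗ[𝕜] F.obj D := R₀.i D ∘ₗ R₀.p D ∘ₗ R.i D

omit hR in
/-- The homotopy `-h i₀ p₀ i` between `i₀ p₀ i` and `i`. -/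
def cmpS (D : Disk m) : B D →ₗ[𝕜] F.obj D := -(R.h D ∘ₗ cmpI R R₀ D)

variable {R₀} (hR₀ : R₀.IsSDR)
include hR₀

omit hR in
theorem d_cmpI (D : Disk m) (b : B D) : (F.obj D).d (cmpI R R₀ D b) = 0 := hR₀.d_i _ _

theorem cmpI_mem (D : Disk m) (n : ℤ) (b : B D) (hb : b ∈ (B D).gr n) :
    cmpI R R₀ D b ∈ (F.obj D).gr n :=
  hR₀.i_mem D n _ (hR₀.p_mem D n _ (hR.i_mem D n b hb))

theorem cmpS_mem (D : Disk m) (n : ℤ) (b : B D) (hb : b ∈ (B D).gr n) :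
    cmpS R R₀ D b ∈ (F.obj D).gr (n - 1) :=
  Submodule.neg_mem _ (hR.h_mem D n _ (cmpI_mem R hR hR₀ D n b hb))

theorem ε_cmpI (D : Disk m) (b : B D) : (F.obj D).ε (cmpI R R₀ D b) = cmpI R R₀ D ((B D).ε b) := by
  simp only [cmpI, LinearMap.comp_apply, hR₀.ε_i, hR₀.ε_p, hR.ε_i]

theorem ε_cmpS (D : Disk m) (b : B D) :
    (F.obj D).ε (cmpS R R₀ D b) = -cmpS R R₀ D ((B D).ε b) := by
  simp only [cmpS, LinearMap.comp_apply, LinearMap.neg_apply, map_neg, hR.ε_h,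
    ε_cmpI R hR hR₀]

theorem p_cmpI (D : Disk m) (b : B D) : R.p D (cmpI R R₀ D b) = b := by
  rw [cmpI, LinearMap.comp_apply, LinearMap.comp_apply, hR₀.i_p D _ (hR.d_i D b), map_add,
    hR.p_i, hR.p_d, add_zero]

omit hR₀ in
theorem p_cmpS (D : Disk m) (b : B D) : R.p D (cmpS R R₀ D b) = 0 := by
  rw [cmpS, LinearMap.neg_apply, LinearMap.comp_apply, map_neg, hR.p_h, neg_zero]

theorem d_cmpS (D : Disk m) (b : B D) :
    (F.obj D).d (cmpS R R₀ D b) = cmpI R R₀ D b - R.i D b := by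
  have := hR.i_p D _ (d_cmpI R hR₀ D b)
  rw [p_cmpI R hR hR₀] at this
  rw [this, cmpS, LinearMap.neg_apply, LinearMap.comp_apply, map_neg, sub_add_cancel_left]

/-- Equivariance of the homotopy: the two ways of interpolating between `i'` and `i` on two
neighbouring entries differ by the boundary of `act (…, s a, s b, …)`. -/
theorem hsum_swap {l r : List (Disk m)} {D₁ D₂ : Disk m} (D : Disk m) (xs : Tup B l)
    {a : B D₁} {b : B D₂} (ys : Tup B r) {p q : ℤ} (ha : a ∈ (B D₁).gr p)
    (hb : b ∈ (B D₂).gr q) :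
    Tup.hsum R.i (cmpI R R₀) (cmpS R R₀) (fun zs => R.pAct D zs)
        (xs.append (.cons a (.cons b ys))) =
      (-1 : 𝕜) ^ (p * q) • Tup.hsum R.i (cmpI R R₀) (cmpS R R₀) (fun zs => R.pAct D zs)
        (xs.append (.cons b (.cons a ys))) := by
  have hia := hR.i_mem _ _ _ ha
  have hib := hR.i_mem _ _ _ hb
  have hja := cmpI_mem R hR hR₀ _ _ _ ha
  have hjb := cmpI_mem R hR hR₀ _ _ _ hb
  have hsa := cmpS_mem R hR hR₀ _ _ _ ha
  have hsb := cmpS_mem R hR hR₀ _ _ _ hb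
  set j := cmpI R R₀ with hj
  set s := cmpS R R₀ with hs
  rw [Tup.hsum_append, Tup.hsum_append]
  have h1 := Tup.hsum_comp (i := R.i) (i' := j) (s := s)
    (DistribSMul.toAddMonoidHom (B D) ((-1 : 𝕜) ^ (p * q)))
    (fun xs' : Tup F.obj l => R.pAct D (xs'.append (Tup.mapL R.i (.cons b (.cons a ys))))) xs
  have h2 := Tup.hsum_comp (i := R.i) (i' := j) (s := s)
    (DistribSMul.toAddMonoidHom (B D) ((-1 : 𝕜) ^ (p * q)))
    (fun ys' : Tup F.obj r => R.pAct D (HL.append (Tup.mapL j xs.twist)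
      (.cons (j D₂ ((B D₂).ε b)) (.cons (j D₁ ((B D₁).ε a)) ys')))) ys
  simp only [DistribSMul.toAddMonoidHom_apply] at h1 h2
  rw [smul_add, ← h1]
  congr 1
  · refine Tup.hsum_congr (fun zs => ?_) xs
    exact R.pAct_swap D zs _ hia hib
  simp only [Tup.hsum, Tup.mapL_cons, smul_add]
  rw [← h2, ← add_assoc, ← add_assoc]
  congr 1
  swap
  · refine Tup.hsum_congr (fun zs => ?_) ys
    exact R.pAct_swap D _ zs (cmpI_mem R hR hR₀ _ _ _ (DGMod.ε_mem _ ha))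
      (cmpI_mem R hR hR₀ _ _ _ (DGMod.ε_mem _ hb))
  -- what remains are the terms with `s` at one of the two swapped entries; they are compared by
  -- evaluating `p d act = 0` on the tuple with `s a` and `s b`
  set pre := Tup.mapL j xs.twist
  have hpre : pre.Closed := Tup.closed_mapL (d_cmpI R hR₀) _
  have hml := (R.pAct_ml D (l ++ D₁ :: D₂ :: r)).prefix pre
  have hd := Tup.dsum_prefix_eq_zero (R.pAct_ml D (l ++ D₁ :: D₂ :: r)) (hR.dsum_pAct D) hpre
    (.cons (s D₁ a) (.cons (s D₂ b) (Tup.mapL R.i ys)))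
  simp only [Tup.dsum] at hd
  rw [Tup.dsum_of_closed ((hml.2 _).2 _) (Tup.closed_mapL hR.d_i _), add_zero,
    d_cmpS R hR hR₀, d_cmpS R hR hR₀, DGMod.ε_of_mem _ hsa] at hd
  have e2 := R.pAct_swap D pre (Tup.mapL R.i ys) hsb hia
  have e3 := R.pAct_swap D pre (Tup.mapL R.i ys) hjb hsa
  rw [DGMod.ε_of_mem _ ha, DGMod.ε_of_mem _ hb]
  obtain ⟨β, hβ⟩ : ∃ β : F.obj D₁ →ₗ[𝕜] F.obj D₂ →ₗ[𝕜] B D, ∀ u v,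
      R.pAct D (pre.append (.cons u (.cons v (Tup.mapL R.i ys)))) = β u v :=
    ⟨LinearMap.mk₂ 𝕜 (fun u v => R.pAct D (pre.append (.cons u (.cons v (Tup.mapL R.i ys)))))
      (fun u v w => map_add (hml.head _) u v) (fun c u w => map_smul (hml.head _) c u)
      (fun u v w => map_add ((hml.2 u).head _) v w)
      (fun c u w => map_smul ((hml.2 u).head _) c w), fun _ _ => rfl⟩
  obtain ⟨β', hβ'⟩ : ∃ β' : F.obj D₂ →ₗ[𝕜] F.obj D₁ →ₗ[𝕜] B D, ∀ u v,
      R.pAct D (pre.append (.cons u (.cons v (Tup.mapL R.i ys)))) = β' u v :=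
    have hml' := (R.pAct_ml D (l ++ D₂ :: D₁ :: r)).prefix pre
    ⟨LinearMap.mk₂ 𝕜 (fun u v => R.pAct D (pre.append (.cons u (.cons v (Tup.mapL R.i ys)))))
      (fun u v w => map_add (hml'.head _) u v) (fun c u w => map_smul (hml'.head _) c u)
      (fun u v w => map_add ((hml'.2 u).head _) v w)
      (fun c u w => map_smul ((hml'.2 u).head _) c w), fun _ _ => rfl⟩
  rw [hβ, hβ'] at e2 e3
  rw [hβ, hβ, hβ', hβ']
  rw [hβ, hβ] at hd
  simp only [map_smul, LinearMap.smul_apply, map_sub, LinearMap.sub_apply, e2, e3, smul_smul,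
    ← zpow_add₀ (show (-1 : 𝕜) ≠ 0 by simp)] at hd ⊢
  rw [neg_one_zpow_congr (b := p) (a := p * q + (q - 1) * p) ⟨p * q - p, by ring⟩,
    neg_one_zpow_congr (b := 0) (a := p * q + (q + q * (p - 1))) ⟨p * q, by ring⟩, zpow_zero]
  have hp : (-1 : 𝕜) ^ p * (-1) ^ p = 1 := by
    rw [← zpow_add₀ (by simp), neg_one_zpow_congr (b := 0) ⟨p, by ring⟩, zpow_zero]
  rw [zpow_sub₀ (by simp), zpow_one, div_neg, div_one] at hd
  -- the signs left depend on the parity of `p` only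
  rcases mul_self_eq_one_iff.1 hp with hp | hp <;> rw [hp] at hd ⊢
  · linear_combination (norm := module) hd
  · linear_combination (norm := module) -hd

omit hR in
theorem cmp_ml (D : Disk m) (Ds : List (Disk m)) : Tup.ML 𝕜 fun xs : Tup B Ds =>
    R.p D (R₀.h D (F.act D (Tup.mapL (cmpI R R₀) xs))) +
      Tup.hsum R.i (cmpI R R₀) (cmpS R R₀) (fun ys => R.pAct D ys) xs :=
  (((F.act_ml D Ds).compMap (cmpI R R₀)).comp (R.p D ∘ₗ R₀.h D)).add
    (Tup.ML.hsum (R.pAct_ml D Ds))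

/-- The primitive of the Massey cocycle of `R`: the comparison of the homotopies `h` and `h₀` of two
retracts on products of cocycles. -/
def cmpCochain : ZeroCochain B where
  toFun D xs := R.p D (R₀.h D (F.act D (Tup.mapL (cmpI R R₀) xs))) +
    Tup.hsum R.i (cmpI R R₀) (cmpS R R₀) (fun ys => R.pAct D ys) xs
  map_add {l r D'} D xs a b ys := map_add ((cmp_ml R hR₀ D (l ++ D' :: r)).at xs ys) a b
  map_smul {l r D'} D xs c a ys := map_smul ((cmp_ml R hR₀ D (l ++ D' :: r)).at xs ys) c a
  mem D xs n hx := by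
    refine Submodule.add_mem _ (hR.p_mem D _ _ (hR₀.h_mem D _ _ (F.act_mem D _ n
      (Tup.hasDeg_mapL (cmpI_mem R hR hR₀) _ _ hx)))) ?_
    simpa using Tup.hsum_mem (P := (B D).gr) 0 hR.i_mem (cmpI_mem R hR hR₀) (cmpS_mem R hR hR₀)
      (g := fun ys => R.pAct D ys) (fun ys n hy => by
        rw [add_zero]; exact hR.p_mem D _ _ (F.act_mem D ys n hy)) xs n hx
  swap D xs a b ys p q ha hb := by
    have h := F.act_swap D (Tup.mapL (cmpI R R₀) xs) _ _ (Tup.mapL (cmpI R R₀) ys) p q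
      (cmpI_mem R hR hR₀ _ _ _ ha) (cmpI_mem R hR hR₀ _ _ _ hb)
    simp only [Tup.mapL_append, Tup.mapL_cons]
    rw [h, map_smul, map_smul, hsum_swap R hR hR₀ D xs ys ha hb, smul_add]

/-- If the Massey cocycle of `R₀` vanishes, the Massey cocycle of `R` is the coboundary of
`cmpCochain`. -/
theorem beta_eq_coboundary {l r Es : List (Disk m)} (D D' : Disk m) (xs : Tup B l) (es : Tup B Es)
    (ys : Tup B r) (hD : Adm (l ++ D' :: r) D) (hE : Adm Es D')
    (h0 : R₀.beta (twoVertex D D' (Tup.mapL (fun D => R₀.p D ∘ₗ R.i D) xs)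
      (Tup.mapL (fun D => R₀.p D ∘ₗ R.i D) es) (Tup.mapL (fun D => R₀.p D ∘ₗ R.i D) ys)) = 0) :
    R.beta (twoVertex D D' xs es ys) =
      (cmpCochain R hR hR₀).toFun D (xs.twist.append (es.append ys))
      - (cmpCochain R hR hR₀).toFun D (xs.twist.append (.cons (R.act D' es) ys))
      - R.act D (xs.append (.cons ((cmpCochain R hR hR₀).toFun D' es) ys)) := by
  have hcomp : ∀ {Ds : List (Disk m)} (zs : Tup B Ds),
      Tup.mapL R₀.i (Tup.mapL (fun D => R₀.p D ∘ₗ R.i D) zs) = Tup.mapL (cmpI R R₀) zs :=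
    fun zs => Tup.mapL_mapL _ _ zs
  rw [R₀.beta_twoVertex, hcomp, hcomp, hcomp] at h0
  rw [R.beta_twoVertex]
  set j := cmpI R R₀ with hj
  set s := cmpS R R₀ with hs
  have cj : ∀ {Ds : List (Disk m)} (zs : Tup B Ds), (Tup.mapL j zs).Closed :=
    fun zs => Tup.closed_mapL (d_cmpI R hR₀) zs
  have ci : ∀ {Ds : List (Disk m)} (zs : Tup B Ds), (Tup.mapL R.i zs).Closed :=
    fun zs => Tup.closed_mapL hR.d_i zs
  have tj : ∀ {Ds : List (Disk m)} (zs : Tup B Ds), (Tup.mapL j zs).twist = Tup.mapL j zs.twist :=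
    fun zs => Tup.twist_mapL (ε_cmpI R hR hR₀) zs
  have ti : ∀ {Ds : List (Disk m)} (zs : Tup B Ds),
      (Tup.mapL R.i zs).twist = Tup.mapL R.i zs.twist := fun zs => Tup.twist_mapL hR.ε_i zs
  -- the primitives `K` and `K'` of `act (i' e) - i' μ(e)` and of `act (i e) - i μ(e)`
  set μ := R.act D' es with hμ
  set Se := Tup.hsum R.i j s (fun zs => F.act D' zs) es with hSe
  have dSe : (F.obj D').d Se = F.act D' (Tup.mapL j es) - F.act D' (Tup.mapL R.i es) := by
    rw [hSe]
    refine (Tup.hsum_comp (F.obj D').d.toAddMonoidHom _ _).symm.trans ?_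
    refine (Tup.hsum_congr (fun zs => F.act_d D' zs) _).trans ?_
    exact Tup.hsum_dsum hR.d_i (d_cmpI R hR₀) (ε_cmpI R hR hR₀) (d_cmpS R hR hR₀)
      (F.act_ml D' Es) es
  obtain ⟨K, hK⟩ : ∃ K, K = -(R₀.h D' (F.act D' (Tup.mapL j es))) := ⟨_, rfl⟩
  obtain ⟨K', hK'⟩ : ∃ K', K' = K - Se + s D' μ := ⟨_, rfl⟩
  have dact : ∀ {Ds : List (Disk m)} (E : Disk m) {zs : Tup F.obj Ds}, zs.Closed →
      (F.obj E).d (F.act E zs) = 0 := fun E zs hz =>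
    (F.act_d E zs).trans (Tup.dsum_of_closed (F.act_ml E _) hz)
  have dK : (F.obj D').d K = F.act D' (Tup.mapL j es) - j D' μ := by
    have h1 := hR₀.i_p D' _ (dact D' (cj es))
    have h2 : j D' μ = R₀.i D' (R₀.p D' (F.act D' (Tup.mapL j es))) := by
      have h3 : F.act D' (Tup.mapL R.i es) = F.act D' (Tup.mapL j es) - (F.obj D').d Se := by
        rw [dSe, sub_sub_cancel]
      rw [hj, cmpI, LinearMap.comp_apply, LinearMap.comp_apply, hμ, R.act_eq, pAct,
        hR.i_p D' _ (dact D' (ci es)), h3]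
      simp only [map_add, map_sub, hR₀.p_d, sub_zero, add_zero]
      rfl
    rw [h2, h1, hK, map_neg, sub_add_cancel_left]
  have dK' : (F.obj D').d K' = F.act D' (Tup.mapL R.i es) - R.i D' μ := by
    rw [hK', map_add, map_sub, dK, dSe, d_cmpS R hR hR₀]
    abel
  -- the contribution of `h₀`
  have e1 : R.p D (R₀.h D (F.act D (Tup.mapL j (xs.twist.append (es.append ys))))) -
      R.p D (R₀.h D (F.act D (Tup.mapL j (xs.twist.append (.cons μ ys))))) =
      -R.pAct D (HL.append (Tup.mapL j xs) (.cons K (Tup.mapL j ys))) := by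
    set y := F.act D (HL.append (Tup.mapL j xs) (.cons K (Tup.mapL j ys))) with hy
    have hp0 : R₀.p D y = 0 := by
      have := map_neg ((R₀.pAct_ml D (l ++ D' :: r)).at (Tup.mapL j xs) (Tup.mapL j ys))
        (R₀.h D' (F.act D' (Tup.mapL j es)))
      rw [Tup.ML.at_apply, Tup.ML.at_apply, h0, neg_zero, ← hK] at this
      exact this
    have hdy : (F.obj D).d y = F.act D (Tup.mapL j (xs.twist.append (es.append ys))) -
        F.act D (Tup.mapL j (xs.twist.append (.cons μ ys))) := by
      rw [hy, F.act_d, Tup.dsum_middle (F.act_ml D _) (cj _) _ (cj _), dK, tj]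
      refine (map_sub ((F.act_ml D (l ++ D' :: r)).at (Tup.mapL j xs.twist) (Tup.mapL j ys))
        _ _).trans ?_
      rw [Tup.ML.at_apply, Tup.ML.at_apply, F.act_act D _ _ _ hD hE, Tup.mapL_append,
        Tup.mapL_append, Tup.mapL_append, Tup.mapL_cons]
    have h := congrArg (R.p D) (hR₀.homotopy D y)
    rw [hp0, map_zero, zero_sub, map_add, hR.p_d, zero_add, hdy, map_sub, map_sub, map_neg] at h
    exact h
  -- the functional `p ∘ act` with all entries but one fixed
  have ml := R.pAct_ml D (l ++ D' :: r)
  set G : Tup B l → F.obj D' → Tup B r → B D := fun xs a ys =>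
    R.pAct D (HL.append (Tup.mapL j xs) (.cons a (Tup.mapL R.i ys))) with hG
  have Gsub : ∀ a b, R.pAct D (HL.append (Tup.mapL j xs) (.cons (a - b) (Tup.mapL R.i ys))) =
      R.pAct D (HL.append (Tup.mapL j xs) (.cons a (Tup.mapL R.i ys))) -
      R.pAct D (HL.append (Tup.mapL j xs) (.cons b (Tup.mapL R.i ys))) := fun a b =>
    map_sub (ml.at (Tup.mapL j xs) (Tup.mapL R.i ys)) a b
  -- interpolation on the left factors
  have e2 : Tup.hsum R.i j s (fun zs : Tup F.obj l => R.pAct D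
        (zs.append (.cons ((F.obj D').d K') (Tup.mapL R.i ys)))) xs.twist =
      R.pAct D (HL.append (Tup.mapL j xs) (.cons K' (Tup.mapL R.i ys))) -
      R.pAct D (HL.append (Tup.mapL R.i xs) (.cons K' (Tup.mapL R.i ys))) := by
    have h1 := Tup.hsum_dsum hR.d_i (d_cmpI R hR₀) (ε_cmpI R hR hR₀) (d_cmpS R hR hR₀)
      (ml.suffix (.cons K' (Tup.mapL R.i ys))) xs
    rw [← h1, ← neg_neg (Tup.hsum R.i j s (fun zs : Tup F.obj l => R.pAct D
        (zs.append (.cons ((F.obj D').d K') (Tup.mapL R.i ys)))) xs.twist),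
      ← Tup.hsum_twist hR.ε_i (ε_cmpI R hR hR₀) (ε_cmpS R hR hR₀) (ml.suffix _),
      ← Tup.hsum_neg]
    refine Tup.hsum_congr (fun zs => ?_) xs
    have h2 := hR.dsum_pAct D (zs.append (.cons K' (Tup.mapL R.i ys)))
    rw [Tup.dsum_append] at h2
    simp only [Tup.dsum] at h2
    rw [Tup.dsum_of_closed ((ml.prefix _).2 _) (ci ys), add_zero] at h2
    exact (eq_neg_of_add_eq_zero_left h2).symm
  -- interpolation on the right factors
  have e3 : Tup.hsum R.i j s (fun zs : Tup F.obj r => R.pAct D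
        (HL.append (Tup.mapL j xs) (.cons ((F.obj D').ε ((F.obj D').d K)) zs))) ys =
      R.pAct D (HL.append (Tup.mapL j xs) (.cons K (Tup.mapL j ys))) -
      R.pAct D (HL.append (Tup.mapL j xs) (.cons K (Tup.mapL R.i ys))) := by
    have h1 := Tup.hsum_dsum hR.d_i (d_cmpI R hR₀) (ε_cmpI R hR hR₀) (d_cmpS R hR hR₀)
      ((ml.prefix (Tup.mapL j xs)).2 K) ys
    rw [← h1]
    refine Tup.hsum_congr (fun zs => ?_) ys
    have h2 := Tup.dsum_prefix_eq_zero ml (hR.dsum_pAct D) (cj xs)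
      (.cons ((F.obj D').ε K) zs)
    simp only [Tup.dsum, DGMod.ε_ε, DGMod.d_ε] at h2
    have h3 := map_neg (ml.at (Tup.mapL j xs) zs) ((F.obj D').ε ((F.obj D').d K))
    rw [Tup.ML.at_apply, Tup.ML.at_apply] at h3
    rw [h3, neg_add_eq_zero] at h2
    exact h2
  -- the difference of the interpolations
  have e4 : Tup.hsum R.i j s (fun zs => R.pAct D zs) (xs.twist.append (es.append ys)) -
      Tup.hsum R.i j s (fun zs => R.pAct D zs) (xs.twist.append (.cons μ ys)) =
      R.pAct D (HL.append (Tup.mapL j xs) (.cons K (Tup.mapL j ys))) -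
      R.pAct D (HL.append (Tup.mapL R.i xs) (.cons K' (Tup.mapL R.i ys))) := by
    rw [Tup.hsum_append, Tup.hsum_append, Tup.hsum_append, Tup.twist_twist]
    have h1 : Tup.hsum R.i j s (fun zs : Tup F.obj l => R.pAct D
          (zs.append (Tup.mapL R.i (es.append ys)))) xs.twist -
        Tup.hsum R.i j s (fun zs : Tup F.obj l => R.pAct D
          (zs.append (Tup.mapL R.i (.cons μ ys)))) xs.twist =
        Tup.hsum R.i j s (fun zs : Tup F.obj l => R.pAct D
          (zs.append (.cons ((F.obj D').d K') (Tup.mapL R.i ys)))) xs.twist := by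
      rw [← Tup.hsum_sub]
      refine Tup.hsum_congr (fun zs => ?_) _
      have h := map_sub (ml.at zs (Tup.mapL R.i ys)) (F.act D' (Tup.mapL R.i es)) (R.i D' μ)
      simp only [Tup.ML.at_apply] at h
      rw [dK', h, R.pAct_act _ _ _ hD hE, Tup.mapL_append, Tup.mapL_cons]
    have h2 : Tup.hsum R.i j s (fun zs : Tup F.obj Es => R.pAct D
          (HL.append (Tup.mapL j xs) (HL.append zs (Tup.mapL R.i ys)))) es =
        R.pAct D (HL.append (Tup.mapL j xs) (.cons Se (Tup.mapL R.i ys))) := by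
      have h := Tup.hsum_comp (i := R.i) (i' := j) (s := s)
        (ml.at (Tup.mapL j xs) (Tup.mapL R.i ys)).toAddMonoidHom (fun zs => F.act D' zs) es
      refine Eq.trans (Tup.hsum_congr (fun zs => ?_) _) h
      exact (R.pAct_act _ _ _ hD hE).symm
    have h3 : Tup.hsum R.i j s (fun zs : Tup F.obj r => R.pAct D
          (HL.append (Tup.mapL j xs) (HL.append (Tup.mapL j es.twist) zs))) ys -
        Tup.hsum R.i j s (fun zs : Tup F.obj r => R.pAct D
          (HL.append (Tup.mapL j xs) (.cons (j D' ((B D').ε μ)) zs))) ys =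
        Tup.hsum R.i j s (fun zs : Tup F.obj r => R.pAct D
          (HL.append (Tup.mapL j xs) (.cons ((F.obj D').ε ((F.obj D').d K)) zs))) ys := by
      rw [← Tup.hsum_sub]
      refine Tup.hsum_congr (fun zs => ?_) _
      have h := map_sub (ml.at (Tup.mapL j xs) zs) (F.act D' (Tup.mapL j es.twist))
        (j D' ((B D').ε μ))
      simp only [Tup.ML.at_apply] at h
      rw [dK, map_sub, F.ε_act, tj, hj, ε_cmpI R hR hR₀, ← hj, h, R.pAct_act _ _ _ hD hE]
    simp only [Tup.hsum]
    have h5 : Se - s D' μ = K - K' := by rw [hK']; abel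
    have h6 := Gsub Se (s D' μ)
    rw [h5, Gsub] at h6
    rw [h2]
    linear_combination (norm := module) h1 + h3 + e2 + e3 - h6
  -- the value of the cochain at the inner vertex
  obtain ⟨K₁, hK₁⟩ : ∃ K₁, K₁ = -(R.h D' (F.act D' (Tup.mapL R.i es))) := ⟨_, rfl⟩
  have dK₁ : (F.obj D').d K₁ = F.act D' (Tup.mapL R.i es) - R.i D' μ := by
    have h1 := hR.i_p D' _ (dact D' (ci es))
    rw [hK₁, map_neg, hμ, R.act_eq, pAct, h1, sub_add_cancel_left]
  have hχ : (cmpCochain R hR hR₀).toFun D' es = -R.p D' (K' - K₁) := by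
    have h1 : Tup.hsum R.i j s (fun zs => R.pAct D' zs) es = R.p D' Se :=
      Tup.hsum_comp (R.p D').toAddMonoidHom (fun zs => F.act D' zs) es
    have h2 : (cmpCochain R hR hR₀).toFun D' es = R.p D' (R₀.h D' (F.act D' (Tup.mapL j es))) +
      Tup.hsum R.i j s (fun zs => R.pAct D' zs) es := rfl
    rw [h2, h1, hK', hK₁, hK]
    simp only [map_sub, map_add, map_neg, hs, p_cmpS R hR, hR.p_h]
    abel
  have hiχ : R.i D' ((cmpCochain R hR hR₀).toFun D' es) =
      (K₁ - K') - (F.obj D').d (R.h D' (K' - K₁)) := by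
    rw [hχ, map_neg, hR.i_p D' _ (by rw [map_sub, dK', dK₁, sub_self])]
    abel
  have e5 : R.act D (xs.append (.cons ((cmpCochain R hR hR₀).toFun D' es) ys)) =
      -R.pAct D (HL.append (Tup.mapL R.i xs)
        (.cons (R.h D' (F.act D' (Tup.mapL R.i es))) (Tup.mapL R.i ys))) -
      R.pAct D (HL.append (Tup.mapL R.i xs) (.cons K' (Tup.mapL R.i ys))) := by
    rw [R.act_eq, Tup.mapL_append, Tup.mapL_cons, hiχ,
      ← sub_zero (-R.pAct D _ - _), ← hR.pAct_exact D (ci xs) (R.h D' (K' - K₁)) (ci ys), hK₁]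
    have hat := ml.at_apply (Tup.mapL R.i xs) (Tup.mapL R.i ys)
    simp only [← hat, map_sub, map_neg]
  have hval : ∀ zs : Tup B (l ++ (Es ++ r)), (cmpCochain R hR hR₀).toFun D zs =
    R.p D (R₀.h D (F.act D (Tup.mapL j zs))) +
      Tup.hsum R.i j s (fun ys => R.pAct D ys) zs := fun _ => rfl
  have hval' : ∀ zs : Tup B (l ++ D' :: r), (cmpCochain R hR hR₀).toFun D zs =
    R.p D (R₀.h D (F.act D (Tup.mapL j zs))) +
      Tup.hsum R.i j s (fun ys => R.pAct D ys) zs := fun _ => rfl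
  rw [e5, hval, hval']
  linear_combination (norm := module) -e1 - e4

end IsSDR

omit hR in
/-- The universal first-order Massey product is trivial as soon as the Massey cocycle of one strong
deformation retract vanishes. -/
theorem massey_trivial {B₀ : Fam.{u} m 𝕜} {R₀ : Retract B₀ F} (hR₀ : R₀.IsSDR)
    (h : ∀ (D : Disk m) (x : DTr B₀ D), x.Valid → x.verts = 2 → R₀.beta x = 0) :
    MasseyTrivial F := by
  intro B R hR
  refine ⟨IsSDR.cmpCochain R hR hR₀, fun D D' xs es ys hv => ?_⟩
  obtain ⟨h1, h2, h3, h4⟩ := valid_twoVertex.1 hv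
  refine IsSDR.beta_eq_coboundary R hR hR₀ D D' xs es ys h1 h3 (h _ _ ?_ ?_)
  · exact valid_twoVertex.2 ⟨h1, h2, h3, h4⟩
  · exact verts_twoVertex _ _ _ _ _

end Retract
end Transfer

/-! ### Formality from vanishing transferred operations -/

section Formality

variable {𝕜 : Type} [Field 𝕜] {m : ℕ} {B : Fam.{u} m 𝕜} {F : PFA.{u} m 𝕜}

namespace Retract

variable {R : Retract B F} (hR : R.IsSDR)

namespace IsSDR

include hR

/-- The strict structure maps on cohomology may be computed with any cocycle representing one of the
entries. -/
theorem act_eq_of_eq_i (D : Disk m) {l r : List (Disk m)} {D' : Disk m} (xs : Tup B l)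
    {z : F.obj D'} (hz : (F.obj D').d z = 0) (ys : Tup B r) :
    R.act D (xs.append (.cons (R.p D' z) ys)) =
      R.pAct D (HL.append (Tup.mapL R.i xs) (.cons z (Tup.mapL R.i ys))) := by
  have hi : ∀ {Ds : List (Disk m)} (zs : Tup B Ds),
      Tup.mapL (fun D => R.i D ∘ₗ R.p D) (Tup.mapL R.i zs) = Tup.mapL R.i zs := fun zs => by
    rw [Tup.mapL_mapL]
    refine Tup.mapL_congr (fun D x => ?_) zs
    simp only [LinearMap.comp_apply, hR.p_i]
  rw [R.act_eq, ← hR.pAct_ip D ((Tup.closed_mapL hR.d_i xs).append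
    (.cons hz (Tup.closed_mapL hR.d_i ys))), Tup.mapL_append, Tup.mapL_append, Tup.mapL_cons,
    Tup.mapL_cons, hi, hi]
  rfl

/-- The cohomology with its induced strict structure maps. -/
abbrev cohomology : PFA.{u} m 𝕜 where
  obj := B
  act D xs := R.act D xs
  act_not_adm D xs h := by
    rw [R.act_eq, pAct, F.act_not_adm D _ h, map_zero]
  act_add D xs a b ys := by
    simp only [R.act_eq, Tup.mapL_append, Tup.mapL_cons, map_add, pAct, F.act_add]
  act_smul D xs c a ys := by
    simp only [R.act_eq, Tup.mapL_append, Tup.mapL_cons, map_smul, pAct, F.act_smul]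
  act_mem D xs n h := by
    rw [R.act_eq]
    exact hR.p_mem D n _ (F.act_mem D _ n (Tup.hasDeg_mapL hR.i_mem _ _ h))
  act_d {Ds} D xs := by
    rw [hR.d_zero]
    have h : ∀ {Es : List (Disk m)} (zs : Tup B Es), zs.Closed := fun zs => by
      induction zs with
      | nil => trivial
      | cons z zs ih => exact .cons (hR.d_zero _ _) ih
    have hml : Tup.ML 𝕜 fun ys : Tup B Ds => R.act D ys := by
      simp only [R.act_eq]
      exact (R.pAct_ml D Ds).compMap R.i
    exact (Tup.dsum_of_closed hml (h xs)).symm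
  act_one {D} x := by
    rw [R.act_eq]
    exact (congrArg (R.p D) (F.act_one _)).trans (hR.p_i D x)
  act_act {l r Es D'} D xs es ys h h' := by
    have hc : (F.obj D').d (F.act D' (Tup.mapL R.i es)) = 0 :=
      (F.act_d D' _).trans (Tup.dsum_of_closed (F.act_ml D' _) (Tup.closed_mapL hR.d_i es))
    rw [R.act_eq D' es, pAct, hR.act_eq_of_eq_i D xs hc ys, R.pAct_act _ _ _ h h', R.act_eq,
      Tup.mapL_append, Tup.mapL_append]
  act_swap D xs a b ys p q ha hb := by
    simp only [R.act_eq, Tup.mapL_append, Tup.mapL_cons]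
    exact R.pAct_swap D _ _ (hR.i_mem _ _ _ ha) (hR.i_mem _ _ _ hb)

/-- The projections identify the cohomology of `F`, with the structure maps induced by those of
`F` on cocycles, with `cohomology`. -/
theorem isCohomology : IsCohomology hR.cohomology F := by
  refine ⟨fun D => R.p D ∘ₗ (LinearMap.ker (F.obj D).d).subtype, fun D => ?_, fun D b => ?_,
    fun D z => ?_, fun D n z hz => hR.p_mem D n _ hz, ?_⟩
  · exact LinearMap.ext fun b => hR.d_zero D b
  · exact ⟨⟨R.i D b, hR.d_i D b⟩, hR.p_i D b⟩
  · have hz : (F.obj D).d z.1 = 0 := z.2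
    have h := hR.i_p D z.1 hz
    change R.p D z.1 = 0 ↔ _
    constructor
    · intro h0
      rw [h0, map_zero] at h
      exact ⟨-R.h D z.1, by rw [map_neg]; exact (eq_neg_of_add_eq_zero_left h.symm).symm⟩
    · rintro ⟨b, hb⟩
      rw [← hb, hR.p_d]
  · intro Ds D zs y hy
    have h1 : ∀ {Es : List (Disk m)} (ws : HL (fun D => LinearMap.ker (F.obj D).d) Es),
        Tup.Closed (A := F.obj) (ws.map (A' := fun D => (F.obj D).carrier) fun _ z => z.1) ∧
        Tup.mapL R.i (ws.map (A' := fun D => (B D).carrier) fun D z =>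
          (R.p D ∘ₗ (LinearMap.ker (F.obj D).d).subtype) z) =
        Tup.mapL (A := F.obj) (fun D => R.i D ∘ₗ R.p D)
          (ws.map (A' := fun D => (F.obj D).carrier) fun _ z => z.1) := by
      intro Es ws
      induction ws with
      | nil => exact ⟨trivial, rfl⟩
      | cons w ws ih =>
        refine ⟨.cons w.2 ih.1, ?_⟩
        simp only [HL.map, Tup.mapL_cons, ih.2]
        rfl
    have h2 := R.act_eq D (zs.map (A' := fun D => (B D).carrier) fun D z =>
          (R.p D ∘ₗ (LinearMap.ker (F.obj D).d).subtype) z)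
    rw [(h1 zs).2, hR.pAct_ip D (h1 zs).1] at h2
    exact h2.trans (congrArg (R.p D) hy).symm

end IsSDR

/-! The functional calculus of the ∞-quasi-isomorphism `ev`. -/

variable (R)

theorem eval_ev {Ds : List (Disk m)} (xs : DFo B Ds) :
    xs.eval (A' := fun D => (F.obj D).carrier) (fun _ => R.ev) = R.evs xs := by
  match xs with
  | .nil => rfl
  | .cons x xs => exact congrArg (HL.cons (R.ev x)) (eval_ev xs)

mutual
theorem ev_lin (c : 𝕜) {D : Disk m} (x y z : DTr B D) (h : DTr.Lin c x y z) :
    R.ev z = R.ev x + c • R.ev y := by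
  match D, x, y, z, h with
  | _, _, _, _, .leaf a b => exact (map_add (R.i _) _ _).trans (congrArg _ (map_smul (R.i _) _ _))
  | _, _, _, _, .node D h =>
    exact evs_lin c _ _ _ h (fun xs => R.h D (F.act D xs)) ((F.act_ml D _).comp (R.h D))
theorem evs_lin (c : 𝕜) {Ds : List (Disk m)} (xs ys zs : DFo B Ds) (h : DFo.Lin c xs ys zs)
    {M : Type u} [AddCommGroup M] [Module 𝕜 M] (g : Tup F.obj Ds → M) (hg : Tup.ML 𝕜 g) :
    g (R.evs zs) = g (R.evs xs) + c • g (R.evs ys) := by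
  match Ds, xs, ys, zs, h with
  | _, _, _, _, .head (x := x) (y := y) (z := z) xs h =>
    have := ev_lin c x y z h
    simp only [evs]
    rw [this, hg.1]
  | _, _, _, _, .tail (xs := xs) (ys := ys) (zs := zs) x h =>
    exact evs_lin c xs ys zs h (fun xs => g (.cons (R.ev x) xs)) (hg.2 _)
end

mutual
theorem ev_mem (hR : R.IsSDR) {D : Disk m} (x : DTr B D) (n : ℤ) (h : DTr.HasDeg x n) :
    R.ev x ∈ (F.obj D).gr n := by
  match D, x with
  | _, .leaf b => exact hR.i_mem _ _ _ h
  | _, .node D xs =>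
    have := hR.h_mem D _ _ (F.act_mem D _ _ (evs_mem hR xs (n + 1) h))
    rwa [add_sub_cancel_right] at this
theorem evs_mem (hR : R.IsSDR) {Ds : List (Disk m)} (xs : DFo B Ds) (n : ℤ)
    (h : DFo.HasDeg xs n) : Tup.HasDeg (R.evs xs) n := by
  match Ds, xs with
  | _, .nil => exact h
  | _, .cons x xs =>
    obtain ⟨p, q, rfl, hp, hq⟩ := h
    exact ⟨p, q, rfl, ev_mem hR x p hp, evs_mem hR xs q hq⟩
end

mutual
theorem ev_swap (hR : R.IsSDR) (s : ℤ) {D : Disk m} (x x' : DTr B D) (h : DTr.Swap s x x') :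
    R.ev x = (-1 : 𝕜) ^ s • R.ev x' := by
  match D, x, x', h with
  | _, _, _, .node D h =>
    refine evs_swap hR s _ _ h (fun _ xs => R.h D (F.act D xs))
      (fun Ds => (F.act_ml D Ds).comp (R.h D)) fun xs a b ys p q ha hb => ?_
    rw [F.act_swap D xs a b ys p q ha hb, map_smul]
theorem evs_swap (hR : R.IsSDR) (s : ℤ) {Ds Ds' : List (Disk m)} (xs : DFo B Ds) (xs' : DFo B Ds')
    (h : DFo.Swap s xs xs') {M : Type u} [AddCommGroup M] [Module 𝕜 M]
    (g : ∀ Ds : List (Disk m), Tup F.obj Ds → M) (hg : ∀ Ds, Tup.ML 𝕜 (g Ds))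
    (hs : ∀ {l r : List (Disk m)} {D₁ D₂ : Disk m} (xs : Tup F.obj l)
      (a : F.obj D₁) (b : F.obj D₂) (ys : Tup F.obj r) (p q : ℤ), a ∈ (F.obj D₁).gr p →
      b ∈ (F.obj D₂).gr q → g _ (xs.append (.cons a (.cons b ys))) =
        (-1 : 𝕜) ^ (p * q) • g _ (xs.append (.cons b (.cons a ys)))) :
    g _ (R.evs xs) = (-1 : 𝕜) ^ s • g _ (R.evs xs') := by
  match Ds, Ds', xs, xs', h with
  | _, _, _, _, .here x y xs p q hp hq hs' =>
    rw [hs']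
    exact hs .nil _ _ _ p q (ev_mem R hR x p hp) (ev_mem R hR y q hq)
  | _, _, _, _, .head (x := x) (x' := x') xs h =>
    have := ev_swap hR s x x' h
    simp only [evs]
    rw [this, ← (hg _).head_apply, map_smul]
    rfl
  | D :: _, _, _, _, .tail (xs := xs) (xs' := xs') x h =>
    exact evs_swap hR s xs xs' h (fun Ds xs => g _ (.cons (R.ev x) xs))
      (fun Ds => (hg (D :: Ds)).2 _)
      fun xs => hs (.cons (R.ev x) xs)
end

mutual
theorem ε_ev (hR : R.IsSDR) {D : Disk m} (x : DTr B D) :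
    (F.obj D).ε (R.ev x) = (-1 : 𝕜) ^ x.verts • R.ev (DTr.twist x) := by
  match D, x with
  | D, .leaf b =>
    change (F.obj D).ε (R.i D b) = (-1 : 𝕜) ^ 0 • R.i D ((B D).ε b)
    rw [pow_zero, one_smul, hR.ε_i]
  | _, .node D xs =>
    have := ε_evs hR xs (fun zs => R.h D (F.act D zs)) ((F.act_ml D _).comp (R.h D))
    refine (hR.ε_h D _).trans ?_
    rw [F.ε_act, this, ← neg_one_smul 𝕜, smul_smul]
    congr 1
    exact (pow_succ' (-1 : 𝕜) _).symm
theorem ε_evs (hR : R.IsSDR) {Ds : List (Disk m)} (xs : DFo B Ds)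
    {M : Type u} [AddCommGroup M] [Module 𝕜 M] (g : Tup F.obj Ds → M) (hg : Tup.ML 𝕜 g) :
    g (R.evs xs).twist = (-1 : 𝕜) ^ xs.verts • g (R.evs (Fo.map (fun D => (B D).ε) xs)) := by
  match Ds, xs with
  | _, .nil => exact (one_smul 𝕜 _).symm.trans (congrArg (· • _) (pow_zero _).symm)
  | _, .cons x xs =>
    have h1 := ε_ev hR x
    have h2 := ε_evs hR xs (fun zs => g (.cons (R.ev (DTr.twist x)) zs)) (hg.2 _)
    simp only [evs, Tup.twist_cons]
    rw [h1, ← hg.head_apply, map_smul, hg.head_apply, h2, smul_smul, ← pow_add]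
    rfl
end

/-- The functional `∑ ± g (ev x_1, …, act (ev (children of x_j)), …, ev x_n)`. -/
def rsum {M : Type u} [AddCommGroup M] [Module 𝕜 M] :
    {Ds : List (Disk m)} → (Tup F.obj Ds → M) → DFo B Ds → M
  | _, _, .nil => 0
  | _, g, .cons x xs => g (.cons (rootAct F (fun _ => R.ev) x) (R.evs xs)) +
      (-1 : 𝕜) ^ x.verts • rsum (fun ys => g (.cons (R.ev (DTr.twist x)) ys)) xs

theorem evs_append' {l r : List (Disk m)} (xs : DFo B l) (ys : DFo B r) :
    R.evs (xs.append ys) = HL.append (R.evs xs) (R.evs ys) := by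
  match l, xs with
  | _, .nil => rfl
  | _, .cons x xs => exact congrArg (HL.cons (R.ev x)) (evs_append' xs ys)

/-- Splicing out a child of the root corresponds under `ev` to composing structure maps, by
associativity of the functional `g`. -/
theorem splice_eq (hR : R.IsSDR) {M : Type u} [AddCommGroup M] [Module 𝕜 M] {Ds : List (Disk m)}
    (xs : DFo B Ds) (hxs : xs.Valid) (g : ∀ {Ds : List (Disk m)}, Tup F.obj Ds → M)
    (hml : Tup.ML 𝕜 (g (Ds := Ds)))
    (hg : ∀ {l r Es : List (Disk m)} {D' : Disk m} (xs : Tup F.obj l)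
    (es : Tup F.obj Es) (ys : Tup F.obj r), l ++ D' :: r = Ds → Adm Es D' →
      g (xs.append (.cons (F.act D' es) ys)) = g (xs.append (es.append ys))) :
    splice hR.cohomology (fun ys => g (R.evs ys)) xs = R.rsum g xs := by
  match Ds, xs, hxs with
  | _, .nil, _ => rfl
  | _, .cons x xs, hx =>
    have ih := splice_eq hR xs hx.2 (fun ys => g (.cons (R.ev (DTr.twist x)) ys)) (hml.2 _)
      fun xs es ys h => hg (.cons (R.ev (DTr.twist x)) xs) es ys (congrArg _ h)
    refine congrArg₂ (· + ·) ?_ (congrArg (_ • ·) ih)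
    match x, hx with
    | .leaf a, _ => exact (map_zero (hml.head _)).symm
    | .node D ys, hx =>
      have h := hg .nil (R.evs ys) (R.evs xs) rfl hx.1.1
      change g (R.evs (ys.append xs)) = g (.cons (F.act D (ys.eval _)) (R.evs xs))
      rw [evs_append', eval_ev]
      exact h.symm

theorem vals_eq_some {Ds : List (Disk m)} (xs : DFo B Ds) {as : Tup B Ds} (h : xs.vals = some as) :
    xs = Fo.leaves as := by
  match Ds, xs with
  | _, .nil => cases as; rfl
  | _, .cons (.leaf a) xs =>
    obtain ⟨bs, hb, rfl⟩ := Option.map_eq_some_iff.1 h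
    exact congrArg (Fo.cons (.leaf a)) (vals_eq_some xs hb)
  | _, .cons (.node _ _) xs => exact absurd h (by simp [Fo.vals])

theorem verts_pos_of_vals {Ds : List (Disk m)} (xs : DFo B Ds) (h : xs.vals = none) :
    1 ≤ xs.verts := by
  match Ds, xs with
  | _, .nil => exact absurd h (by simp [Fo.vals])
  | _, .cons (.leaf a) xs =>
    have := verts_pos_of_vals xs (Option.map_eq_none_iff.1 h)
    exact this.trans (Nat.le_add_left _ _)
  | _, .cons (.node _ _) xs => exact (Nat.le_add_left 1 _).trans (Nat.le_add_right _ _)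

mutual
/-- The Maurer–Cartan equation for `ev`, composed with a linear map `g`: if all transferred
operations with more than one vertex vanish, the codifferential of the cohomology corresponds
under `ev` to the differential of `ev x` plus the structure map applied at the root. Removing one
internal edge from a tree matches the homotopy relation `d h = i p - id - h d` at its root. -/
theorem codiff_eq (hR : R.IsSDR)
    (hβ : ∀ (D : Disk m) (x : DTr B D), x.Valid → 2 ≤ x.verts → R.beta x = 0)
    {D : Disk m} (x : DTr B D) (hx : x.Valid) {M : Type u} [AddCommGroup M] [Module 𝕜 M]
    (g : F.obj D →ₗ[𝕜] M) : codiff hR.cohomology (fun y => g (R.ev y)) x =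
      g ((F.obj D).d (R.ev x) + rootAct F (fun _ => R.ev) x) := by
  match D, x, hx with
  | _, .leaf a, _ =>
    have h1 : codiff hR.cohomology (fun y => g (R.ev y)) (.leaf a) =
      g (R.i _ ((B _).d a)) := rfl
    have h2 : (F.obj _).d (R.ev (.leaf a)) + rootAct F (fun _ => R.ev) (.leaf a) =
      (F.obj _).d (R.i _ a) + 0 := rfl
    rw [h1, h2, hR.d_zero, hR.d_i, map_zero, map_zero, add_zero, map_zero]
  | _, .node (Ds := Ds) D xs, hx =>
    -- both sides are expressed through `y`, and compared by the homotopy relation for `y`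
    set y := F.act D (R.evs xs) with hy
    have hml := (F.act_ml D Ds).comp (g ∘ₗ R.h D)
    have h1 := codiffs_eq hR hβ xs hx.2.2 (fun zs => (g ∘ₗ R.h D) (F.act D zs)) hml
    have h2 := splice_eq R hR xs hx.2.2 (fun zs => (g ∘ₗ R.h D) (F.act D zs)) hml
      fun us es vs h h' => by
        subst h
        rw [F.act_act D us es vs hx.1 h']
    have h3 : Tup.dsum (fun zs => (g ∘ₗ R.h D) (F.act D zs)) (R.evs xs) =
        g (R.h D ((F.obj D).d y)) := by
      rw [hy, F.act_d]
      exact Tup.dsum_comp (g ∘ₗ R.h D).toAddMonoidHom (fun zs => F.act D zs) (R.evs xs)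
    have h5 : codiff hR.cohomology (fun y => g (R.ev y)) (.node D xs) =
      g (R.i D (R.p D y)) -
      codiffs hR.cohomology (fun ys => (g ∘ₗ R.h D) (F.act D (R.evs ys))) xs +
      splice hR.cohomology (fun ys => (g ∘ₗ R.h D) (F.act D (R.evs ys))) xs := by
      have hc : (fun ys => g (R.ev (.node (Ds := Ds) D ys))) =
        fun ys => (g ∘ₗ R.h D) (F.act D (R.evs ys)) := funext fun _ => rfl
      have hs : (fun (Ds : List (Disk m)) (ys : DFo B Ds) => g (R.ev (.node D ys))) =
          fun Ds ys => (g ∘ₗ R.h D) (F.act D (R.evs ys)) := by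
        funext Ds ys
        rfl
      rw [codiff, hc]
      refine congrArg₂ (· + ·) (congrArg (· - _) ?_)
        (congrArg (fun G : ∀ Ds : List (Disk m), DFo B Ds → M =>
        splice hR.cohomology (fun {Ds} => G Ds) xs) hs)
      -- if all children are leaves, the strict structure map appears; otherwise `p y` is the
      -- value of a transferred operation with more than one vertex
      split
      next as h =>
        have := vals_eq_some xs h
        subst this
        rfl
      next h =>
        have := hβ D (.node D xs) hx (Nat.succ_le_succ (verts_pos_of_vals xs h))
        have h4 : R.p D y = 0 := this
        rw [h4, map_zero, map_zero]
    have h6 : (F.obj D).d (R.ev (.node D xs)) + rootAct F (fun _ => R.ev) (.node D xs) =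
        (F.obj D).d (R.h D y) + y := congrArg (_ + F.act D ·) (eval_ev R xs)
    rw [h5, h1, h2, h3, h6, show (F.obj D).d (R.h D y) + y =
      R.i D (R.p D y) - R.h D ((F.obj D).d y) by rw [eq_sub_iff_add_eq, add_right_comm,
        hR.homotopy, sub_add_cancel], map_sub]
    abel
/-- The analogue of `codiff_eq` for forests inside a multilinear functional `g`. -/
theorem codiffs_eq (hR : R.IsSDR)
    (hβ : ∀ (D : Disk m) (x : DTr B D), x.Valid → 2 ≤ x.verts → R.beta x = 0)
    {Ds : List (Disk m)} (xs : DFo B Ds) (hx : xs.Valid) {M : Type u} [AddCommGroup M]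
    [Module 𝕜 M] (g : Tup F.obj Ds → M) (hg : Tup.ML 𝕜 g) :
    codiffs hR.cohomology (fun ys => g (R.evs ys)) xs =
      Tup.dsum g (R.evs xs) + R.rsum g xs := by
  match Ds, xs, hx with
  | _, .nil, _ => exact (add_zero 0).symm
  | _, .cons x xs, hx =>
    have h1 := codiff_eq hR hβ x hx.1 (hg.head (R.evs xs))
    have h2 := codiffs_eq hR hβ xs hx.2 (fun zs => g (.cons (R.ev (DTr.twist x)) zs)) (hg.2 _)
    have h3 : Tup.dsum (fun ys => g (.cons ((F.obj _).ε (R.ev x)) ys)) (R.evs xs) =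
        (-1 : 𝕜) ^ x.verts • Tup.dsum (fun ys => g (.cons (R.ev (DTr.twist x)) ys)) (R.evs xs) := by
      rw [ε_ev R hR]
      refine Eq.trans ?_ (Tup.dsum_comp (DistribSMul.toAddMonoidHom M ((-1 : 𝕜) ^ x.verts)) _ _)
      congr 1
      funext ys
      exact map_smul (hg.head ys) _ _
    have h4 : codiffs hR.cohomology (fun ys => g (R.evs ys)) (.cons x xs) =
      codiff hR.cohomology (fun y => hg.head (R.evs xs) (R.ev y)) x +
      (-1 : 𝕜) ^ x.verts • codiffs hR.cohomology
        (fun ys => g (.cons (R.ev (DTr.twist x)) (R.evs ys))) xs := rfl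
    have h5 : Tup.dsum g (R.evs (.cons x xs)) + R.rsum g (.cons x xs) =
      g (.cons ((F.obj _).d (R.ev x)) (R.evs xs)) +
      Tup.dsum (fun ys => g (.cons ((F.obj _).ε (R.ev x)) ys)) (R.evs xs) +
      (g (.cons (rootAct F (fun _ => R.ev) x) (R.evs xs)) +
      (-1 : 𝕜) ^ x.verts • R.rsum (fun ys => g (.cons (R.ev (DTr.twist x)) ys)) xs) := rfl
    rw [h4, h5, h1, h2, h3, map_add, smul_add, hg.head_apply, hg.head_apply]
    abel
end

/-- If the transferred operations of a strong deformation retract vanish on all trees with more than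
one vertex, decorating trees with `i`, the structure maps and `h` is an ∞-quasi-isomorphism from the
cohomology with its strict structure. -/
theorem formal (hR : R.IsSDR)
    (hβ : ∀ (D : Disk m) (x : DTr B D), x.Valid → 2 ≤ x.verts → R.beta x = 0) : Formal F := by
  refine ⟨hR.cohomology, hR.isCohomology, ⟨fun D x => R.ev x, ?_, ?_, ?_, ?_⟩, ?_⟩
  · exact fun c D x y z _ h => ev_lin R c x y z h
  · exact fun x n _ h => ev_mem R hR x n h
  · exact fun s D x x' _ h => ev_swap R hR s x x' h
  · exact fun {D} x hx => (codiff_eq R hR hβ x hx LinearMap.id).symm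
  · intro D
    constructor
    · rintro z - ⟨b, hb⟩
      refine ⟨0, ?_⟩
      have : R.p D (R.i D z) = 0 := by
        have hb' : (F.obj D).d b = R.i D z := hb
        rw [← hb', hR.p_d]
      exact (map_zero ((B D).d)).trans (this.symm.trans (hR.p_i D z))
    · intro w hw
      exact ⟨R.p D w, R.h D w, hR.d_zero D _, hR.i_p D w hw⟩

end Retract
end Formality

/-! ### Weight gradings and derivations of graded symmetric algebras -/

section Weight

variable {𝕜 : Type} [Field 𝕜] {W : Type u} [AddCommGroup W] [Module 𝕜 W]
  (𝒲 : ℕ → Submodule 𝕜 W)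

namespace GSym

/-- Monomials in homogeneous generators, with their total weight, where a generator of degree `r`
has weight `ρ r`. -/
inductive IsWMon (ρ : ℕ → ℤ) : ℤ → GSym 𝒲 → Prop
  | one : IsWMon ρ 0 1
  | mul {r : ℕ} {w : W} (hw : w ∈ 𝒲 r) {n : ℤ} {x : GSym 𝒲} (hx : IsWMon ρ n x) :
      IsWMon ρ (ρ r + n) (gen 𝒲 w * x)

/-- The span of the monomials of weight `n`. The degree has `ρ r = r - 1`, the word length has
`ρ r = 1`, and the codegree of forms on `ℝ^m` has `ρ r = m - r`. -/
def wt (ρ : ℕ → ℤ) (n : ℤ) : Submodule 𝕜 (GSym 𝒲) := Submodule.span 𝕜 {x | IsWMon 𝒲 ρ n x}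

variable {ρ : ℕ → ℤ}

theorem wt_cast {n n' : ℤ} (h : n = n') {x : GSym 𝒲} (hx : x ∈ wt 𝒲 ρ n) : x ∈ wt 𝒲 ρ n' := h ▸ hx

theorem one_mem_wt : (1 : GSym 𝒲) ∈ wt 𝒲 ρ 0 := Submodule.subset_span IsWMon.one

theorem gen_mul_mem_wt {r : ℕ} {w : W} (hw : w ∈ 𝒲 r) {n : ℤ} {x : GSym 𝒲} (hx : x ∈ wt 𝒲 ρ n) :
    gen 𝒲 w * x ∈ wt 𝒲 ρ (ρ r + n) := by
  have : wt 𝒲 ρ n ≤ (wt 𝒲 ρ (ρ r + n)).comap (LinearMap.mulLeft 𝕜 (gen 𝒲 w)) :=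
    Submodule.span_le.2 fun y hy => Submodule.subset_span (IsWMon.mul hw hy)
  exact this hx

theorem wt_induction {N : ℤ → Submodule 𝕜 (GSym 𝒲)} (h1 : (1 : GSym 𝒲) ∈ N 0)
    (hw : ∀ r, ∀ w ∈ 𝒲 r, ∀ n, ∀ x ∈ wt 𝒲 ρ n, x ∈ N n → gen 𝒲 w * x ∈ N (ρ r + n))
    {n : ℤ} {x : GSym 𝒲} (hx : x ∈ wt 𝒲 ρ n) : x ∈ N n := by
  have key : ∀ n y, IsWMon 𝒲 ρ n y → y ∈ N n := by
    intro n y hy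
    induction hy with
    | one => exact h1
    | mul h hm ih => exact hw _ _ h _ _ (Submodule.subset_span hm) ih
  exact (Submodule.span_le.2 (key n) : wt 𝒲 ρ n ≤ N n) hx

theorem mul_mem_wt {p q : ℤ} {x y : GSym 𝒲} (hx : x ∈ wt 𝒲 ρ p) (hy : y ∈ wt 𝒲 ρ q) :
    x * y ∈ wt 𝒲 ρ (p + q) := by
  refine wt_induction 𝒲 (N := fun n => (wt 𝒲 ρ (n + q)).comap (LinearMap.mulRight 𝕜 y)) ?_ ?_ hx
  · simpa using hy
  · intro r w hw n x _ hx
    simp only [Submodule.mem_comap, LinearMap.mulRight_apply] at hx ⊢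
    rw [mul_assoc, add_assoc]
    exact gen_mul_mem_wt 𝒲 hw hx

theorem gr_eq_wt (n : ℤ) : gr 𝒲 n = wt 𝒲 (fun r => (r : ℤ) - 1) n := by
  refine le_antisymm (fun x hx => ?_) fun x hx => ?_
  · exact gr_induction 𝒲 (one_mem_wt 𝒲) (fun r w hw n x _ hx => gen_mul_mem_wt 𝒲 hw hx) hx
  · exact wt_induction 𝒲 (one_mem 𝒲) (fun r w hw n x _ hx => gen_mul_mem 𝒲 hw hx) hx

/-- Weights outside the additive monoid generated by the weights of nonzero generators do not
occur. -/
theorem eq_zero_of_mem_wt (S : AddSubmonoid ℤ) (hS : ∀ r, ρ r ∉ S → 𝒲 r = ⊥) {n : ℤ}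
    (hn : n ∉ S) {x : GSym 𝒲} (hx : x ∈ wt 𝒲 ρ n) : x = 0 := by
  have key : ∀ n y, IsWMon 𝒲 ρ n y → n ∉ S → y = 0 := by
    intro n y hy
    induction hy with
    | one => exact fun h => absurd S.zero_mem h
    | @mul r w hw n x _ ih =>
      intro h
      by_cases hr : ρ r ∈ S
      · rw [ih fun hn => h (S.add_mem hr hn), mul_zero]
      · have : w = 0 := by simpa [hS r hr] using hw
        rw [this, map_zero, zero_mul]
  have : wt 𝒲 ρ n ≤ ⊥ := Submodule.span_le.2 fun y hy => (key n y hy hn : y = 0)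
  simpa using this hx

/-- Every element is a finite sum of elements of homogeneous weight. -/
theorem iSup_wt [DirectSum.Decomposition 𝒲] : ⨆ n, wt 𝒲 ρ n = ⊤ := by
  refine eq_top_iff.2 fun x _ => ?_
  have h : ∀ x, (⨆ n, wt 𝒲 ρ n).mkQ x = 0 :=
    ShiftedLie.eq_zero_of_gen_mul _ ?_ ?_
  · simpa using h x
  · simpa using Submodule.mem_iSup_of_mem 0 (one_mem_wt 𝒲)
  · intro r w hw x hx
    simp only [Submodule.mkQ_apply, Submodule.Quotient.mk_eq_zero] at hx ⊢
    have : ⨆ n, wt 𝒲 ρ n ≤ (⨆ n, wt 𝒲 ρ n).comap (LinearMap.mulLeft 𝕜 (gen 𝒲 w)) :=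
      iSup_le fun n y hy => Submodule.mem_iSup_of_mem _ (gen_mul_mem_wt 𝒲 hw hy)
    exact this hx

variable {W' : Type u} [AddCommGroup W'] [Module 𝕜 W'] {𝒲' : ℕ → Submodule 𝕜 W'}
  [DirectSum.Decomposition 𝒲] [DirectSum.Decomposition 𝒲']

theorem map_mem_wt {f : W →ₗ[𝕜] W'} (hf : ∀ r, ∀ w ∈ 𝒲 r, f w ∈ 𝒲' r) {n : ℤ} {x : GSym 𝒲}
    (hx : x ∈ wt 𝒲 ρ n) : map 𝒲' f hf x ∈ wt 𝒲' ρ n := by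
  refine wt_induction 𝒲 (N := fun n => (wt 𝒲' ρ n).comap (map 𝒲' f hf).toLinearMap) ?_ ?_ hx
  · simpa using one_mem_wt 𝒲'
  · intro r w hw n x _ hx
    simp only [Submodule.mem_comap, AlgHom.toLinearMap_apply, map_mul, map_gen] at hx ⊢
    exact gen_mul_mem_wt 𝒲' (hf r w hw) hx

end GSym

namespace ShiftedLie

open GSym

variable {𝒲} [DirectSum.Decomposition 𝒲] (L : ShiftedLie 𝒲) {ρ : ℕ → ℤ} {κ : ℤ}

theorem br_mem_wt (hρ : ∀ r s, ρ (r + s) = ρ r + ρ s + κ) {r : ℕ} {w : W} (hw : w ∈ 𝒲 r) {n : ℤ}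
    {x : GSym 𝒲} (hx : x ∈ wt 𝒲 ρ n) : L.br w x ∈ wt 𝒲 ρ (ρ r + n + κ) := by
  refine wt_induction 𝒲 (N := fun n => (wt 𝒲 ρ (ρ r + n + κ)).comap (L.br w)) ?_ ?_ hx
  · simp [br_one]
  · intro s v hv n x hx ih
    rw [Submodule.mem_comap, L.br_gen_mul hw hv]
    refine Submodule.add_mem _ ?_ (Submodule.smul_mem _ _ ?_)
    · exact wt_cast 𝒲 (by rw [hρ]; ring) (gen_mul_mem_wt 𝒲 (L.b_mem _ _ _ hw _ hv) hx)
    · exact wt_cast 𝒲 (by ring) (gen_mul_mem_wt 𝒲 hv ih)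

/-- The quadratic part of the differential shifts weights by `κ`. -/
theorem noδ_d_mem_wt (hρ : ∀ r s, ρ (r + s) = ρ r + ρ s + κ) {n : ℤ}
    {x : GSym 𝒲} (hx : x ∈ wt 𝒲 ρ n) : L.noδ.d x ∈ wt 𝒲 ρ (n + κ) := by
  refine wt_induction 𝒲 (N := fun n => (wt 𝒲 ρ (n + κ)).comap L.noδ.d) ?_ ?_ hx
  · simp [d_one]
  · intro s v hv n x hx ih
    rw [Submodule.mem_comap, L.noδ.d_gen_mul hv]
    refine Submodule.add_mem _ (Submodule.add_mem _ ?_ (L.noδ.br_mem_wt hρ hv hx))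
      (Submodule.smul_mem _ _ (wt_cast 𝒲 (by ring) (gen_mul_mem_wt 𝒲 hv ih)))
    have : L.noδ.δ v = 0 := rfl
    rw [this, map_zero, zero_mul]
    exact Submodule.zero_mem _

end ShiftedLie

end Weight

section Der

variable {𝕜 : Type} [Field 𝕜] {W : Type u} [AddCommGroup W] [Module 𝕜 W]
  {𝒲 : ℕ → Submodule 𝕜 W} [DirectSum.Decomposition 𝒲]

open GSym

/-- The operator `f` on generators changes the parity of degrees by `k`. -/
def HasParity (𝒲 : ℕ → Submodule 𝕜 W) (k : ℕ) (f : W →ₗ[𝕜] W) : Prop :=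
  ∀ r, ∀ w ∈ 𝒲 r, ∃ s, f w ∈ 𝒲 s ∧ Even (s + r + k)

/-- The operator `D` is the derivation of parity `k` extending the operator `f` on generators. -/
structure IsDer (𝒲 : ℕ → Submodule 𝕜 W) (k : ℕ) (f : W →ₗ[𝕜] W) (D : GSym 𝒲 →ₗ[𝕜] GSym 𝒲) :
    Prop where
  one : D 1 = 0
  gen_mul : ∀ r, ∀ w ∈ 𝒲 r, ∀ x, D (gen 𝒲 w * x) =
    gen 𝒲 (f w) * x + (-1 : 𝕜) ^ (k * (r + 1)) • (gen 𝒲 w * D x)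

theorem neg_one_pow_eq_of_even {a b : ℕ} (h : Even (a + b)) : (-1 : 𝕜) ^ a = (-1) ^ b := by
  rw [← zpow_natCast, ← zpow_natCast]
  refine neg_one_zpow_congr ?_
  have : Even ((a : ℤ) + b) := by exact_mod_cast h
  rw [Int.even_sub]
  exact Int.even_add.1 this

theorem gen_comm_of_parity {k : ℕ} {f : W →ₗ[𝕜] W} (hf : HasParity 𝒲 k f) {r s : ℕ} {v w : W}
    (hv : v ∈ 𝒲 r) (hw : w ∈ 𝒲 s) :
    gen 𝒲 (f v) * gen 𝒲 w = (-1 : 𝕜) ^ ((r + k + 1) * (s + 1)) • (gen 𝒲 w * gen 𝒲 (f v)) := by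
  obtain ⟨r', hr, he⟩ := hf r v hv
  rw [gen_comm 𝒲 hr hw, neg_one_pow_eq_of_even (𝕜 := 𝕜)]
  rw [← add_mul]
  rw [show r' + 1 + (r + k + 1) = (r' + r + k) + 2 by ring]
  exact Even.mul_right (he.add even_two) _

theorem exists_isDer {k : ℕ} {f : W →ₗ[𝕜] W} (hf : HasParity 𝒲 k f) : ∃ D, IsDer 𝒲 k f D := by
  refine (exists_rec 𝒲 (LinearMap.mul 𝕜 _ ∘ₗ gen 𝒲 ∘ₗ f)
    (LinearMap.mul 𝕜 _ ∘ₗ gen 𝒲 ∘ₗ scale 𝒲 (fun r => (-1) ^ (k * (r + 1)))) ?_ ?_).imp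
    fun D h => ⟨h.1, fun r w hw x => by simp [h.2, scale_of_mem 𝒲 _ hw]⟩
  · intro r s v hv u hu x
    simp only [LinearMap.comp_apply, scale_of_mem 𝒲 _ hv, scale_of_mem 𝒲 _ hu,
      map_smul, LinearMap.smul_apply, LinearMap.mul_apply', ← mul_assoc]
    rw [gen_comm_of_parity hf hv hu, gen_comm_of_parity hf hu hv]
    simp only [smul_mul_assoc, smul_smul, smul_add]
    rcases neg_one_pow_eq_or 𝕜 r with hr | hr <;> rcases neg_one_pow_eq_or 𝕜 s with hs | hs <;>
    rcases neg_one_pow_eq_or 𝕜 k with hk | hk <;>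
    · simp only [mul_add, add_mul, one_mul, mul_one, pow_add, pow_mul, hr, hs, hk, pow_one, one_pow]
      module
  · intro r s v hv u hu m
    simp only [LinearMap.comp_apply, scale_of_mem 𝒲 _ hv, scale_of_mem 𝒲 _ hu,
      map_smul, LinearMap.smul_apply, LinearMap.mul_apply', ← mul_assoc]
    rw [gen_comm 𝒲 hv hu]
    simp only [smul_mul_assoc, smul_smul]
    congr 1
    ring

namespace IsDer

variable {k : ℕ} {f f' : W →ₗ[𝕜] W} {D D' : GSym 𝒲 →ₗ[𝕜] GSym 𝒲}

theorem eq (h : IsDer 𝒲 k f D) (h' : IsDer 𝒲 k f D') : D = D' := by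
  refine LinearMap.ext fun x => ?_
  have := ShiftedLie.eq_zero_of_gen_mul (D - D') (by simp [h.one, h'.one]) (fun r w hw x hx => ?_) x
  · simpa [sub_eq_zero] using this
  · rw [LinearMap.sub_apply, sub_eq_zero] at hx ⊢
    rw [h.gen_mul r w hw, h'.gen_mul r w hw, hx]

theorem zero : IsDer 𝒲 k 0 0 := ⟨rfl, fun r w _ x => by simp⟩

/-- The graded commutator of two odd derivations is an even derivation. -/
theorem anticomm (hf : HasParity 𝒲 1 f) (hf' : HasParity 𝒲 1 f')
    (h : IsDer 𝒲 1 f D) (h' : IsDer 𝒲 1 f' D') :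
    IsDer 𝒲 0 (f ∘ₗ f' + f' ∘ₗ f) (D ∘ₗ D' + D' ∘ₗ D) := by
  refine ⟨by simp [h.one, h'.one], fun r w hw x => ?_⟩
  obtain ⟨s, hs, he⟩ := hf r w hw
  obtain ⟨s', hs', he'⟩ := hf' r w hw
  simp only [LinearMap.add_apply, LinearMap.comp_apply, h.gen_mul r w hw, h'.gen_mul r w hw,
    map_add, map_smul, h.gen_mul s' _ hs', h'.gen_mul s _ hs]
  rw [neg_one_pow_eq_of_even (𝕜 := 𝕜) (show Even (1 * (s + 1) + r) by
      rwa [show 1 * (s + 1) + r = s + r + 1 by ring]),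
    neg_one_pow_eq_of_even (𝕜 := 𝕜) (show Even (1 * (s' + 1) + r) by
      rwa [show 1 * (s' + 1) + r = s' + r + 1 by ring])]
  simp only [one_mul, zero_mul, pow_zero, one_smul, add_mul, mul_add, pow_add, pow_one]
  rcases neg_one_pow_eq_or 𝕜 r with hr | hr <;>
  · simp only [hr]
    module

/-- The commutator of an even derivation with a derivation. -/
theorem comm {θ : W →ₗ[𝕜] W} {N : GSym 𝒲 →ₗ[𝕜] GSym 𝒲} (hθ : ∀ r, ∀ w ∈ 𝒲 r, θ w ∈ 𝒲 r)
    (hf : HasParity 𝒲 k f) (hN : IsDer 𝒲 0 θ N) (h : IsDer 𝒲 k f D) :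
    IsDer 𝒲 k (θ ∘ₗ f - f ∘ₗ θ) (N ∘ₗ D - D ∘ₗ N) := by
  refine ⟨by simp [h.one, hN.one], fun r w hw x => ?_⟩
  obtain ⟨s, hs, he⟩ := hf r w hw
  simp only [LinearMap.sub_apply, LinearMap.comp_apply, h.gen_mul r w hw, hN.gen_mul r w hw,
    map_add, map_smul, map_sub, h.gen_mul r _ (hθ r w hw), hN.gen_mul s _ hs]
  simp only [zero_mul, pow_zero, one_smul, mul_sub, sub_mul]
  module

theorem comm_eq {θ : W →ₗ[𝕜] W} {N : GSym 𝒲 →ₗ[𝕜] GSym 𝒲} (hθ : ∀ r, ∀ w ∈ 𝒲 r, θ w ∈ 𝒲 r)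
    (hf : HasParity 𝒲 k f) (hN : IsDer 𝒲 0 θ N) (h : IsDer 𝒲 k f D) (hc : ∀ w, θ (f w) = f (θ w))
    (x : GSym 𝒲) : N (D x) = D (N x) := by
  have h1 : θ ∘ₗ f - f ∘ₗ θ = 0 := by ext w; simp [hc]
  have h2 := hN.comm hθ hf h
  rw [h1] at h2
  have h3 := h2.eq zero
  simpa [sub_eq_zero] using LinearMap.congr_fun h3 x

theorem mem_wt {ρ : ℕ → ℤ} {κ : ℤ} (hf : ∀ r, ∀ w ∈ 𝒲 r, ∀ n, ∀ x ∈ wt 𝒲 ρ n,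
    gen 𝒲 (f w) * x ∈ wt 𝒲 ρ (ρ r + n + κ)) (h : IsDer 𝒲 k f D) {n : ℤ} {x : GSym 𝒲}
    (hx : x ∈ wt 𝒲 ρ n) : D x ∈ wt 𝒲 ρ (n + κ) := by
  refine wt_induction 𝒲 (N := fun n => (wt 𝒲 ρ (n + κ)).comap D) ?_ ?_ hx
  · simp [h.one]
  · intro s v hv n x hx ih
    rw [Submodule.mem_comap, h.gen_mul s v hv]
    exact Submodule.add_mem _ (hf s v hv n x hx) (Submodule.smul_mem _ _
      (wt_cast 𝒲 (by ring) (gen_mul_mem_wt 𝒲 hv ih)))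

end IsDer

end Der

/-! ### Extending a retract of the generators to the graded symmetric algebra -/

section GenRetract

variable {𝕜 : Type} [Field 𝕜] {W V : Type u} [AddCommGroup W] [Module 𝕜 W]
  [AddCommGroup V] [Module 𝕜 V] {𝒲 : ℕ → Submodule 𝕜 W} [DirectSum.Decomposition 𝒲]

open GSym

/-- A strong deformation retract of the generators `(W, δ)` onto a graded module `V` on whose image
the bracket vanishes. -/
structure GenRetract (L : ShiftedLie 𝒲) (𝒱 : ℕ → Submodule 𝕜 V) where
  i : V →ₗ[𝕜] W
  p : W →ₗ[𝕜] V
  η : W →ₗ[𝕜] W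
  i_mem : ∀ r, ∀ v ∈ 𝒱 r, i v ∈ 𝒲 r
  p_mem : ∀ r, ∀ w ∈ 𝒲 r, p w ∈ 𝒱 r
  η_mem : ∀ r, ∀ w ∈ 𝒲 (r + 1), η w ∈ 𝒲 r
  η_zero : ∀ w ∈ 𝒲 0, η w = 0
  homotopy : ∀ w, L.δ (η w) + η (L.δ w) = i (p w) - w
  p_i : ∀ v, p (i v) = v
  η_i : ∀ v, η (i v) = 0
  p_η : ∀ w, p (η w) = 0
  η_η : ∀ w, η (η w) = 0
  p_δ : ∀ w, p (L.δ w) = 0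
  δ_i : ∀ v, L.δ (i v) = 0
  b_i : ∀ u v, L.b (i u) (i v) = 0

/-- The derivation of the graded symmetric algebra extending the differential of the generators. -/
def ShiftedLie.linD (L : ShiftedLie 𝒲) : GSym 𝒲 →ₗ[𝕜] GSym 𝒲 := L.d - L.noδ.d

theorem ShiftedLie.br_noδ (L : ShiftedLie 𝒲) {r : ℕ} {w : W} (hw : w ∈ 𝒲 r) (x : GSym 𝒲) :
    L.noδ.br w x = L.br w x := by
  have := eq_zero_of_gen_mul (L.noδ.br w - L.br w) (by simp [br_one]) (fun s v hv x hx => ?_) x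
  · simpa [sub_eq_zero] using this
  · rw [LinearMap.sub_apply, sub_eq_zero] at hx ⊢
    rw [L.br_gen_mul hw hv, L.noδ.br_gen_mul hw hv, hx]
    rfl

theorem ShiftedLie.isDer_linD (L : ShiftedLie 𝒲) : IsDer 𝒲 1 L.δ L.linD := by
  refine ⟨by simp [linD, d_one], fun r w hw x => ?_⟩
  have : L.noδ.δ w = 0 := rfl
  simp only [linD, LinearMap.sub_apply, L.d_gen_mul hw, L.noδ.d_gen_mul hw, L.br_noδ hw, this,
    map_zero, zero_mul, one_mul, mul_sub, smul_sub]
  abel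

theorem ShiftedLie.d_eq (L : ShiftedLie 𝒲) (x : GSym 𝒲) : L.d x = L.linD x + L.noδ.d x := by
  simp [linD]

theorem ShiftedLie.hasParity_δ (L : ShiftedLie 𝒲) : HasParity 𝒲 1 L.δ := fun r w hw =>
  ⟨r + 1, L.δ_mem r w hw, ⟨r + 1, by ring⟩⟩

namespace GenRetract

variable {L : ShiftedLie 𝒲} {𝒱 : ℕ → Submodule 𝕜 V} [DirectSum.Decomposition 𝒱]
  (G : GenRetract L 𝒱)

/-- The inclusion of symmetric algebras. -/
def I : GSym 𝒱 →ₐ[𝕜] GSym 𝒲 := GSym.map 𝒲 G.i G.i_mem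

/-- The projection of symmetric algebras. -/
def P : GSym 𝒲 →ₐ[𝕜] GSym 𝒱 := GSym.map 𝒱 G.p G.p_mem

theorem I_gen (v : V) : G.I (gen 𝒱 v) = gen 𝒲 (G.i v) := GSym.map_gen _ v

theorem P_gen (w : W) : G.P (gen 𝒲 w) = gen 𝒱 (G.p w) := GSym.map_gen _ w

theorem P_I (y : GSym 𝒱) : G.P (G.I y) = y := by
  have : G.P.comp G.I = AlgHom.id 𝕜 _ := algHom_ext' fun v => by simp [I_gen, P_gen, G.p_i]
  exact DFunLike.congr_fun this y

/-- The operator `1 - i p` on generators. -/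
def θ : W →ₗ[𝕜] W := LinearMap.id - G.i ∘ₗ G.p

theorem θ_apply (w : W) : G.θ w = w - G.i (G.p w) := rfl

theorem ip_mem {r : ℕ} {w : W} (hw : w ∈ 𝒲 r) : G.i (G.p w) ∈ 𝒲 r :=
  G.i_mem r _ (G.p_mem r w hw)

theorem θ_mem (r : ℕ) (w : W) (hw : w ∈ 𝒲 r) : G.θ w ∈ 𝒲 r :=
  Submodule.sub_mem _ hw (G.ip_mem hw)

theorem hasParity_η : HasParity 𝒲 1 G.η := by
  intro r w hw
  cases r with
  | zero => exact ⟨1, by rw [G.η_zero w hw]; exact Submodule.zero_mem _, ⟨1, rfl⟩⟩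
  | succ r => exact ⟨r, G.η_mem r w hw, ⟨r + 1, by ring⟩⟩

theorem exists_N : ∃ N, IsDer 𝒲 0 G.θ N := exists_isDer fun r w hw => ⟨r, G.θ_mem r w hw, ⟨r, rfl⟩⟩

/-- The derivation extending `1 - i p`. It counts the generators lying in the kernel of `p`. -/
def N : GSym 𝒲 →ₗ[𝕜] GSym 𝒲 := G.exists_N.choose

theorem isDer_N : IsDer 𝒲 0 G.θ G.N := G.exists_N.choose_spec

/-- The derivation extending `η`. -/
def D : GSym 𝒲 →ₗ[𝕜] GSym 𝒲 := (exists_isDer G.hasParity_η).choose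

theorem isDer_D : IsDer 𝒲 1 G.η G.D := (exists_isDer G.hasParity_η).choose_spec

theorem der_I {k : ℕ} {f : W →ₗ[𝕜] W} {D : GSym 𝒲 →ₗ[𝕜] GSym 𝒲}
    (h : IsDer 𝒲 k f D) (hf : ∀ v, f (G.i v) = 0) (y : GSym 𝒱) : D (G.I y) = 0 := by
  refine ShiftedLie.eq_zero_of_gen_mul (D ∘ₗ G.I.toLinearMap) (by simp [h.one])
    (fun r v hv y hy => ?_) y
  simp only [LinearMap.comp_apply, AlgHom.toLinearMap_apply] at hy ⊢
  rw [map_mul, I_gen, h.gen_mul r _ (G.i_mem r v hv), hy, hf]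
  simp

theorem P_der {k : ℕ} {f : W →ₗ[𝕜] W} {D : GSym 𝒲 →ₗ[𝕜] GSym 𝒲}
    (h : IsDer 𝒲 k f D) (hf : ∀ w, G.p (f w) = 0) (x : GSym 𝒲) : G.P (D x) = 0 := by
  refine ShiftedLie.eq_zero_of_gen_mul (G.P.toLinearMap ∘ₗ D) (by simp [h.one])
    (fun r w hw x hx => ?_) x
  simp only [LinearMap.comp_apply, AlgHom.toLinearMap_apply] at hx ⊢
  rw [h.gen_mul r w hw, map_add, map_smul, map_mul, map_mul, hx, P_gen, hf]
  simp

theorem linD_I (y : GSym 𝒱) : L.linD (G.I y) = 0 := G.der_I L.isDer_linD G.δ_i y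
theorem D_I (y : GSym 𝒱) : G.D (G.I y) = 0 := G.der_I G.isDer_D G.η_i y
theorem N_I (y : GSym 𝒱) : G.N (G.I y) = 0 :=
  G.der_I G.isDer_N (fun v => by rw [θ_apply, G.p_i, sub_self]) y
theorem P_linD (x : GSym 𝒲) : G.P (L.linD x) = 0 := G.P_der L.isDer_linD G.p_δ x
theorem P_D (x : GSym 𝒲) : G.P (G.D x) = 0 := G.P_der G.isDer_D G.p_η x

theorem N_linD (x : GSym 𝒲) : G.N (L.linD x) = L.linD (G.N x) :=
  G.isDer_N.comm_eq G.θ_mem L.hasParity_δ L.isDer_linD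
    (fun w => by rw [θ_apply, θ_apply, G.p_δ, map_sub, G.δ_i, map_zero]) x

theorem N_D (x : GSym 𝒲) : G.N (G.D x) = G.D (G.N x) :=
  G.isDer_N.comm_eq G.θ_mem G.hasParity_η G.isDer_D
    (fun w => by rw [θ_apply, θ_apply, G.p_η, map_sub, G.η_i, map_zero]) x

theorem linD_D (x : GSym 𝒲) : L.linD (G.D x) + G.D (L.linD x) = -G.N x := by
  have h := L.isDer_linD.anticomm L.hasParity_δ G.hasParity_η G.isDer_D
  have hf : L.δ ∘ₗ G.η + G.η ∘ₗ L.δ = -G.θ := by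
    ext w
    simp [G.homotopy, θ_apply]
  rw [hf] at h
  have h' : IsDer 𝒲 0 (-G.θ) (-G.N) := ⟨by simp [G.isDer_N.one], fun r w hw x => by
    simp only [LinearMap.neg_apply, G.isDer_N.gen_mul r w hw, map_neg, neg_mul, mul_neg, smul_neg]
    abel⟩
  exact LinearMap.congr_fun (h.eq h') x

/-- The span of the words with exactly `k` letters in the kernel of `p` and all other letters in
the image of `i`. -/
def part (k : ℕ) : Submodule 𝕜 (GSym 𝒲) :=
  LinearMap.ker (G.N - (k : 𝕜) • LinearMap.id) ⊓
    LinearMap.ker (G.I.toLinearMap ∘ₗ G.P.toLinearMap - (if k = 0 then LinearMap.id else 0))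

theorem mem_part {k : ℕ} {x : GSym 𝒲} :
    x ∈ G.part k ↔ G.N x = (k : 𝕜) • x ∧ G.I (G.P x) = if k = 0 then x else 0 := by
  rw [part, Submodule.mem_inf, LinearMap.mem_ker, LinearMap.mem_ker, LinearMap.sub_apply,
    LinearMap.sub_apply, sub_eq_zero, sub_eq_zero]
  split_ifs <;> rfl

theorem part_of_ker {k r : ℕ} {w : W} (hw : w ∈ 𝒲 r) (h : G.p w = 0) {x : GSym 𝒲}
    (hx : x ∈ G.part k) : gen 𝒲 w * x ∈ G.part (k + 1) := by
  rw [mem_part] at hx ⊢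
  refine ⟨?_, ?_⟩
  · rw [G.isDer_N.gen_mul r w hw, hx.1, θ_apply, h]
    simp only [map_zero, sub_zero, zero_mul, pow_zero, one_smul, mul_smul_comm, Nat.cast_add,
      Nat.cast_one, add_smul]
    abel
  · simp [P_gen, h]

theorem part_of_range {k r : ℕ} {w : W} (hw : w ∈ 𝒲 r) (h : G.i (G.p w) = w) {x : GSym 𝒲}
    (hx : x ∈ G.part k) : gen 𝒲 w * x ∈ G.part k := by
  rw [mem_part] at hx ⊢
  refine ⟨?_, ?_⟩
  · rw [G.isDer_N.gen_mul r w hw, hx.1, θ_apply, h]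
    simp
  · rw [map_mul, map_mul, hx.2, P_gen, I_gen, h]
    split_ifs <;> simp

theorem I_mem_part (y : GSym 𝒱) : G.I y ∈ G.part 0 :=
  G.mem_part.2 ⟨by simp [N_I], by simp [P_I]⟩

/-- Each weight space is spanned by words of its weight all of whose letters lie in the kernel of
`p` or in the image of `i`. -/
theorem wt_le_part {ρ : ℕ → ℤ} (n : ℤ) : wt 𝒲 ρ n ≤ ⨆ k, G.part k ⊓ wt 𝒲 ρ n := by
  intro x hx
  refine wt_induction 𝒲 (N := fun n => ⨆ k, G.part k ⊓ wt 𝒲 ρ n) ?_ ?_ hx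
  · have h1 : (1 : GSym 𝒲) ∈ G.part 0 := by simpa using G.I_mem_part 1
    exact Submodule.mem_iSup_of_mem 0 ⟨h1, one_mem_wt 𝒲⟩
  · intro r w hw n x _ hx
    have h : ⨆ k, G.part k ⊓ wt 𝒲 ρ n ≤
        (⨆ k, G.part k ⊓ wt 𝒲 ρ (ρ r + n)).comap (LinearMap.mulLeft 𝕜 (gen 𝒲 w)) := by
      refine iSup_le fun k y hy => ?_
      have hs : w = G.θ w + G.i (G.p w) := by rw [θ_apply, sub_add_cancel]
      rw [Submodule.mem_comap, LinearMap.mulLeft_apply, hs, map_add, add_mul]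
      refine Submodule.add_mem _
        (Submodule.mem_iSup_of_mem (k + 1) ⟨G.part_of_ker (G.θ_mem r w hw) ?_ hy.1,
          gen_mul_mem_wt 𝒲 (G.θ_mem r w hw) hy.2⟩)
        (Submodule.mem_iSup_of_mem k ⟨G.part_of_range (G.ip_mem hw) ?_ hy.1,
          gen_mul_mem_wt 𝒲 (G.ip_mem hw) hy.2⟩)
      · rw [θ_apply, map_sub, G.p_i, sub_self]
      · rw [G.p_i]
    exact h hx

/-- The operator `N` is diagonalizable with eigenvalues the natural numbers; this uses
characteristic zero to separate the eigenspaces. -/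
theorem isInternal_part [CharZero 𝕜] : DirectSum.IsInternal G.part := by
  rw [DirectSum.isInternal_submodule_iff_iSupIndep_and_iSup_eq_top]
  refine ⟨?_, eq_top_iff.2 ?_⟩
  · have h1 := (Module.End.eigenspaces_iSupIndep G.N).comp
      (Nat.cast_injective : Function.Injective (Nat.cast : ℕ → 𝕜))
    refine h1.mono fun k x hx => ?_
    exact Module.End.mem_eigenspace_iff.2 (G.mem_part.1 hx).1
  · rw [← iSup_wt 𝒲 (ρ := fun _ => 0)]
    exact iSup_le fun n => (G.wt_le_part n).trans (iSup_mono fun k => inf_le_left)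

variable [CharZero 𝕜]

instance instDecompositionPart : DirectSum.Decomposition G.part :=
  G.isInternal_part.chooseDecomposition

/-- The inverse of `N` on the sum of its eigenspaces with nonzero eigenvalue. -/
def J : GSym 𝒲 →ₗ[𝕜] GSym 𝒲 := scale G.part fun k => (k : 𝕜)⁻¹

theorem J_of_mem {k : ℕ} {x : GSym 𝒲} (hx : x ∈ G.part k) : G.J x = (k : 𝕜)⁻¹ • x :=
  scale_of_mem _ _ hx

/-- The homotopy on the graded symmetric algebra: the derivation extending `η`, divided by the
number of letters in the kernel of `p`. -/
def H : GSym 𝒲 →ₗ[𝕜] GSym 𝒲 := G.D ∘ₗ G.J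

theorem H_of_mem {k : ℕ} {x : GSym 𝒲} (hx : x ∈ G.part k) : G.H x = (k : 𝕜)⁻¹ • G.D x := by
  rw [H, LinearMap.comp_apply, G.J_of_mem hx, map_smul]

/-- The inverse of `N` commutes with every operator which commutes with `N` and vanishes against
`I` and `P`. -/
theorem J_comm {T : GSym 𝒲 →ₗ[𝕜] GSym 𝒲} (hN : ∀ x, G.N (T x) = T (G.N x))
    (hI : ∀ y, T (G.I y) = 0) (hP : ∀ x, G.P (T x) = 0) (x : GSym 𝒲) : G.J (T x) = T (G.J x) := by
  refine LinearMap.congr_fun (f := G.J ∘ₗ T) (g := T ∘ₗ G.J) (hom_ext_homog G.part ?_) x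
  intro k x hx
  rw [LinearMap.comp_apply, LinearMap.comp_apply, G.J_of_mem hx, map_smul]
  refine G.J_of_mem (G.mem_part.2 ⟨?_, ?_⟩)
  · rw [hN, (G.mem_part.1 hx).1, map_smul]
  · rw [hP, map_zero]
    split_ifs with h
    · have := (G.mem_part.1 hx).2
      rw [if_pos h] at this
      rw [← this, hI]
    · rfl

/-- The homotopy formula: `linD D + D linD = -N`, and `N J` is the projection away from the kernel
of `N`, which is the image of `I P`. -/
theorem homotopy_H (x : GSym 𝒲) : L.linD (G.H x) + G.H (L.linD x) = G.I (G.P x) - x := by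
  rw [H, LinearMap.comp_apply, LinearMap.comp_apply, G.J_comm G.N_linD G.linD_I G.P_linD, linD_D]
  refine LinearMap.congr_fun (f := -G.N ∘ₗ G.J)
    (g := G.I.toLinearMap ∘ₗ G.P.toLinearMap - LinearMap.id) (hom_ext_homog G.part ?_) x
  intro k x hx
  have h := G.mem_part.1 hx
  simp only [LinearMap.neg_apply, LinearMap.comp_apply, LinearMap.sub_apply,
    AlgHom.toLinearMap_apply, LinearMap.id_apply, G.J_of_mem hx, map_smul, h.1, h.2]
  by_cases hk : k = 0
  · simp [hk]
  · rw [if_neg hk, zero_sub, smul_smul, inv_mul_cancel₀ (Nat.cast_ne_zero.2 hk), one_smul]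

theorem H_I (y : GSym 𝒱) : G.H (G.I y) = 0 := by
  rw [G.H_of_mem (G.I_mem_part y), D_I, smul_zero]

theorem P_H (x : GSym 𝒲) : G.P (G.H x) = 0 := G.P_D _

theorem H_H (x : GSym 𝒲) : G.H (G.H x) = 0 := by
  have h := G.isDer_D.anticomm G.hasParity_η G.hasParity_η G.isDer_D
  have hf : G.η ∘ₗ G.η + G.η ∘ₗ G.η = 0 := by
    ext w
    simp [G.η_η]
  rw [hf] at h
  have hD : ∀ x, G.D (G.D x) = 0 := fun x => by
    have := LinearMap.congr_fun (h.eq IsDer.zero) x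
    rw [LinearMap.add_apply, ← two_smul 𝕜] at this
    exact (smul_eq_zero.1 this).resolve_left two_ne_zero
  rw [H, LinearMap.comp_apply, LinearMap.comp_apply, G.J_comm G.N_D G.D_I G.P_D, hD]

/-- The homotopy shifts weights by `κ`. -/
theorem H_mem_wt {ρ : ℕ → ℤ} {κ : ℤ} (hρ : ∀ r, ρ r = ρ (r + 1) + κ) {n : ℤ} {x : GSym 𝒲}
    (hx : x ∈ wt 𝒲 ρ n) : G.H x ∈ wt 𝒲 ρ (n + κ) := by
  refine G.isDer_D.mem_wt (fun r w hw n x hx => ?_) ?_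
  · cases r with
    | zero =>
      rw [G.η_zero w hw, map_zero, zero_mul]
      exact Submodule.zero_mem _
    | succ r => exact wt_cast 𝒲 (by rw [hρ r]; ring) (gen_mul_mem_wt 𝒲 (G.η_mem r w hw) hx)
  · have : ⨆ k, G.part k ⊓ wt 𝒲 ρ n ≤ (wt 𝒲 ρ n).comap G.J := iSup_le fun k y hy => by
      rw [Submodule.mem_comap, G.J_of_mem hy.1]
      exact Submodule.smul_mem _ _ hy.2
    exact this (G.wt_le_part n hx)

/-- The quadratic part of the differential vanishes on the image of `I`, since the bracket
vanishes on the image of `i`. -/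
theorem noδ_d_I (y : GSym 𝒱) : L.noδ.d (G.I y) = 0 := by
  have hb : ∀ r, ∀ v ∈ 𝒱 r, ∀ y, L.noδ.br (G.i v) (G.I y) = 0 := by
    intro r v hv y
    exact ShiftedLie.br_map_eq_zero G.i_mem (G.i_mem r v hv) (fun u => G.b_i v u) y
  refine ShiftedLie.eq_zero_of_gen_mul (L.noδ.d ∘ₗ G.I.toLinearMap) (by simp [ShiftedLie.d_one])
    (fun r v hv y hy => ?_) y
  simp only [LinearMap.comp_apply, AlgHom.toLinearMap_apply] at hy ⊢
  have h0 : L.noδ.δ (G.i v) = 0 := rfl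
  rw [map_mul, I_gen, L.noδ.d_gen_mul (G.i_mem r v hv), hy, hb r v hv, h0]
  simp

end GenRetract

end GenRetract

/-! ### Koszul signs and symmetrization -/

section Koszul

theorem koszul_succ {n : ℕ} (r : Fin (n + 1) → ℕ) (σ : Equiv.Perm (Fin (n + 1)))
    (τ : Equiv.Perm (Fin n)) (hτ : ∀ l, (σ 0).succAbove (τ l) = σ l.succ) :
    koszul r σ = (∑ x, if x < σ 0 then (r (σ 0) + 1) * (r x + 1) else 0) +
      koszul (r ∘ (σ 0).succAbove) τ := by
  have h1 : (∑ x, if x < σ 0 then (r (σ 0) + 1) * (r x + 1) else 0) =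
      ∑ b : Fin n, if σ b.succ < σ 0 then (r (σ 0) + 1) * (r (σ b.succ) + 1) else 0 := by
    rw [Fin.sum_univ_succAbove _ (σ 0), if_neg (lt_irrefl _), zero_add, ← Equiv.sum_comp τ]
    simp only [hτ]
  have h2 : ∀ a b : Fin n, τ b < τ a ↔ σ b.succ < σ a.succ := fun a b => by
    rw [← hτ, ← hτ, Fin.succAbove_lt_succAbove_iff]
  rw [h1]
  unfold koszul
  rw [Fin.sum_univ_succ, Fin.sum_univ_succ]
  congr 1
  · simp
  · refine Finset.sum_congr rfl fun a _ => ?_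
    rw [Fin.sum_univ_succ]
    simp [h2, hτ]

variable {𝕜 : Type} [Field 𝕜] {A : Type*} [Ring A] [Algebra 𝕜 A]

theorem mul_prod_succAbove {n : ℕ} (r : Fin (n + 1) → ℕ) (u : Fin (n + 1) → A)
    (hu : ∀ a b, a ≠ b → u a * u b = (-1 : 𝕜) ^ ((r a + 1) * (r b + 1)) • (u b * u a))
    (c : Fin (n + 1)) : u c * (List.ofFn (u ∘ c.succAbove)).prod =
      (-1 : 𝕜) ^ (∑ x, if x < c then (r c + 1) * (r x + 1) else 0) • (List.ofFn u).prod := by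
  induction n with
  | zero =>
    cases c using Fin.cases with
    | zero => simp
    | succ c => exact c.elim0
  | succ n ih =>
    cases c using Fin.cases with
    | zero => simp [List.ofFn_succ, Function.comp_def]
    | succ c =>
      have h := ih (r ∘ Fin.succ) (u ∘ Fin.succ)
        (fun a b hab => hu _ _ ((Fin.succ_injective _).ne hab)) c
      have h1 : (List.ofFn (u ∘ c.succ.succAbove)).prod =
          u 0 * (List.ofFn ((u ∘ Fin.succ) ∘ c.succAbove)).prod := by
        rw [List.ofFn_succ, List.prod_cons]
        simp [Function.comp_def]
      rw [h1, ← mul_assoc, hu _ _ (Fin.succ_ne_zero c), smul_mul_assoc, mul_assoc,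
        show u c.succ = (u ∘ Fin.succ) c from rfl, h, mul_smul_comm, smul_smul, ← pow_add]
      conv_rhs => rw [Fin.sum_univ_succ, List.ofFn_succ, List.prod_cons]
      simp [Function.comp_def]

/-- Reordering a product of graded commuting elements. -/
theorem prod_perm {n : ℕ} (r : Fin n → ℕ) (u : Fin n → A)
    (hu : ∀ a b, a ≠ b → u a * u b = (-1 : 𝕜) ^ ((r a + 1) * (r b + 1)) • (u b * u a))
    (σ : Equiv.Perm (Fin n)) :
    (List.ofFn (u ∘ σ)).prod = (-1 : 𝕜) ^ koszul r σ • (List.ofFn u).prod := by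
  induction n with
  | zero => simp [koszul]
  | succ n ih =>
    have h : ∀ l : Fin n, ∃ k, (σ 0).succAbove k = σ l.succ := fun l =>
      Fin.exists_succAbove_eq (σ.injective.ne (Fin.succ_ne_zero l))
    choose τ hτ using h
    have hinj : Function.Injective τ := fun a b hab => by
      have := congrArg (σ 0).succAbove hab
      rw [hτ, hτ] at this
      exact Fin.succ_injective _ (σ.injective this)
    let T := Equiv.ofBijective τ (Finite.injective_iff_bijective.1 hinj)
    have hT : ∀ l, (σ 0).succAbove (T l) = σ l.succ := hτ
    have ih := ih (r ∘ (σ 0).succAbove) (u ∘ (σ 0).succAbove)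
      (fun a b hab => hu _ _ ((Fin.succAbove_right_injective).ne hab)) T
    have h1 : (List.ofFn (u ∘ σ)).prod =
        u (σ 0) * (List.ofFn ((u ∘ (σ 0).succAbove) ∘ T)).prod := by
      rw [List.ofFn_succ, List.prod_cons]
      simp only [Function.comp_def, hT]
    rw [h1, ih, mul_smul_comm, mul_prod_succAbove r u hu, smul_smul, ← pow_add,
      koszul_succ r σ T hT, add_comm]

/-- Comparison of the Koszul signs before and after the degree of the entry `σ j` changes by
one. -/
theorem even_koszul {n : ℕ} (r : Fin n → ℕ) (σ : Equiv.Perm (Fin n)) (j : Fin n) :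
    Even ((koszul r σ + ∑ l, if l < j then r (σ l) + 1 else 0) +
      koszul (Function.update r (σ j) (r (σ j) + 1)) σ + ∑ x, if x < σ j then r x + 1 else 0) := by
  rw [← ZMod.natCast_eq_zero_iff_even]
  have h2 : (2 : ZMod 2) = 0 := by decide
  rw [← Equiv.sum_comp σ (fun x => if x < σ j then r x + 1 else 0)]
  -- the two Koszul signs differ by the letters which `σ` moves past the letter `σ j`
  have hk : ((koszul r σ : ℕ) : ZMod 2) + (koszul (Function.update r (σ j) (r (σ j) + 1)) σ : ℕ) =
      ∑ l, ((if j < l ∧ σ l < σ j then (r (σ l) + 1 : ZMod 2) else 0) +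
        if l < j ∧ σ j < σ l then (r (σ l) + 1 : ZMod 2) else 0) := by
    have h : ∀ a b,
        (((if a < b ∧ σ b < σ a then (r (σ a) + 1) * (r (σ b) + 1) else 0 : ℕ) : ZMod 2) +
        ((if a < b ∧ σ b < σ a then (Function.update r (σ j) (r (σ j) + 1) (σ a) + 1) *
          (Function.update r (σ j) (r (σ j) + 1) (σ b) + 1) else 0 : ℕ) : ZMod 2)) =
        (if a = j then (if j < b ∧ σ b < σ j then (r (σ b) + 1 : ZMod 2) else 0) else 0) +
        (if b = j then (if a < j ∧ σ j < σ a then (r (σ a) + 1 : ZMod 2) else 0) else 0) := by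
      intro a b
      by_cases hc : a < b ∧ σ b < σ a
      · rw [if_pos hc, if_pos hc]
        by_cases ha : a = j
        · subst ha
          have hb : b ≠ a := hc.1.ne'
          rw [Function.update_self, Function.update_of_ne (σ.injective.ne hb), if_pos rfl,
            if_neg hb, if_pos hc]
          push_cast
          linear_combination (r (σ a) + 1) * (r (σ b) + 1) * h2
        · rw [if_neg ha, Function.update_of_ne (σ.injective.ne ha)]
          by_cases hb : b = j
          · subst hb
            rw [Function.update_self, if_pos rfl, if_pos hc]
            push_cast
            linear_combination (r (σ a) + 1) * (r (σ b) + 1) * h2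
          · rw [if_neg hb, Function.update_of_ne (σ.injective.ne hb)]
            push_cast
            linear_combination (r (σ a) + 1) * (r (σ b) + 1) * h2
      · rw [if_neg hc, if_neg hc]
        by_cases ha : a = j
        · subst ha
          rw [if_pos rfl, if_neg hc]
          by_cases hb : b = a
          · subst hb; simp
          · simp [hb]
        · by_cases hb : b = j
          · subst hb; simp [ha, hc]
          · simp [ha, hb]
    unfold koszul
    push_cast [← Finset.sum_add_distrib] at h ⊢
    simp only [h, Finset.sum_add_distrib]
    simp
  push_cast at hk ⊢
  rw [add_assoc, add_add_add_comm, hk, ← Finset.sum_add_distrib,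
    ← Finset.sum_add_distrib]
  refine Finset.sum_eq_zero fun l _ => ?_
  rcases lt_trichotomy l j with h | h | h
  · rcases lt_or_gt_of_ne (σ.injective.ne h.ne) with h' | h' <;>
    · simp only [h, h', not_lt_of_gt, and_self, and_false, false_and, if_true, if_false]
      linear_combination (r (σ l) + 1) * h2
  · subst h; simp
  · rcases lt_or_gt_of_ne (σ.injective.ne h.ne') with h' | h' <;>
    · simp only [h, h', not_lt_of_gt, and_self, and_false, false_and, if_true, if_false]
      first | linear_combination (r (σ l) + 1) * h2 | ring

open Classical in
/-- For a nonempty set `s` of letters and `c ∈ s`, the proportion of orderings in which `c` is the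
last letter of `s` is `1 / |s|`. -/
theorem card_last {n : ℕ} (s : Finset (Fin n)) (c : Fin n) (hc : c ∈ s) :
    s.card * (Finset.univ.filter fun σ : Equiv.Perm (Fin n) =>
      c ∈ s ∧ ∀ l, σ.symm c < l → σ l ∉ s).card = n.factorial := by
  set Q : Equiv.Perm (Fin n) → Fin n → Prop := fun σ c => c ∈ s ∧ ∀ l, σ.symm c < l → σ l ∉ s
    with hQ
  -- transposing `c` and `c'` shows that all letters of `s` are last equally often
  have h1 : ∀ c' ∈ s, (Finset.univ.filter fun σ => Q σ c').card =
      (Finset.univ.filter fun σ => Q σ c).card := by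
    intro c' hc'
    have hs : ∀ x, Equiv.swap c c' x ∈ s ↔ x ∈ s := by
      intro x
      rcases eq_or_ne x c with rfl | h
      · simp [hc, hc']
      · rcases eq_or_ne x c' with rfl | h'
        · simp [hc, hc']
        · rw [Equiv.swap_apply_of_ne_of_ne h h']
    refine Finset.card_equiv (Equiv.mulLeft (Equiv.swap c c')) fun σ => ?_
    simp only [Finset.mem_filter, Finset.mem_univ, true_and, hQ, hc, hc', Equiv.coe_mulLeft,
      Equiv.Perm.mul_apply, hs]
    have : (Equiv.swap c c' * σ).symm c = σ.symm c' := by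
      rw [Equiv.symm_apply_eq]
      simp
    rw [this]
  -- in every ordering exactly one letter of `s` comes last
  have h2 : ∑ c' ∈ s, (Finset.univ.filter fun σ => Q σ c').card = n.factorial := by
    have h3 : ∀ σ : Equiv.Perm (Fin n), (s.filter fun c' => Q σ c').card = 1 := by
      intro σ
      have hne : (s.map σ.symm.toEmbedding).Nonempty := ⟨_, Finset.mem_map_of_mem _ hc⟩
      obtain ⟨j, hj, hmax⟩ := (s.map σ.symm.toEmbedding).exists_max_image id hne
      obtain ⟨c', hc', rfl⟩ := Finset.mem_map.1 hj
      refine Finset.card_eq_one.2 ⟨c', ?_⟩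
      ext d
      simp only [Finset.mem_filter, Finset.mem_singleton, hQ]
      constructor
      · rintro ⟨hd, -, h⟩
        by_contra hne
        have h5 : σ.symm d ≤ σ.symm c' := hmax _ (Finset.mem_map_of_mem _ hd)
        have h6 : σ.symm d ≠ σ.symm c' := σ.symm.injective.ne hne
        exact h _ (lt_of_le_of_ne h5 h6) (by simpa using hc')
      · rintro rfl
        refine ⟨hc', hc', fun l hl hls => ?_⟩
        have : σ.symm (σ l) ≤ σ.symm d := hmax _ (Finset.mem_map_of_mem _ hls)
        rw [Equiv.symm_apply_apply] at this
        exact absurd hl (not_lt.2 this)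
    have h4 : ∑ c' ∈ s, (Finset.univ.filter fun σ => Q σ c').card =
        ∑ σ : Equiv.Perm (Fin n), (s.filter fun c' => Q σ c').card := by
      simp only [Finset.card_filter]
      exact Finset.sum_comm
    rw [h4, Finset.sum_congr rfl fun σ _ => h3 σ]
    simp [Fintype.card_perm]
  rw [Finset.sum_congr rfl h1, Finset.sum_const, smul_eq_mul] at h2
  exact h2

end Koszul

section Symmetrize

variable {𝕜 : Type} [Field 𝕜] {W V : Type u} [AddCommGroup W] [Module 𝕜 W]
  [AddCommGroup V] [Module 𝕜 V] {𝒲 : ℕ → Submodule 𝕜 W} [DirectSum.Decomposition 𝒲]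

open GSym

/-- An odd derivation applied to a word. -/
theorem IsDer.prod {f : W →ₗ[𝕜] W} {D : GSym 𝒲 →ₗ[𝕜] GSym 𝒲} (h : IsDer 𝒲 1 f D) {n : ℕ}
    (r : Fin n → ℕ) (w : Fin n → W) (hw : ∀ k, w k ∈ 𝒲 (r k)) :
    D (List.ofFn fun k => gen 𝒲 (w k)).prod =
      ∑ c, (-1 : 𝕜) ^ (∑ l, if l < c then r l + 1 else 0) •
        (List.ofFn fun l => gen 𝒲 (if l = c then f (w l) else w l)).prod := by
  induction n with
  | zero => simp [h.one]
  | succ n ih =>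
    rw [List.ofFn_succ, List.prod_cons, h.gen_mul _ _ (hw 0),
      ih (fun l => r l.succ) (fun l => w l.succ) fun k => hw _, Fin.sum_univ_succ,
      Finset.mul_sum, Finset.smul_sum]
    congr 1
    · simp [List.ofFn_succ]
    · refine Finset.sum_congr rfl fun c _ => ?_
      rw [mul_smul_comm, smul_smul, ← pow_add, Fin.sum_univ_succ]
      simp [List.ofFn_succ, (Fin.succ_ne_zero _).symm]

namespace GenRetract

variable {L : ShiftedLie 𝒲} {𝒱 : ℕ → Submodule 𝕜 V} [DirectSum.Decomposition 𝒱]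
  (G : GenRetract L 𝒱)

/-- The word obtained by applying `id^{⊗ j} ⊗ η ⊗ (i p)^{⊗ (n - j - 1)}`, as a multilinear map. -/
def symTerm {n : ℕ} (j : Fin n) : MultilinearMap 𝕜 (fun _ : Fin n => W) (GSym 𝒲) :=
  (MultilinearMap.mkPiAlgebraFin 𝕜 n (GSym 𝒲)).compLinearMap fun l => gen 𝒲 ∘ₗ
    (if l < j then LinearMap.id else if l = j then G.η else G.i ∘ₗ G.p)

theorem symTerm_apply {n : ℕ} (j : Fin n) (w : Fin n → W) : G.symTerm j w =
    (List.ofFn fun l => gen 𝒲 (if l < j then w l else if l = j then G.η (w l)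
      else G.i (G.p (w l)))).prod := by
  rw [symTerm, MultilinearMap.compLinearMap_apply, MultilinearMap.mkPiAlgebraFin_apply]
  congr 2
  funext l
  rw [LinearMap.comp_apply]
  congr 1
  split_ifs <;> rfl

/-- For letters in the kernel of `p` or in the image of `i`, with `c` the last letter of the first
kind in the ordering `σ`, the term of the symmetrization belonging to `σ` is `± w_1 ⋯ η(w_c) ⋯ w_n`
with the sign of applying `η` to the letter `c`; all terms not of this kind vanish. -/
theorem symTerm_perm {n : ℕ} (s : Finset (Fin n)) (r : Fin n → ℕ) (w : Fin n → W)
    (hw : ∀ k, w k ∈ 𝒲 (r k)) (hs : ∀ k ∈ s, G.p (w k) = 0) (hs' : ∀ k ∉ s, G.i (G.p (w k)) = w k)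
    (σ : Equiv.Perm (Fin n)) (j : Fin n) [Decidable (σ j ∈ s ∧ ∀ l, j < l → σ l ∉ s)] :
    (-1 : 𝕜) ^ (koszul r σ + ∑ l, if l < j then r (σ l) + 1 else 0) •
      G.symTerm j (fun l => w (σ l)) =
    if σ j ∈ s ∧ ∀ l, j < l → σ l ∉ s then
      (-1 : 𝕜) ^ (∑ l, if l < σ j then r l + 1 else 0) •
        (List.ofFn fun l => gen 𝒲 (if l = σ j then G.η (w l) else w l)).prod
    else 0 := by
  rw [symTerm_apply]
  split_ifs with h
  · set u : Fin n → GSym 𝒲 := fun l => gen 𝒲 (if l = σ j then G.η (w l) else w l) with hu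
    have h1 : (List.ofFn fun l => gen 𝒲 (if l < j then w (σ l) else if l = j then G.η (w (σ l))
        else G.i (G.p (w (σ l))))) = List.ofFn (u ∘ σ) := by
      congr 1
      funext l
      simp only [hu, Function.comp_apply]
      congr 1
      rcases lt_trichotomy l j with hl | hl | hl
      · rw [if_pos hl, if_neg (σ.injective.ne hl.ne)]
      · subst hl
        rw [if_neg (lt_irrefl _), if_pos rfl, if_pos rfl]
      · rw [if_neg (not_lt_of_gt hl), if_neg hl.ne', if_neg (σ.injective.ne hl.ne'),
          hs' _ (h.2 l hl)]
    -- up to parity, `η` raises the degree by one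
    set r' := Function.update r (σ j) (r (σ j) + 1) with hr'
    have hcomm : ∀ a b, a ≠ b → u a * u b = (-1 : 𝕜) ^ ((r' a + 1) * (r' b + 1)) • (u b * u a) := by
      intro a b hab
      by_cases ha : a = σ j
      · have hb : b ≠ σ j := fun hb => hab (ha.trans hb.symm)
        simp only [hu, hr', if_pos ha, if_neg hb]
        rw [ha, Function.update_self, Function.update_of_ne hb]
        exact gen_comm_of_parity G.hasParity_η (hw _) (hw _)
      · by_cases hb : b = σ j
        · simp only [hu, hr', if_pos hb, if_neg ha]
          rw [hb, Function.update_self, Function.update_of_ne ha,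
            gen_comm_of_parity G.hasParity_η (hw _) (hw _), smul_smul, mul_comm (r a + 1),
            ← pow_add, Even.neg_one_pow ⟨_, rfl⟩, one_smul]
        · simp only [hu, hr', if_neg ha, if_neg hb]
          rw [Function.update_of_ne ha, Function.update_of_ne hb]
          exact gen_comm 𝒲 (hw _) (hw _)
    rw [h1, prod_perm r' u hcomm σ, smul_smul, ← pow_add]
    congr 1
    exact neg_one_pow_eq_of_even (even_koszul r σ j)
  · have h0 : (0 : GSym 𝒲) ∈ (List.ofFn fun l => gen 𝒲 (if l < j then w (σ l) else
        if l = j then G.η (w (σ l)) else G.i (G.p (w (σ l))))) := by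
      rw [List.mem_ofFn]
      by_cases hj : σ j ∈ s
      · have : ∃ l, j < l ∧ σ l ∈ s := by
          by_contra hl
          push Not at hl
          exact h ⟨hj, hl⟩
        obtain ⟨l, hl, hls⟩ := this
        refine ⟨l, ?_⟩
        simp only [if_neg (not_lt_of_gt hl), if_neg hl.ne', hs _ hls, map_zero]
      · refine ⟨j, ?_⟩
        simp only [lt_irrefl, if_false, if_true]
        rw [← hs' _ hj, G.η_i, map_zero]
    rw [List.prod_eq_zero h0, smul_zero]

variable [CharZero 𝕜]

omit [CharZero 𝕜] in
theorem prod_mem_part {n : ℕ} (t : Fin n → Prop) [DecidablePred t] (r : Fin n → ℕ) (w : Fin n → W)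
    (hw : ∀ k, w k ∈ 𝒲 (r k)) (ht : ∀ k, t k → G.p (w k) = 0)
    (ht' : ∀ k, ¬t k → G.i (G.p (w k)) = w k) :
    (List.ofFn fun k => gen 𝒲 (w k)).prod ∈ G.part (∑ k, if t k then 1 else 0) := by
  induction n with
  | zero => simpa using G.I_mem_part 1
  | succ n ih =>
    have ih := ih (fun k => t k.succ) (fun k => r k.succ) (fun k => w k.succ) (fun k => hw _)
      (fun k => ht _) fun k => ht' _
    rw [List.ofFn_succ, List.prod_cons, Fin.sum_univ_succ]
    split_ifs with h
    · rw [add_comm]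
      exact G.part_of_ker (hw 0) (ht 0 h) ih
    · rw [zero_add]
      exact G.part_of_range (hw 0) (ht' 0 h) ih

/-- The symmetrization formula for words whose letters lie in the kernel of `p`, for indices in
`s`, or in the image of `i`. Such a word is an eigenvector of `N` with eigenvalue `|s|`, and each
letter of `s` contributes with the proportion `1 / |s|` of all orderings in which it comes last.
-/
theorem H_prod_split {n : ℕ} (s : Finset (Fin n)) (r : Fin n → ℕ) (w : Fin n → W)
    (hw : ∀ k, w k ∈ 𝒲 (r k)) (hs : ∀ k ∈ s, G.p (w k) = 0)
    (hs' : ∀ k ∉ s, G.i (G.p (w k)) = w k) :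
    G.H (List.ofFn fun k => gen 𝒲 (w k)).prod =
      (n.factorial : 𝕜)⁻¹ • ∑ j : Fin n, ∑ σ : Equiv.Perm (Fin n),
        (-1 : 𝕜) ^ (koszul r σ + ∑ l : Fin n, if l < j then r (σ l) + 1 else 0) •
          G.symTerm j fun l => w (σ l) := by
  classical
  have hpart : (List.ofFn fun k => gen 𝒲 (w k)).prod ∈ G.part s.card := by
    have := G.prod_mem_part (· ∈ s) r w hw hs hs'
    rwa [Finset.sum_boole, Finset.filter_mem_eq_inter, Finset.univ_inter, Nat.cast_id] at this
  set g : Fin n → GSym 𝒲 := fun c => (-1 : 𝕜) ^ (∑ l, if l < c then r l + 1 else 0) •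
        (List.ofFn fun l => gen 𝒲 (if l = c then G.η (w l) else w l)).prod with hg
  have h1 : ∑ j : Fin n, ∑ σ : Equiv.Perm (Fin n),
        (-1 : 𝕜) ^ (koszul r σ + ∑ l : Fin n, if l < j then r (σ l) + 1 else 0) •
          G.symTerm j (fun l => w (σ l)) =
      ∑ c, ((Finset.univ.filter fun σ : Equiv.Perm (Fin n) =>
        c ∈ s ∧ ∀ l, σ.symm c < l → σ l ∉ s).card : 𝕜) • g c := by
    rw [Finset.sum_comm]
    have h2 : ∀ σ : Equiv.Perm (Fin n), ∑ j : Fin n,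
        (-1 : 𝕜) ^ (koszul r σ + ∑ l : Fin n, if l < j then r (σ l) + 1 else 0) •
          G.symTerm j (fun l => w (σ l)) =
        ∑ c, if c ∈ s ∧ ∀ l, σ.symm c < l → σ l ∉ s then g c else 0 := by
      intro σ
      refine Eq.trans (Finset.sum_congr rfl fun j _ => ?_) (Equiv.sum_comp σ _)
      rw [Equiv.symm_apply_apply]
      exact G.symTerm_perm s r w hw hs hs' σ j
    rw [Finset.sum_congr rfl fun σ _ => h2 σ, Finset.sum_comm]
    refine Finset.sum_congr rfl fun c _ => ?_
    rw [← Finset.sum_filter, Finset.sum_const, Nat.cast_smul_eq_nsmul]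
  rw [G.H_of_mem hpart, G.isDer_D.prod r w hw, h1, Finset.smul_sum, Finset.smul_sum]
  refine Finset.sum_congr rfl fun c _ => ?_
  by_cases hc : c ∈ s
  · have hcard := card_last s c hc
    have h3 : (s.card : 𝕜) * ((Finset.univ.filter fun σ : Equiv.Perm (Fin n) =>
        c ∈ s ∧ ∀ l, σ.symm c < l → σ l ∉ s).card : 𝕜) = n.factorial := by
      rw [← hcard]
      push_cast
      congr!
    have hs0 : (s.card : 𝕜) ≠ 0 := Nat.cast_ne_zero.2 (Finset.card_ne_zero_of_mem hc)
    have hn0 : (n.factorial : 𝕜) ≠ 0 := Nat.cast_ne_zero.2 n.factorial_ne_zero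
    change (s.card : 𝕜)⁻¹ • g c = _
    refine Eq.trans (congrArg (· • g c) ?_) (mul_smul _ _ _)
    rw [inv_eq_iff_eq_inv, mul_inv, inv_inv, ← div_eq_mul_inv, eq_div_iff, h3]
    intro h0
    rw [h0, mul_zero] at h3
    exact hn0 h3.symm
  · have h4 : (List.ofFn fun l => gen 𝒲 (if l = c then G.η (w l) else w l)).prod = 0 := by
      refine List.prod_eq_zero ((List.mem_ofFn).2 ⟨c, ?_⟩)
      rw [if_pos rfl, ← hs' c hc, G.η_i, map_zero]
    simp only [hg, h4, smul_zero]

/-- The homotopy is the symmetrization of the homotopies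
`id^{⊗ j} ⊗ η ⊗ (i p)^{⊗ (n - j - 1)}`. -/
theorem H_prod {n : ℕ} (r : Fin n → ℕ) (w : Fin n → W) (hw : ∀ k, w k ∈ 𝒲 (r k)) :
    G.H (List.ofFn fun k => gen 𝒲 (w k)).prod =
      (n.factorial : 𝕜)⁻¹ • ∑ j : Fin n, ∑ σ : Equiv.Perm (Fin n),
        (-1 : 𝕜) ^ (koszul r σ + ∑ l : Fin n, if l < j then r (σ l) + 1 else 0) •
          (List.ofFn fun l => gen 𝒲 (if l < j then w (σ l) else if l = j then G.η (w (σ l))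
            else G.i (G.p (w (σ l))))).prod := by
  let Φ : MultilinearMap 𝕜 (fun _ : Fin n => W) (GSym 𝒲) :=
    G.H.compMultilinearMap
      ((MultilinearMap.mkPiAlgebraFin 𝕜 n (GSym 𝒲)).compLinearMap fun _ => gen 𝒲)
  let Ψ : MultilinearMap 𝕜 (fun _ : Fin n => W) (GSym 𝒲) :=
    (n.factorial : 𝕜)⁻¹ • ∑ j : Fin n, ∑ σ : Equiv.Perm (Fin n),
        (-1 : 𝕜) ^ (koszul r σ + ∑ l : Fin n, if l < j then r (σ l) + 1 else 0) •
          (G.symTerm j).domDomCongr σ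
  have hΦ : ∀ w, Φ w = G.H (List.ofFn fun k => gen 𝒲 (w k)).prod := fun w => rfl
  have hΨ : ∀ w, Ψ w = (n.factorial : 𝕜)⁻¹ • ∑ j : Fin n, ∑ σ : Equiv.Perm (Fin n),
        (-1 : 𝕜) ^ (koszul r σ + ∑ l : Fin n, if l < j then r (σ l) + 1 else 0) •
          G.symTerm j fun l => w (σ l) := fun w => by
    simp only [Ψ, smul_apply, sum_apply]
    rfl
  -- by multilinearity, all letters may be assumed in the kernel of `p` or in the image of `i`
  have hs : w = (fun k => G.θ (w k)) + fun k => G.i (G.p (w k)) := by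
    funext k
    simp [θ_apply]
  have key : Φ w = Ψ w := by
    rw [hs, MultilinearMap.map_add_univ, MultilinearMap.map_add_univ]
    refine Finset.sum_congr rfl fun s _ => ?_
    rw [hΦ, hΨ]
    refine G.H_prod_split s r _ (fun k => ?_) (fun k hk => ?_) fun k hk => ?_
    · by_cases hk : k ∈ s
      · rw [Finset.piecewise_eq_of_mem _ _ _ hk]
        exact G.θ_mem _ _ (hw k)
      · rw [Finset.piecewise_eq_of_notMem _ _ _ hk]
        exact G.ip_mem (hw k)
    · rw [Finset.piecewise_eq_of_mem _ _ _ hk, θ_apply, map_sub, G.p_i, sub_self]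
    · rw [Finset.piecewise_eq_of_notMem _ _ _ hk, G.p_i]
  rw [hΦ, hΨ] at key
  simpa only [symTerm_apply] using key

/-- Operators with the same values on words in homogeneous generators agree. -/
theorem _root_.FactEnv.GSym.ext_prod {M : Type*} [AddCommGroup M] [Module 𝕜 M]
    {F F' : GSym 𝒲 →ₗ[𝕜] M}
    (h : ∀ (n : ℕ) (r : Fin n → ℕ) (w : Fin n → W), (∀ k, w k ∈ 𝒲 (r k)) →
      F (List.ofFn fun k => gen 𝒲 (w k)).prod = F' (List.ofFn fun k => gen 𝒲 (w k)).prod) :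
    F = F' := by
  refine LinearMap.ext fun x => ?_
  let S : Submodule 𝕜 (GSym 𝒲) := Submodule.span 𝕜 {y | ∃ (n : ℕ) (r : Fin n → ℕ) (w : Fin n → W),
    (∀ k, w k ∈ 𝒲 (r k)) ∧ y = (List.ofFn fun k => gen 𝒲 (w k)).prod}
  have hS : x ∈ S := by
    have := ShiftedLie.eq_zero_of_gen_mul S.mkQ ?_ ?_ x
    · simpa using this
    · rw [Submodule.mkQ_apply, Submodule.Quotient.mk_eq_zero]
      exact Submodule.subset_span ⟨0, Fin.elim0, Fin.elim0, fun k => k.elim0, by simp⟩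
    · intro r w hw x hx
      rw [Submodule.mkQ_apply, Submodule.Quotient.mk_eq_zero] at hx ⊢
      have : S ≤ S.comap (LinearMap.mulLeft 𝕜 (gen 𝒲 w)) := by
        refine Submodule.span_le.2 ?_
        rintro _ ⟨n, r', w', hw', rfl⟩
        refine Submodule.subset_span ⟨n + 1, Fin.cons r r', Fin.cons w w', ?_, ?_⟩
        · intro k
          cases k using Fin.cases with
          | zero => simpa using hw
          | succ k => simpa using hw' k
        · simp [List.ofFn_succ]
      exact this hx
  have hle : S ≤ LinearMap.ker (F - F') := by
    refine Submodule.span_le.2 ?_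
    rintro _ ⟨n, r, w, hw, rfl⟩
    simp [h n r w hw]
  simpa [sub_eq_zero] using hle hS

end GenRetract
end Symmetrize

/-! ### Perturbing the retract by the Chevalley–Eilenberg differential -/

section Geom

variable {𝕜 : Type} [RCLike 𝕜] {M : Type u} [AddCommGroup M] [Module 𝕜 M] {T : M →ₗ[𝕜] M}

theorem geom_eq_sum (h : ∀ x, ∃ N, (T ^ N) x = 0) {x : M} {N : ℕ} (hN : (T ^ N) x = 0) :
    geom T x = ∑ j ∈ Finset.range N, (T ^ j) x := by
  have h1 : geom T x = ∑ᶠ j : ℕ, (T ^ j) x := by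
    rw [geom, dif_pos h]
    rfl
  rw [h1]
  refine finsum_eq_sum_of_support_subset _ fun j hj => ?_
  by_contra hjN
  refine hj ?_
  rw [Finset.coe_range, Set.mem_Iio, not_lt] at hjN
  obtain ⟨k, rfl⟩ := Nat.exists_eq_add_of_le hjN
  change (T ^ (N + k)) x = 0
  rw [add_comm, pow_add, Module.End.mul_apply, hN, map_zero]

theorem geom_eq_add_apply (h : ∀ x, ∃ N, (T ^ N) x = 0) (x : M) :
    geom T x = x + T (geom T x) := by
  obtain ⟨N, hN⟩ := h x
  have hN' : (T ^ (N + 1)) x = 0 := by rw [pow_succ', Module.End.mul_apply, hN, map_zero]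
  rw [geom_eq_sum h hN, map_sum, ← geom_eq_sum h hN, geom_eq_sum h hN', Finset.sum_range_succ',
    add_comm]
  simp only [pow_succ', Module.End.mul_apply, pow_zero, Module.End.one_apply]

theorem geom_eq_add_geom (h : ∀ x, ∃ N, (T ^ N) x = 0) (x : M) :
    geom T x = x + geom T (T x) := by
  obtain ⟨N, hN⟩ := h x
  have hN' : (T ^ (N + 1)) x = 0 := by rw [pow_succ', Module.End.mul_apply, hN, map_zero]
  have hN'' : (T ^ N) (T x) = 0 := by rw [← Module.End.mul_apply, ← pow_succ, hN']
  rw [geom_eq_sum h hN', geom_eq_sum h hN'', Finset.sum_range_succ', add_comm]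
  simp only [pow_succ, Module.End.mul_apply, pow_zero, Module.End.one_apply]

theorem geom_of_eq_zero (h : ∀ x, ∃ N, (T ^ N) x = 0) {x : M} (hx : T x = 0) : geom T x = x := by
  rw [geom_eq_add_geom h, hx, map_zero, add_zero]

end Geom

section Perturbation

variable {𝕜 : Type} [RCLike 𝕜] {W V : Type u} [AddCommGroup W] [Module 𝕜 W]
  [AddCommGroup V] [Module 𝕜 V] {𝒲 : ℕ → Submodule 𝕜 W} [DirectSum.Decomposition 𝒲]

open GSym

theorem ShiftedLie.linD_linD (L : ShiftedLie 𝒲) (x : GSym 𝒲) :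
    L.linD (L.linD x) = 0 := by
  have h := L.isDer_linD.anticomm L.hasParity_δ L.hasParity_δ L.isDer_linD
  have hf : L.δ ∘ₗ L.δ + L.δ ∘ₗ L.δ = 0 := by
    ext w
    simp [L.δδ]
  rw [hf] at h
  have := LinearMap.congr_fun (h.eq IsDer.zero) x
  rw [LinearMap.add_apply, ← two_smul 𝕜] at this
  exact (smul_eq_zero.1 this).resolve_left two_ne_zero

theorem ShiftedLie.linD_noδ_d (L : ShiftedLie 𝒲) (x : GSym 𝒲) :
    L.linD (L.noδ.d x) = -L.noδ.d (L.linD x) := by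
  have h := L.d_d x
  rw [L.d_eq, L.d_eq x, map_add, map_add, L.linD_linD, L.noδ.d_d, zero_add, add_zero] at h
  exact eq_neg_of_add_eq_zero_left h

namespace GenRetract

variable {L : ShiftedLie 𝒲} {𝒱 : ℕ → Submodule 𝕜 V} [DirectSum.Decomposition 𝒱]
  (G : GenRetract L 𝒱)

/-- The operator whose geometric series perturbs the retract. It lowers word length by one. -/
abbrev T : GSym 𝒲 →ₗ[𝕜] GSym 𝒲 := L.noδ.d ∘ₗ G.H

theorem T_mem_wt {ρ : ℕ → ℤ} {κ κ' : ℤ} (hρ : ∀ r, ρ r = ρ (r + 1) + κ)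
    (hρ' : ∀ r s, ρ (r + s) = ρ r + ρ s + κ') {n : ℤ} {x : GSym 𝒲} (hx : x ∈ wt 𝒲 ρ n) :
    G.T x ∈ wt 𝒲 ρ (n + κ + κ') :=
  L.noδ_d_mem_wt hρ' (G.H_mem_wt hρ hx)

/-- The operator `T` lowers word length by one, hence is locally nilpotent. -/
theorem T_nil (x : GSym 𝒲) : ∃ N, (G.T ^ N) x = 0 := by
  have hlen : ∀ n : ℤ, wt 𝒲 (fun _ => 1) n ≤ Module.End.maxGenEigenspace G.T 0 := by
    intro n x hx
    rw [Module.End.mem_maxGenEigenspace]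
    refine ⟨(n + 1).toNat, ?_⟩
    rw [zero_smul, sub_zero]
    have h : ∀ N : ℕ, (G.T ^ N) x ∈ wt 𝒲 (fun _ => 1) (n - N) := by
      intro N
      induction N with
      | zero => simpa using hx
      | succ N ih =>
        rw [pow_succ', Module.End.mul_apply]
        exact wt_cast 𝒲 (by push_cast; ring)
          (G.T_mem_wt (κ := 0) (κ' := -1) (fun _ => by simp) (fun _ _ => by simp) ih)
    refine eq_zero_of_mem_wt 𝒲 (AddSubmonoid.nonneg ℤ) (fun r hr => ?_) ?_ (h _)
    · exact absurd (by simp) hr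
    · simp only [AddSubmonoid.mem_nonneg]
      omega
  have hx : x ∈ Module.End.maxGenEigenspace G.T 0 := by
    have := iSup_le hlen
    rw [iSup_wt] at this
    exact this trivial
  simpa [Module.End.mem_maxGenEigenspace] using hx

/-- The perturbation operator `∑_j (q H)^j`, where `q` is the quadratic part of the differential. -/
def A : GSym 𝒲 →ₗ[𝕜] GSym 𝒲 := geom G.T

theorem A_eq (x : GSym 𝒲) : G.A x = x + L.noδ.d (G.H (G.A x)) := geom_eq_add_apply G.T_nil x
theorem A_eq' (x : GSym 𝒲) : G.A x = x + G.A (L.noδ.d (G.H x)) := geom_eq_add_geom G.T_nil x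
theorem A_of_eq_zero {x : GSym 𝒲} (h : L.noδ.d (G.H x) = 0) : G.A x = x := geom_of_eq_zero G.T_nil h

theorem A_H (x : GSym 𝒲) : G.A (G.H x) = G.H x :=
  G.A_of_eq_zero (by rw [G.H_H, map_zero])

theorem A_I (y : GSym 𝒱) : G.A (G.I y) = G.I y :=
  G.A_of_eq_zero (by rw [G.H_I, map_zero])

/-- `A` intertwines the full differential with its linear part: since `q` vanishes on the image of
`i`, the homotopy formula gives `(1 - q H) d₀ A = d`, where `A` inverts `1 - q H`. -/
theorem A_d (x : GSym 𝒲) : G.A (L.d x) = L.linD (G.A x) := by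
  set q := L.noδ.d with hq
  have hqI : ∀ x, q (G.H (L.linD x)) = -q x - q (L.linD (G.H x)) := by
    intro x
    have h := congrArg q (G.homotopy_H x)
    rw [map_add, map_sub, G.noδ_d_I] at h
    rw [eq_sub_iff_add_eq, add_comm, h, zero_sub]
  have h1 : L.linD (G.A x) - q (G.H (L.linD (G.A x))) = L.d x := by
    rw [hqI]
    have h2 : L.linD (G.A x) = L.linD x + L.linD (q (G.H (G.A x))) := by
      rw [← map_add]
      exact congrArg _ (G.A_eq x)
    have h3 : q (G.A x) = q x := by
      rw [G.A_eq x, map_add, L.noδ.d_d, add_zero]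
    rw [h3, h2, L.linD_noδ_d, L.d_eq]
    abel
  rw [← h1, map_sub]
  have h4 := G.A_eq' (L.linD (G.A x))
  rw [← sub_eq_iff_eq_add] at h4
  exact h4

theorem P_A_d (x : GSym 𝒲) : G.P (G.A (L.d x)) = 0 := by rw [A_d, P_linD]

theorem d_I (y : GSym 𝒱) : L.d (G.I y) = 0 := by rw [L.d_eq, linD_I, noδ_d_I, add_zero]

/-- The homotopy formula of the perturbed retract. -/
theorem homotopy_hat (x : GSym 𝒲) :
    L.d (G.H (G.A x)) + G.H (G.A (L.d x)) = G.I (G.P (G.A x)) - x := by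
  rw [A_d, L.d_eq, add_right_comm, G.homotopy_H]
  have := G.A_eq x
  rw [← sub_eq_iff_eq_add'] at this
  rw [← this]
  abel

theorem H_mem {n : ℤ} {x : GSym 𝒲} (hx : x ∈ gr 𝒲 n) : G.H x ∈ gr 𝒲 (n - 1) := by
  rw [gr_eq_wt] at hx ⊢
  exact wt_cast 𝒲 (by ring) (G.H_mem_wt (κ := -1) (fun r => by push_cast; ring) hx)

theorem A_mem {n : ℤ} {x : GSym 𝒲} (hx : x ∈ gr 𝒲 n) : G.A x ∈ gr 𝒲 n := by
  obtain ⟨N, hN⟩ := G.T_nil x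
  rw [A, geom_eq_sum G.T_nil hN]
  refine Submodule.sum_mem _ fun j hj => ?_
  clear hj
  induction j with
  | zero => exact hx
  | succ j ih =>
    rw [pow_succ', Module.End.mul_apply]
    have := L.noδ.d_mem (G.H_mem ih)
    rwa [sub_add_cancel] at this

end GenRetract

end Perturbation

/-! ### Integration of compactly supported functions along coordinate lines -/

section LineIntegral

open Filter Topology

variable {𝕜 : Type} [RCLike 𝕜] {m : ℕ}

theorem Cc.exists_bound {U : Set (Fin m → ℝ)} (f : Cc 𝕜 U) :
    ∃ B : ℝ, 1 ≤ B ∧ ∀ x i, B < |x i| → f.1 x = 0 := by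
  obtain ⟨R, hR⟩ := f.2.2.1.isBounded.exists_norm_le
  refine ⟨max R 1, le_max_right _ _, fun x i hx => ?_⟩
  refine image_eq_zero_of_notMem_tsupport fun hxs => ?_
  have h1 := hR x hxs
  have h2 := norm_le_pi_norm x i
  rw [Real.norm_eq_abs] at h2
  exact absurd hx (not_lt.2 ((h2.trans h1).trans (le_max_left _ _)))

/-- A smooth function vanishing outside a bounded set is compactly supported. -/
theorem mem_Cc_univ {f : (Fin m → ℝ) → 𝕜} (hf : ContDiff ℝ ∞ f) {B : ℝ}
    (hB : ∀ x i, B < |x i| → f x = 0) : f ∈ Cc 𝕜 (Set.univ : Set (Fin m → ℝ)) := by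
  refine ⟨hf, HasCompactSupport.intro (K := Metric.closedBall 0 (max B 0))
    (isCompact_closedBall _ _) fun x hx => ?_, Set.subset_univ _⟩
  rw [mem_closedBall_zero_iff, pi_norm_le_iff_of_nonneg (le_max_right _ _)] at hx
  push Not at hx
  obtain ⟨i, hi⟩ := hx
  exact hB x i ((le_max_left _ _).trans_lt hi)

variable (μ : Measure ℝ) [IsLocallyFiniteMeasure μ] (j : Fin m)

/-- The integral of `f` along the line through `x` in the negative direction of the `j`-th
coordinate, with respect to a measure on the line. -/
def lineInt (f : (Fin m → ℝ) → 𝕜) (x : Fin m → ℝ) : 𝕜 :=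
  ∫ s, f (x - s • (Pi.single j 1 : Fin m → ℝ)) ∂μ

theorem sub_smul_single_self (x : Fin m → ℝ) (s : ℝ) :
    (x - s • (Pi.single j 1 : Fin m → ℝ)) j = x j - s := by simp

theorem sub_smul_single_of_ne {i : Fin m} (h : i ≠ j) (x : Fin m → ℝ) (s : ℝ) :
    (x - s • (Pi.single j 1 : Fin m → ℝ)) i = x i := by simp [h]

variable (f : Cc 𝕜 (Set.univ : Set (Fin m → ℝ)))

theorem continuous_line (x : Fin m → ℝ) :
    Continuous fun s : ℝ => f.1 (x - s • (Pi.single j 1 : Fin m → ℝ)) :=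
  f.2.1.continuous.comp (by fun_prop)

theorem hasCompactSupport_line (x : Fin m → ℝ) :
    HasCompactSupport fun s : ℝ => f.1 (x - s • (Pi.single j 1 : Fin m → ℝ)) := by
  obtain ⟨B, -, hB⟩ := Cc.exists_bound f
  refine HasCompactSupport.intro (K := Set.Icc (x j - B) (x j + B)) isCompact_Icc fun s hs => ?_
  refine hB _ j ?_
  rw [sub_smul_single_self]
  by_contra h
  rw [not_lt, abs_le] at h
  exact hs ⟨by linarith, by linarith⟩

theorem integrable_line (x : Fin m → ℝ) :
    Integrable (fun s : ℝ => f.1 (x - s • (Pi.single j 1 : Fin m → ℝ))) μ :=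
  (continuous_line j f x).integrable_of_hasCompactSupport (hasCompactSupport_line j f x)

/-- Smoothness holds since a line integral is a convolution with parameters. -/
theorem contDiff_lineInt : ContDiff ℝ ∞ (lineInt μ j f.1) := by
  rw [contDiff_iff_contDiffAt]
  intro x₀
  obtain ⟨B, -, hB⟩ := Cc.exists_bound f
  have h := contDiffOn_convolution_right_with_param_comp (n := ⊤) (μ := μ)
    (ContinuousLinearMap.lsmul ℝ ℝ : ℝ →L[ℝ] 𝕜 →L[ℝ] 𝕜) (s := Metric.ball x₀ 1)
    (v := fun _ : Fin m → ℝ => (0 : ℝ)) contDiffOn_const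
    (f := fun _ : ℝ => (1 : ℝ)) (g := fun p u => f.1 (p + u • (Pi.single j 1 : Fin m → ℝ)))
    (k := Metric.closedBall 0 (B + ‖x₀‖ + 1)) Metric.isOpen_ball (isCompact_closedBall _ _)
    (fun p u hp hu => hB _ j ?_) (continuous_const.locallyIntegrable)
    (f.2.1.comp (by fun_prop)).contDiffOn
  · have h' := h.contDiffAt (Metric.isOpen_ball.mem_nhds (Metric.mem_ball_self one_pos))
    refine h'.congr_of_eventuallyEq (Eventually.of_forall fun x => ?_)
    simp only [convolution, lineInt]
    refine integral_congr_ae (Eventually.of_forall fun s => ?_)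
    simp [sub_eq_add_neg]
  · rw [mem_closedBall_zero_iff, not_le, Real.norm_eq_abs] at hu
    have h1 : ‖p‖ < ‖x₀‖ + 1 := by
      have := norm_sub_norm_le p x₀
      rw [mem_ball_iff_norm] at hp
      linarith
    have h2 := norm_le_pi_norm p j
    rw [Real.norm_eq_abs] at h2
    have h3 : (p + u • (Pi.single j 1 : Fin m → ℝ)) j = p j + u := by simp
    rw [h3]
    have h4 := abs_sub_abs_le_abs_sub u (-p j)
    rw [abs_neg, sub_neg_eq_add, add_comm u] at h4
    linarith

/-- Differentiation under the integral sign. -/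
theorem fderiv_lineInt (i : Fin m) (x : Fin m → ℝ) :
    fderiv ℝ (lineInt μ j f.1) x (Pi.single i 1) = lineInt μ j (Cc.pd i f).1 x := by
  obtain ⟨B, -, hB⟩ := Cc.exists_bound (Cc.pd i f)
  obtain ⟨C, hC⟩ := (Cc.pd i f).2.2.1.exists_bound_of_continuous (Cc.pd i f).2.1.continuous
  have hd := ((contDiff_lineInt μ j f).differentiable (by simp) x).hasFDerivAt
  set v : Fin m → ℝ := Pi.single i 1 with hv
  have h1 : HasDerivAt (fun h : ℝ => lineInt μ j f.1 (x + h • v))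
      (fderiv ℝ (lineInt μ j f.1) x v) 0 := by
    have hl : HasDerivAt (fun h : ℝ => x + h • v) v 0 := by
      simpa using ((hasDerivAt_id (0 : ℝ)).smul_const v).const_add x
    have hd' : HasFDerivAt (lineInt μ j f.1) (fderiv ℝ (lineInt μ j f.1) x)
      (x + (0 : ℝ) • v) := by simpa using hd
    exact hd'.comp_hasDerivAt 0 hl
  have h2 := (hasDerivAt_integral_of_dominated_loc_of_deriv_le (μ := μ) (𝕜 := ℝ)
    (F := fun h s => f.1 (x + h • v - s • (Pi.single j 1 : Fin m → ℝ)))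
    (F' := fun h s => (Cc.pd i f).1 (x + h • v - s • (Pi.single j 1 : Fin m → ℝ))) (x₀ := 0)
    -- for small `h` all integrands are supported in one interval
    (bound := (Set.Icc (x j - (B + 1)) (x j + (B + 1))).indicator fun _ => C)
    (Metric.ball_mem_nhds 0 one_pos)
    (Eventually.of_forall fun h => (continuous_line j f _).aestronglyMeasurable)
    (integrable_line μ j f _) (continuous_line j (Cc.pd i f) _).aestronglyMeasurable
    (Eventually.of_forall fun s h hh => ?_) ?_ (Eventually.of_forall fun s h _ => ?_)).2
  · rw [h1.unique h2]
    simp [lineInt]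
  · by_cases hs : s ∈ Set.Icc (x j - (B + 1)) (x j + (B + 1))
    · rw [Set.indicator_of_mem hs]
      exact hC _
    · rw [Set.indicator_of_notMem hs, hB _ j, norm_zero]
      rw [sub_smul_single_self]
      by_contra hle
      refine hs ?_
      rw [not_lt, abs_le] at hle
      rw [mem_ball_zero_iff, Real.norm_eq_abs, abs_lt] at hh
      have hvj : (x + h • v) j = x j + h * v j := by simp
      have hv1 : v j = 0 ∨ v j = 1 := by
        rw [hv, Pi.single_apply]
        split_ifs <;> simp
      rw [hvj] at hle
      rcases hv1 with h0 | h0 <;> rw [h0] at hle <;> constructor <;>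
          linarith [hle.1, hle.2, hh.1, hh.2]
  · exact (integrable_indicator_iff measurableSet_Icc).2
      (continuous_const.integrableOn_Icc)
  · have hl : HasDerivAt (fun h : ℝ => x + h • v - s • (Pi.single j 1 : Fin m → ℝ)) v h := by
      simpa using ((((hasDerivAt_id h).smul_const v).const_add x).sub_const
        (s • (Pi.single j 1 : Fin m → ℝ)))
    exact (Cc.differentiable f _).hasFDerivAt.comp_hasDerivAt h hl

theorem hasDerivAt_line (x : Fin m → ℝ) (s : ℝ) :
    HasDerivAt (fun s : ℝ => -f.1 (x - s • (Pi.single j 1 : Fin m → ℝ)))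
      ((Cc.pd j f).1 (x - s • (Pi.single j 1 : Fin m → ℝ))) s := by
  have hl : HasDerivAt (fun s : ℝ => x - s • (Pi.single j 1 : Fin m → ℝ))
      (-(Pi.single j 1 : Fin m → ℝ)) s := by
    simpa using ((hasDerivAt_id s).smul_const (Pi.single j 1 : Fin m → ℝ)).const_sub x
  have := ((Cc.differentiable f _).hasFDerivAt.comp_hasDerivAt s hl).neg
  have h : (Cc.pd j f).1 (x - s • (Pi.single j 1 : Fin m → ℝ)) =
      -(fderiv ℝ f.1 (x - s • (Pi.single j 1 : Fin m → ℝ))) (-(Pi.single j 1 : Fin m → ℝ)) := by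
    rw [map_neg, neg_neg]
    rfl
  rw [h]
  exact this

theorem tendsto_line (x : Fin m → ℝ) {l : Filter ℝ} (hl : l ≤ cocompact ℝ) :
    Tendsto (fun s : ℝ => -f.1 (x - s • (Pi.single j 1 : Fin m → ℝ))) l (𝓝 0) := by
  have := (hasCompactSupport_line j f x).is_zero_at_infty.mono_left hl
  simpa using this.neg

theorem lineInt_Ioi_pd (x : Fin m → ℝ) :
    lineInt (volume.restrict (Set.Ioi 0)) j (Cc.pd j f).1 x = f.1 x := by
  rw [lineInt, integral_Ioi_of_hasDerivAt_of_tendsto' (fun s _ => hasDerivAt_line j f x s)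
    (integrable_line volume j (Cc.pd j f) x).integrableOn
    (tendsto_line j f x _root_.atTop_le_cocompact)]
  simp

theorem lineInt_volume_pd (x : Fin m → ℝ) : lineInt volume j (Cc.pd j f).1 x = 0 := by
  rw [lineInt, integral_of_hasDerivAt_of_tendsto (fun s => hasDerivAt_line j f x s)
    (integrable_line volume j (Cc.pd j f) x)
    (tendsto_line j f x _root_.atBot_le_cocompact) (tendsto_line j f x _root_.atTop_le_cocompact),
    sub_zero]

theorem lineInt_volume_eq (x : Fin m → ℝ) (f : (Fin m → ℝ) → 𝕜) :
    lineInt volume j f x = ∫ t, f (Function.update x j t) := by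
  rw [lineInt, ← integral_sub_left_eq_self _ volume (x j)]
  refine integral_congr_ae (Eventually.of_forall fun s => ?_)
  simp only
  congr 1
  funext i
  by_cases h : i = j
  · subst h; simp
  · simp [h]

theorem lineInt_add (g : Cc 𝕜 (Set.univ : Set (Fin m → ℝ))) (x : Fin m → ℝ) :
    lineInt μ j (f + g).1 x = lineInt μ j f.1 x + lineInt μ j g.1 x :=
  integral_add (integrable_line μ j f x) (integrable_line μ j g x)

theorem lineInt_smul (c : 𝕜) (x : Fin m → ℝ) :
    lineInt μ j (c • f).1 x = c * lineInt μ j f.1 x :=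
  integral_const_mul c _

theorem lineInt_eq_zero {B : ℝ} (hB : ∀ x i, B < |x i| → f.1 x = 0) {i : Fin m} (hi : i ≠ j)
    {x : Fin m → ℝ} (hx : B < |x i|) : lineInt μ j f.1 x = 0 := by
  rw [lineInt, ← integral_zero ℝ 𝕜 (μ := μ)]
  refine integral_congr_ae (Eventually.of_forall fun s => hB _ i ?_)
  rwa [sub_smul_single_of_ne j hi]

/-- The function `ρ(x_j)` with `ρ` the derivative of the smooth transition function. -/
def bumpAt (x : Fin m → ℝ) : 𝕜 := ((deriv Real.smoothTransition (x j) : ℝ) : 𝕜)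

/-- The function `R(x_j)` with `R` the smooth transition function. -/
def stepAt (x : Fin m → ℝ) : 𝕜 := ((Real.smoothTransition (x j) : ℝ) : 𝕜)

theorem contDiff_stepAt : ContDiff ℝ ∞ (stepAt (𝕜 := 𝕜) j) :=
  (RCLike.ofRealCLM (K := 𝕜)).contDiff.comp (g := fun t : ℝ => (t : 𝕜))
    (Real.smoothTransition.contDiff.comp (contDiff_apply ℝ ℝ j))

theorem contDiff_bumpAt : ContDiff ℝ ∞ (bumpAt (𝕜 := 𝕜) j) :=
  (RCLike.ofRealCLM (K := 𝕜)).contDiff.comp (g := fun t : ℝ => (t : 𝕜))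
    (((contDiff_infty_iff_deriv.1 Real.smoothTransition.contDiff).2).comp (contDiff_apply ℝ ℝ j))

theorem fderiv_stepAt (i : Fin m) (x : Fin m → ℝ) :
    fderiv ℝ (stepAt (𝕜 := 𝕜) j) x (Pi.single i 1) = if i = j then bumpAt j x else 0 := by
  have h1 : HasFDerivAt (fun x : Fin m → ℝ => x j) (ContinuousLinearMap.proj j) x :=
    (ContinuousLinearMap.proj (R := ℝ) (φ := fun _ : Fin m => ℝ) j).hasFDerivAt
  have h2 : HasDerivAt Real.smoothTransition (deriv Real.smoothTransition (x j)) (x j) :=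
    ((Real.smoothTransition.contDiff (n := 1)).differentiable (by simp) _).hasDerivAt
  have h3 := (RCLike.ofRealCLM (K := 𝕜)).hasFDerivAt.comp x (h2.comp_hasFDerivAt x h1)
  have h4 : fderiv ℝ (stepAt (𝕜 := 𝕜) j) x = _ := h3.fderiv
  rw [h4]
  by_cases h : i = j
  · subst h
    simp only [ContinuousLinearMap.comp_apply, smul_apply,
      ContinuousLinearMap.proj_apply, Pi.single_eq_same, smul_eq_mul, mul_one, if_true,
      RCLike.ofRealCLM_apply, bumpAt]
  · simp [h, Ne.symm h]

theorem stepAt_of_nonpos {x : Fin m → ℝ} (h : x j ≤ 0) : stepAt (𝕜 := 𝕜) j x = 0 := by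
  simp [stepAt, Real.smoothTransition.zero_of_nonpos h]

theorem stepAt_of_one_le {x : Fin m → ℝ} (h : 1 ≤ x j) : stepAt (𝕜 := 𝕜) j x = 1 := by
  simp [stepAt, Real.smoothTransition.one_of_one_le h]

theorem bumpAt_eq_zero {x : Fin m → ℝ} (h : 1 < |x j|) : bumpAt (𝕜 := 𝕜) j x = 0 := by
  have : deriv Real.smoothTransition (x j) = 0 := by
    rcases lt_abs.1 h with h | h
    · have : Real.smoothTransition =ᶠ[𝓝 (x j)] fun _ => 1 :=
        (eventually_gt_nhds h).mono fun y hy => Real.smoothTransition.one_of_one_le hy.le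
      rw [this.deriv_eq, deriv_const]
    · have : Real.smoothTransition =ᶠ[𝓝 (x j)] fun _ => 0 :=
        (eventually_lt_nhds (b := 0) (by linarith)).mono fun y hy =>
          Real.smoothTransition.zero_of_nonpos hy.le
      rw [this.deriv_eq, deriv_const]
  simp [bumpAt, this]

/-- The operator `π_j`: integrate along the `j`-th coordinate and multiply by `ρ(x_j)`. -/
def lineProj : Cc 𝕜 (Set.univ : Set (Fin m → ℝ)) →ₗ[𝕜] Cc 𝕜 (Set.univ : Set (Fin m → ℝ)) where
  toFun f := ⟨fun x => bumpAt j x * lineInt volume j f.1 x, by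
    obtain ⟨B, hB1, hB⟩ := Cc.exists_bound f
    refine mem_Cc_univ ((contDiff_bumpAt j).mul (contDiff_lineInt _ j f)) (B := B)
      fun x i hx => ?_
    by_cases h : i = j
    · subst h
      rw [bumpAt_eq_zero i (hB1.trans_lt hx), zero_mul]
    · rw [lineInt_eq_zero _ j f hB h hx, mul_zero]⟩
  map_add' f g := by
    ext x
    simp only [lineInt_add, mul_add]
    rfl
  map_smul' c f := by
    ext x
    simp only [lineInt_smul, mul_left_comm _ c]
    rfl

theorem lineProj_apply (x : Fin m → ℝ) :
    (lineProj j f).1 x = bumpAt j x * lineInt volume j f.1 x := rfl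

/-- The operator `P_j`: the primitive of `f - π_j f` along the `j`-th coordinate. -/
def linePrim : Cc 𝕜 (Set.univ : Set (Fin m → ℝ)) →ₗ[𝕜] Cc 𝕜 (Set.univ : Set (Fin m → ℝ)) where
  toFun f := ⟨fun x => lineInt (volume.restrict (Set.Ioi 0)) j f.1 x -
      stepAt j x * lineInt volume j f.1 x, by
    obtain ⟨B, hB1, hB⟩ := Cc.exists_bound f
    refine mem_Cc_univ ((contDiff_lineInt _ j f).sub
      ((contDiff_stepAt j).mul (contDiff_lineInt _ j f))) (B := B) fun x i hx => ?_
    by_cases h : i = j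
    · subst h
      rcases lt_abs.1 hx with hx | hx
      · rw [stepAt_of_one_le i (by linarith), one_mul, sub_eq_zero, lineInt, lineInt]
        refine setIntegral_eq_integral_of_forall_compl_eq_zero fun s hs => hB _ i ?_
        rw [sub_smul_single_self, lt_abs]
        have : s ≤ 0 := not_lt.1 hs
        left
        linarith
      · rw [stepAt_of_nonpos i (by linarith), zero_mul, sub_zero, lineInt]
        refine setIntegral_eq_zero_of_forall_eq_zero fun s hs => hB _ i ?_
        rw [sub_smul_single_self, lt_abs]
        have : 0 < s := hs
        right
        linarith
    · rw [lineInt_eq_zero _ j f hB h hx, lineInt_eq_zero _ j f hB h hx, mul_zero, sub_zero]⟩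
  map_add' f g := by
    ext x
    simp only [lineInt_add, mul_add, add_sub_add_comm]
    rfl
  map_smul' c f := by
    ext x
    simp only [lineInt_smul, mul_left_comm _ c, ← mul_sub]
    rfl

theorem linePrim_apply (x : Fin m → ℝ) : (linePrim j f).1 x =
    lineInt (volume.restrict (Set.Ioi 0)) j f.1 x - stepAt j x * lineInt volume j f.1 x := rfl

theorem pd_linePrim_apply (i : Fin m) (x : Fin m → ℝ) : (Cc.pd i (linePrim j f)).1 x =
    lineInt (volume.restrict (Set.Ioi 0)) j (Cc.pd i f).1 x -
      ((if i = j then bumpAt j x else 0) * lineInt volume j f.1 x +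
        stepAt j x * lineInt volume j (Cc.pd i f).1 x) := by
  have h : (linePrim j f).1 = fun x => lineInt (volume.restrict (Set.Ioi 0)) j f.1 x -
    stepAt j x * lineInt volume j f.1 x := rfl
  have h1 := (contDiff_lineInt (volume.restrict (Set.Ioi 0)) j f).differentiable (by simp) x
  have h2 := (contDiff_lineInt volume j f).differentiable (by simp) x
  have h3 := (contDiff_stepAt (𝕜 := 𝕜) j).differentiable (by simp) x
  simp only [Cc.pd, LinearMap.coe_mk, AddHom.coe_mk]
  rw [h, fderiv_fun_sub h1 (h3.fun_mul h2), fderiv_fun_mul h3 h2]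
  simp only [sub_apply, add_apply, smul_apply, fderiv_lineInt, fderiv_stepAt, smul_eq_mul]
  simp only [Cc.pd, LinearMap.coe_mk, AddHom.coe_mk]
  ring

theorem pd_linePrim_self : Cc.pd j (linePrim j f) = f - lineProj j f := by
  ext x
  rw [pd_linePrim_apply, lineInt_Ioi_pd, lineInt_volume_pd, if_pos rfl, mul_zero, add_zero]
  rfl

theorem linePrim_pd_self : linePrim j (Cc.pd j f) = f := by
  ext x
  rw [linePrim_apply, lineInt_Ioi_pd, lineInt_volume_pd, mul_zero, sub_zero]

theorem pd_linePrim_of_ne {i : Fin m} (h : i ≠ j) :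
    Cc.pd i (linePrim j f) = linePrim j (Cc.pd i f) := by
  ext x
  rw [pd_linePrim_apply, if_neg h, zero_mul, zero_add, linePrim_apply]

/-- The function `x ↦ g x` depends on `x_j` through the factor `ρ(x_j)`. -/
def IsBumpAlong (g : (Fin m → ℝ) → 𝕜) : Prop :=
  ∀ x (s t : ℝ), g (Function.update x j s) * ((deriv Real.smoothTransition t : ℝ) : 𝕜) =
    g (Function.update x j t) * ((deriv Real.smoothTransition s : ℝ) : 𝕜)

theorem isBumpAlong_lineProj : IsBumpAlong j (lineProj j f).1 := by
  intro x s t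
  rw [lineProj_apply, lineProj_apply, lineInt_volume_eq, lineInt_volume_eq]
  simp only [Function.update_idem, bumpAt, Function.update_self]
  ring

theorem IsBumpAlong.lineProj {i : Fin m} (h : IsBumpAlong j f.1) (hij : i ≠ j) :
    IsBumpAlong j (lineProj i f).1 := by
  intro x s t
  rw [lineProj_apply, lineProj_apply, lineInt_volume_eq, lineInt_volume_eq]
  simp only [bumpAt, Function.update_of_ne hij, Function.update_comm hij.symm]
  rw [mul_assoc, mul_assoc, ← integral_mul_const, ← integral_mul_const]
  congr 1
  exact integral_congr_ae (Eventually.of_forall fun u => h _ s t)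

/-- Functions with a bump along every coordinate are proportional. -/
theorem IsBumpAlong.proportional {g : (Fin m → ℝ) → 𝕜} (h : ∀ j, IsBumpAlong j g)
    (x y : Fin m → ℝ) : g x * ∏ j, bumpAt j y = g y * ∏ j, bumpAt j x := by
  have key : ∀ s : Finset (Fin m), g (s.piecewise x y) * ∏ j ∈ s, bumpAt j y =
      g y * ∏ j ∈ s, bumpAt j x := by
    intro s
    induction s using Finset.induction_on with
    | empty => simp
    | insert a s ha ih =>
      rw [Finset.prod_insert ha, Finset.prod_insert ha, Finset.piecewise_insert]
      have h1 := h a (s.piecewise x y) (x a) (y a)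
      have h2 : Function.update (s.piecewise x y) a (y a) = s.piecewise x y := by
        rw [Function.update_eq_self_iff, Finset.piecewise_eq_of_notMem _ _ _ ha]
      rw [h2] at h1
      simp only [bumpAt] at ih ⊢
      rw [← mul_assoc, h1, mul_right_comm, ih]
      ring
  simpa using key Finset.univ

theorem exists_bump_ne_zero : ∃ t : ℝ, deriv Real.smoothTransition t ≠ 0 := by
  by_contra h
  push Not at h
  have := is_const_of_deriv_eq_zero
    ((Real.smoothTransition.contDiff (n := 1)).differentiable (by simp)) h 0 1
  rw [Real.smoothTransition.zero, Real.smoothTransition.one] at this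
  exact zero_ne_one this

end LineIntegral

/-! ### Operators on forms -/

section FormOperators

variable {𝕜 : Type} [RCLike 𝕜] {m : ℕ}

theorem cgr_induction {N : ℕ → Submodule 𝕜 (CForm 𝕜 m)} (h1 : (1 : CForm 𝕜 m) ∈ N 0)
    (h : ∀ r j, ∀ a ∈ cgr 𝕜 m r, a ∈ N r → dx 𝕜 j * a ∈ N (r + 1)) {r : ℕ} {a : CForm 𝕜 m}
    (ha : a ∈ cgr 𝕜 m r) : a ∈ N r := by
  suffices H : cgr 𝕜 m r ≤ cgr 𝕜 m r ⊓ N r from (H ha).2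
  clear ha
  induction r with
  | zero =>
    intro a ha
    refine ⟨ha, ?_⟩
    simp only [cgr, pow_zero, Submodule.one_eq_range, LinearMap.mem_range] at ha
    obtain ⟨c, rfl⟩ := ha
    rw [Algebra.linearMap_apply, Algebra.algebraMap_eq_smul_one]
    exact (N 0).smul_mem c h1
  | succ r ih =>
    intro a ha
    refine ⟨ha, ?_⟩
    rw [cgr, ExteriorAlgebra.exteriorPower, pow_succ'] at ha
    refine Submodule.mul_induction_on ha ?_ fun x y => (N (r + 1)).add_mem
    rintro _ ⟨v, rfl⟩ b hb
    have hv : ExteriorAlgebra.ι 𝕜 v = ∑ j, v j • dx 𝕜 j := by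
      simp only [dx, ← map_smul, ← map_sum]
      congr 1
      ext i
      simp [Finset.sum_apply, Pi.single_apply]
    rw [hv, Finset.sum_mul]
    refine Submodule.sum_mem _ fun j _ => ?_
    rw [smul_mul_assoc]
    exact (N (r + 1)).smul_mem _ (h r j b hb (ih hb).2)

theorem cgr_eq_zero {r : ℕ} (hr : m < r) {a : CForm 𝕜 m} (ha : a ∈ cgr 𝕜 m r) : a = 0 := by
  rw [cgr, ← ExteriorAlgebra.ιMulti_span_fixedDegree 𝕜 (M := Fin m → 𝕜) r] at ha
  refine (Submodule.span_le.2 ?_ : _ ≤ (⊥ : Submodule 𝕜 (CForm 𝕜 m))) ha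
  rintro _ ⟨v, rfl⟩
  refine AlternatingMap.map_linearDependent _ v fun hv => ?_
  have := hv.fintype_card_le_finrank
  simp at this
  omega

variable (𝕜 m) in
/-- The form `dx_1 ∧ ⋯ ∧ dx_m`. -/
def topForm : CForm 𝕜 m := ExteriorAlgebra.ιMulti 𝕜 m fun i => Pi.single i 1

theorem topForm_mem : topForm 𝕜 m ∈ cgr 𝕜 m m :=
  ExteriorAlgebra.ιMulti_range 𝕜 m ⟨_, rfl⟩

theorem topCoeff_ιMulti (v : Fin m → Fin m → 𝕜) :
    topCoeff (ExteriorAlgebra.ιMulti 𝕜 m v) = Matrix.det (Matrix.of v) := by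
  rw [topCoeff, ExteriorAlgebra.liftAlternating_apply_ιMulti, Pi.single_eq_same]
  rfl

theorem topCoeff_topForm : topCoeff (topForm 𝕜 m) = 1 := by
  rw [topForm, topCoeff_ιMulti, ← Matrix.det_one (n := Fin m)]
  congr 1
  ext i j
  simp [Matrix.one_apply, Pi.single_apply, eq_comm]

theorem eq_smul_topForm {a : CForm 𝕜 m} (ha : a ∈ cgr 𝕜 m m) : a = topCoeff a • topForm 𝕜 m := by
  rw [cgr, ← ExteriorAlgebra.ιMulti_span_fixedDegree 𝕜 (M := Fin m → 𝕜) m] at ha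
  suffices h : a ∈ LinearMap.ker (topCoeff.smulRight (topForm 𝕜 m) - LinearMap.id) by
    rw [LinearMap.mem_ker, LinearMap.sub_apply, sub_eq_zero] at h
    exact h.symm
  refine (Submodule.span_le.2 ?_) ha
  rintro _ ⟨v, rfl⟩
  have h : (LinearMap.toSpanSingleton 𝕜 _ (topForm 𝕜 m)).compAlternatingMap
      Matrix.detRowAlternating = ExteriorAlgebra.ιMulti 𝕜 m := by
    refine Module.Basis.ext_alternating (Pi.basisFun 𝕜 (Fin m)) fun σ hσ => ?_
    have h1 := fun f : (Fin m → 𝕜) [⋀^Fin m]→ₗ[𝕜] CForm 𝕜 m =>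
      f.map_perm (Pi.basisFun 𝕜 (Fin m)) (Equiv.ofBijective σ (Finite.injective_iff_bijective.1 hσ))
    refine (h1 _).trans (Eq.trans ?_ (h1 _).symm)
    congr 1
    have h2 : (fun i => Pi.basisFun 𝕜 (Fin m) i) = fun i : Fin m => Pi.single i (1 : 𝕜) := by
      ext i
      simp
    have h3 := topCoeff_topForm (𝕜 := 𝕜) (m := m)
    rw [topForm, topCoeff_ιMulti] at h3
    change Matrix.det (Matrix.of fun i => Pi.basisFun 𝕜 (Fin m) i) • topForm 𝕜 m =
      ExteriorAlgebra.ιMulti 𝕜 m fun i => Pi.basisFun 𝕜 (Fin m) i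
    rw [h2, h3, one_smul]
    rfl
  rw [SetLike.mem_coe, LinearMap.mem_ker, LinearMap.sub_apply, sub_eq_zero]
  refine Eq.trans ?_ (congrArg (fun f => f v) h)
  rw [LinearMap.smulRight_apply, topCoeff_ιMulti]
  rfl

/-- The contraction with the `j`-th coordinate vector field. -/
def contr (j : Fin m) : CForm 𝕜 m →ₗ[𝕜] CForm 𝕜 m :=
  CliffordAlgebra.contractLeft (Q := (0 : QuadraticForm 𝕜 (Fin m → 𝕜))) (LinearMap.proj j)

theorem contr_one (j : Fin m) : contr j (1 : CForm 𝕜 m) = 0 :=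
  CliffordAlgebra.contractLeft_one (Q := (0 : QuadraticForm 𝕜 (Fin m → 𝕜))) _

theorem contr_dx_mul (i j : Fin m) (a : CForm 𝕜 m) :
    contr j (dx 𝕜 i * a) = (if i = j then a else 0) - dx 𝕜 i * contr j a := by
  refine (CliffordAlgebra.contractLeft_ι_mul (Q := (0 : QuadraticForm 𝕜 (Fin m → 𝕜)))
    (d := LinearMap.proj j) (Pi.single i 1) a).trans ?_
  congr 1
  rw [LinearMap.proj_apply, Pi.single_apply]
  simp only [eq_comm (a := j)]
  split_ifs <;> simp

theorem contr_mem (j : Fin m) {r : ℕ} {a : CForm 𝕜 m} (ha : a ∈ cgr 𝕜 m (r + 1)) :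
    contr j a ∈ cgr 𝕜 m r := by
  have := cgr_induction (𝕜 := 𝕜) (m := m)
    (N := fun r => Nat.casesOn (motive := fun _ => Submodule 𝕜 (CForm 𝕜 m)) r
    (LinearMap.ker (contr (𝕜 := 𝕜) j))
    fun r => (cgr 𝕜 m r).comap (contr j)) (contr_one j) (fun r i a ha h => ?_) ha
  · exact this
  · change contr j (dx 𝕜 i * a) ∈ cgr 𝕜 m r
    rw [contr_dx_mul]
    refine Submodule.sub_mem _ (by split_ifs; exacts [ha, Submodule.zero_mem _]) ?_
    cases r with
    | zero =>
      rw [show contr j a = 0 from h, mul_zero]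
      exact Submodule.zero_mem _
    | succ r =>
      rw [add_comm r 1]
      exact cgr_mul (dx_mem i) h

theorem contr_zero (j : Fin m) {a : CForm 𝕜 m} (ha : a ∈ cgr 𝕜 m 0) : contr j a = 0 := by
  have := cgr_induction (𝕜 := 𝕜) (m := m)
    (N := fun r => Nat.casesOn (motive := fun _ => Submodule 𝕜 (CForm 𝕜 m)) r
    (LinearMap.ker (contr (𝕜 := 𝕜) j))
    fun _ => ⊤) (contr_one j) (fun r i a ha h => trivial) ha
  exact this

/-- Euler's formula `∑_j dx_j ∧ ι_j a = |a| a`. -/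
theorem sum_dx_mul_contr {r : ℕ} {a : CForm 𝕜 m} (ha : a ∈ cgr 𝕜 m r) :
    ∑ j, dx 𝕜 j * contr j a = (r : 𝕜) • a := by
  have := cgr_induction (𝕜 := 𝕜) (m := m) (N := fun r => LinearMap.ker
    ((∑ j : Fin m, LinearMap.mulLeft 𝕜 (dx 𝕜 j) ∘ₗ contr (𝕜 := 𝕜) j) - (r : 𝕜) • LinearMap.id))
    (by simp [contr_one])
    (fun r i a ha h => ?_) ha
  · simpa [sub_eq_zero] using this
  · simp only [LinearMap.mem_ker, LinearMap.sub_apply, LinearMap.sum_apply, LinearMap.comp_apply,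
      LinearMap.mulLeft_apply, LinearMap.smul_apply, LinearMap.id_apply, sub_eq_zero,
      contr_dx_mul, mul_sub, Finset.sum_sub_distrib, mul_ite, mul_zero] at h ⊢
    rw [Finset.sum_ite_eq Finset.univ i, if_pos (Finset.mem_univ i)]
    have : ∀ j, dx 𝕜 j * (dx 𝕜 i * contr j a) = -(dx 𝕜 i * (dx 𝕜 j * contr j a)) := fun j => by
      rw [← mul_assoc, dx_mul_dx, neg_mul, mul_assoc]
    simp only [this, Finset.sum_neg_distrib, ← Finset.mul_sum, h, sub_neg_eq_add, mul_smul_comm]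
    push_cast
    module

namespace CT

variable {N N' N'' : Type u} [AddCommGroup N] [Module 𝕜 N] [AddCommGroup N'] [Module 𝕜 N']
  [AddCommGroup N''] [Module 𝕜 N'']

/-- The operator `a ⊗ n ↦ A a ⊗ F n`. -/
def op (A : CForm 𝕜 m →ₗ[𝕜] CForm 𝕜 m) (F : N →ₗ[𝕜] N') : CT 𝕜 m N →ₗ[𝕜] CT 𝕜 m N' :=
  lift ((tm ∘ₗ A).compl₂ F)

@[simp] theorem op_tm (A : CForm 𝕜 m →ₗ[𝕜] CForm 𝕜 m) (F : N →ₗ[𝕜] N') (a : CForm 𝕜 m) (n : N) :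
    op A F (tm a n) = tm (A a) (F n) := rfl

/-- Left multiplication by `dx_j`. -/
def dxMul (N : Type u) [AddCommGroup N] [Module 𝕜 N] (j : Fin m) : CT 𝕜 m N →ₗ[𝕜] CT 𝕜 m N :=
  op (LinearMap.mulLeft 𝕜 (dx 𝕜 j)) LinearMap.id

@[simp] theorem dxMul_tm (j : Fin m) (a : CForm 𝕜 m) (n : N) :
    dxMul N j (tm a n) = tm (dx 𝕜 j * a) n := rfl

/-- Forms are generated by functions under left multiplication by the `dx_j`. -/
theorem gr_induction {P : ℕ → Submodule 𝕜 (CT 𝕜 m N)} (h1 : ∀ n, tm 1 n ∈ P 0)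
    (h : ∀ r j, ∀ x ∈ gr 𝕜 m N r, x ∈ P r → dxMul N j x ∈ P (r + 1)) {r : ℕ} {x : CT 𝕜 m N}
    (hx : x ∈ gr 𝕜 m N r) : x ∈ P r := by
  refine gr_le (fun a ha n => ?_) hx
  exact cgr_induction (𝕜 := 𝕜) (m := m) (N := fun r => (P r).comap (tm.flip n)) (h1 n)
    (fun r j a ha h' => h r j _ (tm_mem ha n) h') ha

theorem induction {P : Submodule 𝕜 (CT 𝕜 m N)} (h1 : ∀ n, tm 1 n ∈ P)
    (h : ∀ j, ∀ x ∈ P, dxMul N j x ∈ P) (x : CT 𝕜 m N) : x ∈ P := by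
  have : LinearMap.ker P.mkQ = ⊤ := by
    rw [LinearMap.ker_eq_top]
    refine hom_ext_homog (gr 𝕜 m N) fun r x hx => ?_
    have := gr_induction (P := fun _ => P) h1 (fun _ j x _ hx => h j x hx) hx
    simpa using this
  rw [Submodule.ker_mkQ] at this
  rw [this]
  trivial

theorem gr_eq_zero {r : ℕ} (hr : m < r) {x : CT 𝕜 m N} (hx : x ∈ gr 𝕜 m N r) : x = 0 := by
  refine gr_le (P := ⊥) (fun a ha n => ?_) hx
  rw [cgr_eq_zero hr ha, map_zero]
  exact Submodule.zero_mem _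

theorem exists_tm_topForm {x : CT 𝕜 m N} (hx : x ∈ gr 𝕜 m N m) : ∃ n, x = tm (topForm 𝕜 m) n := by
  have := gr_le (P := LinearMap.range (tm (N := N) (topForm 𝕜 m))) (fun a ha n => ?_) hx
  · obtain ⟨n, rfl⟩ := this
    exact ⟨n, rfl⟩
  · refine ⟨topCoeff a • n, ?_⟩
    conv_rhs => rw [eq_smul_topForm ha]
    rw [map_smul, map_smul, LinearMap.smul_apply]

/-- Two operators of the form `∑_j dx_j ⊗ A_j` anticommute as soon as the commutators of their
coefficients are symmetric. -/
theorem d_anticomm {A B : Fin m → N →ₗ[𝕜] N}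
    (h : ∀ i j n, A i (B j n) - B j (A i n) = A j (B i n) - B i (A j n)) (x : CT 𝕜 m N) :
    d A (d B x) = -d B (d A x) := by
  refine LinearMap.congr_fun (f := d A ∘ₗ d B) (g := -(d B ∘ₗ d A)) (ext_tm fun r a _ n => ?_) x
  simp only [LinearMap.comp_apply, LinearMap.neg_apply, d_tm, map_sum]
  have hs : ∑ j, ∑ i, tm (dx 𝕜 i * (dx 𝕜 j * a)) (A i (B j n)) +
      ∑ j, ∑ i, tm (dx 𝕜 i * (dx 𝕜 j * a)) (B i (A j n)) =
      ∑ j, ∑ i, tm (dx 𝕜 i * (dx 𝕜 j * a)) (A i (B j n) - B j (A i n)) := by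
    rw [Finset.sum_comm (f := fun j i => tm (dx 𝕜 i * (dx 𝕜 j * a)) (B i (A j n))),
      ← Finset.sum_add_distrib]
    refine Finset.sum_congr rfl fun j _ => ?_
    rw [← Finset.sum_add_distrib]
    refine Finset.sum_congr rfl fun i _ => ?_
    rw [← mul_assoc (dx 𝕜 j), dx_mul_dx j i, neg_mul, mul_assoc, map_neg, LinearMap.neg_apply,
      map_sub, sub_eq_add_neg]
  rw [eq_neg_iff_add_eq_zero, hs]
  have hc := Finset.sum_comm (s := (Finset.univ : Finset (Fin m))) (t := Finset.univ)
    (f := fun j i => tm (dx 𝕜 i * (dx 𝕜 j * a)) (A i (B j n) - B j (A i n)))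
  have h' : ∀ i j : Fin m, tm (dx 𝕜 i * (dx 𝕜 j * a)) (A i (B j n) - B j (A i n)) =
      -tm (dx 𝕜 j * (dx 𝕜 i * a)) (A j (B i n) - B i (A j n)) := by
    intro i j
    rw [← mul_assoc, dx_mul_dx i j, neg_mul, mul_assoc, map_neg, LinearMap.neg_apply, h i j]
  rw [Finset.sum_congr rfl fun j _ => Finset.sum_congr rfl fun i _ => h' i j] at hc
  simp only [Finset.sum_neg_distrib] at hc
  rw [neg_eq_iff_add_eq_zero, ← two_smul 𝕜] at hc
  have h0 := (smul_eq_zero.1 hc).resolve_left two_ne_zero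
  rw [Finset.sum_comm]
  exact h0

theorem dxMul_eq_d (j : Fin m) :
    dxMul N j = d (𝕜 := 𝕜) fun i => if i = j then LinearMap.id else 0 := by
  refine ext_tm fun r a _ n => ?_
  rw [d_tm, Finset.sum_eq_single j]
  · simp
  · intro i _ hi
    simp [hi]
  · simp

theorem d_dxMul (A : Fin m → N →ₗ[𝕜] N) (j : Fin m) (x : CT 𝕜 m N) :
    d A (dxMul N j x) = -dxMul N j (d A x) := by
  rw [dxMul_eq_d]
  refine d_anticomm (fun i k n => ?_) x
  split_ifs <;> simp

end CT

end FormOperators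

/-! ### The compactly supported Poincaré lemma on `ℝ^m` -/

section Poincare

variable {𝕜 : Type} [RCLike 𝕜] {m : ℕ}

theorem dR_mem {U : Set (Fin m → ℝ)} {r : ℕ} {x : Form 𝕜 U} (hx : x ∈ CT.gr 𝕜 m (Cc 𝕜 U) r) :
    dR x ∈ CT.gr 𝕜 m (Cc 𝕜 U) (r + 1) :=
  CT.d_mem (N := Cc 𝕜 U) (Cc.pd (U := U)) r x hx

theorem dR_dR {U : Set (Fin m → ℝ)} (x : Form 𝕜 U) : dR (dR x) = 0 := CT.d_d Cc.pd_comm x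

local notation "Cm" => Cc 𝕜 (Set.univ : Set (Fin m → ℝ))

/-- The homotopy operator `ι_j ⊗ P_j` contracting the `j`-th coordinate direction. -/
def lineHomotopy (j : Fin m) : Form 𝕜 (Set.univ : Set (Fin m → ℝ)) →ₗ[𝕜]
    Form 𝕜 (Set.univ : Set (Fin m → ℝ)) := CT.op (contr j) (linePrim j)

/-- The operator `dx_j ι_j ⊗ π_j` to which the identity is homotopic. -/
def lineProjForm (j : Fin m) : Form 𝕜 (Set.univ : Set (Fin m → ℝ)) →ₗ[𝕜]
    Form 𝕜 (Set.univ : Set (Fin m → ℝ)) :=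
  CT.op (LinearMap.mulLeft 𝕜 (dx 𝕜 j) ∘ₗ contr j) (lineProj j)

theorem dR_lineHomotopy (j : Fin m) (x : Form 𝕜 (Set.univ : Set (Fin m → ℝ))) :
    dR (lineHomotopy j x) + lineHomotopy j (dR x) = x - lineProjForm j x := by
  refine LinearMap.congr_fun (f := dR ∘ₗ lineHomotopy j + lineHomotopy j ∘ₗ dR)
    (g := LinearMap.id - lineProjForm j) (CT.ext_tm fun r a _ f => ?_) x
  simp only [LinearMap.add_apply, LinearMap.comp_apply, dR, lineHomotopy, lineProjForm, CT.op_tm,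
    CT.d_tm, map_sum, LinearMap.sub_apply, LinearMap.id_apply, LinearMap.mulLeft_apply,
    ← Finset.sum_add_distrib, contr_dx_mul]
  rw [Finset.sum_eq_single j]
  · rw [if_pos rfl, pd_linePrim_self, linePrim_pd_self]
    simp only [map_sub, LinearMap.sub_apply]
    abel
  · intro i _ hi
    rw [if_neg hi, pd_linePrim_of_ne j f hi, zero_sub, map_neg, LinearMap.neg_apply,
      add_neg_cancel]
  · simp

theorem lineHomotopy_mem (j : Fin m) {r : ℕ} {x : Form 𝕜 (Set.univ : Set (Fin m → ℝ))}
    (hx : x ∈ CT.gr 𝕜 m Cm (r + 1)) : lineHomotopy j x ∈ CT.gr 𝕜 m Cm r :=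
  CT.gr_le (P := (CT.gr 𝕜 m Cm r).comap (lineHomotopy j))
    (fun _ ha n => CT.tm_mem (contr_mem j ha) (linePrim j n)) hx

theorem lineHomotopy_zero (j : Fin m) {x : Form 𝕜 (Set.univ : Set (Fin m → ℝ))}
    (hx : x ∈ CT.gr 𝕜 m Cm 0) : lineHomotopy j x = 0 :=
  CT.gr_le (P := LinearMap.ker (lineHomotopy j))
    (fun a ha n => by simp [lineHomotopy, contr_zero j ha]) hx

theorem lineProjForm_mem (j : Fin m) {r : ℕ} {x : Form 𝕜 (Set.univ : Set (Fin m → ℝ))}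
    (hx : x ∈ CT.gr 𝕜 m Cm r) : lineProjForm j x ∈ CT.gr 𝕜 m Cm r := by
  refine CT.gr_le (P := (CT.gr 𝕜 m Cm r).comap (lineProjForm j)) (fun a ha n => ?_) hx
  refine CT.tm_mem ?_ (lineProj j n)
  cases r with
  | zero =>
    rw [LinearMap.comp_apply, contr_zero j ha, map_zero]
    exact Submodule.zero_mem _
  | succ r =>
    rw [add_comm r]
    exact cgr_mul (dx_mem j) (contr_mem j ha)

theorem dxMul_lineProjForm_self (j : Fin m) (x : Form 𝕜 (Set.univ : Set (Fin m → ℝ))) :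
    CT.dxMul Cm j (lineProjForm j x) = 0 := by
  refine LinearMap.congr_fun (f := CT.dxMul Cm j ∘ₗ lineProjForm j) (g := 0)
    (CT.ext_tm fun r a _ f => ?_) x
  simp only [LinearMap.comp_apply, lineProjForm, CT.op_tm, CT.dxMul_tm, LinearMap.mulLeft_apply,
    LinearMap.zero_apply]
  rw [← mul_assoc, dx, CliffordAlgebra.ι_sq_scalar]
  simp

theorem dxMul_lineProjForm_of_ne {i j : Fin m} (h : i ≠ j)
    (x : Form 𝕜 (Set.univ : Set (Fin m → ℝ))) :
    CT.dxMul Cm i (lineProjForm j x) = lineProjForm j (CT.dxMul Cm i x) := by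
  refine LinearMap.congr_fun (f := CT.dxMul Cm i ∘ₗ lineProjForm j)
    (g := lineProjForm j ∘ₗ CT.dxMul Cm i) (CT.ext_tm fun r a _ f => ?_) x
  simp only [LinearMap.comp_apply, lineProjForm, CT.op_tm, CT.dxMul_tm, LinearMap.mulLeft_apply,
    contr_dx_mul, if_neg h, zero_sub]
  rw [← mul_assoc, dx_mul_dx, neg_mul, mul_neg, mul_assoc]

/-- Below the top degree, only the zero form is annihilated by all `dx_j`: on such a form the number
operator `∑_j dx_j ι_j`, which is the degree, acts as `m`. -/
theorem eq_zero_of_dxMul_eq_zero {r : ℕ} (hr : r < m) {x : Form 𝕜 (Set.univ : Set (Fin m → ℝ))}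
    (hx : x ∈ CT.gr 𝕜 m Cm r) (h : ∀ j, CT.dxMul Cm j x = 0) : x = 0 := by
  have h1 : ∑ j, CT.op (LinearMap.mulLeft 𝕜 (dx 𝕜 j) ∘ₗ contr j) LinearMap.id x = (r : 𝕜) • x := by
    have := CT.gr_le (P := LinearMap.ker (∑ j, CT.op (LinearMap.mulLeft 𝕜 (dx 𝕜 j) ∘ₗ contr j)
      LinearMap.id - (r : 𝕜) • LinearMap.id)) (fun a ha n => ?_) hx
    · simpa [sub_eq_zero] using this
    · simp only [LinearMap.mem_ker, LinearMap.sub_apply, LinearMap.sum_apply, CT.op_tm,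
        LinearMap.smul_apply, LinearMap.id_apply, LinearMap.comp_apply, LinearMap.mulLeft_apply]
      rw [← LinearMap.sum_apply, ← map_sum, sum_dx_mul_contr ha, map_smul, LinearMap.smul_apply,
        sub_self]
  have h2 : ∀ j, CT.op (LinearMap.mulLeft 𝕜 (dx 𝕜 j) ∘ₗ contr j) LinearMap.id x = x := by
    intro j
    have h3 : CT.op (LinearMap.mulLeft 𝕜 (dx 𝕜 j) ∘ₗ contr j) LinearMap.id x +
        CT.op (contr j) LinearMap.id (CT.dxMul Cm j x) = x := by
      refine LinearMap.congr_fun (f := CT.op (LinearMap.mulLeft 𝕜 (dx 𝕜 j) ∘ₗ contr j)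
        LinearMap.id + CT.op (contr j) LinearMap.id ∘ₗ CT.dxMul Cm j) (g := LinearMap.id)
        (CT.ext_tm fun r a _ f => ?_) x
      simp only [LinearMap.add_apply, LinearMap.comp_apply, CT.op_tm, CT.dxMul_tm, contr_dx_mul,
        LinearMap.mulLeft_apply, LinearMap.id_apply, if_true, map_sub, LinearMap.sub_apply]
      abel
    rwa [h j, map_zero, add_zero] at h3
  simp only [h2, Finset.sum_const, Finset.card_univ, Fintype.card_fin] at h1
  rw [← Nat.cast_smul_eq_nsmul 𝕜, ← sub_eq_zero, ← sub_smul, smul_eq_zero, sub_eq_zero,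
    Nat.cast_inj] at h1
  exact h1.resolve_left hr.ne'

/-- Applying the homotopies of the coordinates in `s` one after another, a closed form is
cohomologous to one annihilated by `dx_j` for all `j ∈ s`. -/
theorem exists_dxMul_eq_zero {r : ℕ} {x : Form 𝕜 (Set.univ : Set (Fin m → ℝ))}
    (hx : x ∈ CT.gr 𝕜 m Cm (r + 1)) (hd : dR x = 0) (s : Finset (Fin m)) :
    ∃ y ∈ CT.gr 𝕜 m Cm (r + 1), dR y = 0 ∧ x - y ∈ (CT.gr 𝕜 m Cm r).map dR ∧
      ∀ j ∈ s, CT.dxMul Cm j y = 0 := by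
  induction s using Finset.induction_on with
  | empty => exact ⟨x, hx, hd, by simp, by simp⟩
  | insert j s hj ih =>
    obtain ⟨y, hy, hyd, hxy, hs⟩ := ih
    have h := dR_lineHomotopy j y
    rw [hyd, map_zero, add_zero] at h
    refine ⟨lineProjForm j y, lineProjForm_mem j hy, ?_, ?_, ?_⟩
    · have h2 := congrArg dR h
      rw [dR_dR, map_sub, hyd, zero_sub, eq_comm, neg_eq_zero] at h2
      exact h2
    · rw [← sub_add_sub_cancel x y, ← h]
      exact Submodule.add_mem _ hxy ⟨_, lineHomotopy_mem j hy, rfl⟩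
    · intro i hi
      rw [Finset.mem_insert] at hi
      rcases hi with rfl | hi
      · exact dxMul_lineProjForm_self i y
      · rw [dxMul_lineProjForm_of_ne (by rintro rfl; exact hj hi), hs i hi, map_zero]

/-- Closed compactly supported forms below the top degree are exact. -/
theorem poincare_succ {r : ℕ} (hr : r + 1 < m) {x : Form 𝕜 (Set.univ : Set (Fin m → ℝ))}
    (hx : x ∈ CT.gr 𝕜 m Cm (r + 1)) (hd : dR x = 0) : x ∈ (CT.gr 𝕜 m Cm r).map dR := by
  obtain ⟨y, hy, -, hxy, hs⟩ := exists_dxMul_eq_zero hx hd Finset.univ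
  rw [eq_zero_of_dxMul_eq_zero hr hy fun j => hs j (Finset.mem_univ j), sub_zero] at hxy
  exact hxy

theorem poincare_zero (hm : 0 < m) {x : Form 𝕜 (Set.univ : Set (Fin m → ℝ))}
    (hx : x ∈ CT.gr 𝕜 m Cm 0) (hd : dR x = 0) : x = 0 := by
  have h := dR_lineHomotopy ⟨0, hm⟩ x
  rw [hd, map_zero, lineHomotopy_zero _ hx, map_zero, add_zero, eq_comm, sub_eq_zero] at h
  rw [h]
  refine CT.gr_le (P := LinearMap.ker (lineProjForm ⟨0, hm⟩)) (fun a ha n => ?_) hx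
  simp [lineProjForm, contr_zero _ ha]

variable (𝕜 m) in
/-- The function `∏_j ρ(x_j)`. -/
def bump : Cc 𝕜 (Set.univ : Set (Fin m → ℝ)) :=
  ⟨fun x => ∏ j, bumpAt j x, mem_Cc_univ (contDiff_prod fun j _ => contDiff_bumpAt j) (B := 1)
    fun _ i hx => Finset.prod_eq_zero (Finset.mem_univ i) (bumpAt_eq_zero i hx)⟩

/-- Applying the homotopies of the coordinates in `s` one after another, a top form is
cohomologous to one which has the standard shape along the coordinates in `s`. -/
theorem exists_isBumpAlong {r : ℕ} (hm : m = r + 1) (f : Cc 𝕜 (Set.univ : Set (Fin m → ℝ)))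
    (s : Finset (Fin m)) : ∃ k : Cc 𝕜 (Set.univ : Set (Fin m → ℝ)),
      CT.tm (topForm 𝕜 m) f - CT.tm (topForm 𝕜 m) k ∈ (CT.gr 𝕜 m Cm r).map dR ∧
      ∀ j ∈ s, IsBumpAlong j k.1 := by
  have htop : topForm 𝕜 m ∈ cgr 𝕜 m (r + 1) := by
    have h : topForm 𝕜 m ∈ cgr 𝕜 m m := topForm_mem
    convert h using 1
    rw [hm]
  induction s using Finset.induction_on with
  | empty => exact ⟨f, by simp, by simp⟩
  | insert j s hj ih =>
    obtain ⟨k, hk, hs⟩ := ih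
    refine ⟨lineProj j k, ?_, ?_⟩
    · have h := dR_lineHomotopy j (CT.tm (topForm 𝕜 m) k)
      have hmem : CT.tm (topForm 𝕜 m) k ∈ CT.gr 𝕜 m Cm (r + 1) := CT.tm_mem htop k
      have h0 : dR (CT.tm (topForm 𝕜 m) k) = 0 :=
        CT.gr_eq_zero (r := r + 1 + 1) (by omega) (dR_mem hmem)
      have h1 : dx 𝕜 j * contr j (topForm 𝕜 m) = topForm 𝕜 m := by
        have h2 := contr_dx_mul j j (topForm 𝕜 m)
        rw [cgr_eq_zero (r := 1 + (r + 1)) (by omega) (cgr_mul (dx_mem j) htop), map_zero,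
          if_pos rfl, eq_comm, sub_eq_zero] at h2
        exact h2.symm
      have h3 : lineProjForm j (CT.tm (topForm 𝕜 m) k) = CT.tm (topForm 𝕜 m) (lineProj j k) := by
        rw [lineProjForm, CT.op_tm, LinearMap.comp_apply, LinearMap.mulLeft_apply, h1]
      rw [h0, map_zero, add_zero, h3] at h
      rw [← sub_add_sub_cancel _ (CT.tm (topForm 𝕜 m) k), ← h]
      exact Submodule.add_mem _ hk ⟨_, lineHomotopy_mem j hmem, rfl⟩
    · intro i hi
      rw [Finset.mem_insert] at hi
      rcases hi with rfl | hi
      · exact isBumpAlong_lineProj i k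
      · exact IsBumpAlong.lineProj i k (hs i hi) (by rintro rfl; exact hj hi)

/-- The top cohomology is at most one-dimensional. -/
theorem poincare_top {r : ℕ} (hm : m = r + 1) {x : Form 𝕜 (Set.univ : Set (Fin m → ℝ))}
    (hx : x ∈ CT.gr 𝕜 m Cm m) :
    ∃ c : 𝕜, x - c • CT.tm (topForm 𝕜 m) (bump 𝕜 m) ∈ (CT.gr 𝕜 m Cm r).map dR := by
  obtain ⟨f, rfl⟩ := CT.exists_tm_topForm hx
  obtain ⟨k, hk, hb⟩ := exists_isBumpAlong hm f Finset.univ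
  obtain ⟨t, ht⟩ := exists_bump_ne_zero
  have hy : ∏ j : Fin m, bumpAt (𝕜 := 𝕜) j (fun _ => t) ≠ 0 :=
    Finset.prod_ne_zero_iff.2 fun j _ => by simpa [bumpAt] using ht
  refine ⟨k.1 (fun _ => t) * (∏ j : Fin m, bumpAt (𝕜 := 𝕜) j (fun _ => t))⁻¹, ?_⟩
  convert hk using 2
  rw [← map_smul]
  congr 1
  ext x
  have h := IsBumpAlong.proportional (fun j => hb j (Finset.mem_univ j)) x fun _ => t
  change _ * _ * (∏ j, bumpAt j x) = k.1 x
  rw [mul_right_comm, ← h, mul_inv_cancel_right₀ hy]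

end Poincare

/-! ### Pullback of compactly supported forms along diffeomorphisms -/

section Pullback

open Filter Topology

variable {𝕜 : Type} [RCLike 𝕜] {m : ℕ}

/-- A function which is smooth on the open set `U` and vanishes outside a compact subset of `U`. -/
theorem mem_Cc {U K : Set (Fin m → ℝ)} (hU : IsOpen U) (hK : IsCompact K) (hKU : K ⊆ U)
    {f : (Fin m → ℝ) → 𝕜} (hf : ContDiffOn ℝ ∞ f U) (h0 : ∀ x ∉ K, f x = 0) : f ∈ Cc 𝕜 U := by
  have hs : tsupport f ⊆ K := closure_minimal (fun x hx => by
    by_contra h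
    exact hx (h0 x h)) hK.isClosed
  refine ⟨contDiff_iff_contDiffAt.2 fun x => ?_, HasCompactSupport.intro hK h0, hs.trans hKU⟩
  by_cases hx : x ∈ U
  · exact hf.contDiffAt (hU.mem_nhds hx)
  · refine (contDiffAt_const (c := (0 : 𝕜))).congr_of_eventuallyEq ?_
    exact eventually_of_mem (hK.isClosed.isOpen_compl.mem_nhds fun h => hx (hKU h))
      fun y hy => h0 y hy

theorem Cc.eq_zero_of_notMem {U : Set (Fin m → ℝ)} (f : Cc 𝕜 U) {x : Fin m → ℝ} (hx : x ∉ U) :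
    f.1 x = 0 :=
  image_eq_zero_of_notMem_tsupport fun h => hx (f.2.2.2 h)

/-- Multiplication by a real-valued function which is smooth on `U`. -/
def Cc.smulFun {U : Set (Fin m → ℝ)} (hU : IsOpen U) {e : (Fin m → ℝ) → ℝ}
    (he : ContDiffOn ℝ ∞ e U) : Cc 𝕜 U →ₗ[𝕜] Cc 𝕜 U where
  toFun f := ⟨fun x => (e x : 𝕜) * f.1 x, mem_Cc hU f.2.2.1 f.2.2.2
    (((RCLike.ofRealCLM (K := 𝕜)).contDiff.comp_contDiffOn he).mul f.2.1.contDiffOn) fun x hx => by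
      rw [image_eq_zero_of_notMem_tsupport hx, mul_zero]⟩
  map_add' f g := by ext x; exact mul_add _ _ _
  map_smul' c f := by ext x; exact mul_left_comm _ _ _

/-- A diffeomorphism between open subsets of `ℝ^m`. -/
structure Diffeo (U V : Set (Fin m → ℝ)) where
  openU : IsOpen U
  openV : IsOpen V
  fwd : (Fin m → ℝ) → (Fin m → ℝ)
  inv : (Fin m → ℝ) → (Fin m → ℝ)
  contDiffOn_fwd : ContDiffOn ℝ ∞ fwd U
  contDiffOn_inv : ContDiffOn ℝ ∞ inv V
  fwd_mem : ∀ x ∈ U, fwd x ∈ V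
  inv_mem : ∀ y ∈ V, inv y ∈ U
  inv_fwd : ∀ x ∈ U, inv (fwd x) = x
  fwd_inv : ∀ y ∈ V, fwd (inv y) = y

namespace Diffeo

variable {U V : Set (Fin m → ℝ)} (T : Diffeo U V)

/-- The inverse diffeomorphism. -/
def symm : Diffeo V U :=
  ⟨T.openV, T.openU, T.inv, T.fwd, T.contDiffOn_inv, T.contDiffOn_fwd, T.inv_mem, T.fwd_mem,
    T.fwd_inv, T.inv_fwd⟩

open Classical in
/-- The composition `f ∘ T`, extended by zero. -/
def comp : Cc 𝕜 V →ₗ[𝕜] Cc 𝕜 U where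
  toFun f := ⟨fun x => if x ∈ U then f.1 (T.fwd x) else 0, by
    refine mem_Cc T.openU (K := T.inv '' tsupport f.1)
      (f.2.2.1.image_of_continuousOn (T.contDiffOn_inv.continuousOn.mono f.2.2.2)) ?_
      ((f.2.1.comp_contDiffOn T.contDiffOn_fwd).congr fun x hx => if_pos hx) fun x hx => ?_
    · rintro _ ⟨y, hy, rfl⟩
      exact T.inv_mem y (f.2.2.2 hy)
    · split_ifs with hxU
      · exact image_eq_zero_of_notMem_tsupport fun h => hx ⟨_, h, T.inv_fwd x hxU⟩
      · rfl⟩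
  map_add' f g := by
    ext x
    by_cases h : x ∈ U <;> simp [h]
  map_smul' c f := by
    ext x
    by_cases h : x ∈ U <;> simp [h]

theorem comp_apply (f : Cc 𝕜 V) {x : Fin m → ℝ} (hx : x ∈ U) : (T.comp f).1 x = f.1 (T.fwd x) :=
  if_pos hx

theorem ext_on {U : Set (Fin m → ℝ)} {f g : Cc 𝕜 U} (h : ∀ x ∈ U, f.1 x = g.1 x) : f = g := by
  ext x
  by_cases hx : x ∈ U
  · exact h x hx
  · rw [Cc.eq_zero_of_notMem f hx, Cc.eq_zero_of_notMem g hx]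

theorem comp_comp_symm (f : Cc 𝕜 U) : T.comp (T.symm.comp f) = f := by
  refine ext_on fun x hx => ?_
  rw [T.comp_apply _ hx, T.symm.comp_apply _ (T.fwd_mem x hx)]
  exact congrArg f.1 (T.inv_fwd x hx)

/-- The entry `∂_j T_i` of the Jacobian matrix. -/
def jac (i j : Fin m) (x : Fin m → ℝ) : ℝ := fderiv ℝ T.fwd x (Pi.single j 1) i

theorem contDiffOn_jac (i j : Fin m) : ContDiffOn ℝ ∞ (T.jac i j) U := by
  have h := (T.contDiffOn_fwd.fderiv_of_isOpen T.openU (m := ∞) (by simp)).clm_apply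
    (contDiffOn_const (c := (Pi.single j 1 : Fin m → ℝ)))
  exact contDiffOn_pi.1 h i

theorem differentiableAt_fwd {x : Fin m → ℝ} (hx : x ∈ U) : DifferentiableAt ℝ T.fwd x :=
  (T.contDiffOn_fwd.differentiableOn (by simp)).differentiableAt (T.openU.mem_nhds hx)

/-- The chain rule. -/
theorem pd_comp_apply (j : Fin m) (f : Cc 𝕜 V) {x : Fin m → ℝ} (hx : x ∈ U) :
    (Cc.pd j (T.comp f)).1 x = ∑ i, (T.jac i j x : 𝕜) * (Cc.pd i f).1 (T.fwd x) := by
  have h1 : (T.comp f).1 =ᶠ[𝓝 x] fun x => f.1 (T.fwd x) :=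
    eventually_of_mem (T.openU.mem_nhds hx) fun y hy => T.comp_apply f hy
  have h2 := ((Cc.differentiable f (T.fwd x)).hasFDerivAt.comp x
    (T.differentiableAt_fwd hx).hasFDerivAt).fderiv
  have h3 : fderiv ℝ (T.comp f).1 x = (fderiv ℝ f.1 (T.fwd x)).comp (fderiv ℝ T.fwd x) :=
    h1.fderiv_eq.trans h2
  change fderiv ℝ (T.comp f).1 x (Pi.single j 1) = _
  rw [h3, ContinuousLinearMap.comp_apply]
  conv_lhs => rw [pi_eq_sum_univ' (fderiv ℝ T.fwd x (Pi.single j 1)), map_sum]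
  refine Finset.sum_congr rfl fun i _ => ?_
  rw [map_smul, RCLike.real_smul_eq_coe_mul]
  rfl

/-- The Jacobian matrices of `T` and its inverse are inverse to each other. -/
theorem sum_jac (i j : Fin m) {x : Fin m → ℝ} (hx : x ∈ U) :
    ∑ l, T.symm.jac i l (T.fwd x) * T.jac l j x = if i = j then 1 else 0 := by
  have h1 : (fun x => T.inv (T.fwd x)) =ᶠ[𝓝 x] id :=
    eventually_of_mem (T.openU.mem_nhds hx) fun y hy => T.inv_fwd y hy
  have h2 := ((T.symm.differentiableAt_fwd (T.fwd_mem x hx)).hasFDerivAt.comp x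
    (T.differentiableAt_fwd hx).hasFDerivAt).fderiv
  have h3 : (fderiv ℝ T.inv (T.fwd x)).comp (fderiv ℝ T.fwd x) = ContinuousLinearMap.id ℝ _ :=
    h2.symm.trans (h1.fderiv_eq.trans fderiv_id)
  have h4 := congrFun (congrArg (fun L => L (Pi.single j (1 : ℝ))) h3) i
  simp only [ContinuousLinearMap.comp_apply, ContinuousLinearMap.id_apply] at h4
  rw [pi_eq_sum_univ' (fderiv ℝ T.fwd x (Pi.single j 1)), map_sum, Finset.sum_apply,
    Pi.single_apply] at h4
  rw [← h4]
  refine Finset.sum_congr rfl fun l _ => ?_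
  rw [map_smul, Pi.smul_apply, smul_eq_mul, mul_comm]
  rfl

/-- Symmetry of second derivatives. -/
theorem pd_jac (i j k : Fin m) {x : Fin m → ℝ} (hx : x ∈ U) :
    fderiv ℝ (T.jac i j) x (Pi.single k 1) = fderiv ℝ (T.jac i k) x (Pi.single j 1) := by
  have hd : DifferentiableAt ℝ (fderiv ℝ T.fwd) x :=
    ((T.contDiffOn_fwd.fderiv_of_isOpen T.openU (m := ∞) (by simp)).differentiableOn
      (by simp)).differentiableAt (T.openU.mem_nhds hx)
  have key : ∀ j k : Fin m, fderiv ℝ (T.jac i j) x (Pi.single k 1) =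
      fderiv ℝ (fderiv ℝ T.fwd) x (Pi.single k 1) (Pi.single j 1) i := by
    intro j k
    have h1 := (hd.hasFDerivAt.clm_apply (hasFDerivAt_const (Pi.single j (1 : ℝ)) x))
    have h2 := (hasFDerivAt_pi'.1 h1 i).fderiv
    change fderiv ℝ (fun x => fderiv ℝ T.fwd x (Pi.single j 1) i) x (Pi.single k 1) = _
    rw [h2]
    simp
  rw [key, key]
  have := (T.contDiffOn_fwd.contDiffAt (T.openU.mem_nhds hx)).isSymmSndFDerivAt
    (by simp; exact WithTop.coe_le_coe.2 le_top)
  rw [this]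

/-- Multiplication by `∂_j T_i`. -/
def mulJac (i j : Fin m) : Cc 𝕜 U →ₗ[𝕜] Cc 𝕜 U := Cc.smulFun T.openU (T.contDiffOn_jac i j)

theorem mulJac_apply (i j : Fin m) (f : Cc 𝕜 U) (x : Fin m → ℝ) :
    (T.mulJac i j f).1 x = (T.jac i j x : 𝕜) * f.1 x := rfl

theorem pd_mulJac (i j k : Fin m) (f : Cc 𝕜 U) {x : Fin m → ℝ} (hx : x ∈ U) :
    (Cc.pd k (T.mulJac i j f)).1 x =
      (fderiv ℝ (T.jac i j) x (Pi.single k 1) : 𝕜) * f.1 x + (T.mulJac i j (Cc.pd k f)).1 x := by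
  have hj : DifferentiableAt ℝ (T.jac i j) x :=
    ((T.contDiffOn_jac i j).differentiableOn (by simp)).differentiableAt (T.openU.mem_nhds hx)
  have h1 := (RCLike.ofRealCLM (K := 𝕜)).hasFDerivAt.comp x hj.hasFDerivAt
  have h2 := (h1.mul (Cc.differentiable f x).hasFDerivAt).fderiv
  have h3 : fderiv ℝ (T.mulJac i j f).1 x = _ := h2
  change fderiv ℝ (T.mulJac i j f).1 x (Pi.single k 1) = _
  rw [h3, mulJac_apply]
  simp [Cc.pd]
  ring

theorem comm_mulJac (i k l : Fin m) (j : Fin m) (f : Cc 𝕜 U) :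
    T.mulJac i j (T.mulJac k l f) = T.mulJac k l (T.mulJac i j f) := by
  ext x
  simp only [mulJac_apply]
  ring

/-- Left multiplication by the pulled back form `T^* dx_i`. -/
def dxMul (i : Fin m) : Form 𝕜 U →ₗ[𝕜] Form 𝕜 U := CT.d (T.mulJac i)

theorem dxMul_eq (i : Fin m) (x : Form 𝕜 U) : T.dxMul i x = CT.d (T.mulJac i) x := rfl

theorem dR_dxMul (i : Fin m) (x : Form 𝕜 U) : dR (T.dxMul i x) = -T.dxMul i (dR x) := by
  refine CT.d_anticomm (fun k j f => ext_on fun x hx => ?_) x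
  change (Cc.pd k (T.mulJac i j f)).1 x - (T.mulJac i j (Cc.pd k f)).1 x =
    (Cc.pd j (T.mulJac i k f)).1 x - (T.mulJac i k (Cc.pd j f)).1 x
  rw [T.pd_mulJac _ _ _ _ hx, T.pd_mulJac _ _ _ _ hx, T.pd_jac i j k hx]
  ring

/-- The operators `∑_j dx_j ⊗ A_j` depend linearly on their coefficients. -/
theorem d_sum_smul {N : Type u} [AddCommGroup N] [Module 𝕜 N] (A : Fin m → Fin m → N →ₗ[𝕜] N)
    (v : Fin m → 𝕜) (x : CT 𝕜 m N) :
    CT.d (fun j => ∑ i, v i • A i j) x = ∑ i, v i • CT.d (A i) x := by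
  have : CT.d (fun j => ∑ i, v i • A i j) = ∑ i, v i • CT.d (𝕜 := 𝕜) (A i) := by
    refine CT.ext_tm fun r a _ n => ?_
    simp only [CT.d_tm, LinearMap.sum_apply, LinearMap.smul_apply, map_sum, map_smul,
      Finset.smul_sum]
    exact Finset.sum_comm
  rw [this]
  simp

/-- The action of constant-coefficient forms on forms on `U` by left multiplication with their
pullback along `T`. -/
def pullMul : CForm 𝕜 m →ₐ[𝕜] Module.End 𝕜 (Form 𝕜 U) :=
  ExteriorAlgebra.lift 𝕜 ⟨∑ i, (LinearMap.proj i).smulRight (T.dxMul i), fun v => by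
    have h : (∑ i : Fin m, (LinearMap.proj i).smulRight (T.dxMul i) :
        (Fin m → 𝕜) →ₗ[𝕜] Module.End 𝕜 (Form 𝕜 U)) v =
        CT.d fun j => ∑ i, v i • T.mulJac i j := by
      refine LinearMap.ext fun x => ?_
      rw [d_sum_smul]
      simp only [LinearMap.sum_apply, LinearMap.smulRight_apply, LinearMap.proj_apply,
        LinearMap.smul_apply]
      rfl
    rw [h]
    refine LinearMap.ext fun x => ?_
    refine CT.d_d (fun k j f => ?_) x
    simp only [LinearMap.sum_apply, LinearMap.smul_apply, map_sum, map_smul, Finset.smul_sum]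
    rw [Finset.sum_comm]
    refine Finset.sum_congr rfl fun a _ => Finset.sum_congr rfl fun b _ => ?_
    rw [smul_comm, T.comm_mulJac]⟩

theorem pullMul_dx_mul (i : Fin m) (a : CForm 𝕜 m) (x : Form 𝕜 U) :
    T.pullMul (dx 𝕜 i * a) x = T.dxMul i (T.pullMul a x) := by
  rw [map_mul, Module.End.mul_apply]
  congr 1
  rw [pullMul, dx, ExteriorAlgebra.lift_ι_apply, LinearMap.sum_apply, Finset.sum_eq_single i]
  · simp
  · intro j _ hj
    simp [hj]
  · simp

/-- The pullback of forms along `T`. -/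
def pull : Form 𝕜 V →ₗ[𝕜] Form 𝕜 U :=
  CT.lift ((LinearMap.llcomp 𝕜 (Cc 𝕜 V) (Form 𝕜 U) (Form 𝕜 U)).flip (CT.tm 1 ∘ₗ T.comp) ∘ₗ
    T.pullMul.toLinearMap)

theorem pull_tm (a : CForm 𝕜 m) (f : Cc 𝕜 V) :
    T.pull (CT.tm a f) = T.pullMul a (CT.tm 1 (T.comp f)) := rfl

theorem pull_one_tm (f : Cc 𝕜 V) : T.pull (CT.tm 1 f) = CT.tm 1 (T.comp f) := by
  rw [pull_tm, map_one]
  rfl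

theorem pull_dxMul (i : Fin m) (x : Form 𝕜 V) :
    T.pull (CT.dxMul (Cc 𝕜 V) i x) = T.dxMul i (T.pull x) := by
  refine LinearMap.congr_fun (f := T.pull ∘ₗ CT.dxMul (Cc 𝕜 V) i) (g := T.dxMul i ∘ₗ T.pull)
    (CT.ext_tm fun r a _ f => ?_) x
  simp only [LinearMap.comp_apply, CT.dxMul_tm, pull_tm, pullMul_dx_mul]

theorem pull_mem {r : ℕ} {x : Form 𝕜 V} (hx : x ∈ CT.gr 𝕜 m (Cc 𝕜 V) r) :
    T.pull x ∈ CT.gr 𝕜 m (Cc 𝕜 U) r := by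
  refine CT.gr_induction (P := fun r => (CT.gr 𝕜 m (Cc 𝕜 U) r).comap T.pull) (fun f => ?_)
    (fun r j x _ h => ?_) hx
  · rw [Submodule.mem_comap, pull_one_tm]
    exact CT.tm_mem (SetLike.one_mem_graded _) _
  · rw [Submodule.mem_comap, pull_dxMul]
    exact CT.d_mem (N := Cc 𝕜 U) (T.mulJac j) r _ h

theorem dR_one_tm {U : Set (Fin m → ℝ)} (f : Cc 𝕜 U) :
    dR (CT.tm 1 f) = ∑ j, CT.dxMul (Cc 𝕜 U) j (CT.tm 1 (Cc.pd j f)) := by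
  rw [dR, CT.d_tm]
  rfl

theorem dxMul_one_tm (i : Fin m) (f : Cc 𝕜 U) :
    T.dxMul i (CT.tm 1 f) = ∑ j, CT.dxMul (Cc 𝕜 U) j (CT.tm 1 (T.mulJac i j f)) := by
  rw [dxMul, CT.d_tm]
  rfl

/-- Pullback commutes with the de Rham differential. -/
theorem pull_dR (x : Form 𝕜 V) : T.pull (dR x) = dR (T.pull x) := by
  have := CT.induction (P := LinearMap.ker (T.pull ∘ₗ dR - dR ∘ₗ T.pull)) (fun f => ?_)
    (fun j x hx => ?_) x
  · simpa [sub_eq_zero] using this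
  · rw [LinearMap.mem_ker, LinearMap.sub_apply, sub_eq_zero, LinearMap.comp_apply,
      LinearMap.comp_apply, pull_one_tm, dR_one_tm, dR_one_tm, map_sum]
    have h : ∀ j, Cc.pd j (T.comp f) = ∑ i, T.mulJac i j (T.comp (Cc.pd i f)) := fun j =>
      ext_on fun x hx => by
        rw [T.pd_comp_apply j f hx, Submodule.coe_sum, Finset.sum_apply]
        refine Finset.sum_congr rfl fun i _ => ?_
        rw [mulJac_apply, T.comp_apply _ hx]
    simp only [pull_dxMul, pull_one_tm, dxMul_one_tm, h, map_sum]
    exact Finset.sum_comm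
  · simp only [LinearMap.mem_ker, LinearMap.sub_apply, sub_eq_zero, LinearMap.comp_apply] at hx ⊢
    rw [pull_dxMul, dR_dxMul, ← hx, dR, CT.d_dxMul, map_neg, pull_dxMul]

/-- The inverse of the Jacobian matrix of `T` turns multiplication by the pulled back coordinate
forms into multiplication by the coordinate forms. -/
theorem pull_symm_dxMul (i : Fin m) (x : Form 𝕜 V) :
    T.pull (T.symm.dxMul i x) = CT.dxMul (Cc 𝕜 U) i (T.pull x) := by
  have := CT.induction (P := LinearMap.ker (T.pull ∘ₗ T.symm.dxMul i -
    CT.dxMul (Cc 𝕜 U) i ∘ₗ T.pull)) (fun f => ?_) (fun j x hx => ?_) x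
  · simpa [sub_eq_zero] using this
  · rw [LinearMap.mem_ker, LinearMap.sub_apply, sub_eq_zero, LinearMap.comp_apply,
      LinearMap.comp_apply, pull_one_tm, dxMul_one_tm, map_sum]
    simp only [pull_dxMul, pull_one_tm, dxMul_one_tm]
    rw [Finset.sum_comm]
    have h : ∀ j, ∑ l, T.mulJac l j (T.comp (T.symm.mulJac i l f)) =
        if i = j then T.comp f else 0 := fun j => ext_on fun x hx => by
      have h1 := T.sum_jac i j hx
      have h2 := congrArg (fun t : ℝ => (t : 𝕜) * (T.comp f).1 x) h1
      simp only [RCLike.ofReal_sum, RCLike.ofReal_mul, Finset.sum_mul] at h2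
      rw [Submodule.coe_sum, Finset.sum_apply]
      refine Eq.trans (Finset.sum_congr rfl fun l _ => ?_) (h2.trans ?_)
      · rw [mulJac_apply, T.comp_apply _ hx, mulJac_apply, T.comp_apply _ hx]
        ring
      · split_ifs <;> simp
    simp only [← map_sum, h]
    rw [Finset.sum_eq_single i]
    · rw [if_pos rfl]
    · intro j _ hj
      rw [if_neg hj.symm, map_zero, map_zero]
    · simp
  · simp only [LinearMap.mem_ker, LinearMap.sub_apply, sub_eq_zero, LinearMap.comp_apply] at hx ⊢
    rw [pull_dxMul, dxMul_eq T.symm, CT.d_dxMul, ← dxMul_eq T.symm, map_neg, pull_dxMul, hx,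
      dxMul_eq T, CT.d_dxMul, neg_neg, ← dxMul_eq]

theorem pull_pull_symm (x : Form 𝕜 U) : T.pull (T.symm.pull x) = x := by
  have := CT.induction (P := LinearMap.ker (T.pull ∘ₗ T.symm.pull - LinearMap.id)) (fun f => ?_)
    (fun j x hx => ?_) x
  · simpa [sub_eq_zero] using this
  · rw [LinearMap.mem_ker, LinearMap.sub_apply, sub_eq_zero, LinearMap.comp_apply, pull_one_tm,
      pull_one_tm, comp_comp_symm, LinearMap.id_apply]
  · simp only [LinearMap.mem_ker, LinearMap.sub_apply, sub_eq_zero, LinearMap.comp_apply,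
      LinearMap.id_apply] at hx ⊢
    rw [pull_dxMul, pull_symm_dxMul, hx]

end Diffeo

theorem Disk.exists_diffeo (D : Disk m) : Nonempty (Diffeo D.carrier (Set.univ)) := by
  obtain ⟨φ, ψ, h1, h2, h3, h4⟩ := D.diffeo
  exact ⟨⟨D.isOpen, isOpen_univ, φ, ψ, h1, h2.contDiffOn, fun _ _ => trivial, fun y _ => (h4 y).1,
    h3, fun y _ => (h4 y).2⟩⟩

end Pullback

/-! ### The compactly supported cohomology of a disk -/

section DiskCohomology

variable {𝕜 : Type} [RCLike 𝕜] {m : ℕ} (D : Disk m)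

/-- Pullback along a diffeomorphism with `ℝ^m` transfers the Poincaré lemma to disks. -/
theorem Disk.exact_succ {r : ℕ} (hr : r + 1 < m) {x : Form 𝕜 D.carrier}
    (hx : x ∈ CT.gr 𝕜 m _ (r + 1)) (hd : dR x = 0) : x ∈ (CT.gr 𝕜 m _ r).map dR := by
  obtain ⟨T⟩ := D.exists_diffeo
  obtain ⟨y, hy, h⟩ := poincare_succ hr (T.symm.pull_mem hx)
    (by rw [← T.symm.pull_dR, hd, map_zero])
  refine ⟨T.pull y, T.pull_mem hy, ?_⟩
  rw [← T.pull_dR, h, T.pull_pull_symm]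

theorem Disk.closed_zero (hm : 0 < m) {x : Form 𝕜 D.carrier} (hx : x ∈ CT.gr 𝕜 m _ 0)
    (hd : dR x = 0) : x = 0 := by
  obtain ⟨T⟩ := D.exists_diffeo
  rw [← T.pull_pull_symm x, poincare_zero hm (T.symm.pull_mem hx)
    (by rw [← T.symm.pull_dR, hd, map_zero]), map_zero]

/-- Stokes' theorem for compactly supported forms. -/
theorem formInt_dR {U : Set (Fin m → ℝ)} (x : Form 𝕜 U) : formInt (dR x) = 0 := by
  refine LinearMap.congr_fun (f := formInt ∘ₗ dR) (g := 0) (CT.ext_tm fun r a _ f => ?_) x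
  rw [LinearMap.comp_apply, dR, CT.d_tm, map_sum]
  refine Finset.sum_eq_zero fun j _ => ?_
  have h : Cc.integral (Cc.pd j f) = 0 := by
    have h1 := integral_mul_fderiv_eq_neg_fderiv_mul_of_integrable (μ := volume)
      (f := fun _ : Fin m → ℝ => (1 : 𝕜)) (g := f.1) (v := Pi.single j 1)
      (by simp) (by
        simp only [one_mul]
        exact (Cc.pd j f).2.1.continuous.integrable_of_hasCompactSupport (Cc.pd j f).2.2.1)
      (by simpa using f.2.1.continuous.integrable_of_hasCompactSupport f.2.2.1)
      (fun x _ => differentiableAt_const _)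
      (fun x _ => Cc.differentiable f x)
    change ∫ x, fderiv ℝ f.1 x (Pi.single j 1) = 0
    simpa using h1
  change topCoeff _ * Cc.integral (Cc.pd j f) = 0
  rw [h, mul_zero]

theorem Disk.exists_formInt_eq_one :
    ∃ x ∈ CT.gr 𝕜 m (Cc 𝕜 D.carrier) m, formInt x = 1 := by
  obtain ⟨T⟩ := D.exists_diffeo
  obtain ⟨f, hf, hc, hs, hr, h1⟩ := exists_contDiff_tsupport_subset (n := ⊤)
    (D.isOpen.mem_nhds (T.inv_mem 0 trivial))
  have hpos : 0 < ∫ x, f x := by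
    refine hs.continuous.integral_pos_of_hasCompactSupport_nonneg_nonzero hc
      (fun x => (hr ⟨x, rfl⟩).1) (x := T.inv 0) ?_
    rw [h1]
    exact one_ne_zero
  let k : Cc 𝕜 D.carrier := ⟨fun x => (f x : 𝕜), mem_Cc D.isOpen hc hf
    ((RCLike.ofRealCLM (K := 𝕜)).contDiff.comp hs).contDiffOn fun x hx => by
      rw [image_eq_zero_of_notMem_tsupport hx, RCLike.ofReal_zero]⟩
  have hk : Cc.integral k = ((∫ x, f x : ℝ) : 𝕜) := integral_ofReal
  refine ⟨CT.tm (topForm 𝕜 m) ((Cc.integral k)⁻¹ • k), CT.tm_mem topForm_mem _, ?_⟩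
  change topCoeff (topForm 𝕜 m) * Cc.integral ((Cc.integral k)⁻¹ • k) = 1
  rw [topCoeff_topForm, map_smul, smul_eq_mul, one_mul, inv_mul_cancel₀]
  rw [hk]
  exact RCLike.ofReal_ne_zero.2 hpos.ne'

/-- The top cohomology is at most one-dimensional and the integral, being nonzero and vanishing on
exact forms, detects it. No change of variables formula is needed. -/
theorem Disk.exact_top {r : ℕ} (hm : m = r + 1) {x : Form 𝕜 D.carrier} (hx : x ∈ CT.gr 𝕜 m _ m)
    (h0 : formInt x = 0) : x ∈ (CT.gr 𝕜 m _ r).map dR := by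
  obtain ⟨T⟩ := D.exists_diffeo
  have key : ∀ y ∈ CT.gr 𝕜 m (Cc 𝕜 D.carrier) m, ∃ c : 𝕜,
      y - c • T.pull (CT.tm (topForm 𝕜 m) (bump 𝕜 m)) ∈ (CT.gr 𝕜 m _ r).map dR := by
    intro y hy
    obtain ⟨c, z, hz, h⟩ := poincare_top hm (T.symm.pull_mem hy)
    refine ⟨c, T.pull z, T.pull_mem hz, ?_⟩
    rw [← T.pull_dR, h, map_sub, map_smul, T.pull_pull_symm]
  obtain ⟨v, hv, hv1⟩ := D.exists_formInt_eq_one (𝕜 := 𝕜)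
  obtain ⟨a, z, hz, ha⟩ := key v hv
  obtain ⟨b, z', hz', hb⟩ := key x hx
  have h1 := congrArg formInt ha
  rw [formInt_dR, map_sub, map_smul, hv1, eq_comm, sub_eq_zero] at h1
  have h2 := congrArg formInt hb
  rw [formInt_dR, map_sub, map_smul, h0, zero_sub, eq_comm, neg_eq_zero, smul_eq_zero] at h2
  have h3 : b = 0 := by
    refine h2.resolve_right fun h => ?_
    rw [h, smul_zero] at h1
    exact one_ne_zero h1
  rw [h3, zero_smul, sub_zero] at hb
  exact ⟨z', hz', hb⟩

end DiskCohomology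

/-! ### Choices and the homotopy on forms -/

section ChoicesLemmas

variable {𝕜 : Type} [RCLike 𝕜] {m : ℕ}

theorem exists_complement_of_le {M : Type*} [AddCommGroup M] [Module 𝕜 M]
    {E X : Submodule 𝕜 M} (h : E ≤ X) : ∃ K ≤ X, K ⊓ E = ⊥ ∧ K ⊔ E = X := by
  obtain ⟨C, hC⟩ := E.exists_isCompl
  refine ⟨C ⊓ X, inf_le_right, ?_, ?_⟩
  · rw [inf_right_comm, inf_comm C, hC.inf_eq_bot, bot_inf_eq]
  · rw [sup_comm, ← sup_inf_assoc_of_le C h, hC.sup_eq_top, top_inf_eq]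

theorem map_dR_le {U : Set (Fin m → ℝ)} (r : ℕ) :
    (CT.gr 𝕜 m (Cc 𝕜 U) r).map dR ≤ CT.gr 𝕜 m (Cc 𝕜 U) (r + 1) := by
  rintro _ ⟨x, hx, rfl⟩
  exact dR_mem hx

/-- Complements exist since subspaces have complements. The volume forms can be prescribed. -/
theorem exists_choices (hm : 1 ≤ m) (v : ∀ D : Disk m, Form 𝕜 D.carrier)
    (hv : ∀ D, v D ∈ CT.gr 𝕜 m _ m) (hv1 : ∀ D, formInt (v D) = 1) :
    ∃ c : Choices 𝕜 m, c.vol = v := by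
  choose C hC using fun (D : Disk m) r =>
    exists_complement_of_le (map_dR_le (𝕜 := 𝕜) (U := D.carrier) r)
  let K : ∀ D : Disk m, ℕ → Submodule 𝕜 (Form 𝕜 D.carrier) := fun D r =>
    if r = m then Submodule.span 𝕜 {v D} else
      Nat.casesOn (motive := fun _ => Submodule 𝕜 (Form 𝕜 D.carrier)) r
        (CT.gr 𝕜 m (Cc 𝕜 D.carrier) 0) fun r => C D r
  have hK : ∀ D r, r + 1 < m → K D (r + 1) = C D r := fun D r h => if_neg h.ne
  exact ⟨{
    vol := v
    vol_mem := hv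
    vol_int := hv1
    K := K
    K_zero := fun D => if_neg (by omega)
    K_top := fun D => if_pos rfl
    K_le := fun D r h => by rw [hK D r h]; exact (hC D r).1
    K_inf := fun D r h => by rw [hK D r h]; exact (hC D r).2.1
    K_sup := fun D r h => by rw [hK D r h]; exact (hC D r).2.2 }, rfl⟩

theorem nonempty_choices (hm : 1 ≤ m) : Nonempty (Choices 𝕜 m) := by
  choose v hv hv1 using fun D : Disk m => D.exists_formInt_eq_one (𝕜 := 𝕜)
  exact (exists_choices hm v hv hv1).nonempty

theorem formInt_of_mem {U : Set (Fin m → ℝ)} {r : ℕ} (h : r ≠ m) {x : Form 𝕜 U}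
    (hx : x ∈ CT.gr 𝕜 m (Cc 𝕜 U) r) : formInt x = 0 :=
  CT.gr_le (P := LinearMap.ker formInt) (fun a ha f => by
    change topCoeff a * Cc.integral f = 0
    rw [topCoeff_of_mem h ha, zero_mul]) hx

/-- Linear maps on the homogeneous components can be glued. -/
theorem exists_glue {ι : Type} [DecidableEq ι] {M N : Type*} [AddCommGroup M] [Module 𝕜 M]
    [AddCommGroup N] [Module 𝕜 N] (𝒲 : ι → Submodule 𝕜 M) [DirectSum.Decomposition 𝒲]
    (f : ι → M →ₗ[𝕜] N) : ∃ F : M →ₗ[𝕜] N, ∀ i, ∀ x ∈ 𝒲 i, F x = f i x := by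
  refine ⟨(DirectSum.toModule 𝕜 ι N fun i => f i ∘ₗ (𝒲 i).subtype) ∘ₗ
    (DirectSum.decomposeLinearEquiv 𝒲).toLinearMap, fun i x hx => ?_⟩
  have : DirectSum.decomposeLinearEquiv 𝒲 x = DirectSum.lof 𝕜 ι (fun i => 𝒲 i) i ⟨x, hx⟩ :=
    DirectSum.decompose_of_mem 𝒲 hx
  simp only [LinearMap.comp_apply, LinearEquiv.coe_coe, this, DirectSum.toModule_lof]
  rfl

/-- A left inverse of `d` on `K` which vanishes on `K'`, provided that `d` is injective on `K`
modulo `K'`. -/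
theorem exists_inverse_on {M : Type*} [AddCommGroup M] [Module 𝕜 M] (d : M →ₗ[𝕜] M)
    (K K' : Submodule 𝕜 M) (hK : ∀ x ∈ K, d x ∈ K' → x = 0) :
    ∃ f : M →ₗ[𝕜] M, (∀ x ∈ K, f (d x) = x) ∧ ∀ x ∈ K', f x = 0 := by
  obtain ⟨e, he⟩ := LinearMap.exists_leftInverse_of_injective (K'.mkQ ∘ₗ d ∘ₗ K.subtype) (by
    rw [LinearMap.ker_eq_bot']
    intro x hx
    simp only [LinearMap.comp_apply, Submodule.mkQ_apply, Submodule.Quotient.mk_eq_zero] at hx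
    exact Subtype.ext (hK x x.2 hx))
  refine ⟨K.subtype ∘ₗ e ∘ₗ K'.mkQ, fun x hx => ?_, fun x hx => ?_⟩
  · have := LinearMap.congr_fun he ⟨x, hx⟩
    exact congrArg Subtype.val this
  · have : K'.mkQ x = 0 := (Submodule.Quotient.mk_eq_zero K').2 hx
    simp [this]

namespace Choices

variable (c : Choices 𝕜 m) (D : Disk m)

theorem K_le_gr {r : ℕ} (hr : r ≤ m) : c.K D r ≤ CT.gr 𝕜 m _ r := by
  rcases hr.eq_or_lt with rfl | hr
  · rw [c.K_top, Submodule.span_le, Set.singleton_subset_iff]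
    exact c.vol_mem D
  · cases r with
    | zero => exact (c.K_zero D).le
    | succ r => exact c.K_le D r hr

theorem vol_mem_K : c.vol D ∈ c.K D m := by
  rw [c.K_top]
  exact Submodule.mem_span_singleton_self _

/-- In the top degree this is Stokes' theorem. -/
theorem K_inf_exact {r : ℕ} (hr : r + 1 ≤ m) {x : Form 𝕜 D.carrier} (hx : x ∈ c.K D (r + 1))
    (hd : x ∈ (CT.gr 𝕜 m _ r).map dR) : x = 0 := by
  rcases hr.eq_or_lt with h | hr
  · rw [h, c.K_top, Submodule.mem_span_singleton] at hx
    obtain ⟨a, rfl⟩ := hx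
    obtain ⟨y, -, hy⟩ := hd
    have := congrArg formInt hy
    rw [formInt_dR, map_smul, c.vol_int, smul_eq_mul, mul_one] at this
    rw [← this, zero_smul]
  · have : x ∈ c.K D (r + 1) ⊓ (CT.gr 𝕜 m _ r).map dR := ⟨hx, hd⟩
    rwa [c.K_inf D r hr, Submodule.mem_bot] at this

theorem eq_zero_of_dR (hm : 1 ≤ m) {r : ℕ} (hr : r < m) {x : Form 𝕜 D.carrier}
    (hx : x ∈ c.K D r) (hd : dR x = 0) : x = 0 := by
  cases r with
  | zero => exact D.closed_zero hm (c.K_le_gr D (Nat.zero_le m) hx) hd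
  | succ r => exact c.K_inf_exact D hr.le hx (D.exact_succ hr (c.K_le_gr D hr.le hx) hd)

theorem exists_isFormHomotopy (hm : 1 ≤ m) : ∃ f, IsFormHomotopy c D f := by
  have h : ∀ r, ∃ f : Form 𝕜 D.carrier →ₗ[𝕜] Form 𝕜 D.carrier,
      (r + 1 ≤ m → ∀ x ∈ c.K D r, f (dR x) = x) ∧ (r + 1 ≤ m → ∀ x ∈ c.K D (r + 1), f x = 0) := by
    intro r
    by_cases hr : r + 1 ≤ m
    · obtain ⟨f, h1, h2⟩ := exists_inverse_on dR (c.K D r) (c.K D (r + 1)) fun x hx hdx =>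
        c.eq_zero_of_dR D hm hr hx
          (c.K_inf_exact D hr hdx ⟨x, c.K_le_gr D (by omega) hx, rfl⟩)
      exact ⟨f, fun _ => h1, fun _ => h2⟩
    · exact ⟨0, fun h => absurd h hr, fun h => absurd h hr⟩
  choose f hf1 hf2 using h
  obtain ⟨F, hF⟩ := exists_glue (CT.gr 𝕜 m (Cc 𝕜 D.carrier)) fun r =>
    Nat.casesOn (motive := fun _ => Form 𝕜 D.carrier →ₗ[𝕜] Form 𝕜 D.carrier) r 0 f
  refine ⟨F, fun r hr x hx => ?_, fun r hr x hx => ?_⟩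
  · exact (hF _ _ (dR_mem (c.K_le_gr D hr.le hx))).trans (hf1 r hr x hx)
  · refine (hF _ _ (c.K_le_gr D hr hx)).trans ?_
    cases r with
    | zero => rfl
    | succ r => exact hf2 r hr x hx

theorem isFormHomotopy (hm : 1 ≤ m) : IsFormHomotopy c D (formHomotopy c D) := by
  have h := c.exists_isFormHomotopy D hm
  rw [formHomotopy, dif_pos h]
  exact h.choose_spec

/-- The decomposition `Ω^{r+1} = K^{r+1} ⊕ d K^r`. -/
theorem exists_add_dR {r : ℕ} (hr : r + 1 ≤ m) {x : Form 𝕜 D.carrier}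
    (hx : x ∈ CT.gr 𝕜 m _ (r + 1)) : ∃ y ∈ c.K D (r + 1), ∃ z ∈ c.K D r, x = y + dR z := by
  have key : ∀ {r : ℕ}, r + 1 ≤ m → ∀ x ∈ CT.gr 𝕜 m (Cc 𝕜 D.carrier) (r + 1),
      ∃ y ∈ c.K D (r + 1), ∃ z ∈ CT.gr 𝕜 m (Cc 𝕜 D.carrier) r, x = y + dR z := by
    intro r hr x hx
    rcases hr.eq_or_lt with h | hr
    · rw [h] at hx ⊢
      obtain ⟨z, hz, hzx⟩ := D.exact_top h.symm (x := x - formInt x • c.vol D)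
        (Submodule.sub_mem _ hx (Submodule.smul_mem _ _ (c.vol_mem D)))
        (by rw [map_sub, map_smul, c.vol_int, smul_eq_mul, mul_one, sub_self])
      exact ⟨_, Submodule.smul_mem _ _ (c.vol_mem_K D), z, hz, by rw [hzx]; abel⟩
    · rw [← c.K_sup D r hr, Submodule.mem_sup] at hx
      obtain ⟨y, hy, _, ⟨z, hz, rfl⟩, rfl⟩ := hx
      exact ⟨y, hy, z, hz, rfl⟩
  obtain ⟨y, hy, z, hz, rfl⟩ := key hr x hx
  cases r with
  | zero => exact ⟨y, hy, z, by rwa [c.K_zero], rfl⟩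
  | succ r =>
    obtain ⟨z', hz', w, -, rfl⟩ := key (by omega) z hz
    exact ⟨y, hy, z', hz', by rw [map_add, dR_dR, add_zero]⟩

theorem formHomotopy_add_dR (hm : 1 ≤ m) {r : ℕ} (hr : r + 1 ≤ m) {y z : Form 𝕜 D.carrier}
    (hy : y ∈ c.K D (r + 1)) (hz : z ∈ c.K D r) : formHomotopy c D (y + dR z) = z := by
  have h := c.isFormHomotopy D hm
  rw [map_add, h.2 _ hr y hy, h.1 r hr z hz, zero_add]

theorem formHomotopy_zero (hm : 1 ≤ m) {x : Form 𝕜 D.carrier} (hx : x ∈ CT.gr 𝕜 m _ 0) :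
    formHomotopy c D x = 0 :=
  (c.isFormHomotopy D hm).2 0 (Nat.zero_le m) x (by rwa [c.K_zero])

theorem formHomotopy_mem_K (hm : 1 ≤ m) {r : ℕ} (hr : r + 1 ≤ m) {x : Form 𝕜 D.carrier}
    (hx : x ∈ CT.gr 𝕜 m _ (r + 1)) : formHomotopy c D x ∈ c.K D r := by
  obtain ⟨y, hy, z, hz, rfl⟩ := c.exists_add_dR D hr hx
  rwa [c.formHomotopy_add_dR D hm hr hy hz]

theorem formHomotopy_mem (hm : 1 ≤ m) {r : ℕ} {x : Form 𝕜 D.carrier}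
    (hx : x ∈ CT.gr 𝕜 m _ (r + 1)) : formHomotopy c D x ∈ CT.gr 𝕜 m _ r := by
  by_cases hr : r + 1 ≤ m
  · exact c.K_le_gr D (by omega) (c.formHomotopy_mem_K D hm hr hx)
  · rw [CT.gr_eq_zero (not_le.1 hr) hx, map_zero]
    exact Submodule.zero_mem _

/-- Induction over homogeneous forms, with the degrees at most `m`. -/
theorem form_ext {M : Type*} [AddCommGroup M] [Module 𝕜 M] {F G : Form 𝕜 D.carrier →ₗ[𝕜] M}
    (h0 : ∀ x ∈ CT.gr 𝕜 m (Cc 𝕜 D.carrier) 0, F x = G x)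
    (h : ∀ r, r + 1 ≤ m → ∀ x ∈ CT.gr 𝕜 m (Cc 𝕜 D.carrier) (r + 1), F x = G x) : F = G := by
  refine hom_ext_homog (CT.gr 𝕜 m (Cc 𝕜 D.carrier)) fun r x hx => ?_
  cases r with
  | zero => exact h0 x hx
  | succ r =>
    by_cases hr : r + 1 ≤ m
    · exact h r hr x hx
    · rw [CT.gr_eq_zero (not_le.1 hr) hx, map_zero, map_zero]

theorem dR_vol : dR (c.vol D) = 0 :=
  CT.gr_eq_zero (Nat.lt_succ_self m) (dR_mem (c.vol_mem D))

theorem formHomotopy_homotopy (hm : 1 ≤ m) (x : Form 𝕜 D.carrier) :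
    dR (formHomotopy c D x) + formHomotopy c D (dR x) = x - formInt x • c.vol D := by
  refine LinearMap.congr_fun (f := dR ∘ₗ formHomotopy c D + formHomotopy c D ∘ₗ dR)
    (g := LinearMap.id - formInt.smulRight (c.vol D)) (form_ext D ?_ ?_) x
  · intro x hx
    simp only [LinearMap.add_apply, LinearMap.comp_apply, LinearMap.sub_apply, LinearMap.id_apply,
      LinearMap.smulRight_apply]
    rw [c.formHomotopy_zero D hm hx, formInt_of_mem (by omega) hx,
      (c.isFormHomotopy D hm).1 0 hm x (by rwa [c.K_zero])]
    simp
  · intro r hr x hx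
    obtain ⟨y, hy, z, hz, rfl⟩ := c.exists_add_dR D hr hx
    simp only [LinearMap.add_apply, LinearMap.comp_apply, LinearMap.sub_apply, LinearMap.id_apply,
      LinearMap.smulRight_apply]
    rw [c.formHomotopy_add_dR D hm hr hy hz, map_add dR, dR_dR, add_zero, map_add formInt,
      formInt_dR, add_zero]
    rcases hr.eq_or_lt with h | hr
    · rw [h, c.K_top, Submodule.mem_span_singleton] at hy
      obtain ⟨a, rfl⟩ := hy
      simp only [map_smul, dR_vol, smul_zero, map_zero, c.vol_int, smul_eq_mul, mul_one]
      abel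
    · rw [(c.isFormHomotopy D hm).1 _ hr y hy, formInt_of_mem hr.ne (c.K_le_gr D hr.le hy)]
      rw [zero_smul, sub_zero, add_comm]

theorem formHomotopy_vol (hm : 1 ≤ m) : formHomotopy c D (c.vol D) = 0 :=
  (c.isFormHomotopy D hm).2 m le_rfl _ (c.vol_mem_K D)

theorem formHomotopy_formHomotopy (hm : 1 ≤ m) (x : Form 𝕜 D.carrier) :
    formHomotopy c D (formHomotopy c D x) = 0 := by
  refine LinearMap.congr_fun (f := formHomotopy c D ∘ₗ formHomotopy c D) (g := 0)
    (form_ext D ?_ ?_) x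
  · intro x hx
    rw [LinearMap.comp_apply, c.formHomotopy_zero D hm hx, map_zero, LinearMap.zero_apply]
  · intro r hr x hx
    exact (c.isFormHomotopy D hm).2 r (by omega) _ (c.formHomotopy_mem_K D hm hr hx)

theorem formInt_formHomotopy (hm : 1 ≤ m) (x : Form 𝕜 D.carrier) :
    formInt (formHomotopy c D x) = 0 := by
  refine LinearMap.congr_fun (f := formInt ∘ₗ formHomotopy c D) (g := 0) (form_ext D ?_ ?_) x
  · intro x hx
    rw [LinearMap.comp_apply, c.formHomotopy_zero D hm hx, map_zero, LinearMap.zero_apply]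
  · intro r hr x hx
    exact formInt_of_mem (by omega) (c.formHomotopy_mem D hm hx)

end Choices

end ChoicesLemmas

/-! ### The retract of the generators of the factorization envelope -/

section EnvelopeRetract

variable {𝕜 : Type} [RCLike 𝕜] {m : ℕ} {g : Type u} [LieRing g] [LieAlgebra 𝕜 g]

theorem GForm.ext_ins {U : Set (Fin m → ℝ)} {M : Type*} [AddCommGroup M] [Module 𝕜 M]
    {F G : GForm 𝕜 g U →ₗ[𝕜] M}
    (h : ∀ α X, F (GForm.ins 𝕜 g α X) = G (GForm.ins 𝕜 g α X)) : F = G := by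
  refine CT.ext_tm fun r a _ n => ?_
  exact LinearMap.congr_fun (f := F ∘ₗ CT.tm a) (g := G ∘ₗ CT.tm a)
    (CG.ext_tm fun f X => h (CT.tm a f) X) n

theorem GForm.δ_ins {U : Set (Fin m → ℝ)} (α : Form 𝕜 U) (X : g) :
    (GForm.shifted 𝕜 g U).δ (GForm.ins 𝕜 g α X) = -GForm.ins 𝕜 g (dR α) X := by
  refine LinearMap.congr_fun (f := (GForm.shifted 𝕜 g U).δ ∘ₗ (GForm.ins 𝕜 g).flip X)
    (g := -((GForm.ins 𝕜 g).flip X ∘ₗ dR)) (CT.ext_tm fun r a _ f => ?_) α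
  have h := CT.d_tm (CG.pd U g) a (CG.tm f X)
  simp only [LinearMap.comp_apply, LinearMap.neg_apply, LinearMap.flip_apply, GForm.ins_tm, dR,
    CT.d_tm, map_sum]
  exact congrArg Neg.neg h

theorem CT.gr_top_le {N : Type u} [AddCommGroup N] [Module 𝕜 N] (r : ℕ) (hr : m < r) :
    CT.gr 𝕜 m N r = ⊥ :=
  le_bot_iff.1 fun _ hx => CT.gr_eq_zero hr hx

namespace Choices

variable (c : Choices 𝕜 m) (D : Disk m)

variable (g) in
/-- The retract of `g ⊗ Ω_c(D)` onto `g` given by the chosen volume form and complements. -/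
def genRetract (hm : 1 ≤ m) : GenRetract (GForm.shifted 𝕜 g D.carrier) (conc 𝕜 g m) where
  i := c.genI g D
  p := GForm.integral
  η := c.genH g D
  i_mem := c.genI_mem D
  p_mem := GForm.integral_mem
  η_mem r w hw := by
    refine CT.gr_le (P := (GForm.gr 𝕜 g D.carrier r).comap (c.genH g D)) (fun a ha n => ?_) hw
    have h := LinearMap.congr_fun
      (f := (GForm.gr 𝕜 g D.carrier r).mkQ ∘ₗ c.genH g D ∘ₗ CT.tm a)
      (g := 0) (CG.ext_tm fun f X => ?_) n
    · exact (Submodule.Quotient.mk_eq_zero (GForm.gr 𝕜 g D.carrier r)).1 h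
    · rw [LinearMap.comp_apply, LinearMap.comp_apply, ← GForm.ins_tm, genH, GForm.onForms_ins]
      exact (Submodule.Quotient.mk_eq_zero _).2
        (GForm.ins_mem (c.formHomotopy_mem D hm (CT.tm_mem ha f)) X)
  η_zero w hw := by
    refine CT.gr_le (P := LinearMap.ker (c.genH g D)) (fun a ha n => ?_) hw
    refine LinearMap.congr_fun (f := c.genH g D ∘ₗ CT.tm a) (g := 0) (CG.ext_tm fun f X => ?_) n
    rw [LinearMap.comp_apply, ← GForm.ins_tm, genH, GForm.onForms_ins,
      c.formHomotopy_zero D hm (CT.tm_mem ha f), map_zero]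
    rfl
  homotopy w := by
    refine LinearMap.congr_fun (f := (GForm.shifted 𝕜 g D.carrier).δ ∘ₗ c.genH g D +
      c.genH g D ∘ₗ (GForm.shifted 𝕜 g D.carrier).δ)
      (g := c.genI g D ∘ₗ GForm.integral - LinearMap.id) (GForm.ext_ins fun α X => ?_) w
    simp only [LinearMap.add_apply, LinearMap.comp_apply, LinearMap.sub_apply, LinearMap.id_apply,
      genH, genI, GForm.δ_ins, GForm.onForms_ins, map_neg, GForm.integral_ins, map_smul]
    have h := congrArg (fun β => GForm.ins 𝕜 g β X) (c.formHomotopy_homotopy D hm α)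
    simp only [map_add, map_sub, map_smul, LinearMap.add_apply, LinearMap.sub_apply,
      LinearMap.smul_apply] at h
    rw [← neg_add, h, neg_sub]
  p_i X := by
    rw [genI, GForm.integral_ins, c.vol_int, one_smul]
  η_i X := by
    rw [genH, genI, GForm.onForms_ins, c.formHomotopy_vol D hm, map_zero, LinearMap.zero_apply]
  p_η w := by
    refine LinearMap.congr_fun (f := GForm.integral ∘ₗ c.genH g D) (g := 0)
      (GForm.ext_ins fun α X => ?_) w
    rw [LinearMap.comp_apply, genH, GForm.onForms_ins, GForm.integral_ins,
      c.formInt_formHomotopy D hm, zero_smul, LinearMap.zero_apply]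
  η_η w := by
    refine LinearMap.congr_fun (f := c.genH g D ∘ₗ c.genH g D) (g := 0)
      (GForm.ext_ins fun α X => ?_) w
    rw [LinearMap.comp_apply, genH, GForm.onForms_ins, GForm.onForms_ins,
      c.formHomotopy_formHomotopy D hm, map_zero, LinearMap.zero_apply, LinearMap.zero_apply]
  p_δ w := by
    refine LinearMap.congr_fun (f := GForm.integral ∘ₗ (GForm.shifted 𝕜 g D.carrier).δ) (g := 0)
      (GForm.ext_ins fun α X => ?_) w
    rw [LinearMap.comp_apply, GForm.δ_ins, map_neg, GForm.integral_ins, formInt_dR, zero_smul,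
      neg_zero, LinearMap.zero_apply]
  δ_i X := by
    rw [genI, GForm.δ_ins, c.dR_vol, map_zero, LinearMap.zero_apply, neg_zero]
  b_i X Y := by
    -- the bracket of two top forms has degree `2 m > m`
    refine CT.gr_eq_zero (r := m + m) (by omega) ?_
    exact (GForm.shifted 𝕜 g D.carrier).b_mem m m _ (c.genI_mem D m X (mem_conc X)) _
      (c.genI_mem D m Y (mem_conc Y))

/-- The symmetrized homotopy `Choices.symH` is the homotopy `D ∘ J` built from derivations.
Operators are determined by their values on words. -/
theorem symH_eq (hm : 1 ≤ m) : c.symH g D = (c.genRetract g D hm).H := by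
  have h : c.IsSymHomotopy (g := g) D (c.genRetract g D hm).H := fun n r w hw =>
    (c.genRetract g D hm).H_prod r w hw
  have hex : ∃ H, c.IsSymHomotopy (g := g) D H := ⟨_, h⟩
  rw [symH, dif_pos hex]
  refine GSym.ext_prod fun n r w hw => ?_
  rw [hex.choose_spec n r w hw, h n r w hw]

end Choices

end EnvelopeRetract

/-! ### Retracts whose transferred operations vanish -/

section Vanishing

variable {𝕜 : Type} [Field 𝕜] {m : ℕ} {B : Fam.{u} m 𝕜} {F : PFA.{u} m 𝕜} {R : Retract B F}

/-- The projections of a strong deformation retract can be replaced by any projections `p'`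
compatible with the inclusions, after correcting the homotopy to `h - i p' h`. -/
theorem Retract.IsSDR.changeProj (hR : R.IsSDR) (p' : ∀ D : Disk m, F.obj D →ₗ[𝕜] B D)
    (hmem : ∀ D n x, x ∈ (F.obj D).gr n → p' D x ∈ (B D).gr n)
    (hd : ∀ D x, p' D ((F.obj D).d x) = 0) (hi : ∀ D b, p' D (R.i D b) = b) :
    Retract.IsSDR ⟨R.i, p', fun D => R.h D - R.i D ∘ₗ p' D ∘ₗ R.h D⟩ where
  d_zero := hR.d_zero
  i_mem := hR.i_mem
  p_mem := hmem
  h_mem D n x hx := Submodule.sub_mem _ (hR.h_mem D n x hx)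
    (hR.i_mem D _ _ (hmem D _ _ (hR.h_mem D n x hx)))
  d_i := hR.d_i
  p_d := hd
  p_i := hi
  homotopy D x := by
    simp only [LinearMap.sub_apply, LinearMap.comp_apply, map_sub, hR.d_i, sub_zero]
    have h1 := hR.homotopy D x
    have h2 : R.h D ((F.obj D).d x) = R.i D (R.p D x) - x - (F.obj D).d (R.h D x) := by
      rw [← h1]
      abel
    rw [h2]
    simp only [map_sub, hi, hd, map_zero]
    abel
  h_i D b := by
    simp only [LinearMap.sub_apply, LinearMap.comp_apply, hR.h_i, map_zero, sub_zero]
  p_h D x := by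
    simp only [LinearMap.sub_apply, LinearMap.comp_apply, map_sub, hi, sub_self]
  h_h D x := by
    simp only [LinearMap.sub_apply, LinearMap.comp_apply, map_sub, hR.h_h, hR.h_i, map_zero,
      sub_zero]

mutual
theorem Retract.hasDeg_of_top (h0 : ∀ D b, b ∈ (B D).gr 0) {D : Disk m} (x : DTr B D) :
    DTr.HasDeg x (-(x.verts : ℤ)) := by
  match D, x with
  | _, .leaf b => exact h0 _ b
  | _, .node D xs =>
    have := Retract.hasDegs_of_top h0 xs
    have h : -((Tr.node D xs).verts : ℤ) + 1 = -(xs.verts : ℤ) := by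
      simp only [Tr.verts]
      push_cast
      ring
    simp only [DTr.HasDeg]
    rwa [h]
theorem Retract.hasDegs_of_top (h0 : ∀ D b, b ∈ (B D).gr 0) {Ds : List (Disk m)} (xs : DFo B Ds) :
    DFo.HasDeg xs (-(xs.verts : ℤ)) := by
  match Ds, xs with
  | _, .nil => rfl
  | _, .cons x xs =>
    refine ⟨_, _, ?_, Retract.hasDeg_of_top h0 x, Retract.hasDegs_of_top h0 xs⟩
    simp only [Fo.verts]
    push_cast
    ring
end

theorem _root_.FactEnv.DGMod.eq_zero_of_mem_of_ne {V : DGMod.{u} 𝕜} {n k : ℤ} (h : n ≠ k) {x : V}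
    (hn : x ∈ V.gr n) (hk : x ∈ V.gr k) : x = 0 := by
  have := (V.internal.submodule_iSupIndep.pairwiseDisjoint h).le_bot ⟨hn, hk⟩
  simpa using this

/-- If the cohomology is concentrated in degree zero, then all transferred operations with at least
two vertices vanish for degree reasons. -/
theorem Retract.IsSDR.beta_eq_zero_of_acyclic (hR : R.IsSDR)
    (h : ∀ (D : Disk m) (n : ℤ), n ≠ 0 → ∀ z ∈ (F.obj D).gr n, (F.obj D).d z = 0 →
      ∃ y, (F.obj D).d y = z) {D : Disk m} (x : DTr B D) (hx : 2 ≤ x.verts) : R.beta x = 0 := by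
  -- `B` is concentrated in degree zero, as `i` sends other degrees to coboundaries
  have h0 : ∀ D b, b ∈ (B D).gr 0 := by
    intro D
    let _ := (B D).internal.chooseDecomposition
    intro b
    induction b using DirectSum.Decomposition.inductionOn (B D).gr with
    | zero => exact Submodule.zero_mem _
    | @homogeneous n b =>
      by_cases hn : n = 0
      · subst hn
        exact b.2
      · obtain ⟨y, hy⟩ := h D n hn _ (hR.i_mem D n b b.2) (hR.d_i D b)
        rw [← hR.p_i D b, ← hy, hR.p_d]
        exact Submodule.zero_mem _
    | add a b ha hb => exact Submodule.add_mem _ ha hb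
  -- an operation with `k` vertices has degree `1 - k`
  cases x with
  | leaf b => simp [Tr.verts] at hx
  | node D xs =>
    have h1 := hR.p_mem D _ _ (F.act_mem D _ _ (Retract.evs_mem R hR xs _ (hasDegs_of_top h0 xs)))
    refine DGMod.eq_zero_of_mem_of_ne ?_ h1 (h0 D _)
    simp only [Tr.verts] at hx
    omega

/-- If `i` takes values in a weight-zero part, `h` maps weight zero to weight one and `p` vanishes
in weight one, then the Massey cocycle vanishes. -/
theorem Retract.beta_eq_zero_of_weight (wt : ∀ D : Disk m, ℤ → Submodule 𝕜 (F.obj D))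
    (hi : ∀ D b, R.i D b ∈ wt D 0) (hh : ∀ D, ∀ x ∈ wt D 0, R.h D x ∈ wt D 1)
    (hp : ∀ D, ∀ x ∈ wt D 1, R.p D x = 0)
    (hact : ∀ {Ds : List (Disk m)} (D : Disk m) (xs : DFo B Ds) (n : ℕ),
      (∀ {D : Disk m} (x : DTr B D), x.verts ≤ n → R.ev x ∈ wt D x.verts) →
      xs.verts ≤ n → F.act D (R.evs xs) ∈ wt D xs.verts)
    {D : Disk m} (x : DTr B D) (hx : x.verts = 2) : R.beta x = 0 := by
  have h0 : ∀ {D : Disk m} (x : DTr B D), x.verts ≤ 0 → R.ev x ∈ wt D x.verts := by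
    intro D x hx
    cases x with
    | leaf b => exact hi D b
    | node D xs => simp [Tr.verts] at hx
  have h1 : ∀ {D : Disk m} (x : DTr B D), x.verts ≤ 1 → R.ev x ∈ wt D x.verts := by
    intro D x hx
    cases x with
    | leaf b => exact hi D b
    | node D xs =>
      simp only [Tr.verts] at hx
      have h2 := hact D xs 0 h0 (by omega)
      have h3 : xs.verts = 0 := by omega
      rw [h3] at h2
      have h4 : (Tr.node D xs).verts = 1 := by simp only [Tr.verts]; omega
      rw [h4]
      exact hh D _ h2
  cases x with
  | leaf b => rfl
  | node D xs =>
    simp only [Tr.verts] at hx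
    have h2 := hact D xs 1 h1 (by omega)
    have h3 : xs.verts = 1 := by omega
    rw [h3] at h2
    exact hp D _ h2

end Vanishing

/-! ### The explicit retracts of the factorization envelope -/

section Explicit

variable {𝕜 : Type} [RCLike 𝕜] {m : ℕ} {g : Type u} [LieRing g] [LieAlgebra 𝕜 g]

open GSym

namespace Choices

variable (c : Choices 𝕜 m)

theorem hatH_apply (hm : 1 ≤ m) (D : Disk m) (x : GSym (GForm.gr 𝕜 g D.carrier)) :
    c.hatH g D x = (c.genRetract g D hm).H ((c.genRetract g D hm).A x) := by
  change c.symH g D (geom (dCE 𝕜 g D ∘ₗ c.symH g D) x) = _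
  rw [c.symH_eq D hm]
  rfl

/-- The perturbed retract is the one obtained from `genRetract` by homological perturbation. -/
theorem hatRetract_eq (hm : 1 ≤ m) : c.hatRetract g =
    { i := fun D => (c.genRetract g D hm).I.toLinearMap
      p := fun D => (c.genRetract g D hm).P.toLinearMap ∘ₗ (c.genRetract g D hm).A
      h := fun D => (c.genRetract g D hm).H ∘ₗ (c.genRetract g D hm).A } := by
  unfold hatRetract hatH
  congr 1 <;> funext D <;> rw [c.symH_eq D hm] <;> rfl

theorem hatRetract_isSDR (hm : 1 ≤ m) : (c.hatRetract g).IsSDR := by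
  rw [c.hatRetract_eq hm]
  exact
    { d_zero := fun _ _ => rfl
      i_mem := fun _ _ _ hb => GSym.map_mem _ hb
      p_mem := fun D _ _ hx => GSym.map_mem _ ((c.genRetract g D hm).A_mem hx)
      h_mem := fun D _ _ hx => (c.genRetract g D hm).H_mem ((c.genRetract g D hm).A_mem hx)
      d_i := fun D b => (c.genRetract g D hm).d_I b
      p_d := fun D x => (c.genRetract g D hm).P_A_d x
      p_i := fun D b => (congrArg (c.genRetract g D hm).P ((c.genRetract g D hm).A_I b)).trans
        ((c.genRetract g D hm).P_I b)
      homotopy := fun D x => (c.genRetract g D hm).homotopy_hat x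
      h_i := fun D b => (congrArg (c.genRetract g D hm).H ((c.genRetract g D hm).A_I b)).trans
        ((c.genRetract g D hm).H_I b)
      p_h := fun D x => (congrArg (c.genRetract g D hm).P ((c.genRetract g D hm).A_H _)).trans
        ((c.genRetract g D hm).P_H _)
      h_h := fun D x => (congrArg (c.genRetract g D hm).H ((c.genRetract g D hm).A_H _)).trans
        ((c.genRetract g D hm).H_H _) }

end Choices

/-- Words in generators concentrated in a degree of weight zero have weight zero. -/
theorem conc_wt {ρ : ℕ → ℤ} (hρ : ρ m = 0) (y : GSym (conc 𝕜 g m)) : y ∈ wt (conc 𝕜 g m) ρ 0 := by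
  refine GSym.induction (one_mem_wt _) (fun w x hx => ?_) y
  exact wt_cast _ (by rw [hρ, zero_add]) (gen_mul_mem_wt _ (mem_conc w) hx)

theorem conc_eq_zero {ρ : ℕ → ℤ} (hρ : ρ m = 0) {n : ℤ} (hn : n ≠ 0) {y : GSym (conc 𝕜 g m)}
    (hy : y ∈ wt (conc 𝕜 g m) ρ n) : y = 0 := by
  refine eq_zero_of_mem_wt _ ⊥ (fun r hr => ?_) (by simpa using hn) hy
  refine if_neg fun h => hr ?_
  rw [h, hρ]
  exact AddSubmonoid.zero_mem _

/-- The codegree of forms on `ℝ^m`. -/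
def codeg (m : ℕ) (r : ℕ) : ℤ := m - r

theorem codeg_self : codeg m m = 0 := sub_self _

/-- Forms have nonnegative codegree. -/
theorem codeg_eq_zero {U : Set (Fin m → ℝ)} {n : ℤ} (hn : n < 0) {x : GSym (GForm.gr 𝕜 g U)}
    (hx : x ∈ wt (GForm.gr 𝕜 g U) (codeg m) n) : x = 0 := by
  refine eq_zero_of_mem_wt _ (AddSubmonoid.nonneg ℤ) (fun r hr => ?_) (by simpa using hn) hx
  refine CT.gr_top_le r ?_
  rw [AddSubmonoid.mem_nonneg, codeg] at hr
  omega

namespace Choices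

variable (c : Choices 𝕜 m)

theorem H_codeg (hm : 1 ≤ m) (D : Disk m) {n : ℤ} {x : GSym (GForm.gr 𝕜 g D.carrier)}
    (hx : x ∈ wt (GForm.gr 𝕜 g D.carrier) (codeg m) n) :
    (c.genRetract g D hm).H x ∈ wt (GForm.gr 𝕜 g D.carrier) (codeg m) (n + 1) :=
  (c.genRetract g D hm).H_mem_wt (fun r => by simp only [codeg]; push_cast; ring) hx

/-- The perturbation lowers the codegree by `m - 1`, hence is trivial in codegrees less than
`m - 1`. -/
theorem A_codeg (hm : 1 ≤ m) (D : Disk m) {n : ℤ} (hn : n + 1 < m)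
    {x : GSym (GForm.gr 𝕜 g D.carrier)} (hx : x ∈ wt (GForm.gr 𝕜 g D.carrier) (codeg m) n) :
    (c.genRetract g D hm).A x = x := by
  refine (c.genRetract g D hm).A_of_eq_zero (codeg_eq_zero (n := n + 1 + (-m)) (by omega) ?_)
  exact (c.genRetract g D hm).T_mem_wt (fun r => by simp only [codeg]; push_cast; ring)
    (fun r s => by simp only [codeg]; push_cast; ring) hx

theorem I_codeg (hm : 1 ≤ m) (D : Disk m) (y : GSym (conc 𝕜 g m)) :
    (c.genRetract g D hm).I y ∈ wt (GForm.gr 𝕜 g D.carrier) (codeg m) 0 :=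
  map_mem_wt _ _ (conc_wt codeg_self y)

theorem P_codeg (hm : 1 ≤ m) (D : Disk m) {n : ℤ} (hn : n ≠ 0) {x : GSym (GForm.gr 𝕜 g D.carrier)}
    (hx : x ∈ wt (GForm.gr 𝕜 g D.carrier) (codeg m) n) : (c.genRetract g D hm).P x = 0 :=
  conc_eq_zero codeg_self hn (map_mem_wt _ _ hx)

end Choices

theorem envExt_wt {D D' : Disk m} {ρ : ℕ → ℤ} {n : ℤ} {x : envObj 𝕜 g D}
    (hx : x ∈ wt (GForm.gr 𝕜 g D.carrier) ρ n) :
    envExt 𝕜 D D' x ∈ (wt (GForm.gr 𝕜 g D'.carrier) ρ n : Submodule 𝕜 (envObj 𝕜 g D')) := by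
  by_cases h : D.carrier ⊆ D'.carrier
  · rw [envExt_of_le h]
    exact map_mem_wt _ _ hx
  · have : envExt 𝕜 (g := g) D D' = 0 := dif_neg h
    rw [this]
    exact Submodule.zero_mem _

theorem envExt_d (D D' : Disk m) (x : envObj 𝕜 g D) :
    envExt 𝕜 D D' ((envObj 𝕜 g D).d x) = (envObj 𝕜 g D').d (envExt 𝕜 D D' x) := by
  by_cases h : D.carrier ⊆ D'.carrier
  · rw [envExt_of_le h]
    exact (ShiftedLie.map_d (GForm.ext_mem h) (GForm.ext_δ h) (GForm.ext_b h) x).symm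
  · have : envExt 𝕜 (g := g) D D' = 0 := dif_neg h
    rw [this]
    exact (map_zero (envObj 𝕜 g D').d).symm

theorem GForm.integral_ext {U V : Set (Fin m → ℝ)} (h : U ⊆ V) (w : GForm 𝕜 g U) :
    GForm.integral (GForm.ext g h w) = GForm.integral w := by
  refine LinearMap.congr_fun (f := GForm.integral ∘ₗ GForm.ext g h) (g := GForm.integral)
    (GForm.ext_ins fun α X => ?_) w
  refine LinearMap.congr_fun (f := GForm.integral ∘ₗ GForm.ext g h ∘ₗ (GForm.ins 𝕜 g).flip X)
    (g := GForm.integral ∘ₗ (GForm.ins 𝕜 g).flip X) (CT.ext_tm fun r a _ f => ?_) α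
  rfl

namespace Choices

variable (c : Choices 𝕜 m)

theorem extP_apply (hm : 1 ≤ m) (D : Disk m) (x : GSym (GForm.gr 𝕜 g D.carrier)) :
    c.extP g D x = (c.genRetract g (Disk.whole m) hm).P ((c.genRetract g (Disk.whole m) hm).A
      (envExt 𝕜 D (Disk.whole m) x)) := by
  change symP 𝕜 g _ (geom (dCE 𝕜 g _ ∘ₗ c.symH g _) _) = _
  rw [c.symH_eq _ hm]
  rfl

theorem extP_mem (hm : 1 ≤ m) (D : Disk m) {n : ℤ} {x : GSym (GForm.gr 𝕜 g D.carrier)}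
    (hx : x ∈ GSym.gr (GForm.gr 𝕜 g D.carrier) n) : c.extP g D x ∈ GSym.gr (conc 𝕜 g m) n := by
  rw [c.extP_apply hm]
  exact GSym.map_mem _ ((c.genRetract g _ hm).A_mem (envExt_mem hx))

/-- The image of `i` has codegree zero, where the perturbation is trivial; there `p` is compatible
with extension by zero. -/
theorem extP_I (hm : 2 ≤ m) (D : Disk m) (y : GSym (conc 𝕜 g m)) :
    c.extP g D (c.symI g D y) = y := by
  have hm1 : 1 ≤ m := by omega
  have hU : D.carrier ⊆ (Disk.whole m).carrier := Set.subset_univ _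
  have h1 : (envExt 𝕜 D (Disk.whole m) (c.symI g D y) : envObj 𝕜 g (Disk.whole m)) ∈
      wt (GForm.gr 𝕜 g (Disk.whole m).carrier) (codeg m) 0 := envExt_wt (c.I_codeg hm1 D y)
  rw [c.extP_apply hm1, c.A_codeg hm1 _ (by omega) h1,
    envExt_of_le hU]
  have h2 : ((c.genRetract g (Disk.whole m) hm1).P.comp
      (GSym.map (GForm.gr 𝕜 g (Disk.whole m).carrier) (GForm.ext g hU)
        (GForm.ext_mem hU))).comp (c.symI g D) = AlgHom.id 𝕜 _ := by
    refine GSym.algHom_ext' fun X => ?_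
    rw [AlgHom.comp_apply, AlgHom.comp_apply, symI, GSym.map_gen, GSym.map_gen, GenRetract.P_gen]
    change gen _ (GForm.integral (GForm.ext g _ (c.genI g D X))) = gen _ X
    rw [GForm.integral_ext, genI, GForm.integral_ins, c.vol_int, one_smul]
  exact DFunLike.congr_fun h2 y

/-- The projections `p̃` are compatible with the inclusions for `m ≥ 2`; the homotopy `h̃` is the
one this change of projections requires. -/
theorem improvedRetract_isSDR (hm : 2 ≤ m) : (c.improvedRetract g).IsSDR := by
  have hm1 : 1 ≤ m := by omega
  refine (c.hatRetract_isSDR (g := g) hm1).changeProj (c.extP g) (fun D n x hx => ?_)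
    (fun D x => ?_) (fun D b => c.extP_I hm D b)
  · exact c.extP_mem hm1 D hx
  · refine (c.extP_apply hm1 D _).trans ?_
    have := envExt_d D (Disk.whole m) x
    exact (congrArg _ (congrArg _ this)).trans ((c.genRetract g _ hm1).P_A_d _)

/-- Structure maps are products of extensions by zero, so they preserve codegree: if each tree `x`
below the root has value of codegree the number of its vertices, so does the value at the root. -/
theorem act_codeg {R : Retract (modelObj 𝕜 g m) (envelope 𝕜 g m)}
    {Ds : List (Disk m)} (D : Disk m) (xs : DFo (modelObj 𝕜 g m) Ds) (n : ℕ)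
    (h : ∀ {D : Disk m} (x : DTr (modelObj 𝕜 g m) D), x.verts ≤ n →
      R.ev x ∈ wt (GForm.gr 𝕜 g D.carrier) (codeg m) x.verts) (hn : xs.verts ≤ n) :
    (envelope 𝕜 g m).act D (R.evs xs) ∈ wt (GForm.gr 𝕜 g D.carrier) (codeg m) xs.verts := by
  have key : ∀ {Ds : List (Disk m)} (xs : DFo (modelObj 𝕜 g m) Ds), xs.verts ≤ n →
      envProd 𝕜 D (R.evs xs) ∈ wt (GForm.gr 𝕜 g D.carrier) (codeg m) xs.verts := by
    intro Ds
    induction Ds with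
    | nil =>
      intro xs _
      cases xs
      exact one_mem_wt _
    | cons D' Ds ih =>
      intro xs hxs
      cases xs with
      | cons x xs =>
        simp only [Fo.verts] at hxs ⊢
        rw [Nat.cast_add]
        exact mul_mem_wt _ (envExt_wt (h x (by omega))) (ih xs (by omega))
  change envAct 𝕜 D (R.evs xs) ∈ _
  unfold envAct
  split_ifs
  · exact key xs hn
  · exact Submodule.zero_mem _

theorem hatH_codeg (hm : 3 ≤ m) (D : Disk m) {x : GSym (GForm.gr 𝕜 g D.carrier)}
    (hx : x ∈ wt (GForm.gr 𝕜 g D.carrier) (codeg m) 0) :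
    c.hatH g D x ∈ wt (GForm.gr 𝕜 g D.carrier) (codeg m) 1 := by
  have hm1 : 1 ≤ m := by omega
  rw [c.hatH_apply hm1, c.A_codeg hm1 D (by omega) hx]
  have h := c.H_codeg hm1 D hx
  rwa [zero_add] at h

theorem hatP_codeg (hm : 3 ≤ m) (D : Disk m) {x : GSym (GForm.gr 𝕜 g D.carrier)}
    (hx : x ∈ wt (GForm.gr 𝕜 g D.carrier) (codeg m) 1) : (c.hatRetract g).p D x = 0 := by
  have hm1 : 1 ≤ m := by omega
  change symP 𝕜 g D (geom (dCE 𝕜 g D ∘ₗ c.symH g D) x) = _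
  rw [c.symH_eq D hm1]
  have h : (c.genRetract g D hm1).P ((c.genRetract g D hm1).A x) = 0 := by
    rw [c.A_codeg hm1 D (by omega) hx]
    exact c.P_codeg hm1 D one_ne_zero hx
  exact h

/-- On a tree with two vertices the value before applying `p̂` has codegree one: `i` has values in
codegree zero, and `ĥ = h` raises the codegree by one as `d_CE` lowers it by `m ≥ 3`. The projection
`p̂ = p` vanishes in codegree one. -/
theorem hatRetract_beta (hm : 3 ≤ m) {D : Disk m} (x : DTr (modelObj 𝕜 g m) D)
    (hx : x.verts = 2) : (c.hatRetract g).beta x = 0 :=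
  Retract.beta_eq_zero_of_weight
    (fun D n => wt (GForm.gr 𝕜 g D.carrier) (codeg m) n)
    (fun D b => c.I_codeg (by omega) D b) (fun D _ hx => c.hatH_codeg hm D hx)
    (fun D _ hx => c.hatP_codeg hm D hx) (fun D xs n h hn => act_codeg D xs n h hn) x hx

theorem extP_codeg (hm : 3 ≤ m) (D : Disk m) {x : GSym (GForm.gr 𝕜 g D.carrier)}
    (hx : x ∈ wt (GForm.gr 𝕜 g D.carrier) (codeg m) 1) : c.extP g D x = 0 := by
  have hm1 : 1 ≤ m := by omega
  have h : (envExt 𝕜 D (Disk.whole m) x : envObj 𝕜 g (Disk.whole m)) ∈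
      wt (GForm.gr 𝕜 g (Disk.whole m).carrier) (codeg m) 1 := envExt_wt hx
  rw [c.extP_apply hm1, c.A_codeg hm1 _ (by omega) h]
  exact c.P_codeg hm1 _ one_ne_zero h

theorem improvedRetract_h_codeg (hm : 3 ≤ m) (D : Disk m) {x : GSym (GForm.gr 𝕜 g D.carrier)}
    (hx : x ∈ wt (GForm.gr 𝕜 g D.carrier) (codeg m) 0) :
    (c.hatH g D - (c.symI g D).toLinearMap ∘ₗ c.extP g D ∘ₗ c.hatH g D) x ∈
      wt (GForm.gr 𝕜 g D.carrier) (codeg m) 1 := by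
  have h := c.hatH_codeg hm D hx
  rw [LinearMap.sub_apply, LinearMap.comp_apply, LinearMap.comp_apply, c.extP_codeg hm D h,
    map_zero, sub_zero]
  exact h

theorem improvedRetract_beta (hm : 3 ≤ m) {D : Disk m} (x : DTr (modelObj 𝕜 g m) D)
    (hx : x.verts = 2) : (c.improvedRetract g).beta x = 0 :=
  Retract.beta_eq_zero_of_weight
    (fun D n => wt (GForm.gr 𝕜 g D.carrier) (codeg m) n)
    (fun D b => c.I_codeg (by omega) D b) (fun D _ hx => c.improvedRetract_h_codeg hm D hx)
    (fun D _ hx => c.extP_codeg hm D hx) (fun D xs n h hn => act_codeg D xs n h hn) x hx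

end Choices

/-- In dimension one the cohomology of the envelope vanishes outside degree zero. -/
theorem envelope_acyclic (D : Disk 1) {n : ℤ} (hn : n ≠ 0) {z : envObj 𝕜 g D}
    (hz : z ∈ (envObj 𝕜 g D).gr n) (hd : (envObj 𝕜 g D).d z = 0) :
    ∃ y, (envObj 𝕜 g D).d y = z := by
  obtain ⟨c⟩ := nonempty_choices (𝕜 := 𝕜) (m := 1) le_rfl
  have hR := c.hatRetract_isSDR (g := g) le_rfl
  have h0 : (c.hatRetract g).p D z = 0 := by
    have h := hR.p_mem D n z hz
    change _ ∈ GSym.gr (conc 𝕜 g 1) n at h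
    rw [gr_eq_wt] at h
    exact conc_eq_zero (by simp) hn h
  have h := hR.homotopy D z
  have hd' : ((envelope 𝕜 g 1).obj D).d z = 0 := hd
  rw [hd', map_zero, add_zero, h0, map_zero] at h
  refine ⟨-(c.hatRetract g).h D z, (map_neg (envObj 𝕜 g D).d _).trans ?_⟩
  exact (congrArg Neg.neg (h.trans (zero_sub (G := (envObj 𝕜 g D)) z))).trans (neg_neg _)

section Sym

theorem conc_mul_comm (x y : GSym (conc 𝕜 g 1)) : x * y = y * x := by
  have h1 : ∀ (w : g) (y : GSym (conc 𝕜 g 1)), gen _ w * y = y * gen _ w := by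
    intro w y
    have := GSym.induction (N := LinearMap.ker (LinearMap.mulLeft 𝕜 (gen (conc 𝕜 g 1) w) -
      LinearMap.mulRight 𝕜 (gen (conc 𝕜 g 1) w))) (by simp) (fun v y hy => ?_) y
    · simpa [sub_eq_zero] using this
    · simp only [LinearMap.mem_ker, LinearMap.sub_apply, sub_eq_zero, LinearMap.mulLeft_apply,
        LinearMap.mulRight_apply] at hy ⊢
      rw [← mul_assoc, gen_comm _ (mem_conc w) (mem_conc v), smul_mul_assoc, mul_assoc, hy,
        ← mul_assoc, Even.neg_one_pow (by decide), one_smul]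
  have := GSym.induction (N := LinearMap.ker (LinearMap.mulRight 𝕜 y - LinearMap.mulLeft 𝕜 y))
    (by simp) (fun w x hx => ?_) x
  · simpa [sub_eq_zero] using this
  · simp only [LinearMap.mem_ker, LinearMap.sub_apply, sub_eq_zero, LinearMap.mulLeft_apply,
      LinearMap.mulRight_apply] at hx ⊢
    rw [mul_assoc, hx, ← mul_assoc, h1, mul_assoc]

instance : CommRing (GSym (conc 𝕜 g 1)) :=
  { (inferInstance : Ring (GSym (conc 𝕜 g 1))) with mul_comm := conc_mul_comm }

variable (𝕜 g) in
/-- The comparison of the symmetric algebra with the graded symmetric algebra on generators of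
degree zero. -/
def symToGSym : SymmetricAlgebra 𝕜 g →ₐ[𝕜] GSym (conc 𝕜 g 1) :=
  SymmetricAlgebra.lift (gen (conc 𝕜 g 1))

theorem symToGSym_ι (X : g) : symToGSym 𝕜 g (SymmetricAlgebra.ι 𝕜 g X) = gen (conc 𝕜 g 1) X :=
  SymmetricAlgebra.lift_ι_apply _ X

/-- All generators of `GSym (conc 𝕜 g 1)` have even degree, so that the algebra is commutative. -/
theorem symToGSym_bijective : Function.Bijective (symToGSym 𝕜 g) := by
  let Ψ : GSym (conc 𝕜 g 1) →ₐ[𝕜] SymmetricAlgebra 𝕜 g :=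
    GSym.lift _ (SymmetricAlgebra.ι 𝕜 g) fun r s v hv w hw => by
      by_cases hr : r = 1
      · subst hr
        rw [Even.neg_one_pow (by simp), one_smul, mul_comm]
      · have : v = 0 := by simpa [conc, hr] using hv
        rw [this, map_zero, zero_mul, mul_zero, smul_zero]
  have h1 : Ψ.comp (symToGSym 𝕜 g) = AlgHom.id 𝕜 _ := by
    refine SymmetricAlgebra.algHom_ext (LinearMap.ext fun X => ?_)
    exact (congrArg Ψ (symToGSym_ι X)).trans (GSym.lift_gen _ _ _ X)
  have h2 : (symToGSym 𝕜 g).comp Ψ = AlgHom.id 𝕜 _ := GSym.algHom_ext' fun X =>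
    (congrArg (symToGSym 𝕜 g) (GSym.lift_gen _ _ _ X)).trans (symToGSym_ι X)
  exact ⟨Function.LeftInverse.injective (g := Ψ) fun x => DFunLike.congr_fun h1 x,
    Function.RightInverse.surjective (g := Ψ) fun x => DFunLike.congr_fun h2 x⟩

/-- The cohomology in dimension one is read off from the perturbed retract, for choices with the
given form `α` as the volume form of `D`. -/
theorem cohomologyIsSym (D : Disk 1) : CohomologyIsSym 𝕜 g D := by
  classical
  refine ⟨fun α hα hα1 => ?_, fun n hn z hz hd => envelope_acyclic D hn hz hd⟩
  -- the retract for choices with `vol D = α` is used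
  choose v hv hv1 using fun D : Disk 1 => D.exists_formInt_eq_one (𝕜 := 𝕜)
  obtain ⟨c, hc⟩ := exists_choices le_rfl (Function.update v D α)
    (fun D' => by
      by_cases h : D' = D
      · subst h; simpa using hα
      · simpa [h] using hv D')
    (fun D' => by
      by_cases h : D' = D
      · subst h; simpa using hα1
      · simpa [h] using hv1 D')
  have hR := c.hatRetract_isSDR (g := g) le_rfl
  have hcD : c.vol D = α := by rw [hc, Function.update_self]
  refine ⟨(c.symI g D).toLinearMap ∘ₗ (symToGSym 𝕜 g).toLinearMap, fun Xs => ?_, fun x => ⟨?_, ?_⟩,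
    fun x hx => ?_, fun z hz hd => ?_⟩
  · change c.symI g D (symToGSym 𝕜 g _) = _
    rw [map_list_prod, map_list_prod, List.map_map, List.map_map]
    congr 1
    refine List.map_congr_left fun X _ => ?_
    simp only [Function.comp_apply]
    rw [symToGSym_ι, Choices.symI, GSym.map_gen, Choices.genI, hcD]
  · refine hR.i_mem D 0 (symToGSym 𝕜 g x) ?_
    change _ ∈ GSym.gr (conc 𝕜 g 1) 0
    rw [gr_eq_wt]
    exact conc_wt (by simp) _
  · exact hR.d_i D (symToGSym 𝕜 g x)
  · obtain ⟨y, hy⟩ := hx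
    have h : symToGSym 𝕜 g x = 0 :=
      (hR.p_i D (symToGSym 𝕜 g x)).symm.trans
        ((congrArg ((c.hatRetract g).p D) hy.symm).trans (hR.p_d D y))
    exact symToGSym_bijective.1 (h.trans (map_zero _).symm)
  · obtain ⟨x, hx⟩ := symToGSym_bijective.2 ((c.hatRetract g).p D z)
    have h := hR.homotopy D z
    have hd' : ((envelope 𝕜 g 1).obj D).d z = 0 := hd
    rw [hd', map_zero, add_zero] at h
    refine ⟨x, -(c.hatRetract g).h D z, ?_⟩
    have h2 : (c.hatRetract g).i D (symToGSym 𝕜 g x) =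
        (c.hatRetract g).i D ((c.hatRetract g).p D z) :=
      congrArg _ hx
    have h3 : z = (c.hatRetract g).i D (symToGSym 𝕜 g x) +
        ((envelope 𝕜 g 1).obj D).d (-(c.hatRetract g).h D z) := by
      rw [h2, map_neg, h]
      exact ((sub_eq_add_neg _ _).symm.trans (sub_sub_cancel (G := envObj 𝕜 g D) _ z)).symm
    exact h3

end Sym

end Explicit

end

end FactEnv

theorem mainTheorem10 {𝕜 : Type} [RCLike 𝕜] {g : Type u} [LieRing g] [LieAlgebra 𝕜 g]
    [FiniteDimensional 𝕜 g] :
    ((∀ D : FactEnv.Disk 1, FactEnv.CohomologyIsSym 𝕜 g D) ∧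
      Nonempty (FactEnv.Choices 𝕜 1) ∧
      (∀ c : FactEnv.Choices 𝕜 1, (c.hatRetract g).IsSDR) ∧
      (∀ (B : FactEnv.Fam.{u} 1 𝕜) (R : FactEnv.Retract B (FactEnv.envelope 𝕜 g 1)), R.IsSDR →
        ∀ (D : FactEnv.Disk 1) (x : FactEnv.DTr B D), x.Valid → 2 ≤ x.verts → R.beta x = 0) ∧
      FactEnv.Formal (FactEnv.envelope 𝕜 g 1)) ∧
    ∀ m : ℕ, 3 ≤ m →
      Nonempty (FactEnv.Choices 𝕜 m) ∧
      (∀ c : FactEnv.Choices 𝕜 m,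
        ((c.hatRetract g).IsSDR ∧
          ∀ (D : FactEnv.Disk m) (x : FactEnv.DTr (FactEnv.modelObj 𝕜 g m) D),
            x.Valid → x.verts = 2 → (c.hatRetract g).beta x = 0) ∧
        ((c.improvedRetract g).IsSDR ∧
          ∀ (D : FactEnv.Disk m) (x : FactEnv.DTr (FactEnv.modelObj 𝕜 g m) D),
            x.Valid → x.verts = 2 → (c.improvedRetract g).beta x = 0)) ∧
      FactEnv.MasseyTrivial (FactEnv.envelope 𝕜 g m) := by
  refine ⟨⟨fun D => FactEnv.cohomologyIsSym D, FactEnv.nonempty_choices le_rfl,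
    fun c => c.hatRetract_isSDR le_rfl, fun B R hR D x _ hx => hR.beta_eq_zero_of_acyclic
      (fun D n hn z hz hd => FactEnv.envelope_acyclic D hn hz hd) x hx, ?_⟩,
    fun m hm => ⟨FactEnv.nonempty_choices (by omega), fun c =>
      ⟨⟨c.hatRetract_isSDR (by omega), fun D x _ hx => c.hatRetract_beta hm x hx⟩,
        c.improvedRetract_isSDR (by omega), fun D x _ hx => c.improvedRetract_beta hm x hx⟩, ?_⟩⟩
  · obtain ⟨c⟩ := FactEnv.nonempty_choices (𝕜 := 𝕜) (m := 1) le_rfl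
    have hR := c.hatRetract_isSDR (g := g) le_rfl
    exact FactEnv.Retract.formal _ hR fun D x _ hx => hR.beta_eq_zero_of_acyclic
      (fun D n hn z hz hd => FactEnv.envelope_acyclic D hn hz hd) x hx
  · obtain ⟨c⟩ := FactEnv.nonempty_choices (𝕜 := 𝕜) (m := m) (by omega)
    exact FactEnv.Retract.massey_trivial (c.hatRetract_isSDR (g := g) (by omega))
      fun D x _ hx => c.hatRetract_beta hm x hx
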